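/- Let $r\in\mathbb N$ and $m_1,\dots,m_r>0$ (the case $r=1$, $m_1=m$, is a single spin-one Boson of mass $m$). Let $g=\mathrm{diag}(1,-1,-1,-1)$, $p\cdot q=p^0q^0-\mathbf p\cdot\mathbf q$, let $X=\bigsqcup_{a=1}^r X^+_{m_a}$ be the disjoint union of the upper mass hyperboloids $X_{m}^+=\{p\in\mathbb R^4: p\cdot p=m^2,\ p^0>0\}$ with measure $\alpha$ equal to $d\mathbf p/2\omega_{m_a}(\mathbf p)$ on $X^+_{m_a}$, $\omega_{m}(\mathbf p)=\sqrt{m^2+\mathbf p^2}$; we write $m(k)=m_a$ for $k\in X^+_{m_a}$. One-particle space. Let $\mathsf H_m=\{\phi\in L^2(X,\mathbb C^4,\alpha): p^\mu\phi_\mu(p)=0\ \text{a.e.}\}$ with the positive form $(\phi,\psi)=\int (-g^{\mu\nu})\overline{\phi_\mu}\psi_\nu\,d\alpha$, and let $\mathcal F_m=\mathcal F^+(\overline{\mathsf H_m})$ be the Bosonic Fock space of its Hilbert completion $\overline{\mathsf H_m}$. Space with ghosts. Let $\mathcal H^{gh}=\bigoplus_{n,w,l,s\ge 0}\mathcal H_{nwls}$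 (Hilbert sum), where $\mathcal H_{nwls}$ consists of the square integrable functions $\Phi^{(nwls)}_{\mu_1\dots\mu_n}(K;P;Q;R)$, $K\in X^n$, $P\in X^w$, $Q\in X^l$, $R\in X^s$, symmetric in the pairs $(\mu_i,k_i)$ and in $R$, antisymmetric in $P$ and in $Q$ (these are the variables of the vector particles, of the Fermionic ghosts $b$ and $c$, and of the Bosonic ghost $a$). Let $(J\Phi)^{(nwls)}(K;P;Q;R)=(-1)^{wl}(-g)^{\otimes n}\Phi^{(nlws)}(K;Q;P;R)$ and $(\Psi,\Phi)=\langle\Psi,J\Phi\rangle$. Let $\mathcal D\subset\mathcal H^{gh}$ be the subspace of vectors with finitely many non-zero components and with momenta in a bounded set. The supercharge $Q=\int d\alpha(k)\,[k^\mu(A_\mu(k)c^*(k)+A^\dagger_\mu(k)b(k))+i\,m(k)(a(k)c^*(k)-a^*(k)b(k))]$ is, explicitly (with empty sums equal to $0$), \begin{align*} (Q\Phi)^{(nwls)}_{\mu_1\dots\mu_n}(K;P;Q;R)&=(-1)^w\sqrt{\tfrac{n+1}{l}}\sum_{i=1}^l(-1)^{i-1}q_i^\nu\,\Phi^{(n+1,w,l-1,s)}_{\nu\mu_1\dots\mu_n}(q_i,K;P;Q\setminus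 q_i;R)\\ &\quad-\sqrt{\tfrac{w+1}{n}}\sum_{i=1}^n(k_i)_{\mu_i}\Phi^{(n-1,w+1,l,s)}_{\mu_1\dots\widehat{\mu_i}\dots\mu_n}(K\setminus k_i;k_i,P;Q;R)\\ &\quad+i(-1)^w\sqrt{\tfrac{s+1}{l}}\sum_{i=1}^l(-1)^{i-1}m(q_i)\,\Phi^{(n,w,l-1,s+1)}_{\mu_1\dots\mu_n}(K;P;Q\setminus q_i;q_i,R)\\ &\quad-i\sqrt{\tfrac{w+1}{s}}\sum_{i=1}^s m(r_i)\,\Phi^{(n,w+1,l,s-1)}_{\mu_1\dots\mu_n}(K;r_i,P;Q;R\setminus r_i). \end{align*} Poincaré action. For $a\in\mathbb R^4$ and $\Lambda\in O(1,3)$ orthochronous, $U_{a,\Lambda}$ acts on vector functions by $(U_{a,\Lambda}\phi)_\mu(p)=e^{ia\cdot p}\Lambda_\mu{}^\nu\phi_\nu(\Lambda^{-1}p)$ and on scalar functions by $f\mapsto e^{ia\cdot p}f(\Lambda^{-1}p)$; for time-reversing $\Lambda$ it acts antilinearly, by $\phi_\mu\mapsto e^{ia\cdot p}\Lambda_\mu{}^\nu\,\overline{\phi_\nu(-\Lambda^{-1}p)}$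 on vector functions and by $f\mapsto\pm e^{ia\cdot p}\,\overline{f(-\Lambda^{-1}p)}$ on scalar functions, with sign $+$ for $a$ and $-$ for $b,c$. $\mathcal U_g$ denotes the second quantisation of this action on $\mathcal D$. **Theorem.** $Q$ is a well-defined linear operator $\mathcal D\to\mathcal D$ with $Q^2=0$, and: 1. the form $(\cdot,\cdot)$ on $\mathrm{Ker}(Q)$ induces a positive definite inner product on $\mathrm{Ker}(Q)/\mathrm{Im}(Q)$; 2. let $\mathcal H'_{\mathcal D}$ be the space of all $\Phi\in\mathcal D$ whose only non-zero components are the $\Phi^{(n000)}$, with $k_1^{\nu_1}\Phi^{(n000)}_{\nu_1\dots\nu_n}(k_1,\dots,k_n)=0$ for all $n\ge 1$. Then $\mathcal H'_{\mathcal D}\subset\mathrm{Ker}(Q)$, and $\Phi\mapsto[\Phi]$ is a linear isomorphism $\mathcal H'_{\mathcal D}\simeq\mathrm{Ker}(Q)/\mathrm{Im}(Q)$; 3. this isomorphism extends to a Hilbert space isomorphism $W:\overline{\mathrm{Ker}(Q)/\mathrm{Im}(Q)}\to\mathcal F_m$ of the completion for the inner product of 1., with $W[\phi_1\vee\dots\vee\phi_n]=\phi_1\vee\dots\vee\phi_n$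 for all $n$ and all $\phi_1,\dots,\phi_n\in\mathsf H_m$ with bounded momentum support; 4. for each element $g$ of the full Poincaré group, $\mathcal U_g$ maps $\mathcal D$ to $\mathcal D$ and $\mathcal H'_{\mathcal D}$ to $\mathcal H'_{\mathcal D}$ and commutes with $Q$; $U_g$ extends from $\mathsf H_m$ to a unitary (antiunitary, if $g$ reverses time) operator $u_g$ of $\overline{\mathsf H_m}$; and the factorised operator $[\Phi]\mapsto[\mathcal U_g\Phi]$ corresponds under $W$ to the operator $\Gamma(u_g)$ of $\mathcal F_m$, where $\Gamma(u_g)(\phi_1\vee\dots\vee\phi_n)=u_g\phi_1\vee\dots\vee u_g\phi_n$. -/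

import Mathlib

open MeasureTheory TensorProduct
open scoped BigOperators ComplexConjugate InnerProductSpace ENNReal

noncomputable section

namespace MassiveVector

/-! ## The Bosonic Fock space of a Hilbert space -/

/-- A complex inner product space bundled with its carrier (used to iterate tensor products). -/
structure BundledIPS where
  carrier : Type
  [grp : NormedAddCommGroup carrier]
  [ips : InnerProductSpace ℂ carrier]

attribute [instance] BundledIPS.grp BundledIPS.ips

section Fock

variable (K : Type) [NormedAddCommGroup K] [InnerProductSpace ℂ K]

/-- `K ⊗ (K ⊗ (⋯ ⊗ ℂ))` with `n` factors `K`, with the tensor product inner product. -/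
def tensorPow : ℕ → BundledIPS
  | 0 => ⟨ℂ⟩
  | n + 1 => ⟨K ⊗[ℂ] (tensorPow n).carrier⟩

/-- The `n`-th algebraic tensor power of `K`. -/
abbrev TPow (n : ℕ) : Type := (tensorPow K n).carrier

/-- The full Fock space: Hilbert sum of the completed tensor powers. -/
abbrev FullFock : Type := lp (fun n : ℕ => UniformSpace.Completion (TPow K n)) 2

variable {K}

/-- The elementary tensor `v₁ ⊗ ⋯ ⊗ vₙ`. -/
def elemTensor : ∀ n : ℕ, (Fin n → K) → TPow K n
  | 0, _ => (1 : ℂ)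
  | n + 1, v => ((v 0) ⊗ₜ[ℂ] (elemTensor n (Fin.tail v)) : K ⊗[ℂ] TPow K n)

/-- The symmetrised tensor `(1/n!) ∑_σ v_{σ1} ⊗ ⋯ ⊗ v_{σn}`. -/
def symTensor (n : ℕ) (v : Fin n → K) : TPow K n :=
  ((n.factorial : ℂ)⁻¹) • ∑ σ : Equiv.Perm (Fin n), elemTensor n (fun i => v (σ i))

/-- `v₁ ∨ ⋯ ∨ vₙ` in the full Fock space. -/
def wedgeFull (n : ℕ) (v : Fin n → K) : FullFock K :=
  lp.single 2 n ((symTensor n v : TPow K n) : UniformSpace.Completion (TPow K n))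

variable (K) in
/-- The closed subspace of the full Fock space generated by all `v₁ ∨ ⋯ ∨ vₙ`. -/
def bosonSubspace : Submodule ℂ (FullFock K) :=
  (Submodule.span ℂ {x | ∃ (n : ℕ) (v : Fin n → K), x = wedgeFull n v}).topologicalClosure

variable (K) in
/-- The Bosonic Fock space `F⁺(K)`. -/
abbrev BosonFock : Type := bosonSubspace K

/-- `v₁ ∨ ⋯ ∨ vₙ` as an element of `F⁺(K)`. -/
def wedge (n : ℕ) (v : Fin n → K) : BosonFock K :=
  ⟨wedgeFull n v, Submodule.le_topologicalClosure _ (Submodule.subset_span ⟨n, v, rfl⟩)⟩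

instance : CompleteSpace (BosonFock K) :=
  (Submodule.isClosed_topologicalClosure _).completeSpace_coe

end Fock

/-! ## Hilbert space completion of a space with a given positive definite form -/

section Completion

variable {V : Type} [AddCommGroup V] [Module ℂ V]

/-- `V` normed by the inner product `c`. -/
def WithForm (_c : InnerProductSpace.Core ℂ V) : Type := V

instance (c : InnerProductSpace.Core ℂ V) : NormedAddCommGroup (WithForm c) :=
  @InnerProductSpace.Core.toNormedAddCommGroup ℂ V _ _ _ c

instance (c : InnerProductSpace.Core ℂ V) : InnerProductSpace ℂ (WithForm c) :=
  @InnerProductSpace.ofCore ℂ V _ _ _ c.toCore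

/-- The Hilbert space completion of `V` with respect to the inner product `c`. -/
abbrev HilbertCompletion (c : InnerProductSpace.Core ℂ V) : Type :=
  UniformSpace.Completion (WithForm c)

/-- The canonical map of `V` into its completion. -/
def toCompletion (c : InnerProductSpace.Core ℂ V) (v : V) : HilbertCompletion c :=
  ((show WithForm c from v : WithForm c) : UniformSpace.Completion (WithForm c))

end Completion

/-! ## Minkowski space and the mass shell -/

/-- Four-momenta `p = (p⁰, p¹, p², p³)`. -/
abbrev Mom : Type := Fin 4 → ℝ

/-- Diagonal entries of the Minkowski metric `g = diag(1,-1,-1,-1)`. -/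
def eta (μ : Fin 4) : ℝ := if μ = 0 then 1 else -1

/-- The Minkowski form `p·q`. -/
def mink (p q : Mom) : ℝ := ∑ μ, eta μ * p μ * q μ

/-- The upper hyperboloid `X⁺_m`. -/
def shell (m : ℝ) : Set Mom := {p | mink p p = m ^ 2 ∧ 0 < p 0}

/-- `ω(𝐩) = √(m² + 𝐩²)`. -/
def energy (m : ℝ) (v : Fin 3 → ℝ) : ℝ := Real.sqrt (m ^ 2 + ∑ i, v i ^ 2)

/-- The point of `X⁺_m` above the spatial momentum `𝐩`. -/
def shellPoint (m : ℝ) (v : Fin 3 → ℝ) : Mom := Fin.cons (energy m v) v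

/-- The Lorentz invariant measure `d𝐩 / 2ω(𝐩)` on `X⁺_m`, seen as a measure on `ℝ⁴`. -/
def shellMeasure (m : ℝ) : Measure Mom :=
  ((volume : Measure (Fin 3 → ℝ)).withDensity
    (fun v => ENNReal.ofReal (1 / (2 * energy m v)))).map (shellPoint m)

/-- One-particle variables of a scalar particle: field index and momentum. -/
abbrev Scal (r : ℕ) : Type := Fin r × Mom

/-- One-particle variables of a vector particle: Lorentz index, field index and momentum. -/
abbrev Vec (r : ℕ) : Type := Fin 4 × Scal r

variable {r : ℕ}

/-- Disjoint union of the shells `X⁺_{m_a}`, `a = 1, …, r`, with their invariant measures. -/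
def scalMeasure (m : Fin r → ℝ) : Measure (Scal r) :=
  Measure.sum fun a => (shellMeasure (m a)).map (Prod.mk a)

def vecMeasure (m : Fin r → ℝ) : Measure (Vec r) :=
  (Measure.count : Measure (Fin 4)).prod (scalMeasure m)

theorem measurable_energy (m : ℝ) : Measurable (energy m) := by
  unfold energy; fun_prop

theorem measurable_shellPoint (m : ℝ) : Measurable (shellPoint m) := by
  refine measurable_pi_iff.2 fun μ => ?_
  refine Fin.cases ?_ (fun i => ?_) μ
  · simpa [shellPoint] using measurable_energy m
  · simpa [shellPoint] using measurable_pi_apply i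

theorem measurableEmbedding_shellPoint (m : ℝ) : MeasurableEmbedding (shellPoint m) := by
  have hinv : Measurable (fun p : Mom => (Fin.tail p : Fin 3 → ℝ)) :=
    measurable_pi_iff.2 fun i => measurable_pi_apply _
  have hl : Function.LeftInverse (fun p : Mom => (Fin.tail p : Fin 3 → ℝ)) (shellPoint m) := by
    intro v; simp [shellPoint]
  have hc : Continuous (shellPoint m) := by
    refine continuous_pi fun μ => ?_
    refine Fin.cases ?_ (fun i => ?_) μ
    · simp only [shellPoint, Fin.cons_zero, energy]; fun_prop
    · simp only [shellPoint, Fin.cons_succ]; fun_prop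
  exact hc.measurableEmbedding hl.injective

instance (m : ℝ) : SigmaFinite (shellMeasure m) := by
  unfold shellMeasure
  exact (measurableEmbedding_shellPoint m).sigmaFinite_map

instance (m : Fin r → ℝ) : SigmaFinite (scalMeasure m) := by
  have h : ∀ a : Fin r, SigmaFinite ((shellMeasure (m a)).map (Prod.mk a)) := fun a =>
    (MeasurableEmbedding.id.prodMk_left a).sigmaFinite_map
  unfold scalMeasure
  infer_instance

instance (m : Fin r → ℝ) : SigmaFinite (vecMeasure m) := by
  unfold vecMeasure; infer_instance

theorem eta_values : eta 0 = 1 ∧ eta 1 = -1 ∧ eta 2 = -1 ∧ eta 3 = -1 :=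
  ⟨if_pos rfl, if_neg (by decide), if_neg (by decide), if_neg (by decide)⟩

theorem mink_self (p : Mom) : mink p p = p 0 ^ 2 - p 1 ^ 2 - p 2 ^ 2 - p 3 ^ 2 := by
  obtain ⟨e0, e1, e2, e3⟩ := eta_values
  simp only [mink, Fin.sum_univ_four, e0, e1, e2, e3]
  ring

theorem ae_mem_shell (m : ℝ) : ∀ᵐ p ∂shellMeasure m, p ∈ shell m := by
  unfold shellMeasure
  rw [(measurableEmbedding_shellPoint m).ae_map_iff]
  have h0 : ∀ᵐ v ∂(volume : Measure (Fin 3 → ℝ)), v ≠ 0 := by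
    rw [ae_iff]; simp
  refine (withDensity_absolutelyContinuous _ _).ae_le ?_
  filter_upwards [h0] with v hv
  have hs : 0 < ∑ i, v i ^ 2 := by
    obtain ⟨i, hi⟩ := Function.ne_iff.1 hv
    exact Finset.sum_pos' (fun i _ => sq_nonneg _) ⟨i, Finset.mem_univ _, by
      have : v i ≠ 0 := by simpa using hi
      positivity⟩
  have he : energy m v ^ 2 = m ^ 2 + ∑ i, v i ^ 2 := Real.sq_sqrt (by positivity)
  refine ⟨?_, ?_⟩
  · rw [Fin.sum_univ_three] at he
    rw [mink_self]
    change energy m v ^ 2 - v 0 ^ 2 - v 1 ^ 2 - v 2 ^ 2 = m ^ 2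
    linarith
  · have : 0 < m ^ 2 + ∑ i, v i ^ 2 := by positivity
    simpa [shellPoint, energy] using Real.sqrt_pos.2 this

theorem ae_mem_shell_scal (m : Fin r → ℝ) : ∀ᵐ y ∂scalMeasure m, y.2 ∈ shell (m y.1) := by
  unfold scalMeasure
  rw [Measure.ae_sum_iff]
  intro a
  have h : MeasurableEmbedding (Prod.mk a : Mom → Scal r) := MeasurableEmbedding.id.prodMk_left a
  rw [h.ae_map_iff]
  exact ae_mem_shell (m a)

theorem quasiMeasurePreserving_mkVec (m : Fin r → ℝ) (ν : Fin 4) :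
    Measure.QuasiMeasurePreserving (fun y : Scal r => ((ν, y) : Vec r))
      (scalMeasure m) (vecMeasure m) := by
  refine ⟨measurable_prodMk_left, ?_⟩
  refine Measure.AbsolutelyContinuous.mk fun s hs h => ?_
  rw [Measure.map_apply measurable_prodMk_left hs]
  have h' := Measure.measure_ae_null_of_prod_null h
  rw [Filter.EventuallyEq, ae_iff, Measure.count_eq_zero_iff] at h'
  by_contra hne
  exact (Set.eq_empty_iff_forall_notMem.1 h' ν) hne

/-! ## The one-particle space of massive vector particles -/

/-- The subspace `H_m = {φ ∈ H | p^μ φ_μ(p) = 0}` of the one-particle space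
`H = L²(X⁺_m, ℂ⁴)` (the direct sum of these over the `r` field species). -/
def transverse (m : Fin r → ℝ) : Submodule ℂ (Lp ℂ 2 (vecMeasure m)) where
  carrier := {φ | ∀ᵐ y ∂scalMeasure m, ∑ ν, (y.2 ν : ℂ) * φ (ν, y) = 0}
  zero_mem' := by
    have h := fun ν => (quasiMeasurePreserving_mkVec m ν).ae (Lp.coeFn_zero ℂ 2 (vecMeasure m))
    filter_upwards [ae_all_iff.2 h] with y hy
    refine Finset.sum_eq_zero fun ν _ => ?_
    rw [hy ν, Pi.zero_apply, mul_zero]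
  add_mem' := by
    intro φ ψ hφ hψ
    rw [Set.mem_ofPred_eq] at hφ hψ ⊢
    have h := fun ν => (quasiMeasurePreserving_mkVec m ν).ae (Lp.coeFn_add φ ψ)
    filter_upwards [ae_all_iff.2 h, hφ, hψ] with y hy h1 h2
    have : ∑ ν, (y.2 ν : ℂ) * (φ + ψ : Lp ℂ 2 (vecMeasure m)) (ν, y) =
        ∑ ν, (y.2 ν : ℂ) * φ (ν, y) + ∑ ν, (y.2 ν : ℂ) * ψ (ν, y) := by
      rw [← Finset.sum_add_distrib]
      exact Finset.sum_congr rfl fun ν _ => by rw [hy ν, Pi.add_apply, mul_add]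
    rw [this, h1, h2, add_zero]
  smul_mem' := by
    intro c φ hφ
    rw [Set.mem_ofPred_eq] at hφ ⊢
    have h := fun ν => (quasiMeasurePreserving_mkVec m ν).ae (Lp.coeFn_smul c φ)
    filter_upwards [ae_all_iff.2 h, hφ] with y hy h1
    have : ∑ ν, (y.2 ν : ℂ) * (c • φ : Lp ℂ 2 (vecMeasure m)) (ν, y) =
        c * ∑ ν, (y.2 ν : ℂ) * φ (ν, y) := by
      rw [Finset.mul_sum]
      exact Finset.sum_congr rfl fun ν _ => by
        rw [hy ν, Pi.smul_apply, smul_eq_mul]; ring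
    rw [this, h1, mul_zero]

/-- `H_m`, to be normed by the Lorentz invariant form instead of the `L²` norm. -/
def PreParticle (m : Fin r → ℝ) : Type := transverse m

instance (m : Fin r → ℝ) : AddCommGroup (PreParticle m) :=
  inferInstanceAs (AddCommGroup (transverse m))

instance (m : Fin r → ℝ) : Module ℂ (PreParticle m) :=
  inferInstanceAs (Module ℂ (transverse m))

/-- The underlying element of `L²`. -/
def PreParticle.toLp {m : Fin r → ℝ} (φ : PreParticle m) : Lp ℂ 2 (vecMeasure m) :=
  (show transverse m from φ).1

/-- The Lorentz invariant form `∫ (-g^{μν}) conj(φ_μ) ψ_ν dα`. -/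
def oneForm {m : Fin r → ℝ} (φ ψ : PreParticle m) : ℂ :=
  ∫ z, (-(eta z.1) : ℂ) * (conj (φ.toLp z) * ψ.toLp z) ∂vecMeasure m

theorem integrable_oneForm {m : Fin r → ℝ} (f g : Lp ℂ 2 (vecMeasure m)) :
    Integrable (fun z => (-(eta z.1) : ℂ) * (conj (f z) * g z)) (vecMeasure m) := by
  have h : Integrable (fun z => conj (f z) * g z) (vecMeasure m) := by
    have := L2.integrable_inner (𝕜 := ℂ) f g
    simpa [RCLike.inner_apply, mul_comm] using this
  refine h.bdd_mul (c := 1) ?_ ?_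
  · have : Measurable (fun z : Vec r => (-(eta z.1) : ℂ)) :=
      (measurable_from_top (f := fun μ : Fin 4 => (-(eta μ) : ℂ))).comp measurable_fst
    exact this.aestronglyMeasurable
  · refine Filter.Eventually.of_forall fun z => ?_
    simp only [eta]
    split_ifs <;> simp

theorem transverse_pointwise {μ : ℝ} {p : Mom} (hp : p ∈ shell μ) {f : Fin 4 → ℂ}
    (hf : ∑ ν, (p ν : ℂ) * f ν = 0) :
    0 ≤ ∑ ν, -eta ν * ‖f ν‖ ^ 2 := by
  obtain ⟨h1, h0⟩ := hp
  obtain ⟨e0, e1, e2, e3⟩ := eta_values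
  rw [mink_self] at h1
  simp only [Fin.sum_univ_four] at hf
  simp only [Fin.sum_univ_four, e0, e1, e2, e3]
  have h2 : (p 0 : ℂ) * f 0 = -(p 1 * f 1 + p 2 * f 2 + p 3 * f 3) := by linear_combination hf
  have h3 : p 0 * ‖f 0‖ ≤ |p 1| * ‖f 1‖ + |p 2| * ‖f 2‖ + |p 3| * ‖f 3‖ := by
    have h4 := congrArg norm h2
    rw [norm_neg, norm_mul, Complex.norm_real, Real.norm_eq_abs, abs_of_pos h0] at h4
    rw [h4]
    refine (norm_add₃_le).trans ?_
    simp
  set x := ‖f 1‖; set y := ‖f 2‖; set z := ‖f 3‖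
  have h5 : (p 0 * ‖f 0‖) ^ 2 ≤ (|p 1| * x + |p 2| * y + |p 3| * z) ^ 2 :=
    pow_le_pow_left₀ (by positivity) h3 2
  have h6 : (|p 1| * x + |p 2| * y + |p 3| * z) ^ 2 ≤
      (p 1 ^ 2 + p 2 ^ 2 + p 3 ^ 2) * (x ^ 2 + y ^ 2 + z ^ 2) := by
    rw [← sq_abs (p 1), ← sq_abs (p 2), ← sq_abs (p 3)]
    nlinarith [sq_nonneg (|p 1| * y - |p 2| * x), sq_nonneg (|p 1| * z - |p 3| * x),
      sq_nonneg (|p 2| * z - |p 3| * y)]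
  have h7 : p 1 ^ 2 + p 2 ^ 2 + p 3 ^ 2 ≤ p 0 ^ 2 := by nlinarith [sq_nonneg μ]
  have h8 : p 0 ^ 2 * ‖f 0‖ ^ 2 ≤ p 0 ^ 2 * (x ^ 2 + y ^ 2 + z ^ 2) := by
    have := mul_le_mul_of_nonneg_right h7 (by positivity : 0 ≤ x ^ 2 + y ^ 2 + z ^ 2)
    nlinarith
  have h9 := le_of_mul_le_mul_left h8 (by positivity)
  linarith

theorem oneForm_self_nonneg {m : Fin r → ℝ} (φ : PreParticle m) : 0 ≤ (oneForm φ φ).re := by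
  have hint : Integrable (fun z : Vec r => (-(eta z.1) : ℂ) * (conj (φ.toLp z) * φ.toLp z))
      ((Measure.count : Measure (Fin 4)).prod (scalMeasure m)) :=
    integrable_oneForm φ.toLp φ.toLp
  have he : oneForm φ φ = ∫ y, ∫ ν, (-(eta ν) : ℂ) * (conj (φ.toLp (ν, y)) * φ.toLp (ν, y))
      ∂(Measure.count : Measure (Fin 4)) ∂scalMeasure m := integral_prod_symm _ hint
  rw [he, ← RCLike.re_eq_complex_re, ← integral_re hint.integral_prod_right]
  refine integral_nonneg_of_ae ?_
  have ht : ∀ᵐ y ∂scalMeasure m, ∑ ν, (y.2 ν : ℂ) * φ.toLp (ν, y) = 0 :=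
    (show transverse m from φ).2
  filter_upwards [ht, ae_mem_shell_scal m] with y h1 h2
  have h3 := transverse_pointwise h2 (f := fun ν => φ.toLp (ν, y)) h1
  have h4 : ∫ ν, (-(eta ν) : ℂ) * (conj (φ.toLp (ν, y)) * φ.toLp (ν, y))
      ∂(Measure.count : Measure (Fin 4)) =
      ((∑ ν, -eta ν * ‖φ.toLp (ν, y)‖ ^ 2 : ℝ) : ℂ) := by
    rw [integral_fintype Integrable.of_finite]
    push_cast
    refine Finset.sum_congr rfl fun ν _ => ?_
    rw [RCLike.conj_mul]
    simp
  rw [h4]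
  exact h3

/-- The invariant form makes `H_m` a pre-Hilbert space. -/
@[reducible]
def particleCore (m : Fin r → ℝ) : PreInnerProductSpace.Core ℂ (PreParticle m) where
  inner := oneForm
  conj_inner_symm φ ψ := by
    unfold oneForm
    rw [← integral_conj]
    refine integral_congr_ae (Filter.Eventually.of_forall fun z => ?_)
    simp only [map_mul, map_neg, Complex.conj_ofReal, Complex.conj_conj]
    ring
  re_inner_nonneg φ := oneForm_self_nonneg φ
  add_left φ ψ χ := by
    unfold oneForm
    rw [← integral_add (integrable_oneForm _ _) (integrable_oneForm _ _)]
    refine integral_congr_ae ?_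
    filter_upwards [Lp.coeFn_add φ.toLp ψ.toLp] with z hz
    have : (φ + ψ).toLp z = φ.toLp z + ψ.toLp z := hz
    rw [this, map_add]
    ring
  smul_left φ ψ c := by
    unfold oneForm
    rw [← integral_const_mul]
    refine integral_congr_ae ?_
    filter_upwards [Lp.coeFn_smul c φ.toLp] with z hz
    have : (c • φ).toLp z = c * φ.toLp z := hz
    rw [this, map_mul]
    ring

instance (m : Fin r → ℝ) : SeminormedAddCommGroup (PreParticle m) :=
  @InnerProductSpace.Core.toSeminormedAddCommGroup ℂ (PreParticle m) _ _ _ (particleCore m)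

instance (m : Fin r → ℝ) : InnerProductSpace ℂ (PreParticle m) :=
  @InnerProductSpace.ofCore ℂ (PreParticle m) _ _ _ (particleCore m)

/-- The one-particle Hilbert space: completion of `H_m` for the invariant form. -/
abbrev Particle (m : Fin r → ℝ) : Type := UniformSpace.Completion (PreParticle m)

/-! ## The Hilbert space with ghosts -/

/-- Variables `(K; P; Q; R)` of a state with `n` vector particles, `w` and `l` Fermionic ghosts
of types `b` and `c`, and `s` scalar ghosts of type `a`. -/
abbrev Config (r n w l s : ℕ) : Type :=
  (Fin n → Vec r) × (Fin w → Scal r) × (Fin l → Scal r) × (Fin s → Scal r)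

def configMeasure (m : Fin r → ℝ) (n w l s : ℕ) : Measure (Config r n w l s) :=
  (Measure.pi fun _ => vecMeasure m).prod ((Measure.pi fun _ => scalMeasure m).prod
    ((Measure.pi fun _ => scalMeasure m).prod (Measure.pi fun _ => scalMeasure m)))

instance (m : Fin r → ℝ) (n w l s : ℕ) : SigmaFinite (configMeasure m n w l s) := by
  unfold configMeasure; infer_instance

/-- Simultaneous permutation of the variables of each of the four types. -/
def permConfig {n w l s : ℕ} (π : Equiv.Perm (Fin n)) (ρ : Equiv.Perm (Fin w))
    (σ : Equiv.Perm (Fin l)) (τ : Equiv.Perm (Fin s)) (x : Config r n w l s) : Config r n w l s :=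
  (x.1 ∘ π, x.2.1 ∘ ρ, x.2.2.1 ∘ σ, x.2.2.2 ∘ τ)

theorem measurePreserving_comp_perm {α : Type} [MeasurableSpace α] (μ : Measure α) [SigmaFinite μ]
    {n : ℕ} (π : Equiv.Perm (Fin n)) :
    MeasurePreserving (fun K : Fin n → α => K ∘ π) (Measure.pi fun _ => μ)
      (Measure.pi fun _ => μ) := by
  have h := measurePreserving_piCongrLeft (fun _ : Fin n => μ) π.symm
  convert h using 1
  ext K i
  rw [MeasurableEquiv.coe_piCongrLeft]
  conv_rhs => rw [← π.symm_apply_apply i]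
  rw [Equiv.piCongrLeft_apply_apply, Function.comp_apply]

theorem measurePreserving_permConfig (m : Fin r → ℝ) {n w l s : ℕ} (π : Equiv.Perm (Fin n))
    (ρ : Equiv.Perm (Fin w)) (σ : Equiv.Perm (Fin l)) (τ : Equiv.Perm (Fin s)) :
    MeasurePreserving (permConfig π ρ σ τ) (configMeasure m n w l s) (configMeasure m n w l s) :=
  (measurePreserving_comp_perm _ π).prod ((measurePreserving_comp_perm _ ρ).prod
    ((measurePreserving_comp_perm _ σ).prod (measurePreserving_comp_perm _ τ)))

/-- `H_{nwls}`: square integrable functions that are symmetric in the variables of the vector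
particles and of the scalar ghosts, antisymmetric in those of each type of Fermionic ghosts. -/
def sector (m : Fin r → ℝ) (n w l s : ℕ) : Submodule ℂ (Lp ℂ 2 (configMeasure m n w l s)) where
  carrier := {Φ | ∀ (π : Equiv.Perm (Fin n)) (ρ : Equiv.Perm (Fin w)) (σ : Equiv.Perm (Fin l))
    (τ : Equiv.Perm (Fin s)), ∀ᵐ x ∂configMeasure m n w l s,
      Φ (permConfig π ρ σ τ x) =
        ((Equiv.Perm.sign ρ : ℤ) : ℂ) * ((Equiv.Perm.sign σ : ℤ) : ℂ) * Φ x}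
  zero_mem' := by
    intro π ρ σ τ
    have h := Lp.coeFn_zero ℂ 2 (configMeasure m n w l s)
    filter_upwards [h, (measurePreserving_permConfig m π ρ σ τ).quasiMeasurePreserving.ae h]
      with x h1 h2
    rw [h1, h2, Pi.zero_apply, Pi.zero_apply, mul_zero]
  add_mem' := by
    intro Φ Ψ hΦ hΨ π ρ σ τ
    have h := Lp.coeFn_add Φ Ψ
    filter_upwards [h, (measurePreserving_permConfig m π ρ σ τ).quasiMeasurePreserving.ae h,
      hΦ π ρ σ τ, hΨ π ρ σ τ] with x h1 h2 h3 h4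
    rw [h1, h2, Pi.add_apply, Pi.add_apply, h3, h4, mul_add]
  smul_mem' := by
    intro c Φ hΦ π ρ σ τ
    have h := Lp.coeFn_smul c Φ
    filter_upwards [h, (measurePreserving_permConfig m π ρ σ τ).quasiMeasurePreserving.ae h,
      hΦ π ρ σ τ] with x h1 h2 h3
    rw [h1, h2, Pi.smul_apply, Pi.smul_apply, h3, smul_eq_mul, smul_eq_mul]
    ring

/-- `H^gh = ⊕_{n,w,l,s} H_{nwls}` (Hilbert sum). -/
abbrev GhostSpace (m : Fin r → ℝ) : Type :=
  lp (fun i : ℕ × ℕ × ℕ × ℕ => sector m i.1 i.2.1 i.2.2.1 i.2.2.2) 2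

/-- Families of amplitudes `Φ^{(nwls)}(K; P; Q; R)`. -/
abbrev Amp (r : ℕ) : Type := ∀ n w l s : ℕ, Config r n w l s → ℂ

/-- The amplitudes of an element of `H^gh`. -/
def amp {m : Fin r → ℝ} (Φ : GhostSpace m) : Amp r := fun n w l s =>
  ((Φ (n, w, l, s) : sector m n w l s) : Lp ℂ 2 (configMeasure m n w l s))

theorem amp_zero (m : Fin r → ℝ) (n w l s : ℕ) :
    amp (0 : GhostSpace m) n w l s =ᵐ[configMeasure m n w l s] 0 :=
  Lp.coeFn_zero ℂ 2 (configMeasure m n w l s)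

theorem amp_add {m : Fin r → ℝ} (Φ Ψ : GhostSpace m) (n w l s : ℕ) :
    amp (Φ + Ψ) n w l s =ᵐ[configMeasure m n w l s] amp Φ n w l s + amp Ψ n w l s :=
  Lp.coeFn_add _ _

theorem amp_smul {m : Fin r → ℝ} (c : ℂ) (Φ : GhostSpace m) (n w l s : ℕ) :
    amp (c • Φ) n w l s =ᵐ[configMeasure m n w l s] c • amp Φ n w l s :=
  Lp.coeFn_smul _ _

/-- All momenta of the configuration are bounded by `R`. -/
def Config.Bounded {n w l s : ℕ} (R : ℝ) (x : Config r n w l s) : Prop :=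
  (∀ i, ‖(x.1 i).2.2‖ ≤ R) ∧ (∀ i, ‖(x.2.1 i).2‖ ≤ R) ∧ (∀ i, ‖(x.2.2.1 i).2‖ ≤ R) ∧
    ∀ i, ‖(x.2.2.2 i).2‖ ≤ R

theorem Config.Bounded.mono {n w l s : ℕ} {R S : ℝ} (h : R ≤ S) {x : Config r n w l s}
    (hx : x.Bounded R) : x.Bounded S :=
  ⟨fun i => (hx.1 i).trans h, fun i => (hx.2.1 i).trans h, fun i => (hx.2.2.1 i).trans h,
    fun i => (hx.2.2.2 i).trans h⟩

/-- The invariant domain of the (unbounded) supercharge and of the Poincaré transformations: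
states with finitely many particles and bounded momenta. -/
def core (m : Fin r → ℝ) : Submodule ℂ (GhostSpace m) where
  carrier := {Φ | {i | Φ i ≠ 0}.Finite ∧ ∃ R : ℝ, ∀ n w l s,
    ∀ᵐ x ∂configMeasure m n w l s, ¬ x.Bounded R → amp Φ n w l s x = 0}
  zero_mem' := by
    refine ⟨by simp, 0, fun n w l s => ?_⟩
    filter_upwards [amp_zero m n w l s] with x hx _
    rw [hx, Pi.zero_apply]
  add_mem' := by
    rintro Φ Ψ ⟨h1, R, hR⟩ ⟨h2, S, hS⟩
    refine ⟨(h1.union h2).subset fun i hi => ?_, max R S, fun n w l s => ?_⟩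
    · by_contra hn
      have hn' : Φ i = 0 ∧ Ψ i = 0 := by
        constructor
        · by_contra h; exact hn (Or.inl h)
        · by_contra h; exact hn (Or.inr h)
      refine hi ?_
      change Φ i + Ψ i = 0
      rw [hn'.1, hn'.2, add_zero]
    · filter_upwards [amp_add Φ Ψ n w l s, hR n w l s, hS n w l s] with x h3 h4 h5 hx
      rw [h3, Pi.add_apply, h4 fun h => hx (h.mono (le_max_left _ _)),
        h5 fun h => hx (h.mono (le_max_right _ _)), add_zero]
  smul_mem' := by
    rintro c Φ ⟨h1, R, hR⟩
    refine ⟨h1.subset fun i hi => ?_, R, fun n w l s => ?_⟩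
    · intro h
      refine hi ?_
      change c • Φ i = 0
      rw [h, smul_zero]
    · filter_upwards [amp_smul c Φ n w l s, hR n w l s] with x h3 h4 hx
      rw [h3, Pi.smul_apply, h4 hx, smul_zero]

/-! ## The Krein form and the supercharge -/

/-- The Krein operator `(JΦ)^{(nwls)}(K;P;Q;R) = (-1)^{wl} (-g)^{⊗n} Φ^{(nlws)}(K;Q;P;R)`. -/
def kreinAmp (Ψ : Amp r) : Amp r := fun n w l s x =>
  (-1 : ℂ) ^ (w * l) * (∏ i, (-(eta (x.1 i).1) : ℂ)) * Ψ n l w s (x.1, x.2.2.1, x.2.1, x.2.2.2)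

/-- The sesquilinear form `(Ψ, Φ) = ⟨Ψ, JΦ⟩` on `H^gh`. -/
def krein {m : Fin r → ℝ} (Ψ Φ : GhostSpace m) : ℂ :=
  ∑' i : ℕ × ℕ × ℕ × ℕ, ∫ x, conj (amp Ψ i.1 i.2.1 i.2.2.1 i.2.2.2 x) *
    kreinAmp (amp Φ) i.1 i.2.1 i.2.2.1 i.2.2.2 x ∂configMeasure m i.1 i.2.1 i.2.2.1 i.2.2.2

/-- The term `k^μ A_μ(k) c*(k)` of the supercharge. -/
def termAc (Ψ : Amp r) : Amp r
  | _, _, 0, _, _ => 0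
  | n, w, l + 1, s, (K, P, Q, R) =>
    (-1 : ℂ) ^ w * (Real.sqrt ((n + 1 : ℝ) / (l + 1 : ℝ)) : ℂ) *
      ∑ i : Fin (l + 1), (-1 : ℂ) ^ (i : ℕ) * ∑ ν : Fin 4, ((Q i).2 ν : ℂ) *
        Ψ (n + 1) w l s (Fin.cons (ν, Q i) K, P, i.removeNth Q, R)

/-- The term `k^μ A†_μ(k) b(k)` of the supercharge. -/
def termAb (Ψ : Amp r) : Amp r
  | 0, _, _, _, _ => 0
  | n + 1, w, l, s, (K, P, Q, R) =>
    -(Real.sqrt ((w + 1 : ℝ) / (n + 1 : ℝ)) : ℂ) *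
      ∑ i : Fin (n + 1), ((eta (K i).1 * (K i).2.2 (K i).1 : ℝ) : ℂ) *
        Ψ n (w + 1) l s (i.removeNth K, Fin.cons (K i).2 P, Q, R)

/-- The term `i m a(k) c*(k)` of the supercharge. -/
def termac (m : Fin r → ℝ) (Ψ : Amp r) : Amp r
  | _, _, 0, _, _ => 0
  | n, w, l + 1, s, (K, P, Q, R) =>
    Complex.I * (-1 : ℂ) ^ w * (Real.sqrt ((s + 1 : ℝ) / (l + 1 : ℝ)) : ℂ) *
      ∑ i : Fin (l + 1), (-1 : ℂ) ^ (i : ℕ) * (m (Q i).1 : ℂ) *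
        Ψ n w l (s + 1) (K, P, i.removeNth Q, Fin.cons (Q i) R)

/-- The term `-i m a*(k) b(k)` of the supercharge. -/
def termab (m : Fin r → ℝ) (Ψ : Amp r) : Amp r
  | _, _, _, 0, _ => 0
  | n, w, l, s + 1, (K, P, Q, R) =>
    -Complex.I * (Real.sqrt ((w + 1 : ℝ) / (s + 1 : ℝ)) : ℂ) *
      ∑ i : Fin (s + 1), (m (R i).1 : ℂ) *
        Ψ n (w + 1) l s (K, Fin.cons (R i) P, Q, i.removeNth R)

/-- `Q = ∑_a ∫ dα(k) [k^μ (A_μ(k) c*(k) + A†_μ(k) b(k)) + i m_a (a(k) c*(k) - a*(k) b(k))]`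
in terms of amplitudes. -/
def superchargeAmp (m : Fin r → ℝ) (Ψ : Amp r) : Amp r := fun n w l s x =>
  termAc Ψ n w l s x + termAb Ψ n w l s x + termac m Ψ n w l s x + termab m Ψ n w l s x

/-- `Q` is the supercharge on the invariant domain. -/
def IsSupercharge (m : Fin r → ℝ) (Q : core m →ₗ[ℂ] core m) : Prop :=
  ∀ (Φ : core m) (n w l s : ℕ), amp (Q Φ : GhostSpace m) n w l s
    =ᵐ[configMeasure m n w l s] superchargeAmp m (amp (Φ : GhostSpace m)) n w l s

/-- `Ker(Q) / Im(Q)`. -/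
abbrev Cohomology {m : Fin r → ℝ} (Q : core m →ₗ[ℂ] core m) : Type :=
  LinearMap.ker Q ⧸ (LinearMap.range Q).submoduleOf (LinearMap.ker Q)

/-- The class `[Φ]` of `Φ ∈ Ker(Q)`. -/
def cls {m : Fin r → ℝ} (Q : core m →ₗ[ℂ] core m) (Φ : LinearMap.ker Q) : Cohomology Q :=
  Submodule.Quotient.mk Φ

/-! ## The subspace `H'` -/

/-- Insertion of `(ν, y)` as the first vector variable. -/
def insVec {n w l s : ℕ} (ν : Fin 4) (y : Scal r) (x : Config r n w l s) :
    Config r (n + 1) w l s :=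
  (Fin.cons (ν, y) x.1, x.2)

theorem quasiMeasurePreserving_insVec (m : Fin r → ℝ) (n w l s : ℕ) (ν : Fin 4) :
    Measure.QuasiMeasurePreserving
      (fun z : Scal r × Config r n w l s => insVec ν z.1 z.2)
      ((scalMeasure m).prod (configMeasure m n w l s)) (configMeasure m (n + 1) w l s) := by
  have h1 := QuasiMeasurePreserving.prodMap (quasiMeasurePreserving_mkVec m ν)
    (Measure.QuasiMeasurePreserving.id (configMeasure m n w l s))
  have h2 := (measurePreserving_prodAssoc (vecMeasure m)
    (Measure.pi fun _ : Fin n => vecMeasure m) ((Measure.pi fun _ : Fin w => scalMeasure m).prod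
    ((Measure.pi fun _ : Fin l => scalMeasure m).prod
      (Measure.pi fun _ : Fin s => scalMeasure m)))).symm
  have h3 := (measurePreserving_piFinSuccAbove (fun _ : Fin (n + 1) => vecMeasure m) 0).symm
  have h4 := h3.prod (MeasurePreserving.id ((Measure.pi fun _ : Fin w => scalMeasure m).prod
    ((Measure.pi fun _ : Fin l => scalMeasure m).prod
      (Measure.pi fun _ : Fin s => scalMeasure m))))
  have h5 := (h4.comp h2).quasiMeasurePreserving.comp h1
  convert h5 using 1
  swap
  · rfl
  ext z : 1
  refine Prod.ext ?_ rfl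
  change (Fin.cons (ν, z.1) z.2.1 : Fin (n + 1) → Vec r) =
    @Fin.insertNth n (fun _ => Vec r) 0 (ν, z.1) z.2.1
  rw [Fin.insertNth_zero']

/-- The part of `H' = ⊕_n H'_n` in the invariant domain: states without ghosts with
`k₁^{ν₁} Φ^{(n)}_{ν₁…νₙ}(k₁,…,kₙ) = 0`. -/
def physical (m : Fin r → ℝ) : Submodule ℂ (core m) where
  carrier := {Φ | (∀ n w l s, (w, l, s) ≠ (0, 0, 0) → (Φ : GhostSpace m) (n, w, l, s) = 0) ∧
    ∀ n, ∀ᵐ z ∂(scalMeasure m).prod (configMeasure m n 0 0 0),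
      ∑ ν, (z.1.2 ν : ℂ) * amp (Φ : GhostSpace m) (n + 1) 0 0 0 (insVec ν z.1 z.2) = 0}
  zero_mem' := by
    refine ⟨fun _ _ _ _ _ => rfl, fun n => ?_⟩
    have h := fun ν => (quasiMeasurePreserving_insVec m n 0 0 0 ν).ae (amp_zero m (n + 1) 0 0 0)
    filter_upwards [ae_all_iff.2 h] with z hz
    refine Finset.sum_eq_zero fun ν _ => ?_
    have := hz ν
    rw [Pi.zero_apply] at this
    rw [Submodule.coe_zero, this, mul_zero]
  add_mem' := by
    rintro Φ Ψ ⟨h1, h2⟩ ⟨h3, h4⟩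
    refine ⟨fun n w l s h => ?_, fun n => ?_⟩
    · change (Φ : GhostSpace m) (n, w, l, s) + (Ψ : GhostSpace m) (n, w, l, s) = 0
      rw [h1 n w l s h, h3 n w l s h, add_zero]
    have h := fun ν => (quasiMeasurePreserving_insVec m n 0 0 0 ν).ae
      (amp_add (Φ : GhostSpace m) (Ψ : GhostSpace m) (n + 1) 0 0 0)
    filter_upwards [ae_all_iff.2 h, h2 n, h4 n] with z hz h5 h6
    rw [Submodule.coe_add]
    simp only [hz, Pi.add_apply, mul_add, Finset.sum_add_distrib]
    rw [h5, h6, add_zero]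
  smul_mem' := by
    rintro c Φ ⟨h1, h2⟩
    refine ⟨fun n w l s h => ?_, fun n => ?_⟩
    · change c • (Φ : GhostSpace m) (n, w, l, s) = 0
      rw [h1 n w l s h, smul_zero]
    have h := fun ν => (quasiMeasurePreserving_insVec m n 0 0 0 ν).ae
      (amp_smul c (Φ : GhostSpace m) (n + 1) 0 0 0)
    filter_upwards [ae_all_iff.2 h, h2 n] with z hz h5
    rw [Submodule.coe_smul]
    simp only [hz, Pi.smul_apply, smul_eq_mul, mul_left_comm _ c, ← Finset.mul_sum]
    rw [h5, mul_zero]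

/-- `φ ∈ H_m` has bounded momenta. -/
def PreParticle.Bounded {m : Fin r → ℝ} (φ : PreParticle m) : Prop :=
  ∃ R : ℝ, ∀ᵐ z ∂vecMeasure m, R < ‖z.2.2‖ → φ.toLp z = 0

/-- `Φ = φ₁ ∨ ⋯ ∨ φₙ` as an element of `H' ⊆ H^gh`. -/
def IsWedge {m : Fin r → ℝ} (n : ℕ) (φ : Fin n → PreParticle m) (Φ : GhostSpace m) : Prop :=
  (∀ i, i ≠ (n, 0, 0, 0) → Φ i = 0) ∧
    amp Φ n 0 0 0 =ᵐ[configMeasure m n 0 0 0] fun x =>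
      (n.factorial : ℂ)⁻¹ * ∑ σ : Equiv.Perm (Fin n), ∏ i, (φ (σ i)).toLp (x.1 i)

/-! ## The Poincaré group -/

/-- Elements `(a, Λ)` of the full Poincaré group: translations and Lorentz matrices. -/
structure Poincare where
  a : Mom
  L : Matrix (Fin 4) (Fin 4) ℝ
  isLorentz : L.transpose * Matrix.diagonal eta * L = Matrix.diagonal eta

namespace Poincare

open Classical in
/-- `+1` if `Λ` is orthochronous, `-1` if it reverses time. -/
def sgn (g : Poincare) : ℝ := if 0 < g.L 0 0 then 1 else -1

open Classical in
/-- Complex conjugation for time-reversing elements, the identity otherwise. -/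
def conjIfReversing (g : Poincare) : ℂ →+* ℂ :=
  if 0 < g.L 0 0 then RingHom.id ℂ else starRingEnd ℂ

instance (g : Poincare) : RingHomInvPair g.conjIfReversing g.conjIfReversing := by
  unfold conjIfReversing
  split_ifs <;> infer_instance

/-- `p ↦ ±Λ⁻¹ p`, the sign being that of `sgn`, so that the upper hyperboloids are preserved. -/
def pull (g : Poincare) (y : Scal r) : Scal r := (y.1, g.sgn • (g.L⁻¹).mulVec y.2)

/-- `Λ_μ{}^ν`, the Lorentz matrix acting on covariant indices. -/
def cov (g : Poincare) (μ ν : Fin 4) : ℝ := eta μ * g.L μ ν * eta ν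

/-- `e^{i a·p}`. -/
def phase (g : Poincare) (p : Mom) : ℂ := Complex.exp (Complex.I * (mink g.a p : ℂ))

end Poincare

/-- The one-particle action: `(U_{a,Λ} φ)(p) = e^{ia·p} Λ φ(Λ⁻¹p)` for orthochronous `Λ` and
`(U_{a,Λ} φ)(p) = e^{ia·p} Λ conj(φ(-Λ⁻¹p))` otherwise; in particular
`(U_{I_t} φ)(p) = I_t conj(φ(I_s p))`. -/
def oneAction (g : Poincare) (f : Vec r → ℂ) (z : Vec r) : ℂ :=
  g.phase z.2.2 * ∑ ν, (g.cov z.1 ν : ℂ) * g.conjIfReversing (f (ν, g.pull z.2))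

/-- The second quantised action on amplitudes. Each scalar variable transforms by
`f ↦ e^{ia·p} f(Λ⁻¹p)`; under time reversal, `a` transforms by `f ↦ conj(f(I_s p))`, and `b`
and `c` by `f ↦ -conj(f(I_s p))`. -/
def ghostAction (g : Poincare) (Ψ : Amp r) : Amp r := fun n w l s x =>
  (g.sgn : ℂ) ^ (w + l) *
    ((∏ i, g.phase (x.1 i).2.2) * (∏ i, g.phase (x.2.1 i).2) * (∏ i, g.phase (x.2.2.1 i).2) *
      ∏ i, g.phase (x.2.2.2 i).2) *
    ∑ ν : Fin n → Fin 4, (∏ i, (g.cov (x.1 i).1 (ν i) : ℂ)) *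
      g.conjIfReversing (Ψ n w l s (fun i => (ν i, g.pull (x.1 i).2), g.pull ∘ x.2.1,
        g.pull ∘ x.2.2.1, g.pull ∘ x.2.2.2))

/-- `U` is the operator `U_g` on the invariant domain of `H^gh`. -/
def IsGhostAction {m : Fin r → ℝ} (g : Poincare)
    (U : core m →ₛₗ[g.conjIfReversing] core m) : Prop :=
  ∀ (Φ : core m) (n w l s : ℕ), amp (U Φ : GhostSpace m) n w l s
    =ᵐ[configMeasure m n w l s] ghostAction g (amp (Φ : GhostSpace m)) n w l s

/-- `u` is the (anti)unitary extension of `U_g` from `H_m` to the one-particle Hilbert space. -/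
def IsParticleAction {m : Fin r → ℝ} (g : Poincare)
    (u : Particle m ≃ₛₗᵢ[g.conjIfReversing] Particle m) : Prop :=
  ∀ φ : PreParticle m, ∃ ψ : PreParticle m,
    (ψ.toLp =ᵐ[vecMeasure m] oneAction g φ.toLp) ∧ u (φ : Particle m) = (ψ : Particle m)

/-- `V = Γ(u)`, i.e. `V (φ₁ ∨ ⋯ ∨ φₙ) = uφ₁ ∨ ⋯ ∨ uφₙ`. -/
def IsSecondQuantised {K : Type} [NormedAddCommGroup K] [InnerProductSpace ℂ K] {σ : ℂ →+* ℂ}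
    [RingHomInvPair σ σ] (u : K ≃ₛₗᵢ[σ] K) (V : BosonFock K ≃ₛₗᵢ[σ] BosonFock K) : Prop :=
  ∀ (n : ℕ) (v : Fin n → K), V (wedge n v) = wedge n fun i => u (v i)


end MassiveVector

end

open MeasureTheory TensorProduct
open scoped BigOperators ComplexConjugate InnerProductSpace ENNReal

noncomputable section

namespace MassiveVector

/-! ## Words of particle variables and second quantised one-particle operators -/

/-! The whole theory is the second quantisation of a four-letter one-particle complex, and the proof
keeps it in that form. A state is encoded by a single function of words in the letters `A`, `b`,
`c`, `a` that picks up the exchange sign under adjacent swaps (`SuperSym`). Its amplitudes are the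
values at sorted words, divided by √(n! w! l! s!). With this normalisation the square roots in the
supercharge disappear, and `superchargeAmp_wordAmp` identifies Q with the superderivation of the
one-particle map A_μ ↦ -p_μ b, c ↦ p^ν A_ν + i m a, a ↦ -i m b, b ↦ 0. By `der_anticomm` the
anticommutator of two odd superderivations is the derivation of the anticommutator of their kernels,
so operator identities reduce to checks on four letters. For instance, Q² = 0 says that -p·p + m² =
0 on the mass shell.

The cohomology is computed by a Hodge-type argument. The involution G exchanges b and c (rescaled by
m^{±2}) and changes the sign of a. For H = GQG one finds -½(QH + HQ) = N, the derivation whose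
kernel is the projection onto the unphysical letters: all ghosts, and the longitudinal part p_μ
p^ν/m² of A. So N counts unphysical particles, and on words of at most n letters its eigenvalues lie
in {0, …, n}. No spectral theory is needed: for a state with at most n particles, (N-n)⋯(N-1)Φ is
physical (`fallingVec_mem_physical`), and for QΦ = 0 it equals a non-zero multiple of Φ plus a
coboundary. Every class therefore has a physical representative (`exists_physical_add`).

The Krein form is symmetric for Q, hence vanishes between cocycles and coboundaries. On transverse
tensors it is positive definite: three covectors depending on p satisfy Σ_j e_j e_j = -g + p p/m²,
and the last term is invisible to transverse tensors, so the form becomes a sum of squares of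
components (`sum_eta_transverse`). Positive definiteness makes a physical coboundary zero, which
gives uniqueness of the representative and the inner product on cohomology
(`exists_core_cohomology`).

Poincaré transformations preserve the invariant measure (`measurePreserving_shell`). They are second
quantisations of one-particle maps intertwining the kernel of Q, and they commute with G. They thus
commute with N and preserve its kernel, the physical space.

All Hilbert space isomorphisms arise from one principle: two total families with the same Gram
matrix, up to complex conjugation, are related by a unique (anti)unitary operator
(`exists_isometryEquiv_of_inner`). For W the families are wedge products. Their totality on the
physical side is the analytic core: a symmetrised transverse projection with momentum cutoff is
bounded on L², fixes the amplitudes under study, and sends indicators of boxes, which are total, to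
wedge products (`eq_zero_of_isWedge`). -/

/-- The variable of a particle of one of the four types. -/
inductive Letter (r : ℕ) : Type
  | A (z : Vec r)
  | b (y : Scal r)
  | c (y : Scal r)
  | a (y : Scal r)

namespace Letter

variable {r : ℕ}

/-- `-1` for Fermionic variables, `1` for Bosonic ones. -/
def eps : Letter r → ℂ
  | A _ => 1
  | b _ => -1
  | c _ => -1
  | a _ => 1

/-- The sign of the exchange of two variables. -/
def swapSign : Letter r → Letter r → ℂ
  | b _, b _ => -1
  | b _, c _ => -1
  | c _, b _ => -1
  | c _, c _ => -1
  | _, _ => 1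

theorem eps_mul_self (x : Letter r) : x.eps * x.eps = 1 := by cases x <;> simp [eps]

theorem swapSign_mul_self (x y : Letter r) : swapSign x y * swapSign x y = 1 := by
  cases x <;> cases y <;> simp [swapSign]

theorem swapSign_comm (x y : Letter r) : swapSign x y = swapSign y x := by
  cases x <;> cases y <;> simp [swapSign]

/-- Changing the statistics of a letter matters only when the other letter is Fermionic. This is the
sign rule that lets an odd superderivation preserve supersymmetry. -/
theorem swapSign_of_eps_neg {x z : Letter r} (h : z.eps = -x.eps) (y : Letter r) :
    swapSign z y = swapSign x y * y.eps := by
  cases x <;> cases y <;> cases z <;> simp [swapSign, eps] at h ⊢ <;> norm_num at h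

theorem swapSign_of_eps_eq {x z : Letter r} (h : z.eps = x.eps) (y : Letter r) :
    swapSign z y = swapSign x y := by
  cases x <;> cases y <;> cases z <;> simp [swapSign, eps] at h ⊢ <;> norm_num at h

/-- One of the two letters is Bosonic. Hence a letter created by an odd kernel passes freely over
letters of the type it was created from. -/
theorem swapSign_eq_one {x z : Letter r} (h : z.eps = -x.eps) : swapSign z x = 1 := by
  cases x <;> cases z <;> simp [swapSign, eps] at h ⊢ <;> norm_num at h

/-- The momentum of the variable lies on its mass shell. -/
def OnShell (m : Fin r → ℝ) : Letter r → Prop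
  | A z => z.2.2 ∈ shell (m z.2.1)
  | b y => y.2 ∈ shell (m y.1)
  | c y => y.2 ∈ shell (m y.1)
  | a y => y.2 ∈ shell (m y.1)

end Letter

section Words

variable {r : ℕ}

/-- Functions of words. -/
abbrev WordFn (r : ℕ) : Type := List (Letter r) → ℂ

/-- Kernels of one-particle operators. -/
abbrev OneKernel (r : ℕ) : Type := Letter r → (Letter r →₀ ℂ)

open Finsupp (linearCombination)

/-- Fixing the first letter. -/
def headFix (x : Letter r) : WordFn r →ₗ[ℂ] WordFn r := LinearMap.funLeft ℂ ℂ (List.cons x)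

@[simp] theorem headFix_apply (x : Letter r) (F : WordFn r) (t : List (Letter r)) :
    headFix x F t = F (x :: t) := rfl

/-- The one-particle operator acting on the first letter. -/
def headOp (κ : OneKernel r) (x : Letter r) : WordFn r →ₗ[ℂ] WordFn r :=
  linearCombination ℂ headFix (κ x)

theorem headOp_apply (κ : OneKernel r) (x : Letter r) (F : WordFn r) :
    headOp κ x F = linearCombination ℂ (fun y => headFix y F) (κ x) := by
  simp [headOp, Finsupp.linearCombination_apply, Finsupp.sum, LinearMap.sum_apply]

theorem headOp_apply_apply (κ : OneKernel r) (x : Letter r) (F : WordFn r) (t : List (Letter r)) :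
    headOp κ x F t = linearCombination ℂ (fun y => F (y :: t)) (κ x) := by
  simp [headOp, Finsupp.linearCombination_apply, Finsupp.sum, LinearMap.sum_apply]

/-- The superderivation with one-particle kernel `κ`, with sign function `e`, at a word. -/
def derAt (e : Letter r → ℂ) (κ : OneKernel r) : List (Letter r) → WordFn r →ₗ[ℂ] ℂ
  | [] => 0
  | x :: t => LinearMap.proj t ∘ₗ headOp κ x + e x • (derAt e κ t ∘ₗ headFix x)

/-- The superderivation with one-particle kernel `κ` and sign function `e`. -/
def der (e : Letter r → ℂ) (κ : OneKernel r) : WordFn r →ₗ[ℂ] WordFn r :=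
  LinearMap.pi (derAt e κ)

@[simp] theorem der_nil (e : Letter r → ℂ) (κ : OneKernel r) (F : WordFn r) :
    der e κ F [] = 0 := rfl

theorem der_cons (e : Letter r → ℂ) (κ : OneKernel r) (F : WordFn r) (x : Letter r)
    (t : List (Letter r)) :
    der e κ F (x :: t) = headOp κ x F t + e x * der e κ (headFix x F) t := rfl

theorem headFix_der (e : Letter r → ℂ) (κ : OneKernel r) (F : WordFn r) (x : Letter r) :
    headFix x (der e κ F) = headOp κ x F + e x • der e κ (headFix x F) := rfl

/-- The kernel of the composition of two one-particle operators. -/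
def compKernel (κ l : OneKernel r) : OneKernel r := fun x => linearCombination ℂ l (κ x)

theorem linearCombination_compKernel {M : Type*} [AddCommGroup M] [Module ℂ M]
    (κ l : OneKernel r) (x : Letter r) (v : Letter r → M) :
    linearCombination ℂ v (compKernel κ l x) =
      linearCombination ℂ (fun y => linearCombination ℂ v (l y)) (κ x) := by
  rw [compKernel, Finsupp.apply_linearCombination]
  rfl

/-- `κ` exchanges Bosonic and Fermionic variables. -/
def IsOdd (κ : OneKernel r) : Prop := ∀ x, ∀ y ∈ (κ x).support, y.eps = -x.eps

/-- `κ` preserves the statistics. -/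
def IsEven (κ : OneKernel r) : Prop := ∀ x, ∀ y ∈ (κ x).support, y.eps = x.eps

theorem linearCombination_congr {M : Type*} [AddCommGroup M] [Module ℂ M] {f : Letter r →₀ ℂ}
    {v w : Letter r → M} (h : ∀ y ∈ f.support, v y = w y) :
    linearCombination ℂ v f = linearCombination ℂ w f := by
  rw [Finsupp.linearCombination_apply, Finsupp.linearCombination_apply]
  exact Finset.sum_congr rfl fun y hy => congrArg (f y • ·) (h y hy)

theorem linearCombination_smul_fun {M : Type*} [AddCommGroup M] [Module ℂ M] (f : Letter r →₀ ℂ)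
    (c : ℂ) (v : Letter r → M) :
    linearCombination ℂ (fun y => c • v y) f = c • linearCombination ℂ v f := by
  simp only [Finsupp.linearCombination_apply, Finsupp.sum, Finset.smul_sum]
  exact Finset.sum_congr rfl fun y _ => smul_comm _ _ _

theorem linearCombination_add_fun {M : Type*} [AddCommGroup M] [Module ℂ M] (f : Letter r →₀ ℂ)
    (v w : Letter r → M) :
    linearCombination ℂ (fun y => v y + w y) f =
      linearCombination ℂ v f + linearCombination ℂ w f := by
  simp only [Finsupp.linearCombination_apply, Finsupp.sum, smul_add, Finset.sum_add_distrib]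

/-- Leibniz rule: after `κ` has replaced the first letter, `l` hits either the new letter, which
composes the kernels, or the rest of the word. The latter costs the sign of the new letter, and `hκ`
makes that sign the same for all letters that `κ` can produce. -/
theorem headOp_der {κ l : OneKernel r} {e : Letter r → ℂ} {c : ℂ} {x : Letter r}
    (hκ : ∀ y ∈ (κ x).support, e y = c) (F : WordFn r) :
    headOp κ x (der e l F) = headOp (compKernel κ l) x F + c • der e l (headOp κ x F) := by
  rw [headOp_apply, headOp_apply, linearCombination_compKernel, headOp_apply,
    Finsupp.apply_linearCombination, ← linearCombination_smul_fun, ← linearCombination_add_fun]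
  refine linearCombination_congr fun y hy => ?_
  rw [headFix_der, headOp_apply, hκ y hy]
  rfl

/-- The anticommutator of two odd superderivations is an even derivation. -/
theorem der_anticomm {m : Fin r → ℝ} {κ l ρ : OneKernel r} (hκ : IsOdd κ) (hl : IsOdd l)
    (h : ∀ x : Letter r, x.OnShell m → compKernel κ l x + compKernel l κ x = ρ x) :
    ∀ (w : List (Letter r)), (∀ x ∈ w, x.OnShell m) → ∀ F : WordFn r,
      der Letter.eps κ (der Letter.eps l F) w + der Letter.eps l (der Letter.eps κ F) w =
        der 1 ρ F w
  | [], _, F => by simp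
  | x :: t, hw, F => by
    have ih := der_anticomm hκ hl h t (fun y hy => hw y (List.mem_cons_of_mem _ hy)) (headFix x F)
    have hx := h x (hw x List.mem_cons_self)
    have h1 : headOp (compKernel κ l) x F + headOp (compKernel l κ) x F = headOp ρ x F := by
      rw [headOp_apply, headOp_apply, headOp_apply, ← map_add, hx]
    have h1' := congrFun h1 t
    have h2 := x.eps_mul_self
    rw [der_cons, der_cons, headOp_der (hκ x), headOp_der (hl x), headFix_der, headFix_der,
      der_cons, ← ih, ← h1]
    simp only [map_add, map_smul, Pi.add_apply, Pi.smul_apply, smul_eq_mul, Pi.one_apply]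
    -- The mixed terms, with one operator on the first letter and one on the rest, cancel in pairs,
    -- because an odd kernel reverses the sign of the first letter. What is left of that sign is its
    -- square, which is 1.
    linear_combination (der Letter.eps κ (der Letter.eps l (headFix x F)) t +
      der Letter.eps l (der Letter.eps κ (headFix x F)) t) * h2

/-! ### Supersymmetric functions of words -/

/-- Supersymmetric functions of words. -/
def SuperSym (F : WordFn r) : Prop :=
  ∀ (p : List (Letter r)) (x y : Letter r) (t : List (Letter r)),
    F (p ++ x :: y :: t) = x.swapSign y * F (p ++ y :: x :: t)

theorem SuperSym.front {F : WordFn r} (h : SuperSym F) (x y : Letter r) (t : List (Letter r)) :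
    F (x :: y :: t) = x.swapSign y * F (y :: x :: t) := h [] x y t

theorem SuperSym.fix {F : WordFn r} (h : SuperSym F) (x : Letter r) :
    SuperSym (headFix x F) := fun p => h (x :: p)

theorem SuperSym.add {F G : WordFn r} (hF : SuperSym F) (hG : SuperSym G) : SuperSym (F + G) :=
  fun p x y t => by simp only [Pi.add_apply]; rw [hF, hG, mul_add]

theorem SuperSym.smul {F : WordFn r} (hF : SuperSym F) (c : ℂ) : SuperSym (c • F) :=
  fun p x y t => by simp only [Pi.smul_apply, smul_eq_mul]; rw [hF]; ring

theorem SuperSym.zero : SuperSym (0 : WordFn r) := fun p x y t => by simp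

theorem SuperSym.appendRight {F : WordFn r} (hF : SuperSym F) (u : List (Letter r)) :
    SuperSym (fun w => F (w ++ u)) := fun p x y t => by
  simpa using hF p x y (t ++ u)

theorem SuperSym.appendLeft {F : WordFn r} (hF : SuperSym F) (u : List (Letter r)) :
    SuperSym (fun w => F (u ++ w)) := fun p x y t => by
  simpa using hF (u ++ p) x y t

theorem SuperSym.linearCombination {ι : Type*} {v : ι → WordFn r} (hv : ∀ i, SuperSym (v i))
    (f : ι →₀ ℂ) : SuperSym (Finsupp.linearCombination ℂ v f) := by
  rw [Finsupp.linearCombination_apply]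
  exact Finset.sum_induction _ SuperSym (fun _ _ => SuperSym.add) SuperSym.zero
    fun i _ => (hv i).smul _

theorem SuperSym.op {F : WordFn r} (h : SuperSym F) (κ : OneKernel r) (x : Letter r) :
    SuperSym (headOp κ x F) := by
  rw [headOp_apply]
  exact SuperSym.linearCombination (fun y => h.fix y) _

/-- The second letter is pulled in front of every letter that `κ` can put first. The sign comes out
of the combination because it is constant on the support. -/
theorem headOp_cons_of_superSym {F : WordFn r} (hF : SuperSym F) {κ : OneKernel r} {x y : Letter r}
    {c : ℂ} (h : ∀ z ∈ (κ x).support, z.swapSign y = c) (t : List (Letter r)) :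
    headOp κ x F (y :: t) = c * headOp κ x (headFix y F) t := by
  rw [headOp_apply_apply, headOp_apply_apply, ← smul_eq_mul, ← linearCombination_smul_fun]
  refine linearCombination_congr fun z hz => ?_
  rw [hF.front, h z hz]
  rfl

theorem SuperSym.headFix_comm {F : WordFn r} (hF : SuperSym F) (x y : Letter r) :
    headFix y (headFix x F) =
      x.swapSign y • headFix x (headFix y F) :=
  funext fun t => hF.front x y t

/-- Only the exchange of the first two letters needs an argument: the term in which the operator
hits one of them turns into the term in which it hits the other after the exchange, and the sign
collected in passing matches by oddness. Exchanges further inside commute with fixing or replacing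
the first letter. -/
theorem SuperSym.der_odd {κ : OneKernel r} (hκ : IsOdd κ) {F : WordFn r} (hF : SuperSym F) :
    SuperSym (der Letter.eps κ F) := by
  intro p
  induction p generalizing F with
  | nil =>
    intro x y t
    have h1 := fun x y => headOp_cons_of_superSym hF (y := y)
      (fun z hz => Letter.swapSign_of_eps_neg (hκ x z hz) y) t
    simp only [List.nil_append, der_cons, h1, Pi.smul_apply, smul_eq_mul,
      hF.headFix_comm x y, map_smul, y.swapSign_comm x]
    linear_combination -(x.eps * headOp κ y (headFix x F) t) *
      Letter.swapSign_mul_self x y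
  | cons z p ih =>
    intro x y t
    have h1 := hF.op κ z p x y t
    have h2 := ih (hF.fix z) x y t
    simp only [List.cons_append, der_cons, h1, h2]
    ring

theorem SuperSym.der_even {κ : OneKernel r} (hκ : IsEven κ) {F : WordFn r} (hF : SuperSym F) :
    SuperSym (der 1 κ F) := by
  intro p
  induction p generalizing F with
  | nil =>
    intro x y t
    have h1 := fun x y => headOp_cons_of_superSym hF (y := y)
      (fun z hz => Letter.swapSign_of_eps_eq (hκ x z hz) y) t
    simp only [List.nil_append, der_cons, h1, Pi.smul_apply, smul_eq_mul,
      hF.headFix_comm x y, map_smul, y.swapSign_comm x, Pi.one_apply]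
    linear_combination -(headOp κ y (headFix x F) t) *
      Letter.swapSign_mul_self x y
  | cons z p ih =>
    intro x y t
    have h1 := hF.op κ z p x y t
    have h2 := ih (hF.fix z) x y t
    simp only [List.cons_append, der_cons, h1, h2, Pi.one_apply]
    ring

/-! ### Factorial powers of the number operator -/

/-- `∏_{j<n} (T - j)`. -/
def fallingOp {M : Type*} [AddCommGroup M] [Module ℂ M] (T : M →ₗ[ℂ] M) : ℕ → (M →ₗ[ℂ] M)
  | 0 => LinearMap.id
  | n + 1 => (T - (n : ℂ) • LinearMap.id) ∘ₗ fallingOp T n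

theorem fallingOp_succ_apply {M : Type*} [AddCommGroup M] [Module ℂ M] (T : M →ₗ[ℂ] M) (n : ℕ)
    (v : M) : fallingOp T (n + 1) v = T (fallingOp T n v) - (n : ℂ) • fallingOp T n v := rfl

theorem fallingOp_comm {M : Type*} [AddCommGroup M] [Module ℂ M] (T : M →ₗ[ℂ] M) (n : ℕ) (v : M) :
    T (fallingOp T n v) = fallingOp T n (T v) := by
  induction n with
  | zero => rfl
  | succ n ih => rw [fallingOp_succ_apply, fallingOp_succ_apply, map_sub, map_smul, ih]

/-- Shifting T by one shifts the zeros of the falling factorial: ∏_{j ≤ n} (T + 1 - j) = (T + 1)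
∏_{j < n} (T - j). -/
theorem fallingOp_add_one {M : Type*} [AddCommGroup M] [Module ℂ M] (T : M →ₗ[ℂ] M) (n : ℕ)
    (v : M) : fallingOp (T + LinearMap.id) (n + 1) v =
      T (fallingOp T n v) + fallingOp T n v := by
  induction n with
  | zero => simp [fallingOp]
  | succ n ih =>
    rw [fallingOp_succ_apply, ih, fallingOp_succ_apply]
    simp only [LinearMap.add_apply, LinearMap.id_apply, map_add, map_sub, map_smul]
    push_cast
    module

/-! ### Falling factorials of the number operator of an idempotent one-particle kernel -/

section Projection

variable {m : Fin r → ℝ} {π : OneKernel r}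

/-- Agreement on words of on-shell letters. -/
def ShellEq (m : Fin r → ℝ) (F G : WordFn r) : Prop :=
  ∀ w : List (Letter r), (∀ x ∈ w, x.OnShell m) → F w = G w

/-- Since `π` is idempotent, a projected first letter counts exactly once: behind the projection, N
becomes N + 1 acting on the remaining letters. Idempotency is only required on shell, since for the
momentum projection it rests on p·p = m². -/
theorem headOp_der_one (hπ : ∀ x : Letter r, x.OnShell m → compKernel π π x = π x) {x : Letter r}
    (hx : x.OnShell m) (F : WordFn r) :
    headOp π x (der 1 π F) = der 1 π (headOp π x F) + headOp π x F := by
  rw [headOp_der (e := 1) (c := 1) (fun _ _ => rfl), one_smul, add_comm]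
  congr 1
  rw [headOp_apply, hπ x hx, headOp_apply]

theorem fallingOp_intertwine {M N : Type*} [AddCommGroup M] [Module ℂ M] [AddCommGroup N]
    [Module ℂ N] {T : M →ₗ[ℂ] M} {T' : N →ₗ[ℂ] N} {B : M →ₗ[ℂ] N} (h : ∀ v, B (T v) = T' (B v))
    (n : ℕ) (v : M) : B (fallingOp T n v) = fallingOp T' n (B v) := by
  induction n with
  | zero => rfl
  | succ n ih => rw [fallingOp_succ_apply, fallingOp_succ_apply, map_sub, map_smul, h, ih]

/-- The first letter splits into its parts under 1 - π and π. On the former N acts as the number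
operator of the tail, on the latter as that operator plus one. -/
theorem headFix_fallingOp (hπ : ∀ x : Letter r, x.OnShell m → compKernel π π x = π x) (F : WordFn r)
    {x : Letter r} (hx : x.OnShell m) (n : ℕ) :
    headFix x (fallingOp (der 1 π) n F) = fallingOp (der 1 π) n (headFix x F - headOp π x F) +
      fallingOp (der 1 π + LinearMap.id) n (headOp π x F) := by
  have h1 := fallingOp_intertwine (T := der 1 π) (T' := der 1 π) (B := headFix x - headOp π x)
    (fun v => by
      simp only [LinearMap.sub_apply, headOp_der_one hπ hx, headFix_der, map_sub, Pi.one_apply,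
        one_smul]
      abel) n F
  have h2 := fallingOp_intertwine (T := der 1 π) (T' := der 1 π + LinearMap.id) (B := headOp π x)
    (fun v => headOp_der_one hπ hx v) n F
  rw [← h2]
  rw [LinearMap.sub_apply, LinearMap.sub_apply] at h1
  rw [← h1, sub_add_cancel]

/-- At a word of k on-shell letters N is a sum of k commuting projections, with eigenvalues in {0,
…, k}. The product over j = 0, …, n - 1 contains all these roots once n > k. The proof is an
induction that splits off the first letter. -/
theorem fallingOp_der_eq_zero (hπ : ∀ x : Letter r, x.OnShell m → compKernel π π x = π x) (n : ℕ)
    (w : List (Letter r)) (hw : ∀ x ∈ w, x.OnShell m) (hn : w.length < n) (F : WordFn r) :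
    fallingOp (der 1 π) n F w = 0 := by
  induction n generalizing w F with
  | zero => omega
  | succ n ih =>
    cases w with
    | nil =>
      clear ih hn
      induction n with
      | zero => simp [fallingOp]
      | succ n ih =>
        rw [fallingOp_succ_apply, Pi.sub_apply, Pi.smul_apply, ih]
        simp
    | cons x t =>
      have ht : ∀ y ∈ t, y.OnShell m := fun y hy => hw y (List.mem_cons_of_mem _ hy)
      have hl : t.length < n := by simpa using hn
      have h1 := congrFun (headFix_fallingOp hπ F (hw x List.mem_cons_self) (n + 1)) t
      rw [headFix_apply] at h1
      -- In both parts n of the n + 1 factors can be brought into a product acting on the shorter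
      -- word t, where the induction hypothesis applies.
      rw [h1, Pi.add_apply, fallingOp_add_one, fallingOp_succ_apply, fallingOp_comm]
      simp only [Pi.sub_apply, Pi.add_apply, Pi.smul_apply, ih t ht hl, fallingOp_comm]
      simp

theorem headOp_fallingOp_sub_one (hπ : ∀ x : Letter r, x.OnShell m → compKernel π π x = π x)
    (F : WordFn r) {x : Letter r} (hx : x.OnShell m) (n : ℕ) :
    headOp π x (fallingOp (der 1 π - LinearMap.id) n F) =
      fallingOp (der 1 π) n (headOp π x F) :=
  fallingOp_intertwine (fun v => by
    rw [LinearMap.sub_apply, map_sub, headOp_der_one hπ hx, LinearMap.id_apply,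
      add_sub_cancel_right]) n F

end Projection

theorem headOp_eq_zero {κ : OneKernel r} {x : Letter r} {F : WordFn r} {t : List (Letter r)}
    (h : ∀ y, F (y :: t) = 0) : headOp κ x F t = 0 := by
  rw [headOp_apply_apply, Finsupp.linearCombination_apply]
  exact Finset.sum_eq_zero fun y _ => by simp [h]

/-- One-particle operators replace letters without changing their number, so the values at words of
each length evolve separately. -/
theorem der_eq_zero_of_length {e : Letter r → ℂ} {κ : OneKernel r} {F : WordFn r} {n : ℕ}
    (h : ∀ u : List (Letter r), u.length = n → F u = 0) (w : List (Letter r)) (hw : w.length = n) :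
    der e κ F w = 0 := by
  induction w generalizing F n with
  | nil => rfl
  | cons x t ih =>
    subst hw
    rw [der_cons, headOp_eq_zero fun y => h _ rfl, ih (F := headFix x F) (fun u hu => h (x :: u) (by simp [hu])) rfl,
      mul_zero, add_zero]

theorem fallingOp_der_eq_zero_of_length {κ : OneKernel r} {F : WordFn r} {n : ℕ}
    (h : ∀ u : List (Letter r), u.length = n → F u = 0) (k : ℕ) (w : List (Letter r))
    (hw : w.length = n) : fallingOp (der 1 κ) k F w = 0 := by
  induction k generalizing w with
  | zero => exact h w hw
  | succ k ih =>
    rw [fallingOp_succ_apply, Pi.sub_apply, Pi.smul_apply, der_eq_zero_of_length ih w hw, ih w hw]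
    simp

/-- The part of `∏_{j=1}^n (N - j) F` that is longitudinal in the first letter vanishes if `F`
does so on words of more than `n` letters. -/
theorem headOp_fallingOp_eq_zero {m : Fin r → ℝ} {π : OneKernel r}
    (hπ : ∀ x : Letter r, x.OnShell m → compKernel π π x = π x) {F : WordFn r} {n : ℕ}
    (hF : ∀ u : List (Letter r), n < u.length → F u = 0) {x : Letter r} (hx : x.OnShell m)
    (t : List (Letter r)) (ht : ∀ y ∈ t, y.OnShell m) :
    headOp π x (fallingOp (der 1 π - LinearMap.id) n F) t = 0 := by
  rw [headOp_fallingOp_sub_one hπ F hx]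
  -- Behind the projection the product is ∏_{j<n} (N - j) on the tail. A tail shorter than n is
  -- killed by this product. For a longer tail the full word has more than n letters, where F itself
  -- vanishes.
  by_cases h : t.length < n
  · exact fallingOp_der_eq_zero hπ n t ht h _
  · exact fallingOp_der_eq_zero_of_length (fun u hu => headOp_eq_zero fun y =>
      hF _ (by simp only [List.length_cons]; omega)) n t rfl

/-! ### Second quantised (anti)linear maps -/

section Gamma

variable {σ : ℂ →+* ℂ}

/-- The function `F` at a word transformed by the one-particle map `u` followed by `σ`. -/
def gammaAt (σ : ℂ →+* ℂ) (u : OneKernel r) : List (Letter r) → (WordFn r →ₛₗ[σ] ℂ)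
  | [] => { toFun := fun F => σ (F []), map_add' := fun _ _ => map_add σ _ _,
            map_smul' := fun _ _ => map_mul σ _ _ }
  | x :: t => linearCombination ℂ (fun y => (gammaAt σ u t).comp (headFix y)) (u x)

/-- The second quantisation of `u` followed by `σ`. -/
def gamma (σ : ℂ →+* ℂ) (u : OneKernel r) (F : WordFn r) : WordFn r := fun w => gammaAt σ u w F

theorem gamma_nil (u : OneKernel r) (F : WordFn r) : gamma σ u F [] = σ (F []) := rfl

theorem gamma_cons (u : OneKernel r) (F : WordFn r) (x : Letter r) (t : List (Letter r)) :
    gamma σ u F (x :: t) = linearCombination ℂ (fun y => gamma σ u (headFix y F) t) (u x) := by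
  simp [gamma, gammaAt, Finsupp.linearCombination_apply, Finsupp.sum, LinearMap.sum_apply]

theorem headFix_gamma (u : OneKernel r) (F : WordFn r) (x : Letter r) :
    headFix x (gamma σ u F) = linearCombination ℂ (fun y => gamma σ u (headFix y F)) (u x) := by
  funext t
  rw [headFix_apply, gamma_cons]
  simp [Finsupp.linearCombination_apply, Finsupp.sum]

theorem gamma_add (u : OneKernel r) (F G : WordFn r) :
    gamma σ u (F + G) = gamma σ u F + gamma σ u G := funext fun w => map_add (gammaAt σ u w) F G

theorem gamma_smul (u : OneKernel r) (c : ℂ) (F : WordFn r) :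
    gamma σ u (c • F) = σ c • gamma σ u F := funext fun w => map_smulₛₗ (gammaAt σ u w) c F

theorem gamma_linearCombination (u : OneKernel r) (v : Letter r → WordFn r) (f : Letter r →₀ ℂ) :
    gamma σ u (linearCombination ℂ v f) =
      linearCombination ℂ (fun y => gamma σ u (v y)) (f.mapRange σ (map_zero σ)) := by
  rw [Finsupp.linearCombination_apply, Finsupp.linearCombination_apply,
    Finsupp.sum_mapRange_index (h := fun i a => a • gamma σ u (v i)) (fun _ => zero_smul _ _)]
  have h : ∀ s : Finset (Letter r), gamma σ u (∑ y ∈ s, f y • v y) =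
      ∑ y ∈ s, σ (f y) • gamma σ u (v y) := by
    classical
    intro s
    induction s using Finset.induction_on with
    | empty =>
      have := gamma_smul (σ := σ) u 0 (0 : WordFn r)
      simpa using this
    | insert y s hy ih => rw [Finset.sum_insert hy, Finset.sum_insert hy, gamma_add, gamma_smul, ih]
  exact h _

/-- An even map sends letters to letters with the same exchange signs, and these signs are ±1, so
that they are fixed by every ring homomorphism σ. -/
theorem SuperSym.gamma {u : OneKernel r} (hu : IsEven u) {F : WordFn r}
    (hF : SuperSym F) : SuperSym (gamma σ u F) := by
  intro p
  induction p generalizing F with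
  | nil =>
    intro x y t
    have key : ∀ x' ∈ (u x).support, ∀ y' ∈ (u y).support,
        MassiveVector.gamma σ u (headFix y' (headFix x' F)) t =
        x.swapSign y * MassiveVector.gamma σ u (headFix x' (headFix y' F)) t := by
      intro x' hx' y' hy'
      have h1 : x'.swapSign y' = x.swapSign y := by
        rw [Letter.swapSign_of_eps_eq (hu x x' hx'), Letter.swapSign_comm,
          Letter.swapSign_of_eps_eq (hu y y' hy'), Letter.swapSign_comm]
      have h2 : σ (x.swapSign y) = x.swapSign y := by
        have h3 : x.swapSign y = 1 ∨ x.swapSign y = -1 := by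
          have := x.swapSign_mul_self y
          exact mul_self_eq_one_iff.1 this
        rcases h3 with h | h <;> simp [h]
      rw [hF.headFix_comm, gamma_smul, h1, h2]
      rfl
    simp only [List.nil_append, gamma_cons, Finsupp.linearCombination_apply, Finsupp.sum,
      smul_eq_mul, Finset.mul_sum]
    rw [Finset.sum_comm]
    refine Finset.sum_congr rfl fun y' hy' => Finset.sum_congr rfl fun x' hx' => ?_
    rw [key x' hx' y' hy']
    ring
  | cons z p ih =>
    intro x y t
    simp only [List.cons_append, gamma_cons, Finsupp.linearCombination_apply, Finsupp.sum,
      smul_eq_mul, Finset.mul_sum]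
    refine Finset.sum_congr rfl fun z' hz' => ?_
    rw [ih (hF.fix z')]
    ring

/-- Second quantised maps intertwine superderivations if the one-particle maps do. -/
theorem gamma_der {m : Fin r → ℝ} {u κ κ' : OneKernel r} (hu : IsEven u)
    (h : ∀ x : Letter r, x.OnShell m →
      linearCombination ℂ (fun y => (κ y).mapRange σ (map_zero σ)) (u x) =
        linearCombination ℂ u (κ' x)) :
    ∀ w : List (Letter r), (∀ x ∈ w, x.OnShell m) → ∀ F : WordFn r,
      gamma σ u (der Letter.eps κ F) w = der Letter.eps κ' (gamma σ u F) w := by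
  intro w
  induction w with
  | nil => intro _ F; rw [gamma_nil, der_nil, der_nil, map_zero]
  | cons x t ih =>
    intro hw F
    replace ih := ih fun y hy => hw y (List.mem_cons_of_mem _ hy)
    have hx := h x (hw x List.mem_cons_self)
    have he : ∀ y : Letter r, σ y.eps = y.eps := fun y => by cases y <;> simp [Letter.eps]
    have h1 : ∀ y ∈ (u x).support, gamma σ u (headFix y (der Letter.eps κ F)) t =
        linearCombination ℂ (fun z => gamma σ u (headFix z F) t)
          ((κ y).mapRange σ (map_zero σ)) +
        x.eps * der Letter.eps κ' (gamma σ u (headFix y F)) t := by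
      intro y hy
      rw [headFix_der, gamma_add, gamma_smul, he, hu x y hy, headOp_apply,
        gamma_linearCombination, Pi.add_apply, Pi.smul_apply, ih, smul_eq_mul]
      congr 1
      simp [Finsupp.linearCombination_apply, Finsupp.sum]
    rw [gamma_cons, linearCombination_congr h1, linearCombination_add_fun, der_cons, headFix_gamma,
      headOp_apply_apply]
    -- The intertwining relation between formal combinations of letters can be evaluated on any
    -- function of letters, in particular on the values of the second quantised function at a fixed
    -- tail.
    have h2 : ∀ v : Letter r → ℂ, linearCombination ℂ
        (fun y => linearCombination ℂ v ((κ y).mapRange σ (map_zero σ))) (u x) =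
        linearCombination ℂ (fun y => linearCombination ℂ v (u y)) (κ' x) := by
      intro v
      have := congrArg (linearCombination ℂ v) hx
      rw [Finsupp.apply_linearCombination, Finsupp.apply_linearCombination] at this
      exact this
    rw [h2, Finsupp.apply_linearCombination]
    simp only [gamma_cons]
    congr 1
    have h3 : ∀ v : Letter r → ℂ, linearCombination ℂ (fun y => x.eps * v y) (u x) =
        x.eps * linearCombination ℂ v (u x) := fun v => linearCombination_smul_fun (u x) x.eps v
    rw [h3]
    simp [Finsupp.linearCombination_apply, Finsupp.sum]

/-- Second quantisation is multiplicative; only the case of mutually inverse one-particle maps is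
needed. It yields that the ghost exchange is an involution. -/
theorem gamma_gamma {u v : OneKernel r} (F : WordFn r)
    (h : ∀ x, linearCombination ℂ v (u x) = Finsupp.single x 1) :
    ∀ w : List (Letter r), gamma (RingHom.id ℂ) u (gamma (RingHom.id ℂ) v F) w = F w
  | [] => rfl
  | x :: t => by
    have h1 : ∀ y, gamma (RingHom.id ℂ) u (headFix y (gamma (RingHom.id ℂ) v F)) t =
        linearCombination ℂ (fun z => F (z :: t)) (v y) := by
      intro y
      rw [headFix_gamma, gamma_linearCombination]
      have h2 : ∀ z, gamma (RingHom.id ℂ) u (gamma (RingHom.id ℂ) v (headFix z F)) t =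
        F (z :: t) := fun z => gamma_gamma (headFix z F) h t
      simp only [← h2]
      simp [Finsupp.linearCombination_apply, Finsupp.sum]
    simp only [gamma_cons (σ := RingHom.id ℂ) u, h1]
    have := congrArg (linearCombination ℂ fun z => F (z :: t)) (h x)
    rw [Finsupp.apply_linearCombination] at this
    rw [← Function.comp_def, this]
    simp

end Gamma

end Words

/-! ## Amplitudes as supersymmetric functions of words -/

section Amplitudes

variable {r : ℕ}

open Finsupp (linearCombination)

/-- Graded Leibniz rule for concatenation: to reach `u` the operator passes all of `w` and collects
the product of its signs. -/
theorem der_append (κ : OneKernel r) (w u : List (Letter r)) (F : WordFn r) :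
    der Letter.eps κ F (w ++ u) = der Letter.eps κ (fun t => F (t ++ u)) w +
      (w.map Letter.eps).prod * der Letter.eps κ (fun t => F (w ++ t)) u := by
  induction w generalizing F with
  | nil => simp
  | cons x w ih =>
    simp only [List.cons_append, der_cons, ih (headFix x F), headOp_apply_apply, List.map_cons,
      List.prod_cons, headFix_apply]
    have h1 : (headFix x fun t => F (t ++ u)) = fun t => F (x :: (t ++ u)) := rfl
    rw [h1]
    ring

theorem SuperSym.move {F : WordFn r} (hF : SuperSym F) {α : Type} {ℓ : α → Letter r} {z : Letter r}
    {s : ℂ} (hs : ∀ x, z.swapSign (ℓ x) = s) {n : ℕ} (K : Fin n → α) (t : List (Letter r)) :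
    F (z :: (List.ofFn (ℓ ∘ K) ++ t)) = s ^ n * F (List.ofFn (ℓ ∘ K) ++ z :: t) := by
  induction n generalizing F with
  | zero => simp
  | succ n ih =>
    have h := ih (hF.fix (ℓ (K 0))) (Fin.tail K)
    rw [List.ofFn_succ, List.cons_append, hF.front, List.cons_append]
    simp only [headFix_apply] at h
    rw [Function.comp_apply, hs]
    have h2 : (fun i : Fin n => (ℓ ∘ K) i.succ) = ℓ ∘ Fin.tail K := rfl
    rw [h2, h]
    ring

/-- A superderivation on a block of variables of the same type. -/
theorem der_block {κ : OneKernel r} (hκ : IsOdd κ) {F : WordFn r} (hF : SuperSym F) {α : Type}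
    {ℓ : α → Letter r} {e : ℂ} (hℓ : ∀ x, (ℓ x).eps = e) {n : ℕ} (K : Fin (n + 1) → α) :
    der Letter.eps κ F (List.ofFn (ℓ ∘ K)) = ∑ i : Fin (n + 1), e ^ (i : ℕ) *
      linearCombination ℂ (fun y => F (y :: List.ofFn (ℓ ∘ i.removeNth K))) (κ (ℓ (K i))) := by
  induction n generalizing F with
  | zero =>
    rw [List.ofFn_succ, der_cons, headOp_apply_apply]
    simp
  | succ n ih =>
    rw [List.ofFn_succ, der_cons, Fin.sum_univ_succ, headOp_apply_apply]
    have h2 : (fun i : Fin (n + 1) => (ℓ ∘ K) i.succ) = ℓ ∘ Fin.tail K := rfl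
    rw [h2, ih (hF.fix _), Finset.mul_sum, Function.comp_apply, hℓ]
    congr 1
    · simp [Fin.removeNth_zero]
    refine Finset.sum_congr rfl fun i _ => ?_
    have h3 : List.ofFn (ℓ ∘ Fin.removeNth i.succ K) =
        ℓ (K 0) :: List.ofFn (ℓ ∘ i.removeNth (Fin.tail K)) := by
      rw [List.ofFn_succ]
      congr 1
      exact congrArg List.ofFn (funext fun j => by simp [Fin.removeNth, Fin.tail])
    rw [h3, Fin.val_succ, pow_succ', ← mul_assoc]
    congr 1
    -- The new letter stands behind the first letter of the block. As it has the opposite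
    -- statistics, moving it to the front costs no sign.
    refine linearCombination_congr fun y hy => ?_
    rw [headFix_apply, hF.front, Letter.swapSign_comm, Letter.swapSign_eq_one, one_mul]
    rw [hκ _ y hy, hℓ, hℓ]

/-- The standard word of a configuration. -/
def Config.word {n w l s : ℕ} (x : Config r n w l s) : List (Letter r) :=
  List.ofFn (Letter.A ∘ x.1) ++ (List.ofFn (Letter.b ∘ x.2.1) ++
    (List.ofFn (Letter.c ∘ x.2.2.1) ++ List.ofFn (Letter.a ∘ x.2.2.2)))

theorem Config.length_word {n w l s : ℕ} (x : Config r n w l s) :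
    x.word.length = n + w + l + s := by
  simp [Config.word]; ring

/-- The normalisation relating amplitudes and functions of words. -/
def ampNorm (n w l s : ℕ) : ℝ :=
  (Real.sqrt (n.factorial * w.factorial * l.factorial * s.factorial))⁻¹

/-- The amplitudes of a function of words. -/
def wordAmp (F : WordFn r) : Amp r := fun n w l s x => (ampNorm n w l s : ℂ) * F x.word

theorem ampNorm_pos (n w l s : ℕ) : 0 < ampNorm n w l s := by
  unfold ampNorm; positivity

/-- The one-particle kernel of the supercharge. -/
def chargeKernel (m : Fin r → ℝ) : OneKernel r
  | .A z => Finsupp.single (.b z.2) (-((eta z.1 * z.2.2 z.1 : ℝ) : ℂ))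
  | .b _ => 0
  | .c y => ∑ ν : Fin 4, Finsupp.single (.A (ν, y)) (y.2 ν : ℂ) +
      Finsupp.single (.a y) (Complex.I * (m y.1 : ℂ))
  | .a y => Finsupp.single (.b y) (-(Complex.I * (m y.1 : ℂ)))

theorem isOdd_chargeKernel (m : Fin r → ℝ) : IsOdd (chargeKernel m) := by
  classical
  intro x y hy
  cases x with
  | A z =>
    have := Finsupp.support_single_subset hy
    rw [Finset.mem_singleton] at this
    subst this; simp [Letter.eps]
  | b y => simp [chargeKernel] at hy
  | c y =>
    rcases Finset.mem_union.1 (Finsupp.support_add hy) with h | h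
    · obtain ⟨ν, -, h⟩ := Finset.mem_biUnion.1 (Finsupp.support_finsetSum h)
      have := Finsupp.support_single_subset h
      rw [Finset.mem_singleton] at this
      subst this; simp [Letter.eps]
    · have := Finsupp.support_single_subset h
      rw [Finset.mem_singleton] at this
      subst this; simp [Letter.eps]
  | a y =>
    have := Finsupp.support_single_subset hy
    rw [Finset.mem_singleton] at this
    subst this; simp [Letter.eps]

/-- The square roots in the supercharge are exactly the quotients of the normalisations of the two
sectors they connect. This is where they are absorbed. -/
theorem ampNorm_mul_factorial {n w l s n' w' l' s' : ℕ} {x : ℝ} (hx : 0 ≤ x)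
    (h : x * (n.factorial * w.factorial * l.factorial * s.factorial) =
      n'.factorial * w'.factorial * l'.factorial * s'.factorial) :
    Real.sqrt x * ampNorm n' w' l' s' = ampNorm n w l s := by
  unfold ampNorm
  rw [← h, Real.sqrt_mul hx, mul_inv, ← mul_assoc]
  by_cases h0 : x = 0
  · exfalso
    rw [h0, zero_mul] at h
    have : (0 : ℝ) < n'.factorial * w'.factorial * l'.factorial * s'.factorial := by positivity
    linarith
  · rw [mul_inv_cancel₀, one_mul]
    exact (Real.sqrt_pos.2 (lt_of_le_of_ne hx (Ne.symm h0))).ne'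

theorem termAc_wordAmp {F : WordFn r} (n w l s : ℕ) (K : Fin n → Vec r)
    (P : Fin w → Scal r) (Q : Fin (l + 1) → Scal r) (R : Fin s → Scal r) :
    termAc (wordAmp F) n w (l + 1) s (K, P, Q, R) = (-1 : ℂ) ^ w * (ampNorm n w (l + 1) s : ℂ) *
      ∑ i : Fin (l + 1), (-1 : ℂ) ^ (i : ℕ) * ∑ ν : Fin 4, ((Q i).2 ν : ℂ) *
        F (Config.word (r := r) (Fin.cons (ν, Q i) K, P, i.removeNth Q, R)) := by
  have h : Real.sqrt ((n + 1 : ℝ) / (l + 1 : ℝ)) * ampNorm (n + 1) w l s =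
      ampNorm n w (l + 1) s := ampNorm_mul_factorial (by positivity) (by
    simp only [Nat.factorial_succ]; push_cast; field_simp)
  rw [← h]
  simp only [termAc, wordAmp, Complex.ofReal_mul, Finset.mul_sum]
  refine Finset.sum_congr rfl fun i _ => Finset.sum_congr rfl fun ν _ => ?_
  ring

theorem termAb_wordAmp {F : WordFn r} (n w l s : ℕ) (K : Fin (n + 1) → Vec r)
    (P : Fin w → Scal r) (Q : Fin l → Scal r) (R : Fin s → Scal r) :
    termAb (wordAmp F) (n + 1) w l s (K, P, Q, R) = -(ampNorm (n + 1) w l s : ℂ) *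
      ∑ i : Fin (n + 1), ((eta (K i).1 * (K i).2.2 (K i).1 : ℝ) : ℂ) *
        F (Config.word (r := r) (i.removeNth K, Fin.cons (K i).2 P, Q, R)) := by
  have h : Real.sqrt ((w + 1 : ℝ) / (n + 1 : ℝ)) * ampNorm n (w + 1) l s =
      ampNorm (n + 1) w l s := ampNorm_mul_factorial (by positivity) (by
    simp only [Nat.factorial_succ]; push_cast; field_simp)
  rw [← h]
  simp only [termAb, wordAmp, Complex.ofReal_mul, Finset.mul_sum]
  refine Finset.sum_congr rfl fun i _ => ?_
  ring

theorem termac_wordAmp {m : Fin r → ℝ} {F : WordFn r} (n w l s : ℕ) (K : Fin n → Vec r)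
    (P : Fin w → Scal r) (Q : Fin (l + 1) → Scal r) (R : Fin s → Scal r) :
    termac m (wordAmp F) n w (l + 1) s (K, P, Q, R) =
      (-1 : ℂ) ^ w * (ampNorm n w (l + 1) s : ℂ) *
      ∑ i : Fin (l + 1), (-1 : ℂ) ^ (i : ℕ) * (Complex.I * (m (Q i).1 : ℂ)) *
        F (Config.word (r := r) (K, P, i.removeNth Q, Fin.cons (Q i) R)) := by
  have h : Real.sqrt ((s + 1 : ℝ) / (l + 1 : ℝ)) * ampNorm n w l (s + 1) =
      ampNorm n w (l + 1) s := ampNorm_mul_factorial (by positivity) (by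
    simp only [Nat.factorial_succ]; push_cast; field_simp)
  rw [← h]
  simp only [termac, wordAmp, Complex.ofReal_mul, Finset.mul_sum]
  refine Finset.sum_congr rfl fun i _ => ?_
  ring

theorem termab_wordAmp {m : Fin r → ℝ} {F : WordFn r} (n w l s : ℕ) (K : Fin n → Vec r)
    (P : Fin w → Scal r) (Q : Fin l → Scal r) (R : Fin (s + 1) → Scal r) :
    termab m (wordAmp F) n w l (s + 1) (K, P, Q, R) = -(ampNorm n w l (s + 1) : ℂ) *
      ∑ i : Fin (s + 1), (Complex.I * (m (R i).1 : ℂ)) *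
        F (Config.word (r := r) (K, Fin.cons (R i) P, Q, i.removeNth R)) := by
  have h : Real.sqrt ((w + 1 : ℝ) / (s + 1 : ℝ)) * ampNorm n (w + 1) l s =
      ampNorm n w l (s + 1) := ampNorm_mul_factorial (by positivity) (by
    simp only [Nat.factorial_succ]; push_cast; field_simp)
  rw [← h]
  simp only [termab, wordAmp, Complex.ofReal_mul, Finset.mul_sum]
  refine Finset.sum_congr rfl fun i _ => ?_
  ring

theorem ofFn_comp_cons {α : Type} (ℓ : α → Letter r) {n : ℕ} (x : α) (K : Fin n → α) :
    List.ofFn (ℓ ∘ (Fin.cons x K : Fin (n + 1) → α)) = ℓ x :: List.ofFn (ℓ ∘ K) := by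
  rw [List.ofFn_succ]; rfl

theorem prod_eps_block {α : Type} {ℓ : α → Letter r} {e : ℂ} (hℓ : ∀ x, (ℓ x).eps = e) {n : ℕ}
    (K : Fin n → α) : ((List.ofFn (ℓ ∘ K)).map Letter.eps).prod = e ^ n := by
  rw [List.map_ofFn, List.prod_ofFn]
  simp [hℓ]

/-- The supercharge is the superderivation with kernel `chargeKernel`. -/
theorem superchargeAmp_wordAmp (m : Fin r → ℝ) {F : WordFn r} (hF : SuperSym F) :
    superchargeAmp m (wordAmp F) = wordAmp (der Letter.eps (chargeKernel m) F) := by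
  funext n w l s ⟨K, P, Q, R⟩
  have hq := isOdd_chargeKernel m
  have eA : ∀ z : Vec r, (Letter.A z).eps = 1 := fun _ => rfl
  have eb : ∀ z : Scal r, (Letter.b z).eps = -1 := fun _ => rfl
  have ec : ∀ z : Scal r, (Letter.c z).eps = -1 := fun _ => rfl
  have ea : ∀ z : Scal r, (Letter.a z).eps = 1 := fun _ => rfl
  set WA := List.ofFn (Letter.A ∘ K) with hWA
  set WB := List.ofFn (Letter.b ∘ P) with hWB
  set WC := List.ofFn (Letter.c ∘ Q) with hWC
  set WD := List.ofFn (Letter.a ∘ R) with hWD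
  -- Leibniz rule over the four blocks of the sorted word. The Bosonic vector block gives no sign,
  -- while the two ghost blocks give (-1)^w and (-1)^l.
  have e1 : der Letter.eps (chargeKernel m) F (Config.word (r := r) (K, P, Q, R)) =
      der Letter.eps (chargeKernel m) (fun t => F (t ++ (WB ++ (WC ++ WD)))) WA +
      der Letter.eps (chargeKernel m) (fun t => F (WA ++ (t ++ (WC ++ WD)))) WB +
      (-1) ^ w * der Letter.eps (chargeKernel m) (fun t => F (WA ++ (WB ++ (t ++ WD)))) WC +
      (-1) ^ w * (-1) ^ l *
        der Letter.eps (chargeKernel m) (fun t => F (WA ++ (WB ++ (WC ++ t)))) WD := by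
    rw [Config.word, der_append, der_append, der_append, prod_eps_block eA, prod_eps_block eb,
      prod_eps_block ec, one_pow]
    ring
  have hA : termAb (wordAmp F) n w l s (K, P, Q, R) = (ampNorm n w l s : ℂ) *
      der Letter.eps (chargeKernel m) (fun t => F (t ++ (WB ++ (WC ++ WD)))) WA := by
    rw [hWA]
    cases n with
    | zero => simp [termAb]
    | succ n =>
      rw [der_block hq (hF.appendRight _) eA, termAb_wordAmp, neg_mul, ← mul_neg, ← Finset.sum_neg_distrib]
      congr 1
      refine Finset.sum_congr rfl fun i _ => ?_
      rw [chargeKernel, Finsupp.linearCombination_single, List.cons_append,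
        hF.move (s := 1) (fun x => rfl), Config.word]
      simp only [ofFn_comp_cons, List.cons_append, smul_eq_mul]
      ring
  -- The kernel vanishes on b, so this block contributes nothing.
  have hB : der Letter.eps (chargeKernel m) (fun t => F (WA ++ (t ++ (WC ++ WD)))) WB = 0 := by
    rw [hWB]
    cases w with
    | zero => simp
    | succ w =>
    rw [der_block hq ((hF.appendLeft WA).appendRight _) eb]
    refine Finset.sum_eq_zero fun i _ => ?_
    rw [chargeKernel, map_zero, mul_zero]
  -- A letter c produces both a vector letter and a scalar letter a, whence two terms of the
  -- supercharge. Both new letters are Bosonic and travel to their own block without sign.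
  have hC : termAc (wordAmp F) n w l s (K, P, Q, R) + termac m (wordAmp F) n w l s (K, P, Q, R) =
      (ampNorm n w l s : ℂ) * ((-1) ^ w *
        der Letter.eps (chargeKernel m) (fun t => F (WA ++ (WB ++ (t ++ WD)))) WC) := by
    rw [hWC]
    cases l with
    | zero => simp [termAc, termac]
    | succ l =>
      rw [der_block hq ((hF.appendLeft WA).appendLeft WB |>.appendRight _) ec,
        termAc_wordAmp, termac_wordAmp, ← mul_add, ← Finset.sum_add_distrib, mul_comm (_ ^ w),
        mul_assoc]
      congr 2
      refine Finset.sum_congr rfl fun i _ => ?_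
      rw [mul_assoc, ← mul_add]
      congr 1
      rw [chargeKernel, map_add, map_sum, Finsupp.linearCombination_single, smul_eq_mul]
      have h1 : ∀ z : Vec r, ∀ t, F (WA ++ (WB ++ Letter.A z :: t)) =
          F (Letter.A z :: (WA ++ (WB ++ t))) := fun z t => by
        rw [hF.move (s := 1) (fun x => rfl), one_pow, one_mul]
        have := (hF.appendLeft WA).move (z := .A z) (ℓ := Letter.b) (s := 1) (fun x => rfl) P t
        rw [this, one_pow, one_mul]
      have h2 : ∀ z : Scal r, ∀ (L : Fin l → Scal r) t,
          F (WA ++ (WB ++ (Letter.a z :: (List.ofFn (Letter.c ∘ L) ++ t)))) =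
          F (WA ++ (WB ++ (List.ofFn (Letter.c ∘ L) ++ Letter.a z :: t))) := fun z L t => by
        have := ((hF.appendLeft WA).appendLeft WB).move (z := .a z) (ℓ := Letter.c) (s := 1)
          (fun x => rfl) L t
        rw [this, one_pow, one_mul]
      congr 1
      · refine Finset.sum_congr rfl fun ν _ => ?_
        rw [Finsupp.linearCombination_single, smul_eq_mul, List.cons_append, h1, Config.word]
        simp only [ofFn_comp_cons, List.cons_append]
        rfl
      · rw [List.cons_append, h2, Config.word]
        simp only [ofFn_comp_cons]
        rfl
  have hD : termab m (wordAmp F) n w l s (K, P, Q, R) =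
      (ampNorm n w l s : ℂ) * ((-1) ^ w * (-1) ^ l *
        der Letter.eps (chargeKernel m) (fun t => F (WA ++ (WB ++ (WC ++ t)))) WD) := by
    rw [hWD]
    cases s with
    | zero => simp [termab]
    | succ s =>
      rw [der_block hq ((hF.appendLeft WA).appendLeft WB |>.appendLeft WC) ea,
        termab_wordAmp, neg_mul, ← mul_neg, ← Finset.sum_neg_distrib]
      congr 1
      rw [Finset.mul_sum]
      refine Finset.sum_congr rfl fun i _ => ?_
      rw [chargeKernel, Finsupp.linearCombination_single, smul_eq_mul, one_pow, one_mul]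
      -- The letter b created in the last block moves back over all c and all b. The resulting sign
      -- (-1)^(w+l) cancels the Leibniz sign of that block.
      have h1 : ∀ z : Scal r, ∀ t, F (WA ++ (WB ++ (WC ++ Letter.b z :: t))) =
          (-1) ^ w * (-1) ^ l * F (WA ++ (Letter.b z :: (WB ++ (WC ++ t)))) := fun z t => by
        have h3 := (hF.appendLeft WA).move (z := .b z) (ℓ := Letter.b) (s := -1) (fun x => rfl) P
          (WC ++ t)
        have h4 := ((hF.appendLeft WA).appendLeft WB).move (z := .b z) (ℓ := Letter.c) (s := -1)
          (fun x => rfl) Q t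
        have hw : ((-1 : ℂ) ^ w) * (-1) ^ w = 1 := by rw [← mul_pow]; norm_num
        have hl : ((-1 : ℂ) ^ l) * (-1) ^ l = 1 := by rw [← mul_pow]; norm_num
        rw [h3, h4]
        linear_combination (-F (WA ++ (WB ++ (WC ++ Letter.b z :: t)))) *
          ((-1 : ℂ) ^ w * (-1) ^ w * hl + hw)
      have hw : ((-1 : ℂ) ^ w) * (-1) ^ w = 1 := by rw [← mul_pow]; norm_num
      have hl : ((-1 : ℂ) ^ l) * (-1) ^ l = 1 := by rw [← mul_pow]; norm_num
      rw [h1, Config.word]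
      simp only [ofFn_comp_cons, List.cons_append]
      linear_combination (Complex.I * ↑(m (R i).1) * F (WA ++ (Letter.b (R i) :: (WB ++ (WC ++
        List.ofFn (Letter.a ∘ i.removeNth R)))))) * ((-1 : ℂ) ^ w * (-1) ^ w * hl + hw)
  simp only [superchargeAmp]
  rw [wordAmp, e1, hB]
  linear_combination hA + hC + hD

end Amplitudes

/-! ## Permutation symmetry -/

section Symmetry

variable {r : ℕ}

/-- Supersymmetry is formulated for lists with a prefix; fixing first letters one by one reduces a
transposition of neighbours in a tuple to the exchange of the first two letters. -/
theorem SuperSym.swap_adjacent {F : WordFn r} (hF : SuperSym F) {n : ℕ} (i : Fin n)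
    (L : Fin (n + 1) → Letter r) :
    F (List.ofFn (L ∘ Equiv.swap i.castSucc i.succ)) =
      (L i.castSucc).swapSign (L i.succ) * F (List.ofFn L) := by
  induction n generalizing F with
  | zero => exact i.elim0
  | succ n ih =>
    refine Fin.cases ?_ (fun j => ?_) i
    · have h1 : List.ofFn (L ∘ Equiv.swap (Fin.castSucc 0) (Fin.succ 0)) =
          L 1 :: L 0 :: List.ofFn (fun k : Fin n => L k.succ.succ) := by
        rw [List.ofFn_succ, List.ofFn_succ]
        have h0 : (L ∘ Equiv.swap (Fin.castSucc 0) (Fin.succ 0)) 0 = L 1 := by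
          exact congrArg L (Equiv.swap_apply_left _ _)
        have h1 : (L ∘ Equiv.swap (Fin.castSucc 0) (Fin.succ 0)) (Fin.succ 0) = L 0 := by
          exact congrArg L (Equiv.swap_apply_right _ _)
        rw [h0, h1]
        refine congrArg (fun u => L 1 :: L 0 :: List.ofFn u) (funext fun k => congrArg L ?_)
        refine Equiv.swap_apply_of_ne_of_ne ?_ ?_
        · exact Fin.succ_ne_zero _
        · intro h
          exact Fin.succ_ne_zero k (Fin.succ_injective _ h)
      have h2 : List.ofFn L = L 0 :: L 1 :: List.ofFn (fun k : Fin n => L k.succ.succ) := by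
        rw [List.ofFn_succ, List.ofFn_succ]
        rfl
      rw [h1, h2, hF.front, Letter.swapSign_comm]
      rfl
    · have h := ih (hF.fix (L 0)) j (Fin.tail L)
      have h1 : List.ofFn (L ∘ Equiv.swap j.succ.castSucc j.succ.succ) =
          L 0 :: List.ofFn (Fin.tail L ∘ Equiv.swap j.castSucc j.succ) := by
        rw [List.ofFn_succ]
        congr 1
        refine congrArg List.ofFn (funext fun k => ?_)
        simp only [Function.comp_apply, Fin.tail]
        congr 1
        rw [← Fin.succ_castSucc]
        exact ((Fin.succ_injective (n + 1)).map_swap _ _ _).symm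
      rw [h1, List.ofFn_succ (f := L)]
      exact h

/-- Permutations of a block of variables of the same type. -/
theorem SuperSym.perm_block {F : WordFn r} (hF : SuperSym F) {α : Type} {ℓ : α → Letter r} {n : ℕ}
    {χ : Equiv.Perm (Fin n) →* ℂ} (hχ : ∀ x y (i j : Fin n), i ≠ j →
      (ℓ x).swapSign (ℓ y) = χ (Equiv.swap i j)) (π : Equiv.Perm (Fin n)) (K : Fin n → α) :
    F (List.ofFn (ℓ ∘ (K ∘ π))) = χ π * F (List.ofFn (ℓ ∘ K)) := by
  cases n with
  | zero =>
    have : π = 1 := Subsingleton.elim _ _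
    subst this
    simp
  | succ n =>
    have h : ∀ π : Equiv.Perm (Fin (n + 1)), ∀ K : Fin (n + 1) → α,
        F (List.ofFn (ℓ ∘ (K ∘ π))) = χ π * F (List.ofFn (ℓ ∘ K)) := by
      intro π
      -- Transpositions of neighbours generate the symmetric group, already as a monoid, so the
      -- character has to be matched only there.
      have hπ : π ∈ Submonoid.closure
          (Set.range fun i : Fin n => Equiv.swap i.castSucc i.succ) := by
        rw [Equiv.Perm.mclosure_swap_castSucc_succ]; trivial
      induction hπ using Submonoid.closure_induction with
      | mem π h =>
        obtain ⟨i, rfl⟩ := h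
        intro K
        have := hF.swap_adjacent i (ℓ ∘ K)
        rw [← hχ (K i.castSucc) (K i.succ) _ _ (Fin.castSucc_lt_succ).ne]
        exact this
      | one => intro K; simp
      | mul π ρ _ _ h1 h2 =>
        intro K
        refine (h2 (K ∘ π)).trans ?_
        rw [map_mul, h1]
        ring
    exact h π K

/-- The sign character with complex values. -/
def signC (n : ℕ) : Equiv.Perm (Fin n) →* ℂ :=
  ((Int.castRingHom ℂ : ℤ →* ℂ).comp (Units.coeHom ℤ)).comp Equiv.Perm.sign

theorem signC_apply {n : ℕ} (π : Equiv.Perm (Fin n)) :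
    signC n π = ((Equiv.Perm.sign π : ℤ) : ℂ) := rfl

theorem signC_swap {n : ℕ} {i j : Fin n} (h : i ≠ j) : signC n (Equiv.swap i j) = -1 := by
  rw [signC_apply, Equiv.Perm.sign_swap h]; simp

theorem signC_mul_self {n : ℕ} (π : Equiv.Perm (Fin n)) : signC n π * signC n π = 1 := by
  rw [signC_apply]
  rcases Int.units_eq_one_or (Equiv.Perm.sign π) with h | h <;> simp [h]

/-- Pointwise (anti)symmetric amplitudes. -/
def IsSymAmp (Ψ : Amp r) : Prop :=
  ∀ (n w l s : ℕ) (π : Equiv.Perm (Fin n)) (ρ : Equiv.Perm (Fin w)) (σ : Equiv.Perm (Fin l))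
    (τ : Equiv.Perm (Fin s)) (x : Config r n w l s),
    Ψ n w l s (permConfig π ρ σ τ x) = signC w ρ * signC l σ * Ψ n w l s x

theorem SuperSym.isSymAmp {F : WordFn r} (hF : SuperSym F) : IsSymAmp (wordAmp F) := by
  intro n w l s π ρ σ τ ⟨K, P, Q, R⟩
  have h1 := fun u => (hF.appendRight u).perm_block (ℓ := Letter.A) (χ := 1)
    (fun _ _ _ _ _ => rfl) π K
  have h2 := fun u v => ((hF.appendLeft u).appendRight v).perm_block (ℓ := Letter.b) (χ := signC w)
    (fun _ _ i j h => (signC_swap h).symm) ρ P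
  have h3 := fun u v => ((hF.appendLeft u).appendRight v).perm_block (ℓ := Letter.c) (χ := signC l)
    (fun _ _ i j h => (signC_swap h).symm) σ Q
  have h4 := fun u => (hF.appendLeft u).perm_block (ℓ := Letter.a) (χ := 1)
    (fun _ _ _ _ _ => rfl) τ R
  have h1' : ∀ u, F (List.ofFn (Letter.A ∘ K ∘ π) ++ u) = F (List.ofFn (Letter.A ∘ K) ++ u) :=
    fun u => by simpa using h1 u
  have h2' : ∀ u v, F (u ++ (List.ofFn (Letter.b ∘ P ∘ ρ) ++ v)) =
      signC w ρ * F (u ++ (List.ofFn (Letter.b ∘ P) ++ v)) := fun u v => h2 u v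
  have h3' : ∀ u u' v, F (u ++ (u' ++ (List.ofFn (Letter.c ∘ Q ∘ σ) ++ v))) =
      signC l σ * F (u ++ (u' ++ (List.ofFn (Letter.c ∘ Q) ++ v))) := fun u u' v => by
    simpa using h3 (u ++ u') v
  have h4' : ∀ u u' v, F (u ++ (u' ++ (v ++ List.ofFn (Letter.a ∘ R ∘ τ)))) =
      F (u ++ (u' ++ (v ++ List.ofFn (Letter.a ∘ R)))) := fun u u' v => by
    simpa using h4 (u ++ (u' ++ v))
  simp only [wordAmp, permConfig, Config.word]
  rw [h1', h2', h3', h4']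
  ring

/-! ### From symmetric amplitudes to functions of words -/

/-- The variables of vector particles in a word. -/
def vecPart : List (Letter r) → List (Vec r)
  | [] => []
  | .A z :: t => z :: vecPart t
  | _ :: t => vecPart t

/-- The variables of `b` ghosts in a word. -/
def bPart : List (Letter r) → List (Scal r)
  | [] => []
  | .b z :: t => z :: bPart t
  | _ :: t => bPart t

/-- The variables of `c` ghosts in a word. -/
def cPart : List (Letter r) → List (Scal r)
  | [] => []
  | .c z :: t => z :: cPart t
  | _ :: t => cPart t

/-- The variables of `a` ghosts in a word. -/
def aPart : List (Letter r) → List (Scal r)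
  | [] => []
  | .a z :: t => z :: aPart t
  | _ :: t => aPart t

/-- The sign of the permutation bringing a word to standard order. -/
def sortSign : List (Letter r) → ℂ
  | [] => 1
  | .c _ :: t => (-1) ^ (bPart t).length * sortSign t
  | _ :: t => sortSign t

theorem vecPart_append (p t : List (Letter r)) : vecPart (p ++ t) = vecPart p ++ vecPart t := by
  induction p with
  | nil => rfl
  | cons x p ih => cases x <;> simp [vecPart, ih]

theorem bPart_append (p t : List (Letter r)) : bPart (p ++ t) = bPart p ++ bPart t := by
  induction p with
  | nil => rfl
  | cons x p ih => cases x <;> simp [bPart, ih]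

theorem cPart_append (p t : List (Letter r)) : cPart (p ++ t) = cPart p ++ cPart t := by
  induction p with
  | nil => rfl
  | cons x p ih => cases x <;> simp [cPart, ih]

theorem aPart_append (p t : List (Letter r)) : aPart (p ++ t) = aPart p ++ aPart t := by
  induction p with
  | nil => rfl
  | cons x p ih => cases x <;> simp [aPart, ih]

/-- Sorting keeps the order within each type, so the only inversions with a sign are those of a c
standing before a b. Concatenation adds one for each c of the first word and b of the second. -/
theorem sortSign_append (p t : List (Letter r)) : sortSign (p ++ t) =
    sortSign p * (-1) ^ ((cPart p).length * (bPart t).length) * sortSign t := by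
  induction p with
  | nil => simp [cPart, sortSign]
  | cons x p ih =>
    cases x <;> simp only [List.cons_append, sortSign, ih, cPart, bPart_append, List.length_append,
      List.length_cons] <;> ring

theorem parts_A (L : List (Vec r)) : vecPart (L.map .A) = L ∧ bPart (L.map .A) = [] ∧
    cPart (L.map .A) = [] ∧ aPart (L.map .A) = [] ∧ sortSign (L.map .A) = 1 := by
  induction L <;> simp_all [vecPart, bPart, cPart, aPart, sortSign]

theorem parts_b (L : List (Scal r)) : vecPart (L.map .b) = [] ∧ bPart (L.map .b) = L ∧
    cPart (L.map .b) = [] ∧ aPart (L.map .b) = [] ∧ sortSign (L.map .b) = 1 := by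
  induction L <;> simp_all [vecPart, bPart, cPart, aPart, sortSign]

theorem parts_c (L : List (Scal r)) : vecPart (L.map .c) = [] ∧ bPart (L.map .c) = [] ∧
    cPart (L.map .c) = L ∧ aPart (L.map .c) = [] ∧ sortSign (L.map .c) = 1 := by
  induction L <;> simp_all [vecPart, bPart, cPart, aPart, sortSign]

theorem parts_a (L : List (Scal r)) : vecPart (L.map .a) = [] ∧ bPart (L.map .a) = [] ∧
    cPart (L.map .a) = [] ∧ aPart (L.map .a) = L ∧ sortSign (L.map .a) = 1 := by
  induction L <;> simp_all [vecPart, bPart, cPart, aPart, sortSign]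

/-- Amplitudes as functions of four lists, with the normalisation removed. -/
def listAmp (Ψ : Amp r) (K : Σ n, Fin n → Vec r) (P Q R : Σ n, Fin n → Scal r) : ℂ :=
  ((ampNorm K.1 P.1 Q.1 R.1)⁻¹ : ℂ) * Ψ K.1 P.1 Q.1 R.1 (K.2, P.2, Q.2, R.2)

/-- The function of words with given amplitudes. -/
def ampWord (Ψ : Amp r) : WordFn r := fun w =>
  sortSign w * listAmp Ψ (List.equivSigmaTuple (vecPart w)) (List.equivSigmaTuple (bPart w))
    (List.equivSigmaTuple (cPart w)) (List.equivSigmaTuple (aPart w))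

theorem equivSigmaTuple_ofFn {α : Type} {n : ℕ} (K : Fin n → α) :
    List.equivSigmaTuple (List.ofFn K) = ⟨n, K⟩ :=
  List.equivSigmaTuple.apply_symm_apply (⟨n, K⟩ : Σ n, Fin n → α)

theorem ampWord_eq {Ψ : Amp r} {u : List (Letter r)} {n w l s : ℕ} {K : Fin n → Vec r}
    {P : Fin w → Scal r} {Q : Fin l → Scal r} {R : Fin s → Scal r} (h1 : vecPart u = List.ofFn K)
    (h2 : bPart u = List.ofFn P) (h3 : cPart u = List.ofFn Q) (h4 : aPart u = List.ofFn R)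
    (h5 : sortSign u = 1) : ampWord Ψ u = ((ampNorm n w l s)⁻¹ : ℂ) * Ψ n w l s (K, P, Q, R) := by
  rw [ampWord, h1, h2, h3, h4, h5, one_mul]
  have : listAmp Ψ (List.equivSigmaTuple (List.ofFn K)) (List.equivSigmaTuple (List.ofFn P))
      (List.equivSigmaTuple (List.ofFn Q)) (List.equivSigmaTuple (List.ofFn R)) =
      listAmp Ψ ⟨n, K⟩ ⟨w, P⟩ ⟨l, Q⟩ ⟨s, R⟩ := by
    rw [equivSigmaTuple_ofFn, equivSigmaTuple_ofFn, equivSigmaTuple_ofFn, equivSigmaTuple_ofFn]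
  exact this

/-- A standard word has no c before a b, so its sorting sign is 1, and the two normalisations are
inverse to each other. Every family of amplitudes, symmetric or not, is thus attained. -/
theorem wordAmp_ampWord (Ψ : Amp r) : wordAmp (ampWord Ψ) = Ψ := by
  funext n w l s ⟨K, P, Q, R⟩
  obtain ⟨a1, a2, a3, a4, a5⟩ := parts_A (List.ofFn K)
  obtain ⟨b1, b2, b3, b4, b5⟩ := parts_b (List.ofFn P)
  obtain ⟨c1, c2, c3, c4, c5⟩ := parts_c (List.ofFn Q)
  obtain ⟨d1, d2, d3, d4, d5⟩ := parts_a (List.ofFn R)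
  have := (ampNorm_pos n w l s).ne'
  rw [wordAmp, ampWord_eq (K := K) (P := P) (Q := Q) (R := R),
    mul_inv_cancel_left₀ (by exact_mod_cast this)]
  all_goals
    simp only [Config.word, ← List.map_ofFn, vecPart_append, bPart_append,
      cPart_append, aPart_append, sortSign_append, a1, a2, a3, a4, a5, b1, b2, b3, b4, b5, c1, c2,
      c3, c4, c5, d1, d2, d3, d4, d5, List.append_nil, List.nil_append, List.length_nil, zero_mul,
      mul_zero, pow_zero, one_mul]

/-- Translates an exchange of neighbours in a list into a transposition of a tuple, the form in
which the symmetry of amplitudes is given. Which indices are transposed is irrelevant, since all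
transpositions have the same sign. -/
theorem exists_ofFn_swap {α : Type} (k : List α) (z z' : α) (t : List α) :
    ∃ (n : ℕ) (K : Fin n → α) (i j : Fin n), i ≠ j ∧ k ++ z :: z' :: t = List.ofFn K ∧
      k ++ z' :: z :: t = List.ofFn (K ∘ Equiv.swap i j) := by
  induction k with
  | nil =>
    refine ⟨t.length + 2, Fin.cons z (Fin.cons z' t.get), 0, 1, by simp, ?_, ?_⟩
    · simp [List.ofFn_succ]
    · rw [List.ofFn_succ, List.ofFn_succ]
      have h : (fun k : Fin t.length => ((Fin.cons z (Fin.cons z' t.get) : Fin (t.length + 2) → α) ∘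
          (Equiv.swap 0 1 : Equiv.Perm (Fin (t.length + 2)))) k.succ.succ) = t.get := by
        funext k
        rw [Function.comp_apply, Equiv.swap_apply_of_ne_of_ne (Fin.succ_ne_zero _)]
        · rfl
        · intro h
          exact Fin.succ_ne_zero k (Fin.succ_injective _ h)
      rw [h, List.ofFn_get]
      have h0 : ((Fin.cons z (Fin.cons z' t.get) : Fin (t.length + 2) → α) ∘
          (Equiv.swap 0 1 : Equiv.Perm (Fin (t.length + 2)))) 0 = z' := by
        rw [Function.comp_apply, Equiv.swap_apply_left]; rfl
      have h1 : ((Fin.cons z (Fin.cons z' t.get) : Fin (t.length + 2) → α) ∘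
          (Equiv.swap 0 1 : Equiv.Perm (Fin (t.length + 2)))) (Fin.succ 0) = z := by
        rw [Function.comp_apply, Fin.succ_zero_eq_one, Equiv.swap_apply_right]; rfl
      rw [h0, h1]
      rfl
  | cons x k ih =>
    obtain ⟨n, K, i, j, hij, h1, h2⟩ := ih
    refine ⟨n + 1, Fin.cons x K, i.succ, j.succ, fun h => hij (Fin.succ_injective _ h), ?_, ?_⟩
    · simp [List.ofFn_succ, h1]
    · rw [List.cons_append, h2, List.ofFn_succ]
      congr 1
      refine congrArg List.ofFn (funext fun k => ?_)
      change K (Equiv.swap i j k) = (Fin.cons x K : Fin (n + 1) → α) (Equiv.swap i.succ j.succ k.succ)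
      rw [← (Fin.succ_injective n).map_swap i j k]
      rfl

theorem IsSymAmp.listAmp_perm {Ψ : Amp r} (hΨ : IsSymAmp Ψ) {n w l s : ℕ} (K : Fin n → Vec r)
    (P : Fin w → Scal r) (Q : Fin l → Scal r) (R : Fin s → Scal r) (π : Equiv.Perm (Fin n))
    (ρ : Equiv.Perm (Fin w)) (σ : Equiv.Perm (Fin l)) (τ : Equiv.Perm (Fin s)) :
    listAmp Ψ ⟨n, K ∘ π⟩ ⟨w, P ∘ ρ⟩ ⟨l, Q ∘ σ⟩ ⟨s, R ∘ τ⟩ =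
      signC w ρ * signC l σ * listAmp Ψ ⟨n, K⟩ ⟨w, P⟩ ⟨l, Q⟩ ⟨s, R⟩ := by
  have := hΨ n w l s π ρ σ τ (K, P, Q, R)
  simp only [permConfig] at this
  simp only [listAmp, this]
  ring

/-- Exchanging neighbours of different types leaves the four sublists unchanged and affects only the
sorting sign, namely for the pair b, c. Exchanging neighbours of the same type transposes two
entries of one sublist, where the symmetry of the amplitude applies. -/
theorem IsSymAmp.superSym_ampWord {Ψ : Amp r} (hΨ : IsSymAmp Ψ) : SuperSym (ampWord Ψ) := by
  intro p x y t
  have key : ∀ (u v : List (Letter r)), vecPart u = vecPart v → bPart u = bPart v →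
      cPart u = cPart v → aPart u = aPart v → ∀ c : ℂ, sortSign u = c * sortSign v →
      ampWord Ψ u = c * ampWord Ψ v := by
    intro u v h1 h2 h3 h4 c h5
    simp only [ampWord, h1, h2, h3, h4, h5]
    ring
  cases x with
  | A z =>
    cases y with
    | A z' =>
      obtain ⟨n, K, i, j, hij, h1, h2⟩ := exists_ofFn_swap (vecPart p) z z' (vecPart t)
      simp only [ampWord, vecPart_append, bPart_append, cPart_append, aPart_append, sortSign_append,
        vecPart, bPart, cPart, aPart, sortSign, h1, h2, equivSigmaTuple_ofFn, Letter.swapSign]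
      have := hΨ.listAmp_perm K (List.equivSigmaTuple (bPart p ++ bPart t)).2
        (List.equivSigmaTuple (cPart p ++ cPart t)).2 (List.equivSigmaTuple (aPart p ++ aPart t)).2
        (Equiv.swap i j) 1 1 1
      simp only [Equiv.Perm.coe_one, Function.comp_id, map_one, one_mul, Sigma.eta] at this
      rw [this, one_mul]
    | b z' => apply key <;> simp [vecPart_append, bPart_append, cPart_append, aPart_append,
        sortSign_append, vecPart, bPart, cPart, aPart, sortSign, Letter.swapSign]
    | c z' => apply key <;> simp [vecPart_append, bPart_append, cPart_append, aPart_append,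
        sortSign_append, vecPart, bPart, cPart, aPart, sortSign, Letter.swapSign]
    | a z' => apply key <;> simp [vecPart_append, bPart_append, cPart_append, aPart_append,
        sortSign_append, vecPart, bPart, cPart, aPart, sortSign, Letter.swapSign]
  | b z =>
    cases y with
    | A z' => apply key <;> simp [vecPart_append, bPart_append, cPart_append, aPart_append,
        sortSign_append, vecPart, bPart, cPart, aPart, sortSign, Letter.swapSign]
    | b z' =>
      obtain ⟨n, K, i, j, hij, h1, h2⟩ := exists_ofFn_swap (bPart p) z z' (bPart t)
      simp only [ampWord, vecPart_append, bPart_append, cPart_append, aPart_append, sortSign_append,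
        vecPart, bPart, cPart, aPart, sortSign, h1, h2, equivSigmaTuple_ofFn, Letter.swapSign]
      have := hΨ.listAmp_perm (List.equivSigmaTuple (vecPart p ++ vecPart t)).2 K
        (List.equivSigmaTuple (cPart p ++ cPart t)).2 (List.equivSigmaTuple (aPart p ++ aPart t)).2
        1 (Equiv.swap i j) 1 1
      simp only [Equiv.Perm.coe_one, Function.comp_id, map_one, one_mul, mul_one, Sigma.eta,
        signC_swap hij] at this
      rw [this]
      simp only [List.length_cons]
      ring
    | c z' =>
      apply key <;> simp [vecPart_append, bPart_append, cPart_append, aPart_append,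
        sortSign_append, vecPart, bPart, cPart, aPart, sortSign, Letter.swapSign]
      ring
    | a z' => apply key <;> simp [vecPart_append, bPart_append, cPart_append, aPart_append,
        sortSign_append, vecPart, bPart, cPart, aPart, sortSign, Letter.swapSign]
  | c z =>
    cases y with
    | A z' => apply key <;> simp [vecPart_append, bPart_append, cPart_append, aPart_append,
        sortSign_append, vecPart, bPart, cPart, aPart, sortSign, Letter.swapSign]
    | b z' =>
      apply key <;> simp [vecPart_append, bPart_append, cPart_append, aPart_append,
        sortSign_append, vecPart, bPart, cPart, aPart, sortSign, Letter.swapSign]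
      ring
    | c z' =>
      obtain ⟨n, K, i, j, hij, h1, h2⟩ := exists_ofFn_swap (cPart p) z z' (cPart t)
      simp only [ampWord, vecPart_append, bPart_append, cPart_append, aPart_append, sortSign_append,
        vecPart, bPart, cPart, aPart, sortSign, h1, h2, equivSigmaTuple_ofFn, Letter.swapSign]
      have := hΨ.listAmp_perm (List.equivSigmaTuple (vecPart p ++ vecPart t)).2
        (List.equivSigmaTuple (bPart p ++ bPart t)).2 K
        (List.equivSigmaTuple (aPart p ++ aPart t)).2 1 1 (Equiv.swap i j) 1
      simp only [Equiv.Perm.coe_one, Function.comp_id, map_one, one_mul, mul_one, Sigma.eta,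
        signC_swap hij] at this
      rw [this]
      ring
    | a z' => apply key <;> simp [vecPart_append, bPart_append, cPart_append, aPart_append,
        sortSign_append, vecPart, bPart, cPart, aPart, sortSign, Letter.swapSign]
  | a z =>
    cases y with
    | A z' => apply key <;> simp [vecPart_append, bPart_append, cPart_append, aPart_append,
        sortSign_append, vecPart, bPart, cPart, aPart, sortSign, Letter.swapSign]
    | b z' => apply key <;> simp [vecPart_append, bPart_append, cPart_append, aPart_append,
        sortSign_append, vecPart, bPart, cPart, aPart, sortSign, Letter.swapSign]
    | c z' => apply key <;> simp [vecPart_append, bPart_append, cPart_append, aPart_append,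
        sortSign_append, vecPart, bPart, cPart, aPart, sortSign, Letter.swapSign]
    | a z' =>
      obtain ⟨n, K, i, j, hij, h1, h2⟩ := exists_ofFn_swap (aPart p) z z' (aPart t)
      simp only [ampWord, vecPart_append, bPart_append, cPart_append, aPart_append, sortSign_append,
        vecPart, bPart, cPart, aPart, sortSign, h1, h2, equivSigmaTuple_ofFn, Letter.swapSign]
      have := hΨ.listAmp_perm (List.equivSigmaTuple (vecPart p ++ vecPart t)).2
        (List.equivSigmaTuple (bPart p ++ bPart t)).2 (List.equivSigmaTuple (cPart p ++ cPart t)).2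
        K 1 1 1 (Equiv.swap i j)
      simp only [Equiv.Perm.coe_one, Function.comp_id, map_one, one_mul, Sigma.eta] at this
      rw [this, one_mul]

/-- Symmetrisation of amplitudes. -/
def symAmp (Ψ : Amp r) : Amp r := fun n w l s x =>
  ((n.factorial * w.factorial * l.factorial * s.factorial : ℂ)⁻¹) *
    ∑ π : Equiv.Perm (Fin n), ∑ ρ : Equiv.Perm (Fin w), ∑ σ : Equiv.Perm (Fin l),
      ∑ τ : Equiv.Perm (Fin s), signC w ρ * signC l σ * Ψ n w l s (permConfig π ρ σ τ x)

/-- Averaging over the group against a character of values ±1: translation reindexes the sums and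
reproduces the character. In contrast to the classes in L², the result is symmetric at every point.
-/
theorem isSymAmp_symAmp (Ψ : Amp r) : IsSymAmp (symAmp Ψ) := by
  intro n w l s π ρ σ τ x
  simp only [symAmp]
  rw [mul_left_comm]
  congr 1
  rw [Finset.mul_sum]
  refine Fintype.sum_equiv (Equiv.mulLeft π) _ _ fun π' => ?_
  rw [Finset.mul_sum]
  refine Fintype.sum_equiv (Equiv.mulLeft ρ) _ _ fun ρ' => ?_
  rw [Finset.mul_sum]
  refine Fintype.sum_equiv (Equiv.mulLeft σ) _ _ fun σ' => ?_
  rw [Finset.mul_sum]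
  refine Fintype.sum_equiv (Equiv.mulLeft τ) _ _ fun τ' => ?_
  simp only [Equiv.coe_mulLeft, map_mul]
  have h : permConfig π' ρ' σ' τ' (permConfig π ρ σ τ x) =
      permConfig (π * π') (ρ * ρ') (σ * σ') (τ * τ') x := rfl
  rw [h]
  have h1 := signC_mul_self ρ
  have h2 := signC_mul_self σ
  linear_combination (-signC w ρ' * signC l σ' *
    Ψ n w l s (permConfig (π * π') (ρ * ρ') (σ * σ') (τ * τ') x)) *
      (signC w ρ * signC w ρ * h2 + h1)

/-- Restriction to words of at most `N` letters. -/
def truncWord (N : ℕ) (F : WordFn r) : WordFn r := fun w => if w.length ≤ N then F w else 0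

theorem SuperSym.trunc {F : WordFn r} (hF : SuperSym F) (N : ℕ) : SuperSym (truncWord N F) := by
  intro p x y t
  have h : (p ++ x :: y :: t).length = (p ++ y :: x :: t).length := by simp
  simp only [truncWord, h]
  split_ifs
  · exact hF p x y t
  · rw [mul_zero]

end Symmetry

/-! ## Maps of bounded density -/

section BddMap

variable {α β γ δ : Type*} [MeasurableSpace α] [MeasurableSpace β] [MeasurableSpace γ]
  [MeasurableSpace δ]

/-- Measurable maps with image measure bounded by a multiple of the target measure. -/
structure BddMap (f : α → β) (μ : Measure α) (ν : Measure β) : Prop where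
  measurable : Measurable f
  bound : ∃ C : ℝ≥0∞, C ≠ ∞ ∧ μ.map f ≤ C • ν

theorem BddMap.of_le {f : α → β} {μ : Measure α} {ν : Measure β} (hf : Measurable f)
    (h : μ.map f ≤ ν) : BddMap f μ ν := ⟨hf, 1, by simp, by simpa using h⟩

theorem _root_.MeasureTheory.MeasurePreserving.bddMap {f : α → β} {μ : Measure α} {ν : Measure β}
    (h : MeasurePreserving f μ ν) : BddMap f μ ν := BddMap.of_le h.measurable h.map_eq.le

theorem BddMap.comp {g : β → γ} {f : α → β} {μ : Measure α} {ν : Measure β} {ρ : Measure γ}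
    (hg : BddMap g ν ρ) (hf : BddMap f μ ν) : BddMap (g ∘ f) μ ρ := by
  obtain ⟨hgm, C, hC, h1⟩ := hg
  obtain ⟨hfm, D, hD, h2⟩ := hf
  refine ⟨hgm.comp hfm, D * C, ENNReal.mul_ne_top hD hC, ?_⟩
  rw [← Measure.map_map hgm hfm]
  refine (Measure.map_mono h2 hgm).trans ?_
  rw [Measure.map_smul, mul_smul]
  gcongr

theorem BddMap.quasiMeasurePreserving {f : α → β} {μ : Measure α} {ν : Measure β}
    (hf : BddMap f μ ν) : Measure.QuasiMeasurePreserving f μ ν := by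
  obtain ⟨hfm, C, hC, h⟩ := hf
  exact ⟨hfm, Measure.absolutelyContinuous_of_le_smul h⟩

theorem BddMap.ae {f : α → β} {μ : Measure α} {ν : Measure β} (hf : BddMap f μ ν) {p : β → Prop}
    (h : ∀ᵐ y ∂ν, p y) : ∀ᵐ x ∂μ, p (f x) := hf.quasiMeasurePreserving.ae h

theorem BddMap.memLp {f : α → β} {μ : Measure α} {ν : Measure β} (hf : BddMap f μ ν)
    {E : Type*} [NormedAddCommGroup E] {g : β → E} {p : ℝ≥0∞} (hg : MemLp g p ν) :
    MemLp (g ∘ f) p μ := by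
  obtain ⟨hfm, C, hC, h⟩ := hf
  exact (hg.of_measure_le_smul hC h).comp_of_map hfm.aemeasurable

theorem BddMap.prodMap {f : α → β} {g : γ → δ} {μ : Measure α} {ν : Measure β} {μ' : Measure γ}
    {ν' : Measure δ} [SFinite μ] [SFinite μ'] [SFinite ν] [SFinite ν']
    (hf : BddMap f μ ν) (hg : BddMap g μ' ν') :
    BddMap (Prod.map f g) (μ.prod μ') (ν.prod ν') := by
  obtain ⟨hfm, C, hC, h1⟩ := hf
  obtain ⟨hgm, D, hD, h2⟩ := hg
  refine ⟨hfm.prodMap hgm, C * D, ENNReal.mul_ne_top hC hD, ?_⟩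
  rw [← Measure.map_prod_map _ _ hfm hgm]
  refine (Measure.prod_mono h1 h2).trans ?_
  rw [Measure.prod_smul_left, Measure.prod_smul_right, smul_smul]

theorem BddMap.id {μ : Measure α} : BddMap (fun x : α => x) μ μ :=
  (MeasurePreserving.id μ).bddMap

theorem BddMap.cons {μ : Measure α} [SigmaFinite μ] {n : ℕ} :
    BddMap (fun z : α × (Fin n → α) => (Fin.cons z.1 z.2 : Fin (n + 1) → α))
      (μ.prod (Measure.pi fun _ => μ)) (Measure.pi fun _ => μ) := by
  have h := (measurePreserving_piFinSuccAbove (fun _ : Fin (n + 1) => μ) 0).symm.bddMap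
  convert h using 1
  funext z
  change (Fin.cons z.1 z.2 : Fin (n + 1) → α) = @Fin.insertNth n (fun _ => α) 0 z.1 z.2
  rw [Fin.insertNth_zero']

theorem BddMap.remove {μ : Measure α} [SigmaFinite μ] {n : ℕ} (i : Fin (n + 1)) :
    BddMap (fun K : Fin (n + 1) → α => (K i, i.removeNth K))
      (Measure.pi fun _ => μ) (μ.prod (Measure.pi fun _ => μ)) :=
  (measurePreserving_piFinSuccAbove (fun _ : Fin (n + 1) => μ) i).bddMap

theorem BddMap.pi {μ : Measure α} {ν : Measure β} [SigmaFinite μ] [SigmaFinite ν] {n : ℕ}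
    {f : Fin n → α → β} (hf : ∀ i, BddMap (f i) μ ν) :
    BddMap (fun (x : Fin n → α) i => f i (x i)) (Measure.pi fun _ => μ) (Measure.pi fun _ => ν) := by
  induction n with
  | zero =>
    have hm : Measurable (fun (x : Fin 0 → α) i => f i (x i)) :=
      measurable_pi_lambda _ fun i => i.elim0
    refine BddMap.of_le hm ?_
    have h1 : (Measure.pi fun _ : Fin 0 => ν) = Measure.dirac (fun i => i.elim0) :=
      Measure.pi_of_empty _ _
    have h2 : (Measure.pi fun _ : Fin 0 => μ) = Measure.dirac (fun i => i.elim0) :=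
      Measure.pi_of_empty _ _
    rw [h1, h2, Measure.map_dirac' hm]
    refine le_of_eq ?_
    congr 1
    exact Subsingleton.elim _ _
  | succ n ih =>
    have h := BddMap.cons.comp (((hf 0).prodMap (ih fun i => hf i.succ)).comp (BddMap.remove 0))
    convert h using 1
    funext x i
    refine Fin.cases ?_ (fun j => ?_) i
    · rfl
    · simp [Prod.map, Fin.tail]

theorem measurePreserving_leftComm (μ : Measure α) (ν : Measure β) (ρ : Measure γ) [SFinite μ]
    [SFinite ν] [SFinite ρ] : MeasurePreserving (fun z : α × β × γ => (z.2.1, z.1, z.2.2))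
      (μ.prod (ν.prod ρ)) (ν.prod (μ.prod ρ)) :=
  (measurePreserving_prodAssoc ν μ ρ).comp
    (((Measure.measurePreserving_swap (μ := μ) (ν := ν)).prod (MeasurePreserving.id ρ)).comp
      (measurePreserving_prodAssoc μ ν ρ).symm)

end BddMap

/-! ### Maps between configuration spaces that move one particle to another type -/

section ConfigMaps

variable {r : ℕ}

/-- A fixed Lorentz index carries the Dirac measure, which is dominated by counting measure. -/
theorem bddMap_mkVec (m : Fin r → ℝ) (ν : Fin 4) :
    BddMap (fun y : Scal r => ((ν, y) : Vec r)) (scalMeasure m) (vecMeasure m) := by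
  refine BddMap.of_le measurable_prodMk_left ?_
  rw [vecMeasure, ← Measure.dirac_prod]
  refine Measure.prod_mono ?_ le_rfl
  refine Measure.le_iff.2 fun s hs => ?_
  rw [Measure.dirac_apply' _ hs, Measure.count_apply hs]
  by_cases h : ν ∈ s
  · rw [Set.indicator_of_mem h, Pi.one_apply]
    exact_mod_cast Set.one_le_encard_iff_nonempty.2 ⟨ν, h⟩
  · rw [Set.indicator_of_notMem h]; exact zero_le

theorem bddMap_snd (m : Fin r → ℝ) :
    BddMap (fun z : Vec r => z.2) (vecMeasure m) (scalMeasure m) := by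
  -- The constant 4 is the number of Lorentz indices being forgotten.
  refine ⟨measurable_snd, 4, by simp, ?_⟩
  have : (vecMeasure m).map (fun z : Vec r => z.2) = (4 : ℝ≥0∞) • scalMeasure m := by
    rw [vecMeasure]
    refine Measure.map_snd_prod.trans ?_
    congr 1
    simp [Measure.count_apply_finite]
  rw [this]

variable (m : Fin r → ℝ) {n w l s : ℕ}

/-- The terms of the supercharge evaluate an amplitude at a configuration in which one particle has
changed its type. Bounded density of this map makes the evaluation independent of the representative
and bounded on L². The map is a composition of removing, reordering and inserting a variable. -/
theorem bddMap_termAc (ν : Fin 4) (i : Fin (l + 1)) :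
    BddMap (fun x : Config r n w (l + 1) s =>
      ((Fin.cons (ν, x.2.2.1 i) x.1, x.2.1, i.removeNth x.2.2.1, x.2.2.2) : Config r (n + 1) w l s))
      (configMeasure m n w (l + 1) s) (configMeasure m (n + 1) w l s) := by
  unfold configMeasure
  have h1 := (BddMap.id (μ := Measure.pi fun _ : Fin n => vecMeasure m)).prodMap
    ((BddMap.id (μ := Measure.pi fun _ : Fin w => scalMeasure m)).prodMap
    ((BddMap.remove (μ := scalMeasure m) i).prodMap
      (BddMap.id (μ := Measure.pi fun _ : Fin s => scalMeasure m))))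
  have h2 := (BddMap.id (μ := Measure.pi fun _ : Fin n => vecMeasure m)).prodMap
    (((measurePreserving_leftComm (Measure.pi fun _ : Fin w => scalMeasure m) (scalMeasure m)
      ((Measure.pi fun _ : Fin l => scalMeasure m).prod
        (Measure.pi fun _ : Fin s => scalMeasure m))).bddMap).comp
    ((BddMap.id (μ := Measure.pi fun _ : Fin w => scalMeasure m)).prodMap
      (measurePreserving_prodAssoc (scalMeasure m) (Measure.pi fun _ : Fin l => scalMeasure m)
        (Measure.pi fun _ : Fin s => scalMeasure m)).bddMap))
  have h3 := ((measurePreserving_prodAssoc (scalMeasure m)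
    (Measure.pi fun _ : Fin n => vecMeasure m) _).symm.bddMap.comp
    (measurePreserving_leftComm (Measure.pi fun _ : Fin n => vecMeasure m) (scalMeasure m)
      ((Measure.pi fun _ : Fin w => scalMeasure m).prod
      ((Measure.pi fun _ : Fin l => scalMeasure m).prod
        (Measure.pi fun _ : Fin s => scalMeasure m)))).bddMap)
  have h4 := (BddMap.cons.comp ((bddMap_mkVec m ν).prodMap
    (BddMap.id (μ := Measure.pi fun _ : Fin n => vecMeasure m)))).prodMap
    (BddMap.id (μ := (Measure.pi fun _ : Fin w => scalMeasure m).prod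
      ((Measure.pi fun _ : Fin l => scalMeasure m).prod
        (Measure.pi fun _ : Fin s => scalMeasure m))))
  exact h4.comp (h3.comp (h2.comp h1))

theorem bddMap_termAb (i : Fin (n + 1)) :
    BddMap (fun x : Config r (n + 1) w l s =>
      ((i.removeNth x.1, Fin.cons (x.1 i).2 x.2.1, x.2.2.1, x.2.2.2) : Config r n (w + 1) l s))
      (configMeasure m (n + 1) w l s) (configMeasure m n (w + 1) l s) := by
  unfold configMeasure
  have h1 := (((bddMap_snd m).prodMap (BddMap.id (μ := Measure.pi fun _ : Fin n => vecMeasure m))).comp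
    (BddMap.remove (μ := vecMeasure m) i)).prodMap
    (BddMap.id (μ := (Measure.pi fun _ : Fin w => scalMeasure m).prod
      ((Measure.pi fun _ : Fin l => scalMeasure m).prod
        (Measure.pi fun _ : Fin s => scalMeasure m))))
  have h2 := (measurePreserving_leftComm (scalMeasure m) (Measure.pi fun _ : Fin n => vecMeasure m)
      ((Measure.pi fun _ : Fin w => scalMeasure m).prod
      ((Measure.pi fun _ : Fin l => scalMeasure m).prod
        (Measure.pi fun _ : Fin s => scalMeasure m)))).bddMap.comp
    (measurePreserving_prodAssoc (scalMeasure m) (Measure.pi fun _ : Fin n => vecMeasure m) _).bddMap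
  have h3 := (BddMap.id (μ := Measure.pi fun _ : Fin n => vecMeasure m)).prodMap
    ((BddMap.cons.prodMap (BddMap.id (μ := (Measure.pi fun _ : Fin l => scalMeasure m).prod
        (Measure.pi fun _ : Fin s => scalMeasure m)))).comp
    (measurePreserving_prodAssoc (scalMeasure m) (Measure.pi fun _ : Fin w => scalMeasure m)
      ((Measure.pi fun _ : Fin l => scalMeasure m).prod
        (Measure.pi fun _ : Fin s => scalMeasure m))).symm.bddMap)
  exact h3.comp (h2.comp h1)

theorem bddMap_termac (i : Fin (l + 1)) :
    BddMap (fun x : Config r n w (l + 1) s =>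
      ((x.1, x.2.1, i.removeNth x.2.2.1, Fin.cons (x.2.2.1 i) x.2.2.2) : Config r n w l (s + 1)))
      (configMeasure m n w (l + 1) s) (configMeasure m n w l (s + 1)) := by
  unfold configMeasure
  have h1 := (BddMap.id (μ := Measure.pi fun _ : Fin n => vecMeasure m)).prodMap
    ((BddMap.id (μ := Measure.pi fun _ : Fin w => scalMeasure m)).prodMap
    (((BddMap.id (μ := Measure.pi fun _ : Fin l => scalMeasure m)).prodMap
      (BddMap.cons (μ := scalMeasure m) (n := s))).comp
    ((measurePreserving_leftComm (scalMeasure m) (Measure.pi fun _ : Fin l => scalMeasure m)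
      (Measure.pi fun _ : Fin s => scalMeasure m)).bddMap.comp
    ((measurePreserving_prodAssoc (scalMeasure m) (Measure.pi fun _ : Fin l => scalMeasure m)
      (Measure.pi fun _ : Fin s => scalMeasure m)).bddMap.comp
    ((BddMap.remove (μ := scalMeasure m) i).prodMap
      (BddMap.id (μ := Measure.pi fun _ : Fin s => scalMeasure m)))))))
  exact h1

theorem bddMap_termab (i : Fin (s + 1)) :
    BddMap (fun x : Config r n w l (s + 1) =>
      ((x.1, Fin.cons (x.2.2.2 i) x.2.1, x.2.2.1, i.removeNth x.2.2.2) : Config r n (w + 1) l s))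
      (configMeasure m n w l (s + 1)) (configMeasure m n (w + 1) l s) := by
  unfold configMeasure
  have h1 := (BddMap.id (μ := Measure.pi fun _ : Fin w => scalMeasure m)).prodMap
    ((measurePreserving_leftComm (Measure.pi fun _ : Fin l => scalMeasure m) (scalMeasure m)
      (Measure.pi fun _ : Fin s => scalMeasure m)).bddMap.comp
    ((BddMap.id (μ := Measure.pi fun _ : Fin l => scalMeasure m)).prodMap
      (BddMap.remove (μ := scalMeasure m) i)))
  have h2 := (BddMap.cons.prodMap (BddMap.id (μ := (Measure.pi fun _ : Fin l => scalMeasure m).prod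
        (Measure.pi fun _ : Fin s => scalMeasure m)))).comp
    ((measurePreserving_prodAssoc (scalMeasure m) (Measure.pi fun _ : Fin w => scalMeasure m)
      ((Measure.pi fun _ : Fin l => scalMeasure m).prod
        (Measure.pi fun _ : Fin s => scalMeasure m))).symm.bddMap.comp
    (measurePreserving_leftComm (Measure.pi fun _ : Fin w => scalMeasure m) (scalMeasure m)
      ((Measure.pi fun _ : Fin l => scalMeasure m).prod
        (Measure.pi fun _ : Fin s => scalMeasure m))).bddMap)
  exact (BddMap.id (μ := Measure.pi fun _ : Fin n => vecMeasure m)).prodMap (h2.comp h1)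

end ConfigMaps

/-! ## Operators on the invariant domain -/

section CoreOperators

variable {r : ℕ} {m : Fin r → ℝ}

/-- Almost everywhere equality of amplitudes. -/
def AmpEq (m : Fin r → ℝ) (Ψ Ψ' : Amp r) : Prop :=
  ∀ n w l s, Ψ n w l s =ᵐ[configMeasure m n w l s] Ψ' n w l s

theorem AmpEq.symm {Ψ Ψ' : Amp r} (h : AmpEq m Ψ Ψ') : AmpEq m Ψ' Ψ :=
  fun n w l s => (h n w l s).symm

theorem AmpEq.trans {Ψ Ψ' Ψ'' : Amp r} (h : AmpEq m Ψ Ψ') (h' : AmpEq m Ψ' Ψ'') :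
    AmpEq m Ψ Ψ'' := fun n w l s => (h n w l s).trans (h' n w l s)

theorem AmpEq.refl (Ψ : Amp r) : AmpEq m Ψ Ψ := fun _ _ _ _ => Filter.EventuallyEq.rfl

theorem AmpEq.add {Ψ Ψ' Θ Θ' : Amp r} (h : AmpEq m Ψ Ψ') (h' : AmpEq m Θ Θ') :
    AmpEq m (Ψ + Θ) (Ψ' + Θ') := fun n w l s => (h n w l s).add (h' n w l s)

theorem AmpEq.smul {Ψ Ψ' : Amp r} (h : AmpEq m Ψ Ψ') (c : ℂ) : AmpEq m (c • Ψ) (c • Ψ') :=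
  fun n w l s => (h n w l s).const_smul c

/-- Amplitudes of vectors of the invariant domain. -/
structure CoreAmp (m : Fin r → ℝ) (Ψ : Amp r) : Prop where
  memLp : ∀ n w l s, MemLp (Ψ n w l s) 2 (configMeasure m n w l s)
  sym : ∃ Ψ', IsSymAmp Ψ' ∧ AmpEq m Ψ Ψ'
  fin : ∃ N, ∀ n w l s, N < n + w + l + s → Ψ n w l s =ᵐ[configMeasure m n w l s] 0
  bdd : ∃ R : ℝ, ∀ n w l s, ∀ᵐ x ∂configMeasure m n w l s, ¬ x.Bounded R → Ψ n w l s x = 0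

/-- There are finitely many permutations, so the symmetry relations hold simultaneously almost
everywhere, and each term of the average then equals the function itself. This provides everywhere
symmetric representatives, without which functions of words could not be formed. -/
theorem symAmp_ae {Ψ : Amp r} {n w l s : ℕ} (h : ∀ (π : Equiv.Perm (Fin n))
    (ρ : Equiv.Perm (Fin w)) (σ : Equiv.Perm (Fin l)) (τ : Equiv.Perm (Fin s)),
    ∀ᵐ x ∂configMeasure m n w l s,
      Ψ n w l s (permConfig π ρ σ τ x) = signC w ρ * signC l σ * Ψ n w l s x) :
    Ψ n w l s =ᵐ[configMeasure m n w l s] symAmp Ψ n w l s := by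
  filter_upwards [ae_all_iff.2 fun π => ae_all_iff.2 fun ρ => ae_all_iff.2 fun σ =>
    ae_all_iff.2 fun τ => h π ρ σ τ] with x hx
  simp only [symAmp, hx]
  have h1 : ∀ (ρ : Equiv.Perm (Fin w)) (σ : Equiv.Perm (Fin l)),
      signC w ρ * signC l σ * (signC w ρ * signC l σ * Ψ n w l s x) = Ψ n w l s x := fun ρ σ => by
    linear_combination (Ψ n w l s x) * (signC w ρ * signC w ρ * signC_mul_self σ + signC_mul_self ρ)
  simp only [h1, Finset.sum_const, Finset.card_univ, Fintype.card_perm, Fintype.card_fin,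
    nsmul_eq_mul]
  have hn : ∀ k : ℕ, (k.factorial : ℂ) ≠ 0 := fun k => by exact_mod_cast k.factorial_ne_zero
  have := hn n
  have := hn w
  have := hn l
  have := hn s
  field_simp

theorem coreAmp_amp (Φ : core m) : CoreAmp m (amp (Φ : GhostSpace m)) where
  memLp n w l s := Lp.memLp _
  sym := ⟨symAmp (amp (Φ : GhostSpace m)), isSymAmp_symAmp _, fun n w l s => symAmp_ae
    ((Φ : GhostSpace m) (n, w, l, s)).2⟩
  fin := by
    obtain ⟨h, -⟩ := Φ.2
    refine ⟨h.toFinset.sup fun i => i.1 + i.2.1 + i.2.2.1 + i.2.2.2, fun n w l s hN => ?_⟩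
    have h0 : (Φ : GhostSpace m) (n, w, l, s) = 0 := by
      by_contra hne
      have := Finset.le_sup (f := fun i : ℕ × ℕ × ℕ × ℕ => i.1 + i.2.1 + i.2.2.1 + i.2.2.2)
        (h.mem_toFinset.2 hne)
      exact absurd hN (not_lt.2 this)
    rw [amp, h0]
    exact Lp.coeFn_zero ℂ 2 _
  bdd := Φ.2.2

theorem core_ext {Φ Φ' : core m}
    (h : AmpEq m (amp (Φ : GhostSpace m)) (amp (Φ' : GhostSpace m))) : Φ = Φ' := by
  refine Subtype.ext (lp.ext (funext fun i => Subtype.ext ?_))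
  exact Lp.ext (h i.1 i.2.1 i.2.2.1 i.2.2.2)

/-- With finitely many non-zero sectors, square summability over the sectors is automatic, so the
four conditions describe the invariant domain completely. -/
theorem CoreAmp.exists_core {Ψ : Amp r} (h : CoreAmp m Ψ) :
    ∃ Φ : core m, AmpEq m (amp (Φ : GhostSpace m)) Ψ := by
  obtain ⟨Ψ', hs, he⟩ := h.sym
  obtain ⟨N, hN⟩ := h.fin
  have hmem : ∀ n w l s, (h.memLp n w l s).toLp (Ψ n w l s) ∈ sector m n w l s := by
    intro n w l s π ρ σ τ
    have h1 : ((h.memLp n w l s).toLp (Ψ n w l s) : Config r n w l s → ℂ)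
      =ᵐ[configMeasure m n w l s] Ψ' n w l s := (h.memLp n w l s).coeFn_toLp.trans (he n w l s)
    filter_upwards [h1, (measurePreserving_permConfig m π ρ σ τ).quasiMeasurePreserving.ae h1]
      with x h2 h3
    rw [h2, h3]
    exact hs n w l s π ρ σ τ x
  let f : ∀ i : ℕ × ℕ × ℕ × ℕ, sector m i.1 i.2.1 i.2.2.1 i.2.2.2 :=
    fun i => ⟨_, hmem i.1 i.2.1 i.2.2.1 i.2.2.2⟩
  have hfin : {i | f i ≠ 0}.Finite := by
    refine Set.Finite.subset (Finset.finite_toSet (Finset.range (N + 1) ×ˢ Finset.range (N + 1) ×ˢ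
      Finset.range (N + 1) ×ˢ Finset.range (N + 1))) fun i hi => ?_
    have : ¬ N < i.1 + i.2.1 + i.2.2.1 + i.2.2.2 := by
      intro hlt
      refine hi (Subtype.ext ?_)
      have := hN _ _ _ _ hlt
      refine (Lp.ext ?_ : (h.memLp i.1 i.2.1 i.2.2.1 i.2.2.2).toLp _ = 0)
      exact (h.memLp _ _ _ _).coeFn_toLp.trans (this.trans (Lp.coeFn_zero ℂ 2 _).symm)
    simp only [Finset.coe_product, Finset.coe_range, Set.mem_prod, Set.mem_Iio]
    omega
  have hl : Memℓp f 2 := by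
    refine memℓp_gen (summable_of_hasFiniteSupport (hfin.subset fun i hi => ?_))
    intro h0
    exact hi (by simp [h0])
  have hae : ∀ n w l s, amp (⟨f, hl⟩ : GhostSpace m) n w l s =ᵐ[configMeasure m n w l s]
      Ψ n w l s := fun n w l s => (h.memLp n w l s).coeFn_toLp
  refine ⟨⟨⟨f, hl⟩, hfin, ?_⟩, hae⟩
  obtain ⟨R, hR⟩ := h.bdd
  refine ⟨R, fun n w l s => ?_⟩
  filter_upwards [hR n w l s, hae n w l s] with x h1 h2 h3
  rw [h2, h1 h3]

/-- Operations on amplitudes that define (anti)linear operators on the invariant domain. -/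
structure AmpOp (m : Fin r → ℝ) (σ : ℂ →+* ℂ) (T : Amp r → Amp r) : Prop where
  congr : ∀ Ψ Ψ', AmpEq m Ψ Ψ' → AmpEq m (T Ψ) (T Ψ')
  add : ∀ Ψ Ψ', T (Ψ + Ψ') = T Ψ + T Ψ'
  smul : ∀ (c : ℂ) Ψ, T (c • Ψ) = σ c • T Ψ
  coreAmp : ∀ Ψ, CoreAmp m Ψ → CoreAmp m (T Ψ)

/-- The values are chosen vector by vector; additivity and semilinearity then follow because a
vector of the domain is determined by its amplitudes almost everywhere. -/
theorem AmpOp.exists_operator {σ : ℂ →+* ℂ} {T : Amp r → Amp r} (hT : AmpOp m σ T) :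
    ∃ A : core m →ₛₗ[σ] core m, ∀ Φ : core m, AmpEq m (amp (A Φ : GhostSpace m))
      (T (amp (Φ : GhostSpace m))) := by
  choose A hA using fun Φ : core m => (hT.coreAmp _ (coreAmp_amp Φ)).exists_core
  refine ⟨{ toFun := A, map_add' := fun Φ Ψ => core_ext ?_, map_smul' := fun c Φ => core_ext ?_ },
    hA⟩
  · refine (hA _).trans ?_
    have h1 : AmpEq m (amp ((Φ + Ψ : core m) : GhostSpace m))
        (amp (Φ : GhostSpace m) + amp (Ψ : GhostSpace m)) := amp_add _ _
    refine (hT.congr _ _ h1).trans ?_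
    rw [hT.add]
    refine ((hA Φ).add (hA Ψ)).symm.trans ?_
    exact AmpEq.symm (fun n w l s => amp_add (A Φ : GhostSpace m) (A Ψ : GhostSpace m) n w l s)
  · refine (hA _).trans ?_
    have h1 : AmpEq m (amp ((c • Φ : core m) : GhostSpace m))
        (c • amp (Φ : GhostSpace m)) := amp_smul _ _
    refine (hT.congr _ _ h1).trans ?_
    rw [hT.smul]
    refine ((hA Φ).smul (σ c)).symm.trans ?_
    exact AmpEq.symm (fun n w l s => amp_smul (σ c) (A Φ : GhostSpace m) n w l s)

/-- `F` is a supersymmetric function of words with the amplitudes of `Φ`. -/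
def Represents (F : WordFn r) (Φ : core m) : Prop :=
  SuperSym F ∧ AmpEq m (amp (Φ : GhostSpace m)) (wordAmp F)

/-- Truncation is compatible with exchanges of letters, so the representative can be made to vanish
at every long word, not just almost everywhere. The algebraic argument on falling factorials of N
needs this pointwise bound. -/
theorem CoreAmp.exists_superSym {Ψ : Amp r} (h : CoreAmp m Ψ) :
    ∃ (N : ℕ) (F : WordFn r), SuperSym F ∧ AmpEq m Ψ (wordAmp F) ∧ ∀ u, N < u.length → F u = 0 := by
  obtain ⟨Ψ', hs, he⟩ := h.sym
  obtain ⟨N, hN⟩ := h.fin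
  refine ⟨N, truncWord N (ampWord Ψ'), hs.superSym_ampWord.trunc N, fun n w l s => ?_,
    fun u hu => if_neg (not_le.2 hu)⟩
  by_cases hl : n + w + l + s ≤ N
  · have h1 : wordAmp (truncWord N (ampWord Ψ')) n w l s = Ψ' n w l s := by
      rw [← congrFun (congrFun (congrFun (congrFun (wordAmp_ampWord Ψ') n) w) l) s]
      funext x
      simp only [wordAmp, truncWord]
      rw [if_pos (by rw [x.length_word]; exact hl)]
    rw [h1]
    exact he n w l s
  · refine (hN n w l s (not_le.1 hl)).trans (Filter.Eventually.of_forall fun x => ?_)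
    simp only [wordAmp, truncWord]
    rw [if_neg (by rw [x.length_word]; exact hl), mul_zero, Pi.zero_apply]

theorem exists_represents (Φ : core m) :
    ∃ (N : ℕ) (F : WordFn r), Represents F Φ ∧ ∀ u, N < u.length → F u = 0 := by
  obtain ⟨N, F, h1, h2, h3⟩ := (coreAmp_amp Φ).exists_superSym
  exact ⟨N, F, ⟨h1, h2⟩, h3⟩

theorem wordAmp_add (F G : WordFn r) : wordAmp (F + G) = wordAmp F + wordAmp G := by
  funext n w l s x; simp [wordAmp, mul_add]

theorem wordAmp_smul (c : ℂ) (F : WordFn r) : wordAmp (c • F) = c • wordAmp F := by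
  funext n w l s x; simp [wordAmp, mul_left_comm]

theorem Represents.add {F G : WordFn r} {Φ Ψ : core m} (hF : Represents F Φ)
    (hG : Represents G Ψ) : Represents (F + G) (Φ + Ψ) := by
  refine ⟨hF.1.add hG.1, ?_⟩
  rw [wordAmp_add]
  exact AmpEq.trans (fun n w l s => amp_add (Φ : GhostSpace m) (Ψ : GhostSpace m) n w l s)
    (hF.2.add hG.2)

theorem Represents.smul {F : WordFn r} {Φ : core m} (hF : Represents F Φ) (c : ℂ) :
    Represents (c • F) (c • Φ) := by
  refine ⟨hF.1.smul c, ?_⟩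
  rw [wordAmp_smul]
  exact AmpEq.trans (fun n w l s => amp_smul c (Φ : GhostSpace m) n w l s) (hF.2.smul c)

theorem ae_pi_fin {α : Type} [MeasurableSpace α] {μ : Measure α} [SigmaFinite μ] {p : α → Prop}
    (h : ∀ᵐ x ∂μ, p x) (n : ℕ) : ∀ᵐ K ∂(Measure.pi fun _ : Fin n => μ), ∀ i, p (K i) :=
  ae_all_iff.2 fun i => (Measure.quasiMeasurePreserving_eval (μ := fun _ : Fin n => μ) i).ae h

/-- The kernel identities hold only for letters on the mass shell. The measures are concentrated
there, which turns these identities into equalities of states. -/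
theorem ae_onShell (m : Fin r → ℝ) (n w l s : ℕ) :
    ∀ᵐ x ∂configMeasure m n w l s, ∀ z ∈ x.word, z.OnShell m := by
  have h1 : ∀ᵐ z ∂vecMeasure m, z.2.2 ∈ shell (m z.2.1) := (bddMap_snd m).ae (ae_mem_shell_scal m)
  have h2 := ae_mem_shell_scal m
  have hA : ∀ᵐ x ∂configMeasure m n w l s, ∀ i, (x.1 i).2.2 ∈ shell (m (x.1 i).2.1) := by
    unfold configMeasure
    exact Measure.quasiMeasurePreserving_fst.ae (ae_pi_fin h1 n)
  have hB : ∀ᵐ x ∂configMeasure m n w l s, ∀ i, (x.2.1 i).2 ∈ shell (m (x.2.1 i).1) := by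
    unfold configMeasure
    exact Measure.quasiMeasurePreserving_snd.ae
      (Measure.quasiMeasurePreserving_fst.ae (ae_pi_fin h2 w))
  have hC : ∀ᵐ x ∂configMeasure m n w l s, ∀ i, (x.2.2.1 i).2 ∈ shell (m (x.2.2.1 i).1) := by
    unfold configMeasure
    exact Measure.quasiMeasurePreserving_snd.ae (Measure.quasiMeasurePreserving_snd.ae
      (Measure.quasiMeasurePreserving_fst.ae (ae_pi_fin h2 l)))
  have hD : ∀ᵐ x ∂configMeasure m n w l s, ∀ i, (x.2.2.2 i).2 ∈ shell (m (x.2.2.2 i).1) := by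
    unfold configMeasure
    exact Measure.quasiMeasurePreserving_snd.ae (Measure.quasiMeasurePreserving_snd.ae
      (Measure.quasiMeasurePreserving_snd.ae (ae_pi_fin h2 s)))
  filter_upwards [hA, hB, hC, hD] with x ha hb hc hd z hz
  simp only [Config.word, List.mem_append, List.mem_ofFn, Function.comp_apply] at hz
  rcases hz with ⟨i, rfl⟩ | ⟨i, rfl⟩ | ⟨i, rfl⟩ | ⟨i, rfl⟩
  · exact ha i
  · exact hb i
  · exact hc i
  · exact hd i

theorem ShellEq.ampEq {F G : WordFn r} (h : ShellEq m F G) : AmpEq m (wordAmp F) (wordAmp G) :=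
  fun n w l s => by
    filter_upwards [ae_onShell m n w l s] with x hx
    simp only [wordAmp, h _ hx]

theorem Represents.of_shellEq {F G : WordFn r} {Φ : core m} (hF : Represents F Φ)
    (h : ShellEq m F G) (hG : SuperSym G) : Represents G Φ := ⟨hG, hF.2.trans h.ampEq⟩

/-- The bridge from algebra to operators: an identity between functions of on-shell words becomes an
identity in the domain. -/
theorem Represents.eq_of_shellEq {F G : WordFn r} {Φ Ψ : core m} (hF : Represents F Φ)
    (hG : Represents G Ψ) (h : ShellEq m F G) : Φ = Ψ :=
  core_ext (hF.2.trans (h.ampEq.trans hG.2.symm))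

/-! ### Square integrability of transformed amplitudes -/

/-- The coefficients, such as components of the momentum, are unbounded. They need only be bounded
where the transported amplitude is supported, and this is why the domain consists of states with
bounded momenta. -/
theorem memLp_term {n w l s n' w' l' s' : ℕ} {f : Config r n w l s → Config r n' w' l' s'}
    (hf : BddMap f (configMeasure m n w l s) (configMeasure m n' w' l' s'))
    {g : Config r n' w' l' s' → ℂ} (hg : MemLp g 2 (configMeasure m n' w' l' s')) {R C : ℝ}
    (hR : ∀ᵐ x ∂configMeasure m n' w' l' s', ¬ x.Bounded R → g x = 0)
    {c : Config r n w l s → ℂ} (hc : Measurable c) (hC : ∀ x, (f x).Bounded R → ‖c x‖ ≤ C) :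
    MemLp (fun x => c x * g (f x)) 2 (configMeasure m n w l s) := by
  refine (hf.memLp hg).of_le_mul (c := C) ?_ ?_
  · exact hc.aestronglyMeasurable.mul (hf.memLp hg).1
  · filter_upwards [hf.ae hR] with x hx
    rw [norm_mul]
    by_cases h : (f x).Bounded R
    · exact mul_le_mul_of_nonneg_right (hC x h) (norm_nonneg _)
    · rw [hx h, norm_zero, mul_zero, Function.comp_apply, hx h, norm_zero, mul_zero]

theorem bdd_term {n w l s n' w' l' s' : ℕ} {f : Config r n w l s → Config r n' w' l' s'}
    (hf : BddMap f (configMeasure m n w l s) (configMeasure m n' w' l' s'))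
    {g : Config r n' w' l' s' → ℂ} {R R' : ℝ}
    (hR : ∀ᵐ x ∂configMeasure m n' w' l' s', ¬ x.Bounded R → g x = 0)
    (hC : ∀ x, (f x).Bounded R → x.Bounded R') :
    ∀ᵐ x ∂configMeasure m n w l s, ¬ x.Bounded R' → g (f x) = 0 := by
  filter_upwards [hf.ae hR] with x hx h
  exact hx fun h' => h (hC x h')

end CoreOperators

/-! ## Existence of the supercharge -/

section TameOperators

variable {r : ℕ} {m : Fin r → ℝ}

/-- Identity or complex conjugation. -/
def IsConjOrId (σ : ℂ →+* ℂ) : Prop := σ = RingHom.id ℂ ∨ σ = starRingEnd ℂ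

theorem IsConjOrId.norm {σ : ℂ →+* ℂ} (h : IsConjOrId σ) (z : ℂ) : ‖σ z‖ = ‖z‖ := by
  rcases h with rfl | rfl <;> simp

theorem IsConjOrId.continuous {σ : ℂ →+* ℂ} (h : IsConjOrId σ) : Continuous σ := by
  rcases h with rfl | rfl
  · exact continuous_id
  · exact Complex.continuous_conj

theorem IsConjOrId.memLp {σ : ℂ →+* ℂ} (h : IsConjOrId σ) {α : Type*} [MeasurableSpace α]
    {μ : Measure α} {f : α → ℂ} {p : ℝ≥0∞} (hf : MemLp f p μ) : MemLp (fun x => σ (f x)) p μ :=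
  hf.of_le (h.continuous.comp_aestronglyMeasurable hf.1)
    (Filter.Eventually.of_forall fun _ => (h.norm _).le)

/-- Operations on amplitudes that preserve square integrability and the size of supports. -/
structure TameOp (m : Fin r → ℝ) (σ : ℂ →+* ℂ) (ρ : ℝ → ℝ) (T : Amp r → Amp r) : Prop where
  congr : ∀ Ψ Ψ', AmpEq m Ψ Ψ' → AmpEq m (T Ψ) (T Ψ')
  add : ∀ Ψ Ψ', T (Ψ + Ψ') = T Ψ + T Ψ'
  smul : ∀ (c : ℂ) Ψ, T (c • Ψ) = σ c • T Ψ
  memLp : ∀ Ψ R, (∀ n w l s, MemLp (Ψ n w l s) 2 (configMeasure m n w l s)) →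
    (∀ n w l s, ∀ᵐ x ∂configMeasure m n w l s, ¬ x.Bounded R → Ψ n w l s x = 0) →
    ∀ n w l s, MemLp (T Ψ n w l s) 2 (configMeasure m n w l s)
  bdd : ∀ Ψ R, (∀ n w l s, ∀ᵐ x ∂configMeasure m n w l s, ¬ x.Bounded R → Ψ n w l s x = 0) →
    ∀ n w l s, ∀ᵐ x ∂configMeasure m n w l s, ¬ x.Bounded (ρ R) → T Ψ n w l s x = 0
  fin : ∀ Ψ N, (∀ n w l s, N < n + w + l + s → Ψ n w l s =ᵐ[configMeasure m n w l s] 0) →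
    ∀ n w l s, N < n + w + l + s → T Ψ n w l s =ᵐ[configMeasure m n w l s] 0

theorem TameOp.sum {σ : ℂ →+* ℂ} {ρ : ℝ → ℝ} {T T' : Amp r → Amp r} (h : TameOp m σ ρ T)
    (h' : TameOp m σ ρ T') : TameOp m σ ρ (fun Ψ => T Ψ + T' Ψ) where
  congr Ψ Ψ' he := (h.congr _ _ he).add (h'.congr _ _ he)
  add Ψ Ψ' := by rw [h.add, h'.add]; abel
  smul c Ψ := by rw [h.smul, h'.smul, smul_add]
  memLp Ψ R h1 h2 n w l s := (h.memLp Ψ R h1 h2 n w l s).add (h'.memLp Ψ R h1 h2 n w l s)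
  bdd Ψ R h1 n w l s := by
    filter_upwards [h.bdd Ψ R h1 n w l s, h'.bdd Ψ R h1 n w l s] with x h2 h3 h4
    simp [h2 h4, h3 h4]
  fin Ψ N h1 n w l s hN := by
    filter_upwards [h.fin Ψ N h1 n w l s hN, h'.fin Ψ N h1 n w l s hN] with x h2 h3
    simp [h2, h3]

/-- The analytic conditions come from tameness and the symmetry from the word picture: applied to a
supersymmetric representative, T again gives the amplitudes of a supersymmetric function. -/
theorem TameOp.ampOp {σ : ℂ →+* ℂ} {ρ : ℝ → ℝ} {T : Amp r → Amp r} (h : TameOp m σ ρ T)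
    {D : WordFn r → WordFn r} (hD : ∀ F, SuperSym F → SuperSym (D F) ∧
      T (wordAmp F) = wordAmp (D F)) : AmpOp m σ T where
  congr := h.congr
  add := h.add
  smul := h.smul
  coreAmp Ψ hΨ := by
    obtain ⟨N, hN⟩ := hΨ.fin
    obtain ⟨R, hR⟩ := hΨ.bdd
    refine ⟨h.memLp Ψ R hΨ.memLp hR, ?_, ⟨N, h.fin Ψ N hN⟩, ⟨ρ R, h.bdd Ψ R hR⟩⟩
    obtain ⟨-, F, hF, he, -⟩ := hΨ.exists_superSym
    exact ⟨wordAmp (D F), (hD F hF).1.isSymAmp, (hD F hF).2 ▸ h.congr _ _ he⟩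

/-- One component of an operation on amplitudes: a finite sum of transforms of one amplitude. -/
def IsSumTerm (m : Fin r → ℝ) (σ : ℂ →+* ℂ) (ρ : ℝ → ℝ) (n w l s : ℕ)
    (T : Amp r → Config r n w l s → ℂ) : Prop :=
  ∃ (ι : Type) (_ : Fintype ι) (n' w' l' s' : ℕ) (f : ι → Config r n w l s → Config r n' w' l' s')
    (c : ι → Config r n w l s → ℂ),
    (∀ i, BddMap (f i) (configMeasure m n w l s) (configMeasure m n' w' l' s')) ∧
    (∀ i, Measurable (c i)) ∧ (∀ i R, ∃ C, ∀ x, (f i x).Bounded R → ‖c i x‖ ≤ C) ∧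
    (∀ i R x, (f i x).Bounded R → x.Bounded (ρ R)) ∧ n + w + l + s ≤ n' + w' + l' + s' ∧
    ∀ Ψ x, T Ψ x = ∑ i, c i x * σ (Ψ n' w' l' s' (f i x))

theorem isSumTerm_zero {σ : ℂ →+* ℂ} {ρ : ℝ → ℝ} {n w l s : ℕ} :
    IsSumTerm m σ ρ n w l s (fun _ _ => 0) :=
  ⟨Empty, inferInstance, n, w, l, s, Empty.elim, Empty.elim, fun i => i.elim, fun i => i.elim,
    fun i => i.elim, fun i => i.elim, le_rfl, fun _ _ => by simp⟩

/-- The supercharge terms, the ghost exchange, the Krein operator and the Poincaré action all have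
components of this shape, so the measure theory is done once here. The inequality between particle
numbers in the shape ensures that the total particle number does not grow. -/
theorem TameOp.of_isSumTerm {σ : ℂ →+* ℂ} (hσ : IsConjOrId σ) {ρ : ℝ → ℝ} {T : Amp r → Amp r}
    (h : ∀ n w l s, IsSumTerm m σ ρ n w l s (fun Ψ => T Ψ n w l s)) : TameOp m σ ρ T where
  congr Ψ Ψ' he n w l s := by
    obtain ⟨ι, _, n', w', l', s', f, c, hf, hc, hC, hρ, hle, hT⟩ := h n w l s
    beta_reduce at hT
    filter_upwards [ae_all_iff.2 fun i => (hf i).ae (he n' w' l' s')] with x hx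
    rw [hT, hT]
    exact Finset.sum_congr rfl fun i _ => by rw [hx i]
  add Ψ Ψ' := by
    funext n w l s x
    obtain ⟨ι, _, n', w', l', s', f, c, hf, hc, hC, hρ, hle, hT⟩ := h n w l s
    beta_reduce at hT
    simp only [Pi.add_apply, hT, map_add, mul_add, Finset.sum_add_distrib]
  smul a Ψ := by
    funext n w l s x
    obtain ⟨ι, _, n', w', l', s', f, c, hf, hc, hC, hρ, hle, hT⟩ := h n w l s
    beta_reduce at hT
    simp only [Pi.smul_apply, hT, map_mul, smul_eq_mul, Finset.mul_sum]
    exact Finset.sum_congr rfl fun i _ => by ring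
  memLp Ψ R h1 h2 n w l s := by
    obtain ⟨ι, _, n', w', l', s', f, c, hf, hc, hC, hρ, hle, hT⟩ := h n w l s
    beta_reduce at hT
    have he : T Ψ n w l s = fun x => ∑ i, c i x * σ (Ψ n' w' l' s' (f i x)) :=
      funext fun x => hT Ψ x
    rw [he]
    refine memLp_finsetSum _ fun i _ => ?_
    obtain ⟨C, hC⟩ := hC i R
    refine memLp_term (hf i) (hσ.memLp (h1 n' w' l' s')) (R := R) (C := C) ?_ (hc i) hC
    filter_upwards [h2 n' w' l' s'] with x h3 h4
    rw [h3 h4, map_zero]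
  bdd Ψ R h1 n w l s := by
    obtain ⟨ι, _, n', w', l', s', f, c, hf, hc, hC, hρ, hle, hT⟩ := h n w l s
    beta_reduce at hT
    filter_upwards [ae_all_iff.2 fun i => bdd_term (hf i) (h1 n' w' l' s') (hρ i R)] with x hx h2
    rw [hT]
    exact Finset.sum_eq_zero fun i _ => by rw [hx i h2, map_zero, mul_zero]
  fin Ψ N h1 n w l s hN := by
    obtain ⟨ι, _, n', w', l', s', f, c, hf, hc, hC, hρ, hle, hT⟩ := h n w l s
    beta_reduce at hT
    filter_upwards [ae_all_iff.2 fun i => (hf i).ae (h1 n' w' l' s' (lt_of_lt_of_le hN hle))]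
      with x hx
    rw [hT, Pi.zero_apply]
    exact Finset.sum_eq_zero fun i _ => by rw [hx i, Pi.zero_apply, map_zero, mul_zero]

end TameOperators

/-! ### The supercharge as an operator on the invariant domain -/

section Supercharge

variable {r : ℕ} (m : Fin r → ℝ)

theorem abs_le_of_norm_le {p : Mom} {R : ℝ} (h : ‖p‖ ≤ R) (ν : Fin 4) : ‖(p ν : ℂ)‖ ≤ R := by
  rw [Complex.norm_real]
  exact (norm_le_pi_norm p ν).trans h

theorem norm_eta (μ : Fin 4) : ‖eta μ‖ = 1 := by
  unfold eta; split_ifs <;> simp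

theorem measurable_mass : Measurable fun y : Scal r => (m y.1 : ℂ) :=
  (measurable_of_countable (fun a : Fin r => (m a : ℂ))).comp measurable_fst

theorem measurable_lowered : Measurable fun z : Vec r => ((eta z.1 * z.2.2 z.1 : ℝ) : ℂ) := by
  refine Complex.measurable_ofReal.comp ?_
  refine measurable_from_prod_countable_right fun μ => ?_
  simp only
  fun_prop

theorem mass_bound : ∃ C : ℝ, ∀ a : Fin r, ‖(m a : ℂ)‖ ≤ C :=
  ⟨∑ a, ‖(m a : ℂ)‖, fun a => Finset.single_le_sum (f := fun a => ‖(m a : ℂ)‖)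
    (fun _ _ => norm_nonneg _) (Finset.mem_univ a)⟩

theorem tameOp_termAc : TameOp m (RingHom.id ℂ) id (termAc (r := r)) := by
  refine TameOp.of_isSumTerm (Or.inl rfl) fun n w l s => ?_
  cases l with
  | zero => exact isSumTerm_zero
  | succ l =>
    refine ⟨Fin (l + 1) × Fin 4, inferInstance, n + 1, w, l, s, fun j x =>
      (Fin.cons (j.2, x.2.2.1 j.1) x.1, x.2.1, j.1.removeNth x.2.2.1, x.2.2.2),
      fun j x => ((-1 : ℂ) ^ w * (Real.sqrt ((n + 1 : ℝ) / (l + 1 : ℝ)) : ℂ) * (-1) ^ (j.1 : ℕ)) *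
        ((x.2.2.1 j.1).2 j.2 : ℂ), fun j => bddMap_termAc m j.2 j.1, fun j => ?_, fun j R => ?_,
      fun j R x h => ?_, by omega, fun Ψ x => ?_⟩
    · refine Measurable.const_mul (Complex.measurable_ofReal.comp ?_) _
      fun_prop
    · refine ⟨‖(-1 : ℂ) ^ w * (Real.sqrt ((n + 1 : ℝ) / (l + 1 : ℝ)) : ℂ) * (-1) ^ (j.1 : ℕ)‖ * R,
        fun x h => ?_⟩
      rw [norm_mul]
      refine mul_le_mul_of_nonneg_left (abs_le_of_norm_le ?_ _) (norm_nonneg _)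
      exact h.1 0
    -- The removed ghost momentum reappears as the first vector variable, so its bound is the one at
    -- index 0.
    · refine ⟨fun i => h.1 i.succ, h.2.1, (Fin.forall_iff_succAbove j.1).2 ⟨h.1 0, h.2.2.1⟩,
        h.2.2.2⟩
    · obtain ⟨K, P, Q, R⟩ := x
      simp only [termAc, RingHom.id_apply, Fintype.sum_prod_type, Finset.mul_sum]
      exact Finset.sum_congr rfl fun i _ => Finset.sum_congr rfl fun ν _ => by ring

theorem tameOp_termAb : TameOp m (RingHom.id ℂ) id (termAb (r := r)) := by
  refine TameOp.of_isSumTerm (Or.inl rfl) fun n w l s => ?_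
  cases n with
  | zero => exact isSumTerm_zero
  | succ n =>
    refine ⟨Fin (n + 1), inferInstance, n, w + 1, l, s, fun i x =>
      (i.removeNth x.1, Fin.cons (x.1 i).2 x.2.1, x.2.2.1, x.2.2.2),
      fun i x => -(Real.sqrt ((w + 1 : ℝ) / (n + 1 : ℝ)) : ℂ) *
        ((eta (x.1 i).1 * (x.1 i).2.2 (x.1 i).1 : ℝ) : ℂ), fun i => bddMap_termAb m i,
      fun i => ?_, fun i R => ?_, fun i R x h => ?_, by omega, fun Ψ x => ?_⟩
    · exact Measurable.const_mul (measurable_lowered.comp (by fun_prop)) _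
    · refine ⟨‖-(Real.sqrt ((w + 1 : ℝ) / (n + 1 : ℝ)) : ℂ)‖ * R, fun x h => ?_⟩
      rw [norm_mul]
      refine mul_le_mul_of_nonneg_left ?_ (norm_nonneg _)
      rw [Complex.ofReal_mul, norm_mul, Complex.norm_real, norm_eta, one_mul]
      exact abs_le_of_norm_le (h.2.1 0) _
    · exact ⟨(Fin.forall_iff_succAbove i).2 ⟨h.2.1 0, h.1⟩, fun j => h.2.1 j.succ, h.2.2.1,
        h.2.2.2⟩
    · obtain ⟨K, P, Q, R⟩ := x
      simp only [termAb, RingHom.id_apply, Finset.mul_sum]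
      exact Finset.sum_congr rfl fun i _ => by ring

theorem tameOp_termac : TameOp m (RingHom.id ℂ) id (termac (r := r) m) := by
  refine TameOp.of_isSumTerm (Or.inl rfl) fun n w l s => ?_
  cases l with
  | zero => exact isSumTerm_zero
  | succ l =>
    refine ⟨Fin (l + 1), inferInstance, n, w, l, s + 1, fun i x =>
      (x.1, x.2.1, i.removeNth x.2.2.1, Fin.cons (x.2.2.1 i) x.2.2.2),
      fun i x => (Complex.I * (-1 : ℂ) ^ w * (Real.sqrt ((s + 1 : ℝ) / (l + 1 : ℝ)) : ℂ) *
        (-1) ^ (i : ℕ)) * (m (x.2.2.1 i).1 : ℂ), fun i => bddMap_termac m i, fun i => ?_,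
      fun i R => ?_, fun i R x h => ?_, by omega, fun Ψ x => ?_⟩
    · exact Measurable.const_mul ((measurable_mass m).comp (by fun_prop)) _
    · obtain ⟨C, hC⟩ := mass_bound m
      refine ⟨‖Complex.I * (-1 : ℂ) ^ w * (Real.sqrt ((s + 1 : ℝ) / (l + 1 : ℝ)) : ℂ) *
        (-1) ^ (i : ℕ)‖ * C, fun x h => ?_⟩
      rw [norm_mul]
      exact mul_le_mul_of_nonneg_left (hC _) (norm_nonneg _)
    · exact ⟨h.1, h.2.1, (Fin.forall_iff_succAbove i).2 ⟨h.2.2.2 0, h.2.2.1⟩,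
        fun j => h.2.2.2 j.succ⟩
    · obtain ⟨K, P, Q, R⟩ := x
      simp only [termac, RingHom.id_apply, Finset.mul_sum]
      exact Finset.sum_congr rfl fun i _ => by ring

theorem tameOp_termab : TameOp m (RingHom.id ℂ) id (termab (r := r) m) := by
  refine TameOp.of_isSumTerm (Or.inl rfl) fun n w l s => ?_
  cases s with
  | zero => exact isSumTerm_zero
  | succ s =>
    refine ⟨Fin (s + 1), inferInstance, n, w + 1, l, s, fun i x =>
      (x.1, Fin.cons (x.2.2.2 i) x.2.1, x.2.2.1, i.removeNth x.2.2.2),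
      fun i x => (-Complex.I * (Real.sqrt ((w + 1 : ℝ) / (s + 1 : ℝ)) : ℂ)) *
        (m (x.2.2.2 i).1 : ℂ), fun i => bddMap_termab m i, fun i => ?_,
      fun i R => ?_, fun i R x h => ?_, by omega, fun Ψ x => ?_⟩
    · exact Measurable.const_mul ((measurable_mass m).comp (by fun_prop)) _
    · obtain ⟨C, hC⟩ := mass_bound m
      refine ⟨‖-Complex.I * (Real.sqrt ((w + 1 : ℝ) / (s + 1 : ℝ)) : ℂ)‖ * C, fun x h => ?_⟩
      rw [norm_mul]
      exact mul_le_mul_of_nonneg_left (hC _) (norm_nonneg _)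
    · exact ⟨h.1, fun j => h.2.1 j.succ, h.2.2.1, (Fin.forall_iff_succAbove i).2 ⟨h.2.1 0,
        h.2.2.2⟩⟩
    · obtain ⟨K, P, Q, R⟩ := x
      simp only [termab, RingHom.id_apply, Finset.mul_sum]
      exact Finset.sum_congr rfl fun i _ => by ring

theorem tameOp_superchargeAmp : TameOp m (RingHom.id ℂ) id (superchargeAmp m) :=
  (((tameOp_termAc m).sum (tameOp_termAb m)).sum (tameOp_termac m)).sum (tameOp_termab m)

theorem ampOp_superchargeAmp : AmpOp m (RingHom.id ℂ) (superchargeAmp m) :=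
  (tameOp_superchargeAmp m).ampOp (D := der Letter.eps (chargeKernel m)) fun _ hF =>
    ⟨hF.der_odd (isOdd_chargeKernel m), superchargeAmp_wordAmp m hF⟩

theorem exists_supercharge : ∃ Q : core m →ₗ[ℂ] core m, IsSupercharge m Q :=
  (ampOp_superchargeAmp m).exists_operator

variable {m}

/-- From here on Q is handled only through its superderivation, and products of operators become
products of superderivations on representatives. -/
theorem IsSupercharge.represents {Q : core m →ₗ[ℂ] core m} (hQ : IsSupercharge m Q) {F : WordFn r}
    {Φ : core m} (hF : Represents F Φ) :
    Represents (der Letter.eps (chargeKernel m) F) (Q Φ) := by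
  refine ⟨hF.1.der_odd (isOdd_chargeKernel m), ?_⟩
  rw [← superchargeAmp_wordAmp m hF.1]
  exact AmpEq.trans (fun n w l s => hQ Φ n w l s) ((ampOp_superchargeAmp m).congr _ _ hF.2)

end Supercharge

/-! ## The contracting homotopy -/

section Homotopy

variable {r : ℕ} {m : Fin r → ℝ}

open Finsupp (linearCombination single)

theorem gamma_block {σ : ℂ →+* ℂ} {u : OneKernel r} {α : Type} {ℓ ℓ' : α → Letter r} {c : α → ℂ}
    (h : ∀ x, u (ℓ x) = single (ℓ' x) (c x)) {n : ℕ} (K : Fin n → α) (t : List (Letter r))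
    (F : WordFn r) : gamma σ u F (List.ofFn (ℓ ∘ K) ++ t) =
      (∏ i, c (K i)) * gamma σ u (fun v => F (List.ofFn (ℓ' ∘ K) ++ v)) t := by
  induction n generalizing F with
  | zero => simp
  | succ n ih =>
    have h1 : ∀ ℓ : α → Letter r, List.ofFn (ℓ ∘ K) = ℓ (K 0) :: List.ofFn (ℓ ∘ Fin.tail K) :=
      fun ℓ => by rw [List.ofFn_succ]; rfl
    rw [h1, h1, List.cons_append, gamma_cons, h, Finsupp.linearCombination_single, ih,
      Fin.prod_univ_succ, smul_eq_mul, ← mul_assoc]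
    rfl

/-- Each of the w letters c passes each of the l letters b, at a sign -1 for every pair. -/
theorem SuperSym.swap_blocks {F : WordFn r} (hF : SuperSym F) {w l : ℕ} (P : Fin w → Scal r)
    (Q : Fin l → Scal r) (t : List (Letter r)) :
    F (List.ofFn (Letter.c ∘ P) ++ (List.ofFn (Letter.b ∘ Q) ++ t)) =
      (-1) ^ (w * l) * F (List.ofFn (Letter.b ∘ Q) ++ (List.ofFn (Letter.c ∘ P) ++ t)) := by
  induction w generalizing F with
  | zero => simp
  | succ w ih =>
    have h1 : List.ofFn (Letter.c ∘ P) = Letter.c (P 0) :: List.ofFn (Letter.c ∘ Fin.tail P) := by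
      rw [List.ofFn_succ]; rfl
    have h2 := ih (hF.fix (.c (P 0))) (Fin.tail P)
    have h3 := hF.move (z := .c (P 0)) (ℓ := Letter.b) (s := -1) (fun _ => rfl) Q
      (List.ofFn (Letter.c ∘ Fin.tail P) ++ t)
    rw [headFix_apply, headFix_apply] at h2
    rw [h1, List.cons_append, h2, h3, List.cons_append]
    ring

variable (m)

/-- The one-particle kernel of the involution exchanging the ghosts `b` and `c`. -/
def flipKernel : OneKernel r
  | .A z => single (.A z) 1
  | .b y => single (.c y) (((m y.1 ^ 2)⁻¹ : ℝ) : ℂ)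
  | .c y => single (.b y) ((m y.1 ^ 2 : ℝ) : ℂ)
  | .a y => single (.a y) (-1)

/-- The involution exchanging the ghosts `b` and `c`, on amplitudes. -/
def flipAmp (Ψ : Amp r) : Amp r := fun n w l s x =>
  ((-1) ^ (w * l) * (-1) ^ s * (∏ i, (((m (x.2.1 i).1 ^ 2)⁻¹ : ℝ) : ℂ)) *
    ∏ i, ((m (x.2.2.1 i).1 ^ 2 : ℝ) : ℂ)) * Ψ n l w s (x.1, x.2.2.1, x.2.1, x.2.2.2)

/-- The kernel turns the block of b into c and vice versa, so the image word is not sorted.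
Restoring the order produces the factor (-1)^(wl), while (-1)^s comes from a ↦ -a. -/
theorem flipAmp_wordAmp {F : WordFn r} (hF : SuperSym F) :
    flipAmp m (wordAmp F) = wordAmp (gamma (RingHom.id ℂ) (flipKernel m) F) := by
  funext n w l s ⟨K, P, Q, R⟩
  have h : ampNorm n l w s = ampNorm n w l s := by
    unfold ampNorm
    ring_nf
  have h4 := gamma_block (σ := RingHom.id ℂ) (u := flipKernel m) (ℓ := Letter.a) (ℓ' := Letter.a)
    (c := fun _ => -1) (fun _ => rfl) R []
  simp only [List.append_nil] at h4
  simp only [flipAmp, wordAmp, Config.word, h]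
  rw [gamma_block (ℓ' := Letter.A) (c := fun _ => 1) (fun _ => rfl),
    gamma_block (ℓ' := Letter.c) (c := fun y => (((m y.1 ^ 2)⁻¹ : ℝ) : ℂ)) (fun _ => rfl),
    gamma_block (ℓ' := Letter.b) (c := fun y => ((m y.1 ^ 2 : ℝ) : ℂ)) (fun _ => rfl),
    h4, gamma_nil, (hF.appendLeft _).swap_blocks]
  simp only [Finset.prod_const_one, Finset.prod_const, Finset.card_univ, Fintype.card_fin,
    RingHom.id_apply, List.append_nil]
  ring

theorem isEven_flipKernel : IsEven (flipKernel m) := by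
  intro x y hy
  cases x <;>
  · have := Finsupp.support_single_subset hy
    rw [Finset.mem_singleton] at this
    subst this; rfl

/-- The one-particle kernel of the supercharge conjugated with the involution. -/
def homotopyKernel : OneKernel r
  | .A z => single (.c z.2) (-((eta z.1 * z.2.2 z.1 * (m z.2.1 ^ 2)⁻¹ : ℝ) : ℂ))
  | .b y => ∑ ν : Fin 4, single (.A (ν, y)) ((y.2 ν * (m y.1 ^ 2)⁻¹ : ℝ) : ℂ) +
      single (.a y) (-(Complex.I * ((m y.1)⁻¹ : ℝ)))
  | .c _ => 0
  | .a y => single (.c y) (Complex.I * ((m y.1)⁻¹ : ℝ))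

theorem isOdd_homotopyKernel : IsOdd (homotopyKernel m) := by
  classical
  intro x y hy
  cases x with
  | A z =>
    have := Finsupp.support_single_subset hy
    rw [Finset.mem_singleton] at this
    subst this; simp [Letter.eps]
  | c y => simp [homotopyKernel] at hy
  | b y =>
    rcases Finset.mem_union.1 (Finsupp.support_add hy) with h | h
    · obtain ⟨ν, -, h⟩ := Finset.mem_biUnion.1 (Finsupp.support_finsetSum h)
      have := Finsupp.support_single_subset h
      rw [Finset.mem_singleton] at this
      subst this; simp [Letter.eps]
    · have := Finsupp.support_single_subset h
      rw [Finset.mem_singleton] at this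
      subst this; simp [Letter.eps]
  | a y =>
    have := Finsupp.support_single_subset hy
    rw [Finset.mem_singleton] at this
    subst this; simp [Letter.eps]

/-- The kernel of the projection onto the unphysical one-particle states. -/
def unphysKernel : OneKernel r
  | .A z => ∑ ν : Fin 4,
      single (.A (ν, z.2)) ((eta z.1 * z.2.2 z.1 * (m z.2.1 ^ 2)⁻¹ * z.2.2 ν : ℝ) : ℂ)
  | x => single x 1

theorem isEven_unphysKernel : IsEven (unphysKernel m) := by
  classical
  intro x y hy
  cases x with
  | A z =>
    obtain ⟨ν, -, h⟩ := Finset.mem_biUnion.1 (Finsupp.support_finsetSum hy)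
    have := Finsupp.support_single_subset h
    rw [Finset.mem_singleton] at this
    subst this; rfl
  | _ =>
    have := Finsupp.support_single_subset hy
    rw [Finset.mem_singleton] at this
    subst this; rfl

variable {m}

/-- Only c survives two applications. The route through A gives -p·p and the route through a gives
(i m)(-i m) = m², so the scalar ghost cancels the mass term exactly on shell. The sum is doubled to
match the anticommutator of the kernel with itself. -/
theorem compKernel_chargeKernel {x : Letter r} (hx : x.OnShell m) :
    compKernel (chargeKernel m) (chargeKernel m) x +
      compKernel (chargeKernel m) (chargeKernel m) x = 0 := by
  cases x with
  | A z => simp only [compKernel, chargeKernel, Finsupp.linearCombination_single, smul_zero, add_zero]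
  | b y => simp only [compKernel, chargeKernel, map_zero, add_zero]
  | a y => simp only [compKernel, chargeKernel, Finsupp.linearCombination_single, smul_zero, add_zero]
  | c y =>
    have h : ∑ ν, y.2 ν * (eta ν * y.2 ν) = m y.1 ^ 2 := by
      rw [← hx.1]
      exact Finset.sum_congr rfl fun ν _ => by ring
    simp only [compKernel, chargeKernel, map_add, map_sum, Finsupp.linearCombination_single,
      Finsupp.smul_single, smul_eq_mul]
    rw [← Finsupp.single_finsetSum, ← Finsupp.single_add, ← Finsupp.single_add]
    have h2 : ∑ ν, (y.2 ν : ℂ) * -((eta ν * y.2 ν : ℝ) : ℂ) = -((m y.1 ^ 2 : ℝ) : ℂ) := by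
      rw [← h]
      push_cast
      rw [← Finset.sum_neg_distrib]
      exact Finset.sum_congr rfl fun ν _ => by ring
    rw [h2]
    have h3 : (-((m y.1 ^ 2 : ℝ) : ℂ)) + Complex.I * (m y.1 : ℂ) * -(Complex.I * (m y.1 : ℂ)) = 0 := by
      push_cast
      linear_combination (-(m y.1 : ℂ) ^ 2) * Complex.I_sq
    rw [h3, add_zero, Finsupp.single_zero]

theorem der_zero_kernel (F : WordFn r) : ∀ w : List (Letter r), der 1 (0 : OneKernel r) F w = 0
  | [] => rfl
  | x :: t => by
    rw [der_cons, der_zero_kernel, headOp_apply_apply]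
    simp

theorem der_charge_sq (F : WordFn r) :
    ShellEq m (der Letter.eps (chargeKernel m) (der Letter.eps (chargeKernel m) F)) 0 := by
  intro w hw
  have h := der_anticomm (ρ := 0) (isOdd_chargeKernel m) (isOdd_chargeKernel m)
    (fun x hx => compKernel_chargeKernel hx) w hw F
  rw [der_zero_kernel] at h
  rw [Pi.zero_apply]
  linear_combination h / 2

/-- The rescalings m² and m⁻² of the two ghosts are mutually inverse; the positivity of the masses
enters here. -/
theorem flip_flip (hm : ∀ a, 0 < m a) (F : WordFn r) :
    gamma (RingHom.id ℂ) (flipKernel m) (gamma (RingHom.id ℂ) (flipKernel m) F) = F := by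
  refine funext (gamma_gamma F fun x => ?_)
  have h : ∀ a, (m a : ℂ) ≠ 0 := fun a => by exact_mod_cast (hm a).ne'
  cases x with
  | A z => simp [flipKernel]
  | b y => simp [flipKernel, h]
  | c y => simp [flipKernel, h]
  | a y => simp [flipKernel]

/-- Together with the involution property this shows that GQG is the superderivation of
`homotopyKernel`, which is the kernel of Q conjugated with the exchange of b and c. -/
theorem flip_der (hm : ∀ a, 0 < m a) (F : WordFn r) :
    ShellEq m (gamma (RingHom.id ℂ) (flipKernel m) (der Letter.eps (chargeKernel m) F))
      (der Letter.eps (homotopyKernel m) (gamma (RingHom.id ℂ) (flipKernel m) F)) := by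
  intro w hw
  refine gamma_der (isEven_flipKernel m) (fun x _ => ?_) w hw F
  have h : ∀ a, (m a : ℂ) ≠ 0 := fun a => by exact_mod_cast (hm a).ne'
  have hid : ∀ f : Letter r →₀ ℂ, f.mapRange (RingHom.id ℂ) (map_zero _) = f := fun f => by
    ext; simp
  simp only [hid]
  cases x with
  | A z =>
    simp only [flipKernel, homotopyKernel, chargeKernel, Finsupp.linearCombination_single,
      Finsupp.smul_single, smul_eq_mul]
    congr 1
    push_cast
    field_simp [h z.2.1]
  | b y =>
    simp only [flipKernel, homotopyKernel, chargeKernel, Finsupp.linearCombination_single,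
      Finsupp.smul_single, smul_eq_mul, map_add, map_sum, smul_add, Finset.smul_sum]
    congr 1
    · refine Finset.sum_congr rfl fun ν _ => ?_
      congr 1
      push_cast
      ring
    · congr 1
      push_cast
      field_simp [h y.1]
  | c y => simp [flipKernel, homotopyKernel, chargeKernel]
  | a y =>
    simp only [flipKernel, homotopyKernel, chargeKernel, Finsupp.linearCombination_single,
      Finsupp.smul_single, smul_eq_mul]
    congr 1
    push_cast
    field_simp [h y.1]

theorem sum_mink_mass {y : Scal r} (hy : y.2 ∈ shell (m y.1)) :
    ∑ ν, (y.2 ν : ℂ) * ((eta ν : ℂ) * (y.2 ν : ℂ)) = (m y.1 : ℂ) ^ 2 := by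
  have h : ∑ ν, y.2 ν * (eta ν * y.2 ν) = m y.1 ^ 2 := by
    rw [← hy.1]
    exact Finset.sum_congr rfl fun ν _ => by ring
  exact_mod_cast h

/-- On b and on c, the routes through A and through a contribute -1 each, by p·p = m² and i² = -1.
On A the two orders of composition agree in the longitudinal part and cancel in the component along
a. On a they agree in the scalar part and cancel in the vector part. The weights m^{±2} and the sign
of a in the ghost exchange are chosen to achieve this. -/
theorem compKernel_homotopy (hm : ∀ a, 0 < m a) {x : Letter r} (hx : x.OnShell m) :
    compKernel (chargeKernel m) (homotopyKernel m) x +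
      compKernel (homotopyKernel m) (chargeKernel m) x = (-2 : ℂ) • unphysKernel m x := by
  have h : ∀ a, (m a : ℂ) ≠ 0 := fun a => by exact_mod_cast (hm a).ne'
  have hI := Complex.I_sq
  cases x with
  | A z =>
    simp only [compKernel, chargeKernel, homotopyKernel, unphysKernel,
      Finsupp.linearCombination_single, Finsupp.smul_single, smul_eq_mul, smul_add,
      Finset.smul_sum, map_add, map_sum]
    rw [add_add_add_comm, ← Finset.sum_add_distrib, ← Finsupp.single_add]
    have e1 : -((eta z.1 * z.2.2 z.1 : ℝ) : ℂ) * -(Complex.I * ((m z.2.1)⁻¹ : ℝ)) +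
        -((eta z.1 * z.2.2 z.1 * (m z.2.1 ^ 2)⁻¹ : ℝ) : ℂ) * (Complex.I * (m z.2.1 : ℂ)) = 0 := by
      push_cast
      field_simp [h z.2.1]
      ring
    rw [e1, Finsupp.single_zero, add_zero]
    refine Finset.sum_congr rfl fun ν _ => ?_
    rw [← Finsupp.single_add]
    congr 1
    push_cast
    ring
  | b y =>
    simp only [compKernel, chargeKernel, homotopyKernel, unphysKernel,
      Finsupp.linearCombination_single, Finsupp.smul_single, smul_eq_mul, map_add, map_sum,
      map_zero, zero_add]
    rw [← Finsupp.single_finsetSum, ← Finsupp.single_add]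
    congr 1
    have h1 := sum_mink_mass hx
    have h2 : ∑ ν, ((y.2 ν * (m y.1 ^ 2)⁻¹ : ℝ) : ℂ) * -((eta ν * y.2 ν : ℝ) : ℂ) =
        -((m y.1 : ℂ) ^ 2)⁻¹ * ∑ ν, (y.2 ν : ℂ) * ((eta ν : ℂ) * (y.2 ν : ℂ)) := by
      rw [Finset.mul_sum]
      exact Finset.sum_congr rfl fun ν _ => by push_cast; ring
    rw [h2, h1]
    push_cast
    have := h y.1
    field_simp
    rw [hI]
    ring
  | c y =>
    simp only [compKernel, chargeKernel, homotopyKernel, unphysKernel,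
      Finsupp.linearCombination_single, Finsupp.smul_single, smul_eq_mul, map_add, map_sum,
      map_zero, add_zero]
    rw [← Finsupp.single_finsetSum, ← Finsupp.single_add]
    congr 1
    have h1 := sum_mink_mass hx
    have h2 : ∑ ν, (y.2 ν : ℂ) * -((eta ν * y.2 ν * (m y.1 ^ 2)⁻¹ : ℝ) : ℂ) =
        -((m y.1 : ℂ) ^ 2)⁻¹ * ∑ ν, (y.2 ν : ℂ) * ((eta ν : ℂ) * (y.2 ν : ℂ)) := by
      rw [Finset.mul_sum]
      exact Finset.sum_congr rfl fun ν _ => by push_cast; ring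
    rw [h2, h1]
    push_cast
    have := h y.1
    field_simp
    rw [hI]
    ring
  | a y =>
    simp only [compKernel, chargeKernel, homotopyKernel, unphysKernel,
      Finsupp.linearCombination_single, Finsupp.smul_single, smul_eq_mul, smul_add,
      Finset.smul_sum, map_add, map_sum]
    rw [add_add_add_comm, ← Finset.sum_add_distrib, ← Finsupp.single_add]
    have e1 : ∀ ν, (single (Letter.A (ν, y)) (-(Complex.I * (m y.1 : ℂ)) *
        ((y.2 ν * (m y.1 ^ 2)⁻¹ : ℝ) : ℂ)) : Letter r →₀ ℂ) +
        single (Letter.A (ν, y)) (Complex.I * ((m y.1)⁻¹ : ℝ) * (y.2 ν : ℂ)) = 0 := by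
      intro ν
      rw [← Finsupp.single_add, Finsupp.single_eq_zero]
      push_cast
      field_simp [h y.1]
      ring
    rw [Finset.sum_eq_zero fun ν _ => e1 ν, zero_add]
    congr 1
    push_cast
    have := h y.1
    field_simp
    rw [hI]
    ring

/-- For vector letters, squaring p_μ p^ν/m² produces a contraction p·p, which equals m² on shell. -/
theorem compKernel_unphys (hm : ∀ a, 0 < m a) {x : Letter r} (hx : x.OnShell m) :
    compKernel (unphysKernel m) (unphysKernel m) x = unphysKernel m x := by
  have h : ∀ a, (m a : ℂ) ≠ 0 := fun a => by exact_mod_cast (hm a).ne'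
  cases x with
  | A z =>
    simp only [compKernel, unphysKernel, map_sum, Finsupp.linearCombination_single,
      Finset.smul_sum, Finsupp.smul_single, smul_eq_mul]
    rw [Finset.sum_comm]
    refine Finset.sum_congr rfl fun ν _ => ?_
    rw [← Finsupp.single_finsetSum]
    congr 1
    have h1 := sum_mink_mass (y := z.2) hx
    have h2 : ∑ i, ((eta z.1 * z.2.2 z.1 * (m z.2.1 ^ 2)⁻¹ * z.2.2 i : ℝ) : ℂ) *
        ((eta i * z.2.2 i * (m z.2.1 ^ 2)⁻¹ * z.2.2 ν : ℝ) : ℂ) =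
        (eta z.1 * z.2.2 z.1 * ((m z.2.1 : ℂ) ^ 2)⁻¹ * ((m z.2.1 : ℂ) ^ 2)⁻¹ * z.2.2 ν : ℂ) *
          ∑ i, (z.2.2 i : ℂ) * ((eta i : ℂ) * (z.2.2 i : ℂ)) := by
      rw [Finset.mul_sum]
      exact Finset.sum_congr rfl fun ν _ => by push_cast; ring
    rw [h2, h1]
    push_cast
    field_simp [h z.2.1]
  | _ => simp [compKernel, unphysKernel]

theorem der_smul_kernel (c : ℂ) (κ : OneKernel r) (F : WordFn r) :
    ∀ w : List (Letter r), der 1 (fun x => c • κ x) F w = c * der 1 κ F w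
  | [] => by simp
  | x :: t => by
    rw [der_cons, der_cons, der_smul_kernel c κ, headOp_apply_apply, headOp_apply_apply, map_smul]
    simp only [smul_eq_mul, Pi.one_apply]
    ring

theorem der_homotopy (hm : ∀ a, 0 < m a) (F : WordFn r) :
    ShellEq m ((-1 / 2 : ℂ) • (der Letter.eps (chargeKernel m) (der Letter.eps (homotopyKernel m) F) +
      der Letter.eps (homotopyKernel m) (der Letter.eps (chargeKernel m) F)))
      (der 1 (unphysKernel m) F) := by
  intro w hw
  have h := der_anticomm (ρ := fun x => (-2 : ℂ) • unphysKernel m x) (isOdd_chargeKernel m)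
    (isOdd_homotopyKernel m) (fun x hx => compKernel_homotopy hm hx) w hw F
  rw [der_smul_kernel] at h
  simp only [Pi.smul_apply, Pi.add_apply, smul_eq_mul]
  rw [h]
  ring

end Homotopy

/-! ## Contraction of the complex onto the physical states -/

section Contraction

variable {r : ℕ} (m : Fin r → ℝ)

theorem measurable_species_prod {α : Type*} [MeasurableSpace α] {n : ℕ} (h : Fin r → ℂ)
    {P : α → Fin n → Scal r} (hP : Measurable P) : Measurable fun x => ∏ i, h (P x i).1 := by
  refine Finset.measurable_fun_prod _ fun i _ => ?_
  exact (measurable_from_top (f := h)).comp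
    (measurable_fst.comp ((measurable_pi_apply i).comp hP))

/-- There are finitely many species, hence finitely many values of such a product; their sum in norm
serves as a bound. -/
theorem species_prod_bound (h : Fin r → ℂ) (n : ℕ) :
    ∃ C : ℝ, 0 ≤ C ∧ ∀ P : Fin n → Scal r, ‖∏ i, h (P i).1‖ ≤ C :=
  ⟨∑ a : Fin n → Fin r, ‖∏ i, h (a i)‖, Finset.sum_nonneg fun _ _ => norm_nonneg _,
    fun P => Finset.single_le_sum (f := fun a : Fin n → Fin r => ‖∏ i, h (a i)‖)
      (fun _ _ => norm_nonneg _) (Finset.mem_univ fun i => (P i).1)⟩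

theorem bddMap_swapGhosts (n w l s : ℕ) :
    BddMap (fun x : Config r n w l s => ((x.1, x.2.2.1, x.2.1, x.2.2.2) : Config r n l w s))
      (configMeasure m n w l s) (configMeasure m n l w s) := by
  unfold configMeasure
  exact (BddMap.id (μ := Measure.pi fun _ : Fin n => vecMeasure m)).prodMap
    (measurePreserving_leftComm (Measure.pi fun _ : Fin w => scalMeasure m)
      (Measure.pi fun _ : Fin l => scalMeasure m)
      (Measure.pi fun _ : Fin s => scalMeasure m)).bddMap

theorem tameOp_flipAmp : TameOp m (RingHom.id ℂ) id (flipAmp m) := by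
  refine TameOp.of_isSumTerm (Or.inl rfl) fun n w l s => ?_
  refine ⟨Unit, inferInstance, n, l, w, s, fun _ x => (x.1, x.2.2.1, x.2.1, x.2.2.2),
    fun _ x => ((-1) ^ (w * l) * (-1) ^ s * (∏ i, (((m (x.2.1 i).1 ^ 2)⁻¹ : ℝ) : ℂ)) *
      ∏ i, ((m (x.2.2.1 i).1 ^ 2 : ℝ) : ℂ)), fun _ => bddMap_swapGhosts m n w l s, fun _ => ?_,
    fun _ R => ?_, fun _ R x h => ⟨h.1, h.2.2.1, h.2.1, h.2.2.2⟩, by omega, fun Ψ x => ?_⟩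
  · exact (Measurable.const_mul (measurable_species_prod
      (fun a => (((m a ^ 2)⁻¹ : ℝ) : ℂ)) (measurable_fst.comp measurable_snd)) _).mul
      (measurable_species_prod (fun a => ((m a ^ 2 : ℝ) : ℂ))
        (measurable_fst.comp (measurable_snd.comp measurable_snd)))
  · obtain ⟨C, hC0, hC⟩ := species_prod_bound (fun a => (((m a ^ 2)⁻¹ : ℝ) : ℂ)) w
    obtain ⟨D, hD0, hD⟩ := species_prod_bound (fun a => ((m a ^ 2 : ℝ) : ℂ)) l
    refine ⟨C * D, fun x _ => ?_⟩
    have h1 : ‖((-1 : ℂ) ^ (w * l) * (-1) ^ s)‖ = 1 := by simp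
    rw [norm_mul, norm_mul, h1, one_mul]
    exact mul_le_mul (hC _) (hD _) (norm_nonneg _) hC0
  · simp [flipAmp]

theorem ampOp_flipAmp : AmpOp m (RingHom.id ℂ) (flipAmp m) :=
  (tameOp_flipAmp m).ampOp (D := gamma (RingHom.id ℂ) (flipKernel m)) fun _ hF =>
    ⟨hF.gamma (isEven_flipKernel m), flipAmp_wordAmp m hF⟩

variable {m}

/-- `G` is the involution exchanging the ghosts `b` and `c`. -/
def IsFlip (m : Fin r → ℝ) (G : core m →ₗ[ℂ] core m) : Prop :=
  ∀ Φ : core m, AmpEq m (amp (G Φ : GhostSpace m)) (flipAmp m (amp (Φ : GhostSpace m)))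

theorem exists_flip : ∃ G : core m →ₗ[ℂ] core m, IsFlip m G := (ampOp_flipAmp m).exists_operator

theorem IsFlip.represents {G : core m →ₗ[ℂ] core m} (hG : IsFlip m G) {F : WordFn r} {Φ : core m}
    (hF : Represents F Φ) : Represents (gamma (RingHom.id ℂ) (flipKernel m) F) (G Φ) := by
  refine ⟨hF.1.gamma (isEven_flipKernel m), ?_⟩
  rw [← flipAmp_wordAmp m hF.1]
  exact (hG Φ).trans ((ampOp_flipAmp m).congr _ _ hF.2)

variable {Q G : core m →ₗ[ℂ] core m}

theorem IsSupercharge.sq_eq_zero (hQ : IsSupercharge m Q) (Φ : core m) : Q (Q Φ) = 0 := by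
  obtain ⟨-, F, hF, -⟩ := exists_represents Φ
  refine (hQ.represents (hQ.represents hF)).eq_of_shellEq (G := 0)
    ⟨SuperSym.zero, ?_⟩ (der_charge_sq F)
  intro n w l s
  filter_upwards [amp_zero m n w l s] with x hx
  rw [Submodule.coe_zero, hx]
  simp [wordAmp]

theorem Represents.homotopy (hm : ∀ a, 0 < m a) (hQ : IsSupercharge m Q) (hG : IsFlip m G)
    {F : WordFn r} {Φ : core m} (hF : Represents F Φ) :
    Represents (der Letter.eps (homotopyKernel m) F) (G (Q (G Φ))) := by
  have h := flip_der hm (gamma (RingHom.id ℂ) (flipKernel m) F)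
  rw [flip_flip hm] at h
  exact (hG.represents (hQ.represents (hG.represents hF))).of_shellEq h
    (hF.1.der_odd (isOdd_homotopyKernel m))

/-- The number operator of unphysical particles. -/
def unphysNumber (Q G : core m →ₗ[ℂ] core m) : core m →ₗ[ℂ] core m :=
  (-1 / 2 : ℂ) • (Q ∘ₗ (G ∘ₗ Q ∘ₗ G) + (G ∘ₗ Q ∘ₗ G) ∘ₗ Q)

theorem unphysNumber_apply (Φ : core m) : unphysNumber Q G Φ =
    (-1 / 2 : ℂ) • (Q (G (Q (G Φ))) + G (Q (G (Q Φ)))) := rfl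

theorem Represents.number (hm : ∀ a, 0 < m a) (hQ : IsSupercharge m Q) (hG : IsFlip m G)
    {F : WordFn r} {Φ : core m} (hF : Represents F Φ) :
    Represents (der 1 (unphysKernel m) F) (unphysNumber Q G Φ) := by
  rw [unphysNumber_apply]
  exact (((hQ.represents (hF.homotopy hm hQ hG)).add
    ((hQ.represents hF).homotopy hm hQ hG)).smul (-1 / 2)).of_shellEq (der_homotopy hm F)
    (hF.1.der_even (isEven_unphysKernel m))

theorem fallingOp_sub_id_succ {M : Type*} [AddCommGroup M] [Module ℂ M] (T : M →ₗ[ℂ] M) (n : ℕ)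
    (v : M) : fallingOp (T - LinearMap.id) (n + 1) v = T (fallingOp (T - LinearMap.id) n v) +
      (-((n + 1 : ℕ) : ℂ)) • fallingOp (T - LinearMap.id) n v := by
  rw [fallingOp_succ_apply, LinearMap.sub_apply, LinearMap.id_apply]
  push_cast
  module

/-- `(N - n) ⋯ (N - 2) (N - 1) v`. -/
def fallingVec {M : Type*} [AddCommMonoid M] [Module ℂ M] (N : M →ₗ[ℂ] M) (v : M) : ℕ → M
  | 0 => v
  | n + 1 => N (fallingVec N v n) + (-((n + 1 : ℕ) : ℂ)) • fallingVec N v n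

/-- On the kernel of N the product acts as the scalar (-1)^n n!. -/
theorem exists_fallingVec_eq_smul {M : Type*} [AddCommMonoid M] [Module ℂ M] {N : M →ₗ[ℂ] M} {v : M}
    (h : N v = 0) (n : ℕ) : ∃ c : ℂ, c ≠ 0 ∧ fallingVec N v n = c • v := by
  induction n with
  | zero => exact ⟨1, one_ne_zero, (one_smul _ _).symm⟩
  | succ n ih =>
    obtain ⟨c, hc, h1⟩ := ih
    refine ⟨-((n + 1 : ℕ) : ℂ) * c, mul_ne_zero (neg_ne_zero.2 (Nat.cast_ne_zero.2
      n.succ_ne_zero)) hc, ?_⟩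
    rw [fallingVec, h1, map_smul, h, smul_zero, zero_add, mul_smul]

theorem exists_eq_smul_fallingVec {M : Type*} [AddCommMonoid M] [Module ℂ M] {N : M →ₗ[ℂ] M} {v : M}
    (h : N v = 0) (n : ℕ) : ∃ c : ℂ, v = c • fallingVec N v n := by
  obtain ⟨c, hc, h1⟩ := exists_fallingVec_eq_smul h n
  exact ⟨c⁻¹, by rw [h1, inv_smul_smul₀ hc]⟩

/-- On a cocycle one half of the anticommutator vanishes, so N produces the coboundary -½ QHv. Every
factor N - j therefore multiplies v by -j modulo the image of Q, and the accumulated scalar (-1)^n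
n! is not zero. -/
theorem exists_fallingVec_eq_add {M : Type*} [AddCommMonoid M] [Module ℂ M] {N Q H : M →ₗ[ℂ] M}
    (hN : ∀ v, N v = (-1 / 2 : ℂ) • (Q (H v) + H (Q v))) (hQ : ∀ v, Q (Q v) = 0) {v : M}
    (h : Q v = 0) (n : ℕ) : ∃ c : ℂ, c ≠ 0 ∧ ∃ u, fallingVec N v n = c • v + Q u := by
  induction n with
  | zero => exact ⟨1, one_ne_zero, 0, by rw [map_zero, add_zero, one_smul]; rfl⟩
  | succ n ih =>
    obtain ⟨c, hc, u, h1⟩ := ih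
    refine ⟨-((n + 1 : ℕ) : ℂ) * c, mul_ne_zero (neg_ne_zero.2 (Nat.cast_ne_zero.2
      n.succ_ne_zero)) hc, (-1 / 2 : ℂ) • H (c • v + Q u) + (-((n + 1 : ℕ) : ℂ)) • u, ?_⟩
    rw [fallingVec, h1, hN]
    simp only [map_add Q, map_smul Q, h, hQ, map_zero, smul_zero, add_zero, smul_add, mul_smul]
    abel

theorem exists_eq_smul_fallingVec_add {M : Type*} [AddCommMonoid M] [Module ℂ M]
    {N Q H : M →ₗ[ℂ] M} (hN : ∀ v, N v = (-1 / 2 : ℂ) • (Q (H v) + H (Q v)))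
    (hQ : ∀ v, Q (Q v) = 0) {v : M} (h : Q v = 0) (n : ℕ) :
    ∃ (c : ℂ) (u : M), v = c • fallingVec N v n + Q u := by
  obtain ⟨c, hc, u, h1⟩ := exists_fallingVec_eq_add hN hQ h n
  refine ⟨c⁻¹, -c⁻¹ • u, ?_⟩
  rw [h1, map_smul, smul_add, inv_smul_smul₀ hc, add_assoc, ← add_smul, add_neg_cancel, zero_smul,
    add_zero]

theorem Represents.falling (hm : ∀ a, 0 < m a) (hQ : IsSupercharge m Q) (hG : IsFlip m G)
    {F : WordFn r} {Φ : core m} (hF : Represents F Φ) (n : ℕ) :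
    Represents (fallingOp (der 1 (unphysKernel m) - LinearMap.id) n F)
      (fallingVec (unphysNumber Q G) Φ n) := by
  induction n with
  | zero => exact hF
  | succ n ih =>
    rw [fallingOp_sub_id_succ]
    exact (ih.number hm hQ hG).add (ih.smul _)

theorem config_word_zero {n : ℕ} (x : Config r n 0 0 0) :
    x.word = List.ofFn (Letter.A ∘ x.1) := by simp [Config.word]

theorem insVec_word {n : ℕ} (ν : Fin 4) (y : Scal r) (x : Config r n 0 0 0) :
    (insVec ν y x).word = Letter.A (ν, y) :: x.word := by
  rw [config_word_zero, config_word_zero, List.ofFn_succ]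
  rfl

theorem ae_prod_and {α β : Type*} [MeasurableSpace α] [MeasurableSpace β]
    {μ : Measure α} {ν : Measure β} [SFinite ν] {p : α → Prop} {q : β → Prop}
    (hp : ∀ᵐ x ∂μ, p x) (hq : ∀ᵐ x ∂ν, q x) : ∀ᵐ z ∂μ.prod ν, p z.1 ∧ q z.2 :=
  (Measure.quasiMeasurePreserving_fst.ae hp).and (Measure.quasiMeasurePreserving_snd.ae hq)

/-- On a ghost letter the unphysical projection is the identity, and supersymmetry moves the first
ghost of a sorted word in front of the vector letters, so all amplitudes with ghosts vanish. On a
vector letter the projection is p_μ times the contraction with the momentum, and so the contraction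
vanishes as soon as some p_μ is non-zero. -/
theorem Represents.mem_physical (hm : ∀ a, 0 < m a) {F : WordFn r} {Φ : core m} (hF : Represents F Φ)
    (h : ∀ x : Letter r, x.OnShell m → ∀ t : List (Letter r), (∀ y ∈ t, y.OnShell m) →
      headOp (unphysKernel m) x F t = 0) : Φ ∈ physical m := by
  have hghost : ∀ (z : Letter r) (t : List (Letter r)), unphysKernel m z = Finsupp.single z 1 →
      z.OnShell m → (∀ y ∈ t, y.OnShell m) → F (z :: t) = 0 := by
    intro z t hz h1 h2
    have h3 := h z h1 t h2
    rw [headOp_apply_apply, hz, Finsupp.linearCombination_single, one_smul] at h3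
    exact h3
  have hzero : ∀ (z : Letter r) {n : ℕ} (K : Fin n → Vec r) (t : List (Letter r)),
      unphysKernel m z = Finsupp.single z 1 → (∀ x, z.swapSign (Letter.A x) = 1) →
      (∀ y ∈ List.ofFn (Letter.A ∘ K) ++ z :: t, y.OnShell m) →
      F (List.ofFn (Letter.A ∘ K) ++ z :: t) = 0 := by
    intro z n K t hz hs hon
    have h1 := hF.1.move hs K t
    rw [one_pow, one_mul] at h1
    rw [← h1]
    refine hghost z _ hz (hon z (by simp)) fun y hy => hon y ?_
    rcases List.mem_append.1 hy with hy | hy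
    · exact List.mem_append_left _ hy
    · exact List.mem_append_right _ (List.mem_cons_of_mem _ hy)
  refine ⟨fun n w l s hne => ?_, fun n => ?_⟩
  · have h0 : amp (Φ : GhostSpace m) n w l s =ᵐ[configMeasure m n w l s] 0 := by
      refine (hF.2 n w l s).trans ?_
      filter_upwards [ae_onShell m n w l s] with x hx
      obtain ⟨K, P, Q, R⟩ := x
      simp only [wordAmp, Config.word] at hx ⊢
      rw [Pi.zero_apply]
      refine mul_eq_zero_of_right _ ?_
      cases w with
      | succ w =>
        rw [show List.ofFn (Letter.b ∘ P) = Letter.b (P 0) :: List.ofFn (Letter.b ∘ Fin.tail P) by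
          rw [List.ofFn_succ]; rfl, List.cons_append] at hx ⊢
        exact hzero _ _ _ rfl (fun _ => rfl) hx
      | zero =>
        rw [List.ofFn_zero, List.nil_append] at hx ⊢
        cases l with
        | succ l =>
          rw [show List.ofFn (Letter.c ∘ Q) = Letter.c (Q 0) :: List.ofFn (Letter.c ∘ Fin.tail Q) by
            rw [List.ofFn_succ]; rfl, List.cons_append] at hx ⊢
          exact hzero _ _ _ rfl (fun _ => rfl) hx
        | zero =>
          rw [List.ofFn_zero, List.nil_append] at hx ⊢
          cases s with
          | succ s =>
            rw [show List.ofFn (Letter.a ∘ R) = Letter.a (R 0) :: List.ofFn (Letter.a ∘ Fin.tail R)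
              by rw [List.ofFn_succ]; rfl] at hx ⊢
            exact hzero _ _ _ rfl (fun _ => rfl) hx
          | zero => exact absurd rfl hne
    exact Subtype.ext (Lp.ext (h0.trans (Lp.coeFn_zero ℂ 2 _).symm))
  · have h1 := fun ν => (quasiMeasurePreserving_insVec m n 0 0 0 ν).ae (hF.2 (n + 1) 0 0 0)
    filter_upwards [ae_all_iff.2 h1, ae_prod_and (ae_mem_shell_scal m)
      (ae_onShell m n 0 0 0)] with z hz ⟨h2, h3⟩
    simp only [hz, wordAmp, insVec_word]
    -- The time component is taken because p⁰ > 0 on the upper shell.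
    have h4 := h (.A (0, z.1)) h2 z.2.word h3
    rw [headOp_apply_apply, unphysKernel, map_sum] at h4
    simp only [Finsupp.linearCombination_single, smul_eq_mul] at h4
    have hp : (z.1.2 0 : ℂ) ≠ 0 := by exact_mod_cast h2.2.ne'
    have hq : (m z.1.1 : ℂ) ≠ 0 := by exact_mod_cast (hm z.1.1).ne'
    have h5 : (z.1.2 0 : ℂ) * ((m z.1.1 : ℂ) ^ 2)⁻¹ *
        ∑ ν, (z.1.2 ν : ℂ) * F (.A (ν, z.1) :: z.2.word) = 0 := by
      rw [← h4, Finset.mul_sum]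
      refine Finset.sum_congr rfl fun ν _ => ?_
      rw [eta_values.1]
      push_cast
      ring
    have h6 := (mul_eq_zero.1 h5).resolve_left (mul_ne_zero hp (inv_ne_zero (pow_ne_zero 2 hq)))
    calc _ = (ampNorm (n + 1) 0 0 0 : ℂ) * ∑ ν, (z.1.2 ν : ℂ) * F (.A (ν, z.1) :: z.2.word) := by
          rw [Finset.mul_sum]
          exact Finset.sum_congr rfl fun ν _ => by ring
      _ = 0 := by rw [h6, mul_zero]

/-- The number n of factors is a bound for the length of the words on which the representative is
supported: N has no eigenvalue beyond n there, and the factors N - 1, …, N - n leave only its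
kernel. -/
theorem fallingVec_mem_physical (hm : ∀ a, 0 < m a) (hQ : IsSupercharge m Q) (hG : IsFlip m G)
    (Φ : core m) : ∃ n, fallingVec (unphysNumber Q G) Φ n ∈ physical m := by
  obtain ⟨n, F, hF, hn⟩ := exists_represents Φ
  exact ⟨n, (hF.falling hm hQ hG n).mem_physical hm fun x hx t ht =>
    headOp_fallingOp_eq_zero (fun x hx => compKernel_unphys hm hx) hn hx t ht⟩

theorem bddMap_extract (m : Fin r → ℝ) (n w l s : ℕ) :
    BddMap (fun x : Config r n w (l + 1) s => (x.2.2.1 0,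
      ((x.1, x.2.1, (0 : Fin (l + 1)).removeNth x.2.2.1, x.2.2.2) : Config r n w l s)))
      (configMeasure m n w (l + 1) s) ((scalMeasure m).prod (configMeasure m n w l s)) := by
  unfold configMeasure
  have h1 := (BddMap.id (μ := Measure.pi fun _ : Fin n => vecMeasure m)).prodMap
    ((BddMap.id (μ := Measure.pi fun _ : Fin w => scalMeasure m)).prodMap
    ((BddMap.remove (μ := scalMeasure m) (0 : Fin (l + 1))).prodMap
      (BddMap.id (μ := Measure.pi fun _ : Fin s => scalMeasure m))))
  have h2 := (BddMap.id (μ := Measure.pi fun _ : Fin n => vecMeasure m)).prodMap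
    (((measurePreserving_leftComm (Measure.pi fun _ : Fin w => scalMeasure m) (scalMeasure m)
      ((Measure.pi fun _ : Fin l => scalMeasure m).prod
        (Measure.pi fun _ : Fin s => scalMeasure m))).bddMap).comp
    ((BddMap.id (μ := Measure.pi fun _ : Fin w => scalMeasure m)).prodMap
      (measurePreserving_prodAssoc (scalMeasure m) (Measure.pi fun _ : Fin l => scalMeasure m)
        (Measure.pi fun _ : Fin s => scalMeasure m)).bddMap))
  have h3 := (measurePreserving_leftComm (Measure.pi fun _ : Fin n => vecMeasure m) (scalMeasure m)
      ((Measure.pi fun _ : Fin w => scalMeasure m).prod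
      ((Measure.pi fun _ : Fin l => scalMeasure m).prod
        (Measure.pi fun _ : Fin s => scalMeasure m)))).bddMap
  exact h3.comp (h2.comp h1)

/-- The ghost free part of a family of amplitudes. -/
def ghostFree (Ψ : Amp r) : Amp r
  | n, 0, 0, 0 => Ψ n 0 0 0
  | _, _, _, _ => 0

theorem ghostFree_of_ne (Ψ : Amp r) {n w l s : ℕ} (h : (w, l, s) ≠ (0, 0, 0)) :
    ghostFree Ψ n w l s = 0 := by
  rcases w with _ | w <;> rcases l with _ | l <;> rcases s with _ | s <;>
    first | exact absurd rfl h | rfl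

theorem ampEq_ghostFree {Φ : core m} (h : Φ ∈ physical m) :
    AmpEq m (amp (Φ : GhostSpace m)) (ghostFree (amp (Φ : GhostSpace m))) := by
  intro n w l s
  by_cases h0 : (w, l, s) = (0, 0, 0)
  · simp only [Prod.mk.injEq] at h0
    obtain ⟨rfl, rfl, rfl⟩ := h0
    rfl
  · rw [ghostFree_of_ne _ h0]
    have := h.1 n w l s h0
    unfold amp
    rw [this]
    exact Lp.coeFn_zero ℂ 2 _

theorem core_eq_zero {Φ : core m} (h : AmpEq m (amp (Φ : GhostSpace m)) 0) : Φ = 0 :=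
  core_ext (h.trans fun n w l s => (amp_zero m n w l s).symm)

theorem IsSupercharge.physical_le_ker (hQ : IsSupercharge m Q) {Φ : core m}
    (h : Φ ∈ physical m) : Q Φ = 0 := by
  refine core_eq_zero (AmpEq.trans (fun n w l s => hQ Φ n w l s)
    (((ampOp_superchargeAmp m).congr _ _ (ampEq_ghostFree h)).trans ?_))
  set Ψ := ghostFree (amp (Φ : GhostSpace m)) with hΨ
  intro n w l s
  have h1 : ∀ x, termAb Ψ n w l s x = 0 := by
    intro x
    cases n with
    | zero => rfl
    | succ n =>
      simp [termAb, hΨ, ghostFree_of_ne]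
  have h2 : ∀ x, termac m Ψ n w l s x = 0 := by
    intro x
    cases l with
    | zero => rfl
    | succ n =>
      simp [termac, hΨ, ghostFree_of_ne]
  have h3 : ∀ x, termab m Ψ n w l s x = 0 := by
    intro x
    cases s with
    | zero => rfl
    | succ n =>
      simp [termab, hΨ, ghostFree_of_ne]
  -- The only term reaching a non-zero sector from a ghost-free state contracts its first vector
  -- variable with the momentum of the new c ghost, and this contraction is zero by transversality.
  have h4 : termAc Ψ n w l s =ᵐ[configMeasure m n w l s] 0 := by
    cases l with
    | zero => rfl
    | succ l =>
      by_cases h0 : (w, l, s) = (0, 0, 0)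
      · simp only [Prod.mk.injEq] at h0
        obtain ⟨rfl, rfl, rfl⟩ := h0
        filter_upwards [(bddMap_extract m n 0 0 0).ae (h.2 n)] with x hx
        obtain ⟨K, P, Q, R⟩ := x
        simp only [termAc, Fin.sum_univ_succ (n := 0), Finset.univ_eq_empty, Finset.sum_empty]
        simp only [Fin.sum_univ_zero, add_zero]
        exact mul_eq_zero_of_right _ (mul_eq_zero_of_right _ hx)
      · refine Filter.Eventually.of_forall fun x => ?_
        simp [termAc, hΨ, ghostFree_of_ne _ h0]
  filter_upwards [h4] with x hx
  simp [superchargeAmp, h1, h2, h3, hx]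

/-- Without ghosts there is nothing to exchange or rescale. Consequently H = GQG annihilates
physical states just as Q does. -/
theorem IsFlip.eq_of_mem_physical (hG : IsFlip m G) {Φ : core m} (h : Φ ∈ physical m) :
    G Φ = Φ := by
  refine core_ext ((hG Φ).trans (((ampOp_flipAmp m).congr _ _ (ampEq_ghostFree h)).trans
    (AmpEq.trans ?_ (ampEq_ghostFree h).symm)))
  intro n w l s
  refine Filter.Eventually.of_forall fun x => ?_
  by_cases h0 : (w, l, s) = (0, 0, 0)
  · simp only [Prod.mk.injEq] at h0
    obtain ⟨rfl, rfl, rfl⟩ := h0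
    obtain ⟨K, P, Q, R⟩ := x
    have h1 : P = Q := Subsingleton.elim _ _
    subst h1
    simp [flipAmp]
  · have h1 : (l, w, s) ≠ (0, 0, 0) := by
      simp only [ne_eq, Prod.mk.injEq] at h0 ⊢
      tauto
    simp [flipAmp, ghostFree_of_ne _ h0, ghostFree_of_ne _ h1]

theorem contract_zero {M : Type*} [AddCommMonoid M] [Module ℂ M] {Q G : M →ₗ[ℂ] M} {v : M}
    (h : G v = v) (h' : Q v = 0) : (-1 / 2 : ℂ) • (Q (G (Q (G v))) + G (Q (G (Q v)))) = 0 := by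
  simp only [h, h', map_zero, add_zero, smul_zero]

-- If NΦ = 0, then Φ is a multiple of (N-n)⋯(N-1)Φ, which is physical for large n. Conversely both Q
-- and GQG annihilate physical states. Describing the physical space as the kernel of N reduces its
-- Poincaré invariance to commutation with Q and G.
set_option maxHeartbeats 1000000 in
theorem unphysNumber_eq_zero_iff (hm : ∀ a, 0 < m a) (hQ : IsSupercharge m Q) (hG : IsFlip m G)
    (Φ : core m) : unphysNumber Q G Φ = 0 ↔ Φ ∈ physical m := by
  refine ⟨fun h => ?_, fun h => ?_⟩
  · obtain ⟨n, hn⟩ := fallingVec_mem_physical hm hQ hG Φ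
    obtain ⟨c, h2⟩ := exists_eq_smul_fallingVec h n
    rw [h2]
    exact (physical m).smul_mem c hn
  · exact (unphysNumber_apply Φ).trans
      (contract_zero (hG.eq_of_mem_physical h) (hQ.physical_le_ker h))

-- For a cocycle (N-n)⋯(N-1)Φ is a non-zero multiple of Φ up to a coboundary, and for large n it is
-- physical; solving for Φ gives the decomposition.
set_option maxHeartbeats 1000000 in
theorem exists_physical_add (hm : ∀ a, 0 < m a) (hQ : IsSupercharge m Q) {Φ : core m}
    (h : Q Φ = 0) : ∃ Ψ ∈ physical m, ∃ Θ, Φ = Ψ + Q Θ := by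
  obtain ⟨G, hG⟩ := exists_flip (m := m)
  obtain ⟨n, hn⟩ := fallingVec_mem_physical hm hQ hG Φ
  obtain ⟨c, Θ, h2⟩ := exists_eq_smul_fallingVec_add (N := unphysNumber Q G) (Q := Q)
    (H := G ∘ₗ Q ∘ₗ G) unphysNumber_apply hQ.sq_eq_zero h n
  exact ⟨c • fallingVec (unphysNumber Q G) Φ n, (physical m).smul_mem _ hn, Θ, h2⟩

end Contraction

/-! ## The Krein form and the symmetry of the supercharge -/

section KreinSymmetry

variable {r : ℕ} (m : Fin r → ℝ) {n w l s : ℕ}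

theorem measurePreserving_cons {α : Type} [MeasurableSpace α] (μ : Measure α) [SigmaFinite μ]
    (n : ℕ) : MeasurePreserving (fun z : α × (Fin n → α) => (Fin.cons z.1 z.2 : Fin (n + 1) → α))
      (μ.prod (Measure.pi fun _ => μ)) (Measure.pi fun _ => μ) := by
  have h := (measurePreserving_piFinSuccAbove (fun _ : Fin (n + 1) => μ) 0).symm
  convert h using 1
  ext z : 1
  change _ = @Fin.insertNth n (fun _ => α) 0 z.1 z.2
  rw [Fin.insertNth_zero']

theorem measurePreserving_removeVec (i : Fin (n + 1)) :
    MeasurePreserving (fun x : Config r (n + 1) w l s =>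
      (x.1 i, ((i.removeNth x.1, x.2) : Config r n w l s)))
      (configMeasure m (n + 1) w l s) ((vecMeasure m).prod (configMeasure m n w l s)) := by
  unfold configMeasure
  exact (measurePreserving_prodAssoc (vecMeasure m) (Measure.pi fun _ : Fin n => vecMeasure m) _).comp
    ((measurePreserving_piFinSuccAbove (fun _ : Fin (n + 1) => vecMeasure m) i).prod
      (MeasurePreserving.id ((Measure.pi fun _ : Fin w => scalMeasure m).prod
        ((Measure.pi fun _ : Fin l => scalMeasure m).prod
          (Measure.pi fun _ : Fin s => scalMeasure m)))))

theorem measurePreserving_consVec :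
    MeasurePreserving (fun z : Vec r × Config r n w l s =>
      ((Fin.cons z.1 z.2.1, z.2.2) : Config r (n + 1) w l s))
      ((vecMeasure m).prod (configMeasure m n w l s)) (configMeasure m (n + 1) w l s) := by
  unfold configMeasure
  exact ((measurePreserving_cons (vecMeasure m) n).prod
      (MeasurePreserving.id ((Measure.pi fun _ : Fin w => scalMeasure m).prod
        ((Measure.pi fun _ : Fin l => scalMeasure m).prod
          (Measure.pi fun _ : Fin s => scalMeasure m))))).comp
    (measurePreserving_prodAssoc (vecMeasure m) (Measure.pi fun _ : Fin n => vecMeasure m) _).symm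

theorem measurePreserving_removeGhost (i : Fin (w + 1)) :
    MeasurePreserving (fun x : Config r n (w + 1) l s =>
      (x.2.1 i, ((x.1, i.removeNth x.2.1, x.2.2) : Config r n w l s)))
      (configMeasure m n (w + 1) l s) ((scalMeasure m).prod (configMeasure m n w l s)) := by
  unfold configMeasure
  exact (measurePreserving_leftComm (Measure.pi fun _ : Fin n => vecMeasure m) (scalMeasure m) _).comp
    ((MeasurePreserving.id (Measure.pi fun _ : Fin n => vecMeasure m)).prod
      ((measurePreserving_prodAssoc (scalMeasure m) (Measure.pi fun _ : Fin w => scalMeasure m) _).comp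
        ((measurePreserving_piFinSuccAbove (fun _ : Fin (w + 1) => scalMeasure m) i).prod
          (MeasurePreserving.id ((Measure.pi fun _ : Fin l => scalMeasure m).prod
            (Measure.pi fun _ : Fin s => scalMeasure m))))))

theorem measurePreserving_removeScal (i : Fin (s + 1)) :
    MeasurePreserving (fun x : Config r n w l (s + 1) =>
      (x.2.2.2 i, ((x.1, x.2.1, x.2.2.1, i.removeNth x.2.2.2) : Config r n w l s)))
      (configMeasure m n w l (s + 1)) ((scalMeasure m).prod (configMeasure m n w l s)) := by
  unfold configMeasure
  have h1 := (MeasurePreserving.id (Measure.pi fun _ : Fin n => vecMeasure m)).prod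
    ((MeasurePreserving.id (Measure.pi fun _ : Fin w => scalMeasure m)).prod
      ((measurePreserving_leftComm (Measure.pi fun _ : Fin l => scalMeasure m) (scalMeasure m)
        (Measure.pi fun _ : Fin s => scalMeasure m)).comp
      ((MeasurePreserving.id (Measure.pi fun _ : Fin l => scalMeasure m)).prod
        (measurePreserving_piFinSuccAbove (fun _ : Fin (s + 1) => scalMeasure m) i))))
  have h2 := (MeasurePreserving.id (Measure.pi fun _ : Fin n => vecMeasure m)).prod
    (measurePreserving_leftComm (Measure.pi fun _ : Fin w => scalMeasure m) (scalMeasure m)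
      ((Measure.pi fun _ : Fin l => scalMeasure m).prod
        (Measure.pi fun _ : Fin s => scalMeasure m)))
  have h3 := measurePreserving_leftComm (Measure.pi fun _ : Fin n => vecMeasure m) (scalMeasure m)
      ((Measure.pi fun _ : Fin w => scalMeasure m).prod
      ((Measure.pi fun _ : Fin l => scalMeasure m).prod
        (Measure.pi fun _ : Fin s => scalMeasure m)))
  exact h3.comp (h2.comp h1)

theorem measurePreserving_consScal :
    MeasurePreserving (fun z : Scal r × Config r n w l s =>
      ((z.2.1, z.2.2.1, z.2.2.2.1, Fin.cons z.1 z.2.2.2.2) : Config r n w l (s + 1)))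
      ((scalMeasure m).prod (configMeasure m n w l s)) (configMeasure m n w l (s + 1)) := by
  unfold configMeasure
  have h1 := (MeasurePreserving.id (Measure.pi fun _ : Fin n => vecMeasure m)).prod
    ((MeasurePreserving.id (Measure.pi fun _ : Fin w => scalMeasure m)).prod
      (((MeasurePreserving.id (Measure.pi fun _ : Fin l => scalMeasure m)).prod
        (measurePreserving_cons (scalMeasure m) s)).comp
      (measurePreserving_leftComm (scalMeasure m) (Measure.pi fun _ : Fin l => scalMeasure m)
        (Measure.pi fun _ : Fin s => scalMeasure m))))
  have h2 := (MeasurePreserving.id (Measure.pi fun _ : Fin n => vecMeasure m)).prod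
    (measurePreserving_leftComm (scalMeasure m) (Measure.pi fun _ : Fin w => scalMeasure m)
      ((Measure.pi fun _ : Fin l => scalMeasure m).prod
        (Measure.pi fun _ : Fin s => scalMeasure m)))
  have h3 := measurePreserving_leftComm (scalMeasure m) (Measure.pi fun _ : Fin n => vecMeasure m)
      ((Measure.pi fun _ : Fin w => scalMeasure m).prod
      ((Measure.pi fun _ : Fin l => scalMeasure m).prod
        (Measure.pi fun _ : Fin s => scalMeasure m)))
  exact h1.comp (h2.comp h3)

theorem measurePreserving_swapGhosts (n w l s : ℕ) :
    MeasurePreserving (fun x : Config r n w l s =>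
      ((x.1, x.2.2.1, x.2.1, x.2.2.2) : Config r n l w s))
      (configMeasure m n w l s) (configMeasure m n l w s) := by
  unfold configMeasure
  exact (MeasurePreserving.id (Measure.pi fun _ : Fin n => vecMeasure m)).prod
    (measurePreserving_leftComm (Measure.pi fun _ : Fin w => scalMeasure m)
      (Measure.pi fun _ : Fin l => scalMeasure m)
      (Measure.pi fun _ : Fin s => scalMeasure m))

theorem integral_comp_measurePreserving {α β : Type*} [MeasurableSpace α] [MeasurableSpace β]
    {μ : Measure α} {ν : Measure β} {f : α → β} (hf : MeasurePreserving f μ ν) {g : β → ℂ}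
    (hg : AEStronglyMeasurable g ν) : ∫ x, g (f x) ∂μ = ∫ y, g y ∂ν := by
  rw [← hf.map_eq] at hg ⊢
  rw [integral_map hf.measurable.aemeasurable hg]

/-- A vector variable is a scalar variable with a summed Lorentz index. This matches integrals over
vector momenta with integrals over ghost momenta. -/
theorem integral_vec {X : Type*} [MeasurableSpace X] {ν : Measure X} [SFinite ν]
    {g : Vec r × X → ℂ} (hg : Integrable g ((vecMeasure m).prod ν)) :
    ∫ z, g z ∂(vecMeasure m).prod ν = ∫ z, ∑ μ, g ((μ, z.1), z.2) ∂(scalMeasure m).prod ν := by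
  have h1 := (measurePreserving_prodAssoc (Measure.count : Measure (Fin 4)) (scalMeasure m) ν).symm
  have h2 : Integrable (fun z : Fin 4 × Scal r × X => g ((z.1, z.2.1), z.2.2))
      ((Measure.count : Measure (Fin 4)).prod ((scalMeasure m).prod ν)) :=
    h1.integrable_comp_of_integrable hg
  have h3 : ∫ z, g z ∂(vecMeasure m).prod ν = ∫ z : Fin 4 × Scal r × X, g ((z.1, z.2.1), z.2.2)
      ∂(Measure.count : Measure (Fin 4)).prod ((scalMeasure m).prod ν) :=
    (integral_comp_measurePreserving h1 hg.aestronglyMeasurable).symm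
  rw [h3, integral_prod_symm _ h2]
  refine integral_congr_ae ?_
  filter_upwards [h2.prod_left_ae] with z hz
  rw [integral_fintype hz]
  simp

variable {m}

theorem IsSymAmp.move_vec {Ψ : Amp r} (hΨ : IsSymAmp Ψ) (i : Fin (n + 1)) (K : Fin (n + 1) → Vec r)
    (y : (Fin w → Scal r) × (Fin l → Scal r) × (Fin s → Scal r)) :
    Ψ (n + 1) w l s (K, y) = Ψ (n + 1) w l s (Fin.cons (K i) (i.removeNth K), y) := by
  have h := hΨ (n + 1) w l s i.cycleRange 1 1 1 (Fin.cons (K i) (i.removeNth K), y)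
  have h2 : (Fin.cons (K i) (i.removeNth K) : Fin (n + 1) → Vec r) ∘ i.cycleRange = K := by
    funext j
    rw [Function.comp_apply, Fin.cons_apply_cycleRange, Fin.insertNth_self_removeNth]
  rw [map_one, map_one, one_mul, one_mul] at h
  rw [← h, permConfig]
  dsimp only
  rw [h2]
  rfl

/-- Bringing the i-th variable to the front is the cycle of the first i + 1 positions, of sign
(-1)^i. The sign cancels the alternating sign in the supercharge. -/
theorem IsSymAmp.move_ghost {Ψ : Amp r} (hΨ : IsSymAmp Ψ) (i : Fin (w + 1)) (K : Fin n → Vec r)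
    (P : Fin (w + 1) → Scal r) (y : (Fin l → Scal r) × (Fin s → Scal r)) :
    Ψ n (w + 1) l s (K, P, y) =
      (-1) ^ (i : ℕ) * Ψ n (w + 1) l s (K, Fin.cons (P i) (i.removeNth P), y) := by
  have h := hΨ n (w + 1) l s 1 i.cycleRange 1 1 (K, Fin.cons (P i) (i.removeNth P), y)
  have h2 : (Fin.cons (P i) (i.removeNth P) : Fin (w + 1) → Scal r) ∘ i.cycleRange = P := by
    funext j
    rw [Function.comp_apply, Fin.cons_apply_cycleRange, Fin.insertNth_self_removeNth]
  rw [map_one, mul_one, signC_apply, Fin.sign_cycleRange] at h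
  push_cast at h
  rw [← h, permConfig]
  dsimp only
  rw [h2]
  rfl

theorem IsSymAmp.move_scal {Ψ : Amp r} (hΨ : IsSymAmp Ψ) (i : Fin (s + 1)) (K : Fin n → Vec r)
    (P : Fin w → Scal r) (Q : Fin l → Scal r) (R : Fin (s + 1) → Scal r) :
    Ψ n w l (s + 1) (K, P, Q, R) = Ψ n w l (s + 1) (K, P, Q, Fin.cons (R i) (i.removeNth R)) := by
  have h := hΨ n w l (s + 1) 1 1 1 i.cycleRange (K, P, Q, Fin.cons (R i) (i.removeNth R))
  have h2 : (Fin.cons (R i) (i.removeNth R) : Fin (s + 1) → Scal r) ∘ i.cycleRange = R := by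
    funext j
    rw [Function.comp_apply, Fin.cons_apply_cycleRange, Fin.insertNth_self_removeNth]
  rw [map_one, map_one, one_mul, one_mul] at h
  rw [← h, permConfig]
  dsimp only
  rw [h2]
  rfl

variable (m)

theorem tameOp_kreinAmp : TameOp m (RingHom.id ℂ) id (kreinAmp (r := r)) := by
  refine TameOp.of_isSumTerm (Or.inl rfl) fun n w l s => ?_
  refine ⟨Unit, inferInstance, n, l, w, s, fun _ x => (x.1, x.2.2.1, x.2.1, x.2.2.2),
    fun _ x => (-1) ^ (w * l) * (∏ i, (-(eta (x.1 i).1) : ℂ)),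
    fun _ => bddMap_swapGhosts m n w l s, fun _ => ?_,
    fun _ R => ⟨1, fun x _ => ?_⟩, fun _ R x h => ⟨h.1, h.2.2.1, h.2.1, h.2.2.2⟩, by omega,
    fun Ψ x => ?_⟩
  · refine Measurable.const_mul (Finset.measurable_fun_prod _ fun i _ => ?_) _
    exact (measurable_from_top (f := fun μ : Fin 4 => (-(eta μ) : ℂ))).comp (by fun_prop)
  · have h (i) : ‖(-(eta (x.1 i).1) : ℂ)‖ = 1 := by rw [norm_neg, Complex.norm_real, norm_eta]
    rw [norm_mul, norm_prod, Finset.prod_congr rfl fun i _ => h i]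
    simp
  · simp [kreinAmp]

/-- Square integrable amplitudes with finitely many particles. -/
structure FinAmp (m : Fin r → ℝ) (Ψ : Amp r) : Prop where
  memLp : ∀ n w l s, MemLp (Ψ n w l s) 2 (configMeasure m n w l s)
  fin : ∃ N, ∀ n w l s, N < n + w + l + s → Ψ n w l s =ᵐ[configMeasure m n w l s] 0

variable {m}

theorem CoreAmp.finAmp {Ψ : Amp r} (h : CoreAmp m Ψ) : FinAmp m Ψ := ⟨h.memLp, h.fin⟩

theorem TameOp.finAmp {σ : ℂ →+* ℂ} {ρ : ℝ → ℝ} {T : Amp r → Amp r} (hT : TameOp m σ ρ T)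
    {Ψ : Amp r} (h : CoreAmp m Ψ) : FinAmp m (T Ψ) := by
  obtain ⟨R, hR⟩ := h.bdd
  obtain ⟨N, hN⟩ := h.fin
  exact ⟨hT.memLp Ψ R h.memLp hR, N, hT.fin Ψ N hN⟩

theorem FinAmp.kreinAmp {Ψ : Amp r} (h : FinAmp m Ψ) : FinAmp m (kreinAmp Ψ) := by
  obtain ⟨N, hN⟩ := h.fin
  refine ⟨fun n w l s => ?_, N, (tameOp_kreinAmp m).fin Ψ N hN⟩
  have h1 := (bddMap_swapGhosts m n w l s).memLp (h.memLp n l w s)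
  have h2 : Measurable fun x : Config r n w l s =>
      (-1 : ℂ) ^ (w * l) * (∏ i, (-(eta (x.1 i).1) : ℂ)) := by
    refine Measurable.const_mul (Finset.measurable_fun_prod _ fun i _ => ?_) _
    exact (measurable_from_top (f := fun μ : Fin 4 => (-(eta μ) : ℂ))).comp (by fun_prop)
  refine MemLp.of_le h1 (h2.aestronglyMeasurable.mul h1.aestronglyMeasurable)
    (Filter.Eventually.of_forall fun x => ?_)
  have h (i) : ‖(-(eta (x.1 i).1) : ℂ)‖ = 1 := by rw [norm_neg, Complex.norm_real, norm_eta]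
  simp only [Function.comp_apply, MassiveVector.kreinAmp]
  rw [norm_mul, norm_mul, norm_prod, Finset.prod_congr rfl fun i _ => h i]
  simp

theorem FinAmp.add {Ψ Ψ' : Amp r} (h : FinAmp m Ψ) (h' : FinAmp m Ψ') : FinAmp m (Ψ + Ψ') := by
  obtain ⟨N, hN⟩ := h.fin
  obtain ⟨N', hN'⟩ := h'.fin
  refine ⟨fun n w l s => (h.memLp n w l s).add (h'.memLp n w l s), max N N', fun n w l s hl => ?_⟩
  have := (hN n w l s (lt_of_le_of_lt (le_max_left _ _) hl)).add
    (hN' n w l s (lt_of_le_of_lt (le_max_right _ _) hl))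
  simpa using this

/-- The contribution of a sector to the Krein form. -/
def kreinTerm (m : Fin r → ℝ) (Ψ Φ : Amp r) (i : ℕ × ℕ × ℕ × ℕ) : ℂ :=
  ∫ x, conj (Ψ i.1 i.2.1 i.2.2.1 i.2.2.2 x) *
    kreinAmp Φ i.1 i.2.1 i.2.2.1 i.2.2.2 x ∂configMeasure m i.1 i.2.1 i.2.2.1 i.2.2.2

/-- The Krein form on amplitudes. -/
def kreinForm (m : Fin r → ℝ) (Ψ Φ : Amp r) : ℂ := ∑' i, kreinTerm m Ψ Φ i

theorem krein_eq (Ψ Φ : GhostSpace m) : krein Ψ Φ = kreinForm m (amp Ψ) (amp Φ) := rfl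

theorem kreinAmp_congr {Φ Φ' : Amp r} (h : AmpEq m Φ Φ') : AmpEq m (kreinAmp Φ) (kreinAmp Φ') :=
  (tameOp_kreinAmp m).congr _ _ h

theorem kreinForm_congr {Ψ Ψ' Φ Φ' : Amp r} (h : AmpEq m Ψ Ψ') (h' : AmpEq m Φ Φ') :
    kreinForm m Ψ Φ = kreinForm m Ψ' Φ' := by
  refine tsum_congr fun i => integral_congr_ae ?_
  filter_upwards [h i.1 i.2.1 i.2.2.1 i.2.2.2, kreinAmp_congr h' i.1 i.2.1 i.2.2.1 i.2.2.2]
    with x h1 h2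
  rw [h1, h2]

theorem FinAmp.integrable {Ψ Φ : Amp r} (h : FinAmp m Ψ) (h' : FinAmp m Φ) (n w l s : ℕ) :
    Integrable (fun x => conj (Ψ n w l s x) * Φ n w l s x) (configMeasure m n w l s) :=
  MemLp.integrable_mul (p := 2) (q := 2) ((h.memLp n w l s).star) (h'.memLp n w l s)

theorem summable_of_bounded_degree {f : ℕ × ℕ × ℕ × ℕ → ℂ} {N : ℕ}
    (h : ∀ n w l s, N < n + w + l + s → f (n, w, l, s) = 0) : Summable f := by
  refine summable_of_ne_finset_zero (s := Finset.range (N + 1) ×ˢ Finset.range (N + 1) ×ˢ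
    Finset.range (N + 1) ×ˢ Finset.range (N + 1)) fun ⟨n, w, l, s⟩ hi => h n w l s ?_
  simp only [Finset.mem_product, Finset.mem_range] at hi
  omega

theorem FinAmp.summable {Ψ Φ : Amp r} (h : FinAmp m Ψ) : Summable (kreinTerm m Ψ Φ) := by
  obtain ⟨N, hN⟩ := h.fin
  refine summable_of_bounded_degree (N := N) fun n w l s hl => ?_
  refine integral_eq_zero_of_ae ?_
  filter_upwards [hN n w l s hl] with x hx
  rw [hx]
  simp

theorem kreinForm_add_right {Ψ Φ Φ' : Amp r} (h : FinAmp m Ψ) (h1 : FinAmp m Φ)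
    (h2 : FinAmp m Φ') : kreinForm m Ψ (Φ + Φ') = kreinForm m Ψ Φ + kreinForm m Ψ Φ' := by
  unfold kreinForm
  rw [← h.summable.tsum_add h.summable]
  refine tsum_congr fun i => ?_
  unfold kreinTerm
  rw [← integral_add (h.integrable h1.kreinAmp _ _ _ _) (h.integrable h2.kreinAmp _ _ _ _)]
  refine integral_congr_ae (Filter.Eventually.of_forall fun x => ?_)
  simp only [(tameOp_kreinAmp m).add, Pi.add_apply, mul_add]

theorem kreinForm_smul_right (c : ℂ) (Ψ Φ : Amp r) :
    kreinForm m Ψ (c • Φ) = c * kreinForm m Ψ Φ := by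
  unfold kreinForm
  rw [← tsum_mul_left]
  refine tsum_congr fun i => ?_
  unfold kreinTerm
  rw [← integral_const_mul]
  refine integral_congr_ae (Filter.Eventually.of_forall fun x => ?_)
  simp only [(tameOp_kreinAmp m).smul, Pi.smul_apply, smul_eq_mul, RingHom.id_apply]
  ring

/-- The Krein operator exchanges the two kinds of Fermionic ghosts, so conjugation becomes a
symmetry only after reindexing the sectors by w ↔ l. The signs (-1)^(wl) and the metric factors are
real and symmetric. -/
theorem kreinForm_conj {Ψ Φ : Amp r} (h : FinAmp m Ψ) (h1 : FinAmp m Φ) :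
    conj (kreinForm m Ψ Φ) = kreinForm m Φ Ψ := by
  unfold kreinForm
  have hinj : Function.Injective fun i : ℕ × ℕ × ℕ × ℕ => (i.1, i.2.2.1, i.2.1, i.2.2.2) := by
    rintro ⟨n, w, l, s⟩ ⟨n', w', l', s'⟩ h
    simp only [Prod.mk.injEq] at h
    simp only [Prod.mk.injEq]
    tauto
  have hsupp : Function.support (kreinTerm m Φ Ψ) ⊆
      Set.range fun i : ℕ × ℕ × ℕ × ℕ => (i.1, i.2.2.1, i.2.1, i.2.2.2) := fun ⟨n, w, l, s⟩ _ =>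
    ⟨(n, l, w, s), rfl⟩
  rw [← hinj.tsum_eq hsupp, Complex.conj_tsum]
  refine tsum_congr fun ⟨n, w, l, s⟩ => ?_
  unfold kreinTerm
  rw [← integral_conj]
  have h2 := h1.integrable h.kreinAmp n l w s
  rw [← integral_comp_measurePreserving (measurePreserving_swapGhosts m n w l s)
    h2.aestronglyMeasurable]
  refine integral_congr_ae (Filter.Eventually.of_forall fun x => ?_)
  simp only [kreinAmp, map_mul, map_pow, map_neg, map_one, map_prod, Complex.conj_conj,
    Complex.conj_ofReal, mul_comm w l]
  ring

end KreinSymmetry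

/-! ### Symmetry of the supercharge for the Krein form -/

section SuperchargeAdjoint

variable {r : ℕ} {m : Fin r → ℝ} {n w l s : ℕ}

/-- By symmetry all k ways of singling out one particle contribute equally. The resulting factor k
combines with the square roots of the supercharge. -/
theorem integral_sum_measurePreserving {α β : Type*} [MeasurableSpace α] [MeasurableSpace β]
    {μ : Measure α} {ν : Measure β} {k : ℕ} {f : Fin k → α → β}
    (hf : ∀ i, MeasurePreserving (f i) μ ν) {g : β → ℂ} (hg : Integrable g ν) (c : ℂ) :
    ∫ x, ∑ i, c * g (f i x) ∂μ = c * k * ∫ y, g y ∂ν := by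
  rw [integral_finsetSum (f := fun i x => c * g (f i x)) _
    fun i _ => ((hf i).integrable_comp_of_integrable hg).const_mul c]
  rw [Finset.sum_congr rfl fun i _ => by
    rw [integral_const_mul, integral_comp_measurePreserving (hf i) hg.aestronglyMeasurable]]
  rw [Finset.sum_const, Finset.card_univ, Fintype.card_fin, nsmul_eq_mul]
  ring

/-- Both sides equal √((a+1)(b+1)), the common prefactor of the two adjoint terms. -/
theorem sqrt_div_mul (a b : ℕ) : (Real.sqrt ((a + 1 : ℝ) / (b + 1 : ℝ)) : ℂ) * ((b + 1 : ℕ) : ℂ) =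
    (Real.sqrt ((b + 1 : ℝ) / (a + 1 : ℝ)) : ℂ) * ((a + 1 : ℕ) : ℂ) := by
  have h : ∀ x y : ℝ, 0 < x → 0 < y → Real.sqrt (x / y) * y = Real.sqrt (x * y) := by
    intro x y hx hy
    rw [show x * y = x / y * (y * y) by field_simp, Real.sqrt_mul (by positivity),
      Real.sqrt_mul_self hy.le]
  have h1 : Real.sqrt ((a + 1 : ℝ) / (b + 1 : ℝ)) * (b + 1 : ℝ) =
      Real.sqrt ((b + 1 : ℝ) / (a + 1 : ℝ)) * (a + 1 : ℝ) := by
    rw [h _ _ (by positivity) (by positivity), h _ _ (by positivity) (by positivity), mul_comm]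
  exact_mod_cast congrArg (Complex.ofReal) h1

theorem eta_mul_self (μ : Fin 4) : (eta μ : ℂ) * eta μ = 1 := by
  unfold eta
  split_ifs <;> simp

/-- The integrand common to both sides of the adjointness of `A_μ c*` and `A†_μ b`. -/
def vecPairing (Φ Ψ : Amp r) (n w l s : ℕ) (z : Vec r × Config r n w l s) : ℂ :=
  conj (Φ n (w + 1) l s (z.2.1, Fin.cons z.1.2 z.2.2.1, z.2.2.2)) *
    (∏ i, (-(eta (z.2.1 i).1) : ℂ)) * (z.1.2.2 z.1.1 : ℂ) *
    Ψ (n + 1) l w s (Fin.cons z.1 z.2.1, z.2.2.2.1, z.2.2.1, z.2.2.2.2)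

/-- The momentum factor is unbounded, but Φ has bounded support in the same variable. The integrand
is therefore a product of two square integrable functions, up to sign. -/
theorem integrable_vecPairing {Φ Ψ : Amp r} (hΦ : CoreAmp m Φ) (hΨ : CoreAmp m Ψ) :
    Integrable (vecPairing Φ Ψ n w l s) ((vecMeasure m).prod (configMeasure m n w l s)) := by
  obtain ⟨R, hR⟩ := hΦ.bdd
  have h1 := memLp_term (bddMap_termAb m (n := n) (w := w) (l := l) (s := s) 0)
    (hΦ.memLp _ _ _ _) (hR _ _ _ _) (C := R)
    (c := fun x => ((eta (x.1 0).1 * (x.1 0).2.2 (x.1 0).1 : ℝ) : ℂ))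
    (measurable_lowered.comp (by fun_prop)) (fun x h => by
      rw [Complex.ofReal_mul, norm_mul, Complex.norm_real, norm_eta, one_mul]
      exact abs_le_of_norm_le (h.2.1 0) _)
  have h2 := MemLp.integrable_mul (p := 2) (q := 2) h1.star
    (hΨ.finAmp.kreinAmp.memLp (n + 1) w l s)
  have h3 := ((measurePreserving_consVec m).integrable_comp_of_integrable h2).const_mul
    (-(-1) ^ (w * l))
  refine h3.congr (Filter.Eventually.of_forall fun z => ?_)
  have hs : ((-1 : ℂ) ^ (w * l)) * (-1) ^ (w * l) = 1 := by rw [← mul_pow]; simp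
  have hr : (0 : Fin (n + 1)).removeNth (Fin.cons z.1 z.2.1 : Fin (n + 1) → Vec r) = z.2.1 := by
    rw [Fin.removeNth_zero, Fin.tail_cons]
  simp only [Function.comp_apply, Pi.mul_apply, Pi.star_apply, kreinAmp, vecPairing, hr,
    Fin.cons_zero, Fin.prod_univ_succ, Fin.cons_succ, star_mul', RCLike.star_def,
    Complex.conj_ofReal]
  push_cast
  linear_combination (conj (Φ n (w + 1) l s (z.2.1, Fin.cons z.1.2 z.2.2.1, z.2.2.2)) *
    (∏ i, (-(eta (z.2.1 i).1) : ℂ)) * (z.1.2.2 z.1.1 : ℂ) *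
    Ψ (n + 1) l w s (Fin.cons z.1 z.2.1, z.2.2.2.1, z.2.2.1, z.2.2.2.2)) *
    (eta_mul_self z.1.1 * (-1 : ℂ) ^ (w * l) * (-1 : ℂ) ^ (w * l) + hs)

/-- Both sides integrate the same function of one distinguished particle and the rest: on the left
this particle is one of w + 1 ghosts, on the right one of n + 1 vector particles. The c ghost
created by the operator occupies the slot w because the Krein operator exchanges b and c. -/
theorem kreinTerm_termAc {Φ Ψ : Amp r} (hΦ : CoreAmp m Φ) (hΨ : CoreAmp m Ψ) (sΦ : IsSymAmp Φ)
    (sΨ : IsSymAmp Ψ) : kreinTerm m Φ (termAc Ψ) (n, w + 1, l, s) =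
      kreinTerm m (termAb Φ) Ψ (n + 1, w, l, s) := by
  have hg := integrable_vecPairing (n := n) (w := w) (l := l) (s := s) hΦ hΨ
  have hg2 : Integrable (fun z : Scal r × Config r n w l s =>
      ∑ μ, vecPairing Φ Ψ n w l s ((μ, z.1), z.2))
      ((scalMeasure m).prod (configMeasure m n w l s)) := by
    refine integrable_finsetSum _ fun μ _ => ?_
    rw [← memLp_one_iff_integrable] at hg ⊢
    exact ((bddMap_mkVec m μ).prodMap (BddMap.id (μ := configMeasure m n w l s))).memLp hg
  have h1 : kreinTerm m Φ (termAc Ψ) (n, w + 1, l, s) =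
      ∫ x, ∑ i : Fin (w + 1), ((-1) ^ (w * l) * (Real.sqrt ((n + 1 : ℝ) / (w + 1 : ℝ)) : ℂ)) *
        ∑ μ, vecPairing Φ Ψ n w l s ((μ, x.2.1 i), (x.1, i.removeNth x.2.1, x.2.2))
        ∂configMeasure m n (w + 1) l s := by
    refine integral_congr_ae (Filter.Eventually.of_forall fun ⟨K, P, Q, R⟩ => ?_)
    simp only [kreinAmp, termAc, vecPairing, Finset.mul_sum]
    refine Finset.sum_congr rfl fun i _ => Finset.sum_congr rfl fun ν _ => ?_
    rw [sΦ.move_ghost i K P (Q, R)]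
    have hl : ((-1 : ℂ) ^ l) * (-1) ^ l = 1 := by rw [← mul_pow]; simp
    have hi : ((-1 : ℂ) ^ (i : ℕ)) * (-1) ^ (i : ℕ) = 1 := by rw [← mul_pow]; simp
    simp only [map_mul, map_pow, map_neg, map_one, add_mul, one_mul, pow_add]
    linear_combination (conj (Φ n (w + 1) l s (K, Fin.cons (P i) (i.removeNth P), Q, R)) *
      (∏ i, (-(eta (K i).1) : ℂ)) * ((P i).2 ν : ℂ) * (-1) ^ (w * l) *
      (Real.sqrt ((n + 1 : ℝ) / (w + 1 : ℝ)) : ℂ) *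
      Ψ (n + 1) l w s (Fin.cons (ν, P i) K, Q, i.removeNth P, R)) *
      (hl * (-1 : ℂ) ^ (i : ℕ) * (-1 : ℂ) ^ (i : ℕ) + hi)
  have h2 : kreinTerm m (termAb Φ) Ψ (n + 1, w, l, s) =
      ∫ x, ∑ i : Fin (n + 1), ((-1) ^ (w * l) * (Real.sqrt ((w + 1 : ℝ) / (n + 1 : ℝ)) : ℂ)) *
        vecPairing Φ Ψ n w l s (x.1 i, (i.removeNth x.1, x.2)) ∂configMeasure m (n + 1) w l s := by
    refine integral_congr_ae (Filter.Eventually.of_forall fun ⟨K, P, Q, R⟩ => ?_)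
    simp only [kreinAmp, termAb, vecPairing, map_mul, map_neg, map_sum, Finset.mul_sum,
      Finset.sum_mul, Complex.conj_ofReal]
    refine Finset.sum_congr rfl fun i _ => ?_
    -- The metric sign of the distinguished particle cancels the one lowering the index of its
    -- momentum.
    rw [sΨ.move_vec i K (Q, P, R), Fin.prod_univ_succAbove _ i]
    simp only [Fin.removeNth_apply]
    push_cast
    linear_combination (conj (Φ n (w + 1) l s (i.removeNth K, Fin.cons (K i).2 P, Q, R)) *
      (∏ j, (-(eta (K (i.succAbove j)).1) : ℂ)) * ((K i).2.2 (K i).1 : ℂ) * (-1) ^ (w * l) *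
      (Real.sqrt ((w + 1 : ℝ) / (n + 1 : ℝ)) : ℂ) *
      Ψ (n + 1) l w s (Fin.cons (K i) (i.removeNth K), Q, P, R)) *
      eta_mul_self (K i).1
  rw [h1, h2, integral_sum_measurePreserving (fun i => measurePreserving_removeGhost m i) hg2,
    integral_sum_measurePreserving (fun i => measurePreserving_removeVec m i) hg,
    integral_vec m hg, mul_assoc _ _ ((w + 1 : ℕ) : ℂ), mul_assoc _ _ ((n + 1 : ℕ) : ℂ),
    sqrt_div_mul]

/-- The integrand common to both sides of the adjointness of `a c*` and `a* b`. -/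
def scalPairing (m : Fin r → ℝ) (Φ Ψ : Amp r) (n w l s : ℕ) (z : Scal r × Config r n w l s) : ℂ :=
  conj (Φ n (w + 1) l s (z.2.1, Fin.cons z.1 z.2.2.1, z.2.2.2)) *
    (∏ i, (-(eta (z.2.1 i).1) : ℂ)) * (m z.1.1 : ℂ) *
    Ψ n l w (s + 1) (z.2.1, z.2.2.2.1, z.2.2.1, Fin.cons z.1 z.2.2.2.2)

theorem integrable_scalPairing {Φ Ψ : Amp r} (hΦ : CoreAmp m Φ) (hΨ : CoreAmp m Ψ) :
    Integrable (scalPairing m Φ Ψ n w l s) ((scalMeasure m).prod (configMeasure m n w l s)) := by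
  obtain ⟨R, hR⟩ := hΦ.bdd
  obtain ⟨C, hC⟩ := mass_bound m
  have h1 := memLp_term (bddMap_termab m (n := n) (w := w) (l := l) (s := s) 0)
    (hΦ.memLp _ _ _ _) (hR _ _ _ _) (C := C)
    (c := fun x => (m (x.2.2.2 0).1 : ℂ))
    ((measurable_mass m).comp (by fun_prop)) (fun x h => hC _)
  have h2 := MemLp.integrable_mul (p := 2) (q := 2) h1.star
    (hΨ.finAmp.kreinAmp.memLp n w l (s + 1))
  have h3 := ((measurePreserving_consScal m).integrable_comp_of_integrable h2).const_mul
    ((-1) ^ (w * l))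
  refine h3.congr (Filter.Eventually.of_forall fun z => ?_)
  have hs : ((-1 : ℂ) ^ (w * l)) * (-1) ^ (w * l) = 1 := by rw [← mul_pow]; simp
  have hr : (0 : Fin (s + 1)).removeNth (Fin.cons z.1 z.2.2.2.2 : Fin (s + 1) → Scal r) =
      z.2.2.2.2 := by
    rw [Fin.removeNth_zero, Fin.tail_cons]
  simp only [Function.comp_apply, Pi.mul_apply, Pi.star_apply, kreinAmp, scalPairing, hr,
    Fin.cons_zero, star_mul', RCLike.star_def, Complex.conj_ofReal]
  linear_combination (conj (Φ n (w + 1) l s (z.2.1, Fin.cons z.1 z.2.2.1, z.2.2.2)) *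
    (∏ i, (-(eta (z.2.1 i).1) : ℂ)) * (m z.1.1 : ℂ) *
    Ψ n l w (s + 1) (z.2.1, z.2.2.2.1, z.2.2.1, Fin.cons z.1 z.2.2.2.2)) * hs

theorem kreinTerm_termac {Φ Ψ : Amp r} (hΦ : CoreAmp m Φ) (hΨ : CoreAmp m Ψ) (sΦ : IsSymAmp Φ)
    (sΨ : IsSymAmp Ψ) : kreinTerm m Φ (termac m Ψ) (n, w + 1, l, s) =
      kreinTerm m (termab m Φ) Ψ (n, w, l, s + 1) := by
  have hg := integrable_scalPairing (n := n) (w := w) (l := l) (s := s) hΦ hΨ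
  have h1 : kreinTerm m Φ (termac m Ψ) (n, w + 1, l, s) =
      ∫ x, ∑ i : Fin (w + 1), (Complex.I * (-1) ^ (w * l) *
        (Real.sqrt ((s + 1 : ℝ) / (w + 1 : ℝ)) : ℂ)) *
        scalPairing m Φ Ψ n w l s (x.2.1 i, (x.1, i.removeNth x.2.1, x.2.2))
        ∂configMeasure m n (w + 1) l s := by
    refine integral_congr_ae (Filter.Eventually.of_forall fun ⟨K, P, Q, R⟩ => ?_)
    simp only [kreinAmp, termac, scalPairing, Finset.mul_sum]
    refine Finset.sum_congr rfl fun i _ => ?_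
    rw [sΦ.move_ghost i K P (Q, R)]
    have hl : ((-1 : ℂ) ^ l) * (-1) ^ l = 1 := by rw [← mul_pow]; simp
    have hi : ((-1 : ℂ) ^ (i : ℕ)) * (-1) ^ (i : ℕ) = 1 := by rw [← mul_pow]; simp
    simp only [map_mul, map_pow, map_neg, map_one, add_mul, one_mul, pow_add]
    linear_combination (conj (Φ n (w + 1) l s (K, Fin.cons (P i) (i.removeNth P), Q, R)) *
      (∏ i, (-(eta (K i).1) : ℂ)) * (m (P i).1 : ℂ) * (-1) ^ (w * l) * Complex.I *
      (Real.sqrt ((s + 1 : ℝ) / (w + 1 : ℝ)) : ℂ) *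
      Ψ n l w (s + 1) (K, Q, i.removeNth P, Fin.cons (P i) R)) *
      (hl * (-1 : ℂ) ^ (i : ℕ) * (-1 : ℂ) ^ (i : ℕ) + hi)
  have h2 : kreinTerm m (termab m Φ) Ψ (n, w, l, s + 1) =
      ∫ x, ∑ i : Fin (s + 1), (Complex.I * (-1) ^ (w * l) *
        (Real.sqrt ((w + 1 : ℝ) / (s + 1 : ℝ)) : ℂ)) *
        scalPairing m Φ Ψ n w l s (x.2.2.2 i, (x.1, x.2.1, x.2.2.1, i.removeNth x.2.2.2))
        ∂configMeasure m n w l (s + 1) := by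
    refine integral_congr_ae (Filter.Eventually.of_forall fun ⟨K, P, Q, R⟩ => ?_)
    simp only [kreinAmp, termab, scalPairing, map_mul, map_neg, map_sum, Finset.mul_sum,
      Finset.sum_mul, Complex.conj_ofReal, Complex.conj_I]
    refine Finset.sum_congr rfl fun i _ => ?_
    rw [sΨ.move_scal i K Q P R]
    ring
  rw [h1, h2, integral_sum_measurePreserving (fun i => measurePreserving_removeGhost m i) hg,
    integral_sum_measurePreserving (fun i => measurePreserving_removeScal m i) hg,
    mul_assoc _ _ ((w + 1 : ℕ) : ℂ), mul_assoc _ _ ((s + 1 : ℕ) : ℂ), sqrt_div_mul]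

/-- Sectors are matched by (n, w+1, l, s) ↔ (n+1, w, l, s). Those not of this form contribute zero,
as there is no ghost, respectively no vector particle, to single out. -/
theorem kreinForm_termAc {Φ Ψ : Amp r} (hΦ : CoreAmp m Φ) (hΨ : CoreAmp m Ψ) (sΦ : IsSymAmp Φ)
    (sΨ : IsSymAmp Ψ) : kreinForm m Φ (termAc Ψ) = kreinForm m (termAb Φ) Ψ := by
  unfold kreinForm
  have h1 : Function.Injective fun i : ℕ × ℕ × ℕ × ℕ => (i.1, i.2.1 + 1, i.2.2.1, i.2.2.2) := by
    rintro ⟨n, w, l, s⟩ ⟨n', w', l', s'⟩ h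
    simpa using h
  have h2 : Function.Injective fun i : ℕ × ℕ × ℕ × ℕ => (i.1 + 1, i.2.1, i.2.2.1, i.2.2.2) := by
    rintro ⟨n, w, l, s⟩ ⟨n', w', l', s'⟩ h
    simpa using h
  have h3 : Function.support (kreinTerm m Φ (termAc Ψ)) ⊆
      Set.range fun i : ℕ × ℕ × ℕ × ℕ => (i.1, i.2.1 + 1, i.2.2.1, i.2.2.2) := by
    rintro ⟨n, w, l, s⟩ hi
    cases w with
    | zero => exact absurd (by simp [kreinTerm, kreinAmp, termAc]) hi
    | succ w => exact ⟨(n, w, l, s), rfl⟩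
  have h4 : Function.support (kreinTerm m (termAb Φ) Ψ) ⊆
      Set.range fun i : ℕ × ℕ × ℕ × ℕ => (i.1 + 1, i.2.1, i.2.2.1, i.2.2.2) := by
    rintro ⟨n, w, l, s⟩ hi
    cases n with
    | zero => exact absurd (by simp [kreinTerm, termAb]) hi
    | succ n => exact ⟨(n, w, l, s), rfl⟩
  rw [← h1.tsum_eq h3, ← h2.tsum_eq h4]
  exact tsum_congr fun ⟨n, w, l, s⟩ => kreinTerm_termAc hΦ hΨ sΦ sΨ

theorem kreinForm_termac {Φ Ψ : Amp r} (hΦ : CoreAmp m Φ) (hΨ : CoreAmp m Ψ) (sΦ : IsSymAmp Φ)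
    (sΨ : IsSymAmp Ψ) : kreinForm m Φ (termac m Ψ) = kreinForm m (termab m Φ) Ψ := by
  unfold kreinForm
  have h1 : Function.Injective fun i : ℕ × ℕ × ℕ × ℕ => (i.1, i.2.1 + 1, i.2.2.1, i.2.2.2) := by
    rintro ⟨n, w, l, s⟩ ⟨n', w', l', s'⟩ h
    simpa using h
  have h2 : Function.Injective fun i : ℕ × ℕ × ℕ × ℕ => (i.1, i.2.1, i.2.2.1, i.2.2.2 + 1) := by
    rintro ⟨n, w, l, s⟩ ⟨n', w', l', s'⟩ h
    simpa using h
  have h3 : Function.support (kreinTerm m Φ (termac m Ψ)) ⊆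
      Set.range fun i : ℕ × ℕ × ℕ × ℕ => (i.1, i.2.1 + 1, i.2.2.1, i.2.2.2) := by
    rintro ⟨n, w, l, s⟩ hi
    cases w with
    | zero => exact absurd (by simp [kreinTerm, kreinAmp, termac]) hi
    | succ w => exact ⟨(n, w, l, s), rfl⟩
  have h4 : Function.support (kreinTerm m (termab m Φ) Ψ) ⊆
      Set.range fun i : ℕ × ℕ × ℕ × ℕ => (i.1, i.2.1, i.2.2.1, i.2.2.2 + 1) := by
    rintro ⟨n, w, l, s⟩ hi
    cases s with
    | zero => exact absurd (by simp [kreinTerm, termab]) hi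
    | succ s => exact ⟨(n, w, l, s), rfl⟩
  rw [← h1.tsum_eq h3, ← h2.tsum_eq h4]
  exact tsum_congr fun ⟨n, w, l, s⟩ => kreinTerm_termac hΦ hΨ sΦ sΨ

/-- Two of the four terms have been shown to be adjoint to the other two. The reverse relations
follow by complex conjugation, since the form is Hermitian. -/
theorem kreinForm_superchargeAmp {Φ Ψ : Amp r} (hΦ : CoreAmp m Φ) (hΨ : CoreAmp m Ψ)
    (sΦ : IsSymAmp Φ) (sΨ : IsSymAmp Ψ) :
    kreinForm m Φ (superchargeAmp m Ψ) = kreinForm m (superchargeAmp m Φ) Ψ := by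
  have f := fun {Θ : Amp r} (h : CoreAmp m Θ) => (tameOp_termAc m).finAmp h
  have f' := fun {Θ : Amp r} (h : CoreAmp m Θ) => (tameOp_termAb m).finAmp h
  have g := fun {Θ : Amp r} (h : CoreAmp m Θ) => (tameOp_termac m).finAmp h
  have g' := fun {Θ : Amp r} (h : CoreAmp m Θ) => (tameOp_termab m).finAmp h
  have e : ∀ {Θ Ξ : Amp r}, CoreAmp m Θ → CoreAmp m Ξ → kreinForm m Θ (superchargeAmp m Ξ) =
      kreinForm m Θ (termAc Ξ) + kreinForm m Θ (termAb Ξ) + kreinForm m Θ (termac m Ξ) +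
        kreinForm m Θ (termab m Ξ) := by
    intro Θ Ξ h1 h2
    rw [← kreinForm_add_right h1.finAmp (f h2) (f' h2),
      ← kreinForm_add_right h1.finAmp ((f h2).add (f' h2)) (g h2),
      ← kreinForm_add_right h1.finAmp (((f h2).add (f' h2)).add (g h2)) (g' h2)]
    rfl
  have h1 : ∀ {Θ Ξ : Amp r}, CoreAmp m Θ → CoreAmp m Ξ → IsSymAmp Θ → IsSymAmp Ξ →
      kreinForm m Θ (termAb Ξ) = conj (kreinForm m Ξ (termAc Θ)) := by
    intro Θ Ξ h1 h2 h3 h4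
    rw [kreinForm_termAc h2 h1 h4 h3, kreinForm_conj (f' h2) h1.finAmp]
  have h2 : ∀ {Θ Ξ : Amp r}, CoreAmp m Θ → CoreAmp m Ξ → IsSymAmp Θ → IsSymAmp Ξ →
      kreinForm m Θ (termab m Ξ) = conj (kreinForm m Ξ (termac m Θ)) := by
    intro Θ Ξ h1 h2 h3 h4
    rw [kreinForm_termac h2 h1 h4 h3, kreinForm_conj (g' h2) h1.finAmp]
  have h3 : FinAmp m (superchargeAmp m Φ) := (tameOp_superchargeAmp m).finAmp hΦ
  rw [← kreinForm_conj hΨ.finAmp h3, e hΦ hΨ, e hΨ hΦ, h1 hΦ hΨ sΦ sΨ, h2 hΦ hΨ sΦ sΨ,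
    h1 hΨ hΦ sΨ sΦ, h2 hΨ hΦ sΨ sΦ]
  simp only [map_add, Complex.conj_conj]
  ring

theorem CoreAmp.congr {Ψ Ψ' : Amp r} (h : CoreAmp m Ψ) (he : AmpEq m Ψ Ψ') : CoreAmp m Ψ' where
  memLp n w l s := (h.memLp n w l s).ae_eq (he n w l s)
  sym := by
    obtain ⟨Θ, h1, h2⟩ := h.sym
    exact ⟨Θ, h1, he.symm.trans h2⟩
  fin := by
    obtain ⟨N, hN⟩ := h.fin
    exact ⟨N, fun n w l s hl => (he n w l s).symm.trans (hN n w l s hl)⟩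
  bdd := by
    obtain ⟨R, hR⟩ := h.bdd
    refine ⟨R, fun n w l s => ?_⟩
    filter_upwards [hR n w l s, he n w l s] with x h1 h2
    rw [← h2]
    exact h1

theorem IsSupercharge.ampEq {Q : core m →ₗ[ℂ] core m} (hQ : IsSupercharge m Q) (Φ : core m)
    {Φ' : Amp r} (h : AmpEq m (amp (Φ : GhostSpace m)) Φ') :
    AmpEq m (amp (Q Φ : GhostSpace m)) (superchargeAmp m Φ') :=
  AmpEq.trans (fun n w l s => hQ Φ n w l s) ((ampOp_superchargeAmp m).congr _ _ h)

theorem CoreAmp.exists_isSymAmp {Ψ : Amp r} (h : CoreAmp m Ψ) :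
    ∃ Ψ', AmpEq m Ψ Ψ' ∧ CoreAmp m Ψ' ∧ IsSymAmp Ψ' := by
  obtain ⟨Ψ', h1, h2⟩ := h.sym
  exact ⟨Ψ', h2, h.congr h2, h1⟩


theorem IsSupercharge.krein_symm_of_ampEq {Q : core m →ₗ[ℂ] core m} (hQ : IsSupercharge m Q)
    (Φ Ψ : core m) {Φ' Ψ' : Amp r} (h : AmpEq m (amp (Φ : GhostSpace m)) Φ' ∧ CoreAmp m Φ' ∧
      IsSymAmp Φ') (h' : AmpEq m (amp (Ψ : GhostSpace m)) Ψ' ∧ CoreAmp m Ψ' ∧ IsSymAmp Ψ') :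
    krein (Φ : GhostSpace m) (Q Ψ : GhostSpace m) = krein (Q Φ : GhostSpace m) (Ψ : GhostSpace m) :=
  (kreinForm_congr h.1 (hQ.ampEq Ψ h'.1)).trans ((kreinForm_superchargeAmp h.2.1 h'.2.1 h.2.2
    h'.2.2).trans (kreinForm_congr (hQ.ampEq Φ h.1) h'.1).symm)

theorem IsSupercharge.krein_symm {Q : core m →ₗ[ℂ] core m} (hQ : IsSupercharge m Q) (Φ Ψ : core m) :
    krein (Φ : GhostSpace m) (Q Ψ : GhostSpace m) = krein (Q Φ : GhostSpace m) (Ψ : GhostSpace m) :=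
  (coreAmp_amp Φ).exists_isSymAmp.elim fun _ h => (coreAmp_amp Ψ).exists_isSymAmp.elim fun _ h' =>
    hQ.krein_symm_of_ampEq Φ Ψ h h'

theorem krein_add_right (Φ Ψ Ψ' : core m) : krein (Φ : GhostSpace m) ((Ψ + Ψ' : core m) : GhostSpace m) =
    krein (Φ : GhostSpace m) (Ψ : GhostSpace m) + krein (Φ : GhostSpace m) (Ψ' : GhostSpace m) :=
  (kreinForm_congr (AmpEq.refl _) fun n w l s => amp_add (Ψ : GhostSpace m) Ψ' n w l s).trans
    (kreinForm_add_right (coreAmp_amp Φ).finAmp (coreAmp_amp Ψ).finAmp (coreAmp_amp Ψ').finAmp)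

theorem krein_smul_right (c : ℂ) (Φ Ψ : core m) :
    krein (Φ : GhostSpace m) ((c • Ψ : core m) : GhostSpace m) =
      c * krein (Φ : GhostSpace m) (Ψ : GhostSpace m) :=
  (kreinForm_congr (AmpEq.refl _) fun n w l s => amp_smul c (Ψ : GhostSpace m) n w l s).trans
    (kreinForm_smul_right _ _ _)

theorem krein_conj (Φ Ψ : core m) : conj (krein (Φ : GhostSpace m) (Ψ : GhostSpace m)) =
    krein (Ψ : GhostSpace m) (Φ : GhostSpace m) :=
  kreinForm_conj (coreAmp_amp Φ).finAmp (coreAmp_amp Ψ).finAmp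

/-- Symmetry of Q moves it onto the cocycle. This is what makes the form well defined on cohomology.
-/
theorem krein_range (Q : core m →ₗ[ℂ] core m) (hQ : IsSupercharge m Q) {Φ : core m} (h : Q Φ = 0)
    (Ψ : core m) : krein (Φ : GhostSpace m) (Q Ψ : GhostSpace m) = 0 := by
  have h1 := hQ.krein_symm Φ Ψ
  rw [h1, h]
  refine (krein_conj _ _).symm.trans ?_
  have h2 := krein_smul_right 0 Ψ (0 : core m)
  rw [zero_mul, smul_zero] at h2
  rw [h2, map_zero]

end SuperchargeAdjoint

/-! ## Lorentz invariance of the measure on the mass shells -/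

section Lorentz

open Matrix

/-- `Mᵀ η M = η` and `M₀₀ > 0`. -/
structure IsOrthochronous (M : Matrix (Fin 4) (Fin 4) ℝ) : Prop where
  lorentz : Mᵀ * Matrix.diagonal eta * M = Matrix.diagonal eta
  pos : 0 < M 0 0

/-- `η Mᵀ η`, the inverse of a Lorentz matrix. -/
def lorentzInv (M : Matrix (Fin 4) (Fin 4) ℝ) : Matrix (Fin 4) (Fin 4) ℝ :=
  Matrix.diagonal eta * Mᵀ * Matrix.diagonal eta

theorem eta_mul_eta (μ : Fin 4) : eta μ * eta μ = 1 := by exact_mod_cast eta_mul_self μ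

theorem diagonal_eta_mul_self : Matrix.diagonal eta * Matrix.diagonal eta = 1 := by
  rw [Matrix.diagonal_mul_diagonal, ← Matrix.diagonal_one]
  congr 1
  funext μ
  exact eta_mul_eta μ

theorem lorentzInv_apply (M : Matrix (Fin 4) (Fin 4) ℝ) (μ ν : Fin 4) :
    lorentzInv M μ ν = eta μ * M ν μ * eta ν := by
  rw [lorentzInv, Matrix.mul_diagonal, Matrix.diagonal_mul, Matrix.transpose_apply]

theorem lorentzInv_mul {M : Matrix (Fin 4) (Fin 4) ℝ}
    (h : Mᵀ * Matrix.diagonal eta * M = Matrix.diagonal eta) : lorentzInv M * M = 1 := by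
  rw [lorentzInv, Matrix.mul_assoc, Matrix.mul_assoc, ← Matrix.mul_assoc Mᵀ, h,
    diagonal_eta_mul_self]

theorem mul_lorentzInv {M : Matrix (Fin 4) (Fin 4) ℝ}
    (h : Mᵀ * Matrix.diagonal eta * M = Matrix.diagonal eta) : M * lorentzInv M = 1 :=
  mul_eq_one_comm.1 (lorentzInv_mul h)

theorem lorentz_lorentzInv {M : Matrix (Fin 4) (Fin 4) ℝ}
    (h : Mᵀ * Matrix.diagonal eta * M = Matrix.diagonal eta) :
    (lorentzInv M)ᵀ * Matrix.diagonal eta * lorentzInv M = Matrix.diagonal eta := by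
  have h1 : (lorentzInv M)ᵀ = Matrix.diagonal eta * M * Matrix.diagonal eta := by
    simp [lorentzInv, Matrix.transpose_mul, Matrix.mul_assoc]
  rw [h1]
  simp only [Matrix.mul_assoc]
  rw [← Matrix.mul_assoc (Matrix.diagonal eta) (Matrix.diagonal eta) (lorentzInv M),
    diagonal_eta_mul_self, Matrix.one_mul, mul_lorentzInv h, Matrix.mul_one]

theorem sum_eta_mul {M : Matrix (Fin 4) (Fin 4) ℝ}
    (h : Mᵀ * Matrix.diagonal eta * M = Matrix.diagonal eta) (ν ν' : Fin 4) :
    ∑ μ, eta μ * M μ ν * M μ ν' = if ν = ν' then eta ν else 0 := by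
  have h1 := congrFun (congrFun h ν) ν'
  rw [Matrix.mul_apply, Matrix.diagonal_apply] at h1
  rw [← h1]
  refine Finset.sum_congr rfl fun μ _ => ?_
  rw [Matrix.mul_diagonal, Matrix.transpose_apply]
  ring

/-- The defining relation controls columns. For rows it is applied to the inverse η Mᵀ η, which is
again a Lorentz matrix. -/
theorem lorentz_row {M : Matrix (Fin 4) (Fin 4) ℝ}
    (h : Mᵀ * Matrix.diagonal eta * M = Matrix.diagonal eta) :
    M 0 0 ^ 2 = 1 + ∑ i : Fin 3, M 0 i.succ ^ 2 := by
  have h1 := sum_eta_mul (lorentz_lorentzInv h) 0 0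
  simp only [lorentzInv_apply, Fin.sum_univ_succ (n := 3), Fin.sum_univ_three, if_true] at h1
  simp only [eta, Fin.succ_ne_zero, if_true, if_false] at h1
  simp only [Fin.sum_univ_three]
  linarith

theorem mink_mulVec {M : Matrix (Fin 4) (Fin 4) ℝ}
    (h : Mᵀ * Matrix.diagonal eta * M = Matrix.diagonal eta) (p q : Mom) :
    mink (M *ᵥ p) (M *ᵥ q) = mink p q := by
  have h1 : ∀ p q : Mom, mink p q = p ⬝ᵥ (Matrix.diagonal eta *ᵥ q) := by
    intro p q
    simp only [mink, dotProduct, Matrix.mulVec_diagonal]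
    exact Finset.sum_congr rfl fun μ _ => by ring
  rw [h1, h1, Matrix.mulVec_mulVec, Matrix.dotProduct_mulVec, Matrix.vecMul_mulVec,
    ← Matrix.dotProduct_mulVec, ← Matrix.mul_assoc, h]

/-- By Cauchy–Schwarz the spatial part of (Mp)⁰ has square at most (M₀₀² - 1)|𝐩|², which is below
(M₀₀ p⁰)² for timelike p. Its sign therefore cannot prevail. -/
theorem IsOrthochronous.mulVec_pos {M : Matrix (Fin 4) (Fin 4) ℝ} (hM : IsOrthochronous M) {p : Mom}
    (hp : ∑ i : Fin 3, p i.succ ^ 2 < p 0 ^ 2) (h0 : 0 < p 0) : 0 < (M *ᵥ p) 0 := by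
  have h1 := lorentz_row hM.lorentz
  have h2 := Finset.sum_mul_sq_le_sq_mul_sq Finset.univ (fun i : Fin 3 => M 0 i.succ)
    (fun i => p i.succ)
  have h3 : (M *ᵥ p) 0 = M 0 0 * p 0 + ∑ i : Fin 3, M 0 i.succ * p i.succ := by
    simp only [Matrix.mulVec, dotProduct, Fin.sum_univ_succ (n := 3)]
  set S := ∑ i : Fin 3, M 0 i.succ * p i.succ
  set A := ∑ i : Fin 3, M 0 i.succ ^ 2
  set B := ∑ i : Fin 3, p i.succ ^ 2
  have hA : 0 ≤ A := Finset.sum_nonneg fun _ _ => sq_nonneg _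
  have hB : 0 ≤ B := Finset.sum_nonneg fun _ _ => sq_nonneg _
  have h4 : S ^ 2 < (M 0 0 * p 0) ^ 2 := by
    rw [mul_pow, h1]
    nlinarith
  have h5 := abs_lt_of_sq_lt_sq h4 (mul_pos hM.pos h0).le
  rw [h3]
  linarith [(abs_lt.1 h5).1]

theorem shell_sum_lt {μ : ℝ} (hμ : 0 < μ) {p : Mom} (hp : p ∈ shell μ) :
    ∑ i : Fin 3, p i.succ ^ 2 < p 0 ^ 2 := by
  have h1 := hp.1
  rw [mink_self] at h1
  simp only [Fin.sum_univ_succ, Fin.sum_univ_zero]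
  change p 1 ^ 2 + (p 2 ^ 2 + (p 3 ^ 2 + 0)) < _
  nlinarith [pow_pos hμ 2]

theorem IsOrthochronous.mulVec_mem_shell {M : Matrix (Fin 4) (Fin 4) ℝ} (hM : IsOrthochronous M)
    {μ : ℝ} (hμ : 0 < μ) {p : Mom} (hp : p ∈ shell μ) : M *ᵥ p ∈ shell μ :=
  ⟨by rw [mink_mulVec hM.lorentz, hp.1], hM.mulVec_pos (shell_sum_lt hμ hp) hp.2⟩

theorem energy_pos {μ : ℝ} (hμ : 0 < μ) (v : Fin 3 → ℝ) : 0 < energy μ v :=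
  Real.sqrt_pos.2 (by positivity)

theorem energy_sq (μ : ℝ) (v : Fin 3 → ℝ) : energy μ v ^ 2 = μ ^ 2 + ∑ i, v i ^ 2 :=
  Real.sq_sqrt (by positivity)

theorem shellPoint_mem {μ : ℝ} (hμ : 0 < μ) (v : Fin 3 → ℝ) : shellPoint μ v ∈ shell μ := by
  refine ⟨?_, energy_pos hμ v⟩
  rw [mink_self]
  have := energy_sq μ v
  rw [Fin.sum_univ_three] at this
  change energy μ v ^ 2 - v 0 ^ 2 - v 1 ^ 2 - v 2 ^ 2 = μ ^ 2
  linarith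

theorem shellPoint_tail {μ : ℝ} {p : Mom} (hp : p ∈ shell μ) :
    shellPoint μ (fun i => p i.succ) = p := by
  have h : energy μ (fun i => p i.succ) = p 0 := by
    have h1 := hp.1
    rw [mink_self] at h1
    rw [energy, Real.sqrt_eq_iff_mul_self_eq (by positivity) hp.2.le, Fin.sum_univ_three]
    change μ ^ 2 + (p 1 ^ 2 + p 2 ^ 2 + p 3 ^ 2) = p 0 * p 0
    linarith
  rw [shellPoint, h]
  exact Fin.cons_self_tail p

/-- The action of a Lorentz matrix on the spatial momenta. -/
def spatial (M : Matrix (Fin 4) (Fin 4) ℝ) (μ : ℝ) (v : Fin 3 → ℝ) : Fin 3 → ℝ :=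
  fun i => (M *ᵥ shellPoint μ v) i.succ

theorem IsOrthochronous.shellPoint_spatial {M : Matrix (Fin 4) (Fin 4) ℝ} (hM : IsOrthochronous M)
    {μ : ℝ} (hμ : 0 < μ) (v : Fin 3 → ℝ) : shellPoint μ (spatial M μ v) = M *ᵥ shellPoint μ v :=
  shellPoint_tail (hM.mulVec_mem_shell hμ (shellPoint_mem hμ v))

theorem IsOrthochronous.inv {M : Matrix (Fin 4) (Fin 4) ℝ} (hM : IsOrthochronous M) :
    IsOrthochronous (lorentzInv M) :=
  ⟨lorentz_lorentzInv hM.lorentz, by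
    rw [lorentzInv_apply, eta_values.1, one_mul, mul_one]; exact hM.pos⟩

theorem tail_shellPoint (μ : ℝ) (v : Fin 3 → ℝ) : (fun i : Fin 3 => shellPoint μ v i.succ) = v := rfl

theorem IsOrthochronous.spatial_inv {M : Matrix (Fin 4) (Fin 4) ℝ} (hM : IsOrthochronous M)
    {μ : ℝ} (hμ : 0 < μ) (v : Fin 3 → ℝ) : spatial (lorentzInv M) μ (spatial M μ v) = v := by
  unfold spatial
  rw [show (fun i : Fin 3 => (M *ᵥ shellPoint μ v) i.succ) = spatial M μ v from rfl,
    hM.shellPoint_spatial hμ, Matrix.mulVec_mulVec, lorentzInv_mul hM.lorentz, Matrix.one_mulVec,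
    tail_shellPoint]

theorem lorentzInv_lorentzInv (M : Matrix (Fin 4) (Fin 4) ℝ) : lorentzInv (lorentzInv M) = M := by
  ext μ ν
  rw [lorentzInv_apply, lorentzInv_apply]
  linear_combination (M μ ν) * (eta_mul_eta ν * eta μ * eta μ + eta_mul_eta μ)

/-- The matrix of the derivative of `spatial`. -/
def spatialDeriv (M : Matrix (Fin 4) (Fin 4) ℝ) (μ : ℝ) (v : Fin 3 → ℝ) :
    Matrix (Fin 3) (Fin 3) ℝ :=
  Matrix.of fun i j => M i.succ 0 * (v j / energy μ v) + M i.succ j.succ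

theorem hasFDerivAt_energy {μ : ℝ} (hμ : 0 < μ) (v : Fin 3 → ℝ) :
    HasFDerivAt (energy μ) (∑ j : Fin 3, (v j / energy μ v) •
      (ContinuousLinearMap.proj j : (Fin 3 → ℝ) →L[ℝ] ℝ)) v := by
  have h1 : HasFDerivAt (fun v : Fin 3 → ℝ => μ ^ 2 + ∑ i, v i ^ 2)
      (∑ j : Fin 3, (2 * v j) • (ContinuousLinearMap.proj j : (Fin 3 → ℝ) →L[ℝ] ℝ)) v := by
    refine HasFDerivAt.const_add _ (HasFDerivAt.fun_sum fun j _ => ?_)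
    have := (hasFDerivAt_apply (𝕜 := ℝ) j v).pow 2
    simpa using this
  have h2 := h1.sqrt (by positivity)
  refine h2.congr_fderiv ?_
  rw [Finset.smul_sum]
  refine Finset.sum_congr rfl fun j _ => ?_
  rw [smul_smul]
  congr 1
  change 1 / (2 * energy μ v) * (2 * v j) = _
  field_simp [(energy_pos hμ v).ne']

theorem spatial_apply (M : Matrix (Fin 4) (Fin 4) ℝ) (μ : ℝ) (v : Fin 3 → ℝ) (i : Fin 3) :
    spatial M μ v i = M i.succ 0 * energy μ v + ∑ j : Fin 3, M i.succ j.succ * v j := by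
  simp only [spatial, Matrix.mulVec, dotProduct, Fin.sum_univ_succ (n := 3)]
  rfl

theorem hasFDerivAt_spatial (M : Matrix (Fin 4) (Fin 4) ℝ) {μ : ℝ} (hμ : 0 < μ) (v : Fin 3 → ℝ) :
    HasFDerivAt (spatial M μ)
      (LinearMap.toContinuousLinearMap (Matrix.toLin' (spatialDeriv M μ v))) v := by
  rw [hasFDerivAt_pi']
  intro i
  have h1 : HasFDerivAt (fun v : Fin 3 → ℝ => M i.succ 0 * energy μ v +
      ∑ j : Fin 3, M i.succ j.succ * v j)
      (M i.succ 0 • (∑ j : Fin 3, (v j / energy μ v) •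
        (ContinuousLinearMap.proj j : (Fin 3 → ℝ) →L[ℝ] ℝ)) +
      ∑ j : Fin 3, M i.succ j.succ • (ContinuousLinearMap.proj j : (Fin 3 → ℝ) →L[ℝ] ℝ)) v :=
    ((hasFDerivAt_energy hμ v).const_mul _).add
      (HasFDerivAt.fun_sum fun j _ => (hasFDerivAt_apply (𝕜 := ℝ) j v).const_mul _)
  have h2 : (fun v => spatial M μ v i) = fun v : Fin 3 → ℝ => M i.succ 0 * energy μ v +
      ∑ j : Fin 3, M i.succ j.succ * v j := funext fun v => spatial_apply M μ v i
  rw [h2]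
  refine h1.congr_fderiv (ContinuousLinearMap.ext fun x => ?_)
  simp [spatialDeriv, Matrix.mulVec, dotProduct, add_mul, Finset.sum_add_distrib, Finset.mul_sum,
    mul_assoc]

/-- The Jacobian matrix is the spatial minor of MN, where the shear N carries dω = Σ (v_j/ω) dv_j in
its first row. Its determinant is the (0,0) entry of adj(N) adj(M), and adj(M) = det(M) M⁻¹ with M⁻¹
= η Mᵀ η. The entry comes out as det(M) (M₀₀ + Σ_j M₀ⱼ v_j/ω), and |det M| = 1. -/
theorem IsOrthochronous.abs_det_spatialDeriv {M : Matrix (Fin 4) (Fin 4) ℝ}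
    (hM : IsOrthochronous M) {μ : ℝ} (hμ : 0 < μ) (v : Fin 3 → ℝ) :
    |(spatialDeriv M μ v).det| = energy μ (spatial M μ v) / energy μ v := by
  set w : Fin 3 → ℝ := fun j => v j / energy μ v with hw
  set N : Matrix (Fin 4) (Fin 4) ℝ := !![1, w 0, w 1, w 2; 0, 1, 0, 0; 0, 0, 1, 0; 0, 0, 0, 1]
    with hN
  set N' : Matrix (Fin 4) (Fin 4) ℝ := !![1, -w 0, -w 1, -w 2; 0, 1, 0, 0; 0, 0, 1, 0; 0, 0, 0, 1]
    with hN'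
  have h1 : N * N' = 1 := by
    ext i j
    fin_cases i <;> fin_cases j <;> simp [hN, hN', Matrix.mul_apply, Fin.sum_univ_four]
  have h2 : N.det = 1 := by
    simp [hN, Matrix.det_succ_row_zero, Fin.sum_univ_succ]
  have h3 : N.adjugate = N' := by
    rw [← Matrix.mul_one N.adjugate, ← h1, ← Matrix.mul_assoc, Matrix.adjugate_mul, h2, one_smul,
      Matrix.one_mul]
  have h4 : M.adjugate = M.det • lorentzInv M := by
    rw [← Matrix.mul_one M.adjugate, ← mul_lorentzInv hM.lorentz, ← Matrix.mul_assoc,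
      Matrix.adjugate_mul, Matrix.smul_mul, Matrix.one_mul]
  have h5 : spatialDeriv M μ v = (M * N).submatrix (Fin.succAbove 0) (Fin.succAbove 0) := by
    ext i j
    fin_cases j <;>
      simp [spatialDeriv, hN, Matrix.mul_apply, Fin.sum_univ_four, hw]
  have h6 : (spatialDeriv M μ v).det = (M * N).adjugate 0 0 := by
    rw [Matrix.adjugate_fin_succ_eq_det_submatrix, h5]
    simp
  have h7 : |M.det| = 1 := by
    have := congrArg Matrix.det hM.lorentz
    rw [Matrix.det_mul, Matrix.det_mul, Matrix.det_transpose] at this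
    have he : (Matrix.diagonal eta).det ≠ 0 := by
      rw [Matrix.det_diagonal, Fin.prod_univ_four]
      obtain ⟨e0, e1, e2, e3⟩ := eta_values
      rw [e0, e1, e2, e3]; norm_num
    have h8 : M.det ^ 2 = 1 := by
      refine mul_right_cancel₀ he ?_
      linear_combination this
    rw [← sq_eq_sq₀ (abs_nonneg _) zero_le_one, sq_abs, h8, one_pow]
  have h8 := hM.shellPoint_spatial hμ v
  have h9 : energy μ (spatial M μ v) = M 0 0 * energy μ v + ∑ j : Fin 3, M 0 j.succ * v j := by
    have := congrFun h8 0
    simp only [Matrix.mulVec, dotProduct, Fin.sum_univ_succ (n := 3)] at this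
    exact this
  have h10 : (spatialDeriv M μ v).det = M.det * (energy μ (spatial M μ v) / energy μ v) := by
    rw [h6, Matrix.adjugate_mul_distrib, h3, h4, Matrix.mul_smul, Matrix.smul_apply, smul_eq_mul,
      Matrix.mul_apply, h9]
    have := (energy_pos hμ v).ne'
    obtain ⟨e0, e1, e2, e3⟩ := eta_values
    simp only [lorentzInv_apply, Fin.sum_univ_four, Fin.sum_univ_three, e0, e1, e2, e3]
    simp [hN', hw]
    field_simp
    exact Or.inl (by ring)
  rw [h10, abs_mul, h7, one_mul, abs_of_pos (div_pos (energy_pos hμ _) (energy_pos hμ _))]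

/-- In spatial coordinates M acts bijectively with Jacobian ω(Mv)/ω(v), and this quotient is
compensated by the density 1/2ω. -/
theorem IsOrthochronous.measurePreserving_shell {M : Matrix (Fin 4) (Fin 4) ℝ}
    (hM : IsOrthochronous M) {μ : ℝ} (hμ : 0 < μ) :
    MeasurePreserving (fun p : Mom => M *ᵥ p) (shellMeasure μ) (shellMeasure μ) := by
  have hmeas : Measurable fun p : Mom => M *ᵥ p := by
    refine measurable_pi_iff.2 fun i => ?_
    simp only [Matrix.mulVec, dotProduct]
    fun_prop
  refine ⟨hmeas, ?_⟩
  have hS : Measurable (spatial M μ) :=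
    measurable_pi_iff.2 fun i => (measurable_pi_apply _).comp (hmeas.comp (measurable_shellPoint μ))
  have hinj : Function.Injective (spatial M μ) :=
    Function.LeftInverse.injective (hM.spatial_inv hμ)
  have hsurj : Function.Surjective (spatial M μ) := fun v => ⟨spatial (lorentzInv M) μ v, by
    have := hM.inv.spatial_inv hμ v
    rwa [lorentzInv_lorentzInv] at this⟩
  have h1 := map_withDensity_abs_det_fderiv_eq_addHaar (μ := (volume : Measure (Fin 3 → ℝ)))
    MeasurableSet.univ.nullMeasurableSet
    (fun v _ => (hasFDerivAt_spatial M hμ v).hasFDerivWithinAt) hinj.injOn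
  rw [Set.image_univ, hsurj.range_eq, Measure.restrict_univ] at h1
  have hD : (fun v => ENNReal.ofReal
      |(LinearMap.toContinuousLinearMap (Matrix.toLin' (spatialDeriv M μ v))).det|) =
      fun v => ENNReal.ofReal (energy μ (spatial M μ v) / energy μ v) := by
    funext v
    rw [LinearMap.det_toContinuousLinearMap, LinearMap.det_toLin', hM.abs_det_spatialDeriv hμ]
  rw [hD] at h1
  have hE := measurable_energy μ
  have hk : Measurable fun v : Fin 3 → ℝ => ENNReal.ofReal (1 / (2 * energy μ v)) := by fun_prop
  have hk' : Measurable fun v => ENNReal.ofReal (1 / (2 * energy μ (spatial M μ v))) := hk.comp hS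
  have hd : Measurable fun v => ENNReal.ofReal (energy μ (spatial M μ v) / energy μ v) :=
    ((hE.comp hS).div hE).ennreal_ofReal
  have h2 : (fun p : Mom => M *ᵥ p) ∘ shellPoint μ = shellPoint μ ∘ spatial M μ :=
    funext fun v => (hM.shellPoint_spatial hμ v).symm
  unfold shellMeasure
  rw [Measure.map_map hmeas (measurable_shellPoint μ), h2,
    ← Measure.map_map (measurable_shellPoint μ) hS]
  congr 1
  ext s hs
  rw [Measure.map_apply hS hs, withDensity_apply _ (hS hs), withDensity_apply _ hs]
  conv_rhs => rw [← h1]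
  rw [setLIntegral_map hs hk hS, restrict_withDensity (hS hs),
    lintegral_withDensity_eq_lintegral_mul _ hd hk']
  refine lintegral_congr fun v => ?_
  rw [Pi.mul_apply, ← ENNReal.ofReal_mul (div_nonneg (energy_pos hμ _).le (energy_pos hμ _).le)]
  congr 1
  have h3 := (energy_pos hμ v).ne'
  have h4 := (energy_pos hμ (spatial M μ v)).ne'
  field_simp

end Lorentz

/-! ### The Poincaré action on the space with ghosts -/

section PoincareAction

open Matrix

variable {r : ℕ} (g : Poincare)

namespace Poincare

theorem isConjOrId : IsConjOrId g.conjIfReversing := by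
  unfold conjIfReversing
  split_ifs
  · exact Or.inl rfl
  · exact Or.inr rfl

theorem sgn_mul_self : g.sgn * g.sgn = 1 := by
  unfold sgn
  split_ifs <;> norm_num

theorem conj_ofReal (x : ℝ) : g.conjIfReversing (x : ℂ) = x := by
  unfold conjIfReversing
  split_ifs
  · rfl
  · exact Complex.conj_ofReal x

/-- Explains the sign of b and c under time reversal: it compensates the conjugation of the factor i
in the mass terms of the supercharge. -/
theorem sgn_mul_conj_I : (g.sgn : ℂ) * g.conjIfReversing Complex.I = Complex.I := by
  unfold conjIfReversing sgn
  split_ifs <;> simp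

/-- The matrix of `pull`. -/
def pullMatrix : Matrix (Fin 4) (Fin 4) ℝ := g.sgn • lorentzInv g.L

theorem inv_eq : g.L⁻¹ = lorentzInv g.L :=
  Matrix.inv_eq_left_inv (lorentzInv_mul g.isLorentz)

theorem pull_eq (y : Scal r) : g.pull y = (y.1, g.pullMatrix *ᵥ y.2) := by
  rw [pull, pullMatrix, inv_eq, Matrix.smul_mulVec]

theorem isOrthochronous : IsOrthochronous g.pullMatrix := by
  refine ⟨?_, ?_⟩
  · rw [pullMatrix, Matrix.transpose_smul, Matrix.smul_mul, Matrix.smul_mul, Matrix.mul_smul,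
      lorentz_lorentzInv g.isLorentz, smul_smul, sgn_mul_self, one_smul]
  · have h := lorentz_row g.isLorentz
    have h1 : g.L 0 0 ≠ 0 := by
      intro h0
      rw [h0] at h
      have : 0 ≤ ∑ i : Fin 3, g.L 0 i.succ ^ 2 := Finset.sum_nonneg fun _ _ => sq_nonneg _
      linarith
    rw [pullMatrix, Matrix.smul_apply, smul_eq_mul, lorentzInv_apply, eta_values.1, one_mul, mul_one,
      sgn]
    split_ifs with h2
    · rwa [one_mul]
    · rw [neg_one_mul, neg_pos]
      exact lt_of_le_of_ne (not_lt.1 h2) h1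

theorem measurable_pull : Measurable (g.pull (r := r)) := by
  have h : Measurable fun p : Mom => g.pullMatrix *ᵥ p := by
    refine measurable_pi_iff.2 fun i => ?_
    simp only [Matrix.mulVec, dotProduct]
    fun_prop
  rw [show g.pull (r := r) = fun y => (y.1, g.pullMatrix *ᵥ y.2) from funext g.pull_eq]
  exact measurable_fst.prodMk (h.comp measurable_snd)

theorem measurePreserving_pull {m : Fin r → ℝ} (hm : ∀ a, 0 < m a) :
    MeasurePreserving g.pull (scalMeasure m) (scalMeasure m) := by
  refine ⟨g.measurable_pull, ?_⟩
  unfold scalMeasure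
  rw [Measure.map_sum g.measurable_pull.aemeasurable]
  congr 1
  funext a
  have h := g.isOrthochronous.measurePreserving_shell (hm a)
  rw [Measure.map_map g.measurable_pull measurable_prodMk_left]
  conv_rhs => rw [← h.map_eq, Measure.map_map measurable_prodMk_left h.measurable]
  congr 1
  funext p
  exact g.pull_eq (a, p)

theorem norm_phase (p : Mom) : ‖g.phase p‖ = 1 := by
  rw [phase, mul_comm, Complex.norm_exp_ofReal_mul_I]

theorem measurable_phase : Measurable g.phase := by
  unfold phase mink
  fun_prop

/-- The constant is the norm of the inverse matrix. Momentum supports grow at most by this factor,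
so bounded supports stay bounded. -/
theorem exists_norm_le_pull : ∃ C : ℝ, ∀ (R : ℝ) (y : Scal r), ‖(g.pull y).2‖ ≤ R → ‖y.2‖ ≤ C * R := by
  refine ⟨‖LinearMap.toContinuousLinearMap (Matrix.toLin' (lorentzInv g.pullMatrix))‖,
    fun R y h => ?_⟩
  have h1 := (LinearMap.toContinuousLinearMap
    (Matrix.toLin' (lorentzInv g.pullMatrix))).le_opNorm (g.pull y).2
  rw [LinearMap.coe_toContinuousLinearMap', Matrix.toLin'_apply, pull_eq, Matrix.mulVec_mulVec,
    lorentzInv_mul g.isOrthochronous.lorentz, Matrix.one_mulVec] at h1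
  rw [pull_eq] at h
  exact h1.trans (mul_le_mul_of_nonneg_left h (norm_nonneg _))

theorem sum_cov_pull (y : Scal r) (μ : Fin 4) :
    ∑ ν, g.cov μ ν * (eta ν * (g.pull y).2 ν) = g.sgn * (eta μ * y.2 μ) := by
  have h : g.L *ᵥ (g.pull y).2 = g.sgn • y.2 := by
    rw [pull_eq, pullMatrix, Matrix.mulVec_mulVec, Matrix.mul_smul, mul_lorentzInv g.isLorentz,
      Matrix.smul_mulVec, Matrix.one_mulVec]
  have h1 := congrFun h μ
  simp only [Matrix.mulVec, dotProduct, Pi.smul_apply, smul_eq_mul] at h1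
  calc _ = eta μ * ∑ ν, g.L μ ν * (g.pull y).2 ν := by
        rw [Finset.mul_sum]
        refine Finset.sum_congr rfl fun ν _ => ?_
        rw [cov]
        linear_combination (eta μ * g.L μ ν * (g.pull y).2 ν) * eta_mul_eta ν
    _ = _ := by rw [h1]; ring

/-- Contraction with the momentum is covariant up to the sign of time reversal. This preserves
transversality and, together with the lowered version above, yields commutation with Q. -/
theorem sum_mul_cov (y : Scal r) (ν : Fin 4) :
    ∑ μ, y.2 μ * g.cov μ ν = g.sgn * (g.pull y).2 ν := by
  rw [pull_eq, pullMatrix, Matrix.smul_mulVec]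
  simp only [Pi.smul_apply, smul_eq_mul]
  rw [← mul_assoc, sgn_mul_self, one_mul]
  simp only [Matrix.mulVec, dotProduct]
  refine Finset.sum_congr rfl fun μ _ => ?_
  rw [lorentzInv_apply, cov]
  ring

theorem sum_eta_cov_cov (ν ν' : Fin 4) :
    ∑ μ, eta μ * g.cov μ ν * g.cov μ ν' = if ν = ν' then eta ν else 0 := by
  have h := sum_eta_mul g.isLorentz ν ν'
  have h1 : ∑ μ, eta μ * g.cov μ ν * g.cov μ ν' =
      eta ν * eta ν' * ∑ μ, eta μ * g.L μ ν * g.L μ ν' := by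
    rw [Finset.mul_sum]
    refine Finset.sum_congr rfl fun μ _ => ?_
    rw [cov, cov]
    linear_combination (eta ν * eta ν' * g.L μ ν * g.L μ ν' * eta μ) * eta_mul_eta μ
  rw [h1, h]
  split_ifs with h2
  · subst h2
    linear_combination eta ν * eta_mul_eta ν
  · rw [mul_zero]

end Poincare

open Finsupp (linearCombination single)

theorem gamma_block_sum {σ : ℂ →+* ℂ} {u : OneKernel r} {α ι : Type} [Fintype ι]
    {ℓ : α → Letter r} {ℓ' : ι → α → Letter r} {c : ι → α → ℂ}
    (h : ∀ x, u (ℓ x) = ∑ ν, single (ℓ' ν x) (c ν x)) {n : ℕ} (K : Fin n → α) (t : List (Letter r))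
    (F : WordFn r) : gamma σ u F (List.ofFn (ℓ ∘ K) ++ t) = ∑ ν : Fin n → ι,
      (∏ i, c (ν i) (K i)) * gamma σ u (fun v => F (List.ofFn (fun i => ℓ' (ν i) (K i)) ++ v)) t := by
  induction n generalizing F with
  | zero => simp
  | succ n ih =>
    rw [show List.ofFn (ℓ ∘ K) = ℓ (K 0) :: List.ofFn (ℓ ∘ Fin.tail K) by rw [List.ofFn_succ]; rfl,
      List.cons_append, gamma_cons, h, map_sum,
      ← (Fin.consEquiv fun _ : Fin (n + 1) => ι).sum_comp, Fintype.sum_prod_type]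
    refine Finset.sum_congr rfl fun ν _ => ?_
    rw [Finsupp.linearCombination_single, ih, smul_eq_mul, Finset.mul_sum]
    refine Finset.sum_congr rfl fun μ _ => ?_
    rw [Fin.prod_univ_succ, ← mul_assoc]
    simp only [List.ofFn_succ]
    rfl

/-- The kernel of the one-particle action. -/
def actionKernel (g : Poincare) : OneKernel r
  | .A z => ∑ ν : Fin 4, single (.A (ν, g.pull z.2)) (g.phase z.2.2 * (g.cov z.1 ν : ℂ))
  | .b y => single (.b (g.pull y)) (g.sgn * g.phase y.2)
  | .c y => single (.c (g.pull y)) (g.sgn * g.phase y.2)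
  | .a y => single (.a (g.pull y)) (g.phase y.2)

theorem isEven_actionKernel : IsEven (actionKernel (r := r) g) := by
  classical
  intro x y hy
  cases x with
  | A z =>
    obtain ⟨ν, -, h⟩ := Finset.mem_biUnion.1 (Finsupp.support_finsetSum hy)
    have := Finsupp.support_single_subset h
    rw [Finset.mem_singleton] at this
    subst this; rfl
  | _ =>
    have := Finsupp.support_single_subset hy
    rw [Finset.mem_singleton] at this
    subst this; rfl

theorem ghostAction_wordAmp (F : WordFn r) :
    ghostAction g (wordAmp F) = wordAmp (gamma g.conjIfReversing (actionKernel g) F) := by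
  funext n w l s ⟨K, P, Q, R⟩
  have h4 := fun F => gamma_block (σ := g.conjIfReversing) (u := actionKernel g) (ℓ := Letter.a)
    (ℓ' := fun y => Letter.a (g.pull y)) (c := fun y => g.phase y.2) (fun _ => rfl) R [] F
  simp only [List.append_nil] at h4
  simp only [ghostAction, wordAmp, Config.word]
  rw [gamma_block_sum (ℓ' := fun ν z => Letter.A (ν, g.pull z.2))
    (c := fun ν z => g.phase z.2.2 * (g.cov z.1 ν : ℂ)) (fun _ => rfl), Finset.mul_sum,
    Finset.mul_sum]
  refine Finset.sum_congr rfl fun ν _ => ?_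
  rw [gamma_block (ℓ' := fun y => Letter.b (g.pull y)) (c := fun y => g.sgn * g.phase y.2)
      (fun _ => rfl),
    gamma_block (ℓ' := fun y => Letter.c (g.pull y)) (c := fun y => g.sgn * g.phase y.2)
      (fun _ => rfl), h4, gamma_nil]
  simp only [Finset.prod_mul_distrib, Finset.prod_const, Finset.card_univ, Fintype.card_fin,
    List.append_nil, map_mul, g.conj_ofReal, pow_add]
  simp only [Function.comp_def]
  ring

theorem tameOp_ghostAction {m : Fin r → ℝ} (hm : ∀ a, 0 < m a) :
    ∃ C : ℝ, TameOp m g.conjIfReversing (fun R => C * R) (ghostAction (r := r) g) := by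
  obtain ⟨C, hC⟩ := g.exists_norm_le_pull (r := r)
  refine ⟨C, TameOp.of_isSumTerm g.isConjOrId fun n w l s => ?_⟩
  refine ⟨Fin n → Fin 4, inferInstance, n, w, l, s, fun ν x => (fun i => (ν i, g.pull (x.1 i).2),
      fun i => g.pull (x.2.1 i), fun i => g.pull (x.2.2.1 i), fun i => g.pull (x.2.2.2 i)),
    fun ν x => (g.sgn : ℂ) ^ (w + l) * ((∏ i, g.phase (x.1 i).2.2) * (∏ i, g.phase (x.2.1 i).2) *
      (∏ i, g.phase (x.2.2.1 i).2) * ∏ i, g.phase (x.2.2.2 i).2) *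
      (∏ i, (g.cov (x.1 i).1 (ν i) : ℂ)), fun ν => ?_, fun ν => ?_, fun ν R => ?_,
    fun ν R x h => ?_, le_rfl, fun Ψ x => ?_⟩
  · have hp := (g.measurePreserving_pull hm).bddMap
    exact (BddMap.pi fun i => (bddMap_mkVec m (ν i)).comp (hp.comp (bddMap_snd m))).prodMap
      ((BddMap.pi fun _ => hp).prodMap ((BddMap.pi fun _ => hp).prodMap (BddMap.pi fun _ => hp)))
  · have hph := g.measurable_phase
    have hcov : ∀ i, Measurable fun x : Config r n w l s => (g.cov (x.1 i).1 (ν i) : ℂ) := fun i =>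
      (measurable_from_top (f := fun μ => (g.cov μ (ν i) : ℂ))).comp (by fun_prop)
    refine Measurable.mul (Measurable.const_mul ?_ _) (Finset.measurable_fun_prod _ fun i _ => hcov i)
    refine Measurable.mul (Measurable.mul (Measurable.mul ?_ ?_) ?_) ?_ <;>
    · refine Finset.measurable_fun_prod _ fun i _ => hph.comp ?_
      fun_prop
  · refine ⟨|g.sgn| ^ (w + l) * ∑ μ : Fin n → Fin 4, ‖∏ i, (g.cov (μ i) (ν i) : ℂ)‖, fun x _ => ?_⟩
    simp only [norm_mul, norm_pow, norm_prod, g.norm_phase, Finset.prod_const_one, mul_one,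
      Complex.norm_real, Real.norm_eq_abs]
    refine mul_le_mul_of_nonneg_left ?_ (by positivity)
    exact Finset.single_le_sum (f := fun μ : Fin n → Fin 4 => ∏ i, |g.cov (μ i) (ν i)|)
      (fun _ _ => Finset.prod_nonneg fun _ _ => abs_nonneg _)
      (Finset.mem_univ fun i => (x.1 i).1)
  · exact ⟨fun i => hC _ _ (h.1 i), fun i => hC _ _ (h.2.1 i), fun i => hC _ _ (h.2.2.1 i),
      fun i => hC _ _ (h.2.2.2 i)⟩
  · simp only [ghostAction, Finset.mul_sum]
    refine Finset.sum_congr rfl fun ν _ => ?_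
    simp only [Function.comp_def]
    ring

theorem ampOp_ghostAction {m : Fin r → ℝ} (hm : ∀ a, 0 < m a) :
    AmpOp m g.conjIfReversing (ghostAction (r := r) g) := by
  obtain ⟨C, hC⟩ := tameOp_ghostAction g hm
  exact hC.ampOp (D := gamma g.conjIfReversing (actionKernel g)) fun F hF =>
    ⟨hF.gamma (isEven_actionKernel g), ghostAction_wordAmp g F⟩

variable {m : Fin r → ℝ}

theorem exists_ghostAction (hm : ∀ a, 0 < m a) :
    ∃ U : core m →ₛₗ[g.conjIfReversing] core m, IsGhostAction g U :=
  (ampOp_ghostAction g hm).exists_operator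

variable {g}

theorem IsGhostAction.represents (hm : ∀ a, 0 < m a) {U : core m →ₛₗ[g.conjIfReversing] core m}
    (hU : IsGhostAction g U) {F : WordFn r} {Φ : core m} (hF : Represents F Φ) :
    Represents (gamma g.conjIfReversing (actionKernel g) F) (U Φ) := by
  refine ⟨hF.1.gamma (isEven_actionKernel g), ?_⟩
  rw [← ghostAction_wordAmp g]
  exact AmpEq.trans (fun n w l s => hU Φ n w l s) ((ampOp_ghostAction g hm).congr _ _ hF.2)

/-- For A and for the vector part of c, the sign arising from the momentum matches the sign with
which b and c transform. In the mass terms the same sign matches the conjugation of i. -/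
theorem actionKernel_chargeKernel (m : Fin r → ℝ) (x : Letter r) :
    linearCombination ℂ (fun y => (chargeKernel m y).mapRange g.conjIfReversing (map_zero _))
      (actionKernel g x) = linearCombination ℂ (actionKernel g) (chargeKernel m x) := by
  have hs : (g.sgn : ℂ) * g.sgn = 1 := by exact_mod_cast g.sgn_mul_self
  have hI := g.sgn_mul_conj_I
  cases x with
  | A z =>
    simp only [actionKernel, chargeKernel, map_sum, Finsupp.linearCombination_single,
      Finsupp.mapRange_single, Finsupp.smul_single, smul_eq_mul, map_neg, g.conj_ofReal]
    rw [← Finsupp.single_finsetSum]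
    congr 1
    have h := g.sum_cov_pull z.2 z.1
    have h1 : ∑ ν, (g.cov z.1 ν : ℂ) * ((eta ν : ℂ) * ((g.pull z.2).2 ν : ℂ)) =
        (g.sgn : ℂ) * ((eta z.1 : ℂ) * (z.2.2 z.1 : ℂ)) := by exact_mod_cast h
    push_cast
    calc _ = -(g.phase z.2.2) * ∑ ν, (g.cov z.1 ν : ℂ) * ((eta ν : ℂ) * ((g.pull z.2).2 ν : ℂ)) := by
          rw [Finset.mul_sum]
          exact Finset.sum_congr rfl fun ν _ => by ring
      _ = _ := by rw [h1]; ring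
  | b y =>
    simp only [actionKernel, chargeKernel, Finsupp.linearCombination_single, Finsupp.mapRange_zero,
      smul_zero, map_zero]
  | c y =>
    have hadd : ∀ f h : Letter r →₀ ℂ, (f + h).mapRange g.conjIfReversing (map_zero _) =
        f.mapRange g.conjIfReversing (map_zero _) + h.mapRange g.conjIfReversing (map_zero _) :=
      fun f h => Finsupp.mapRange_add (map_add _) f h
    have hsum : ∀ f : Fin 4 → (Letter r →₀ ℂ),
        (∑ ν, f ν).mapRange g.conjIfReversing (map_zero _) =
          ∑ ν, (f ν).mapRange g.conjIfReversing (map_zero _) := fun f => by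
      simp only [Fin.sum_univ_four, hadd]
    simp only [actionKernel, chargeKernel, Finsupp.linearCombination_single, hadd, hsum,
      Finsupp.mapRange_single, smul_add, Finset.smul_sum, Finsupp.smul_single, smul_eq_mul, map_add,
      map_sum, map_mul, g.conj_ofReal]
    congr 1
    · rw [Finset.sum_comm]
      refine Finset.sum_congr rfl fun ν _ => ?_
      rw [← Finsupp.single_finsetSum]
      congr 1
      have h1 : ∑ μ, (y.2 μ : ℂ) * (g.cov μ ν : ℂ) = (g.sgn : ℂ) * ((g.pull y).2 ν : ℂ) := by
        exact_mod_cast g.sum_mul_cov y ν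
      calc _ = g.phase y.2 * ((g.sgn : ℂ) * ((g.pull y).2 ν : ℂ)) := by ring
        _ = _ := by
          rw [← h1, Finset.mul_sum]
          exact Finset.sum_congr rfl fun ν _ => by ring
    · rw [g.pull_eq]
      congr 1
      linear_combination (g.phase y.2 * (m y.1 : ℂ)) * hI
  | a y =>
    simp only [actionKernel, chargeKernel, Finsupp.linearCombination_single,
      Finsupp.mapRange_single, Finsupp.smul_single, smul_eq_mul, map_neg, map_mul, g.conj_ofReal]
    rw [g.pull_eq]
    congr 1
    linear_combination (-g.phase y.2 * (m y.1 : ℂ)) * (g.sgn * hI - g.conjIfReversing Complex.I * hs)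

theorem IsGhostAction.comm_supercharge (hm : ∀ a, 0 < m a)
    {U : core m →ₛₗ[g.conjIfReversing] core m} (hU : IsGhostAction g U) {Q : core m →ₗ[ℂ] core m}
    (hQ : IsSupercharge m Q) (Φ : core m) : U (Q Φ) = Q (U Φ) :=
  (exists_represents Φ).elim fun _ h => h.elim fun F hF =>
    (hU.represents hm (hQ.represents hF.1)).eq_of_shellEq (hQ.represents (hU.represents hm hF.1))
      fun w hw => gamma_der (isEven_actionKernel g) (fun x _ => actionKernel_chargeKernel m x) w hw F

/-- The exchange rescales by real functions of the species, which Poincaré transformations preserve,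
and b and c transform in the same way. -/
theorem flipAmp_ghostAction (Ψ : Amp r) :
    flipAmp m (ghostAction g Ψ) = ghostAction g (flipAmp m Ψ) := by
  funext n w l s x
  have h1 : ∀ {k : ℕ} (P : Fin k → Scal r) (i : Fin k), (g.pull (P i)).1 = (P i).1 := fun _ _ => rfl
  simp only [flipAmp, ghostAction, Function.comp_apply, h1, Finset.mul_sum, map_mul, map_pow,
    map_neg, map_one, map_prod, g.conj_ofReal]
  refine Finset.sum_congr rfl fun ν _ => ?_
  rw [add_comm l w]
  ring

theorem IsGhostAction.comm_flip (hm : ∀ a, 0 < m a)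
    {U : core m →ₛₗ[g.conjIfReversing] core m} (hU : IsGhostAction g U) {G : core m →ₗ[ℂ] core m}
    (hG : IsFlip m G) (Φ : core m) : U (G Φ) = G (U Φ) := by
  refine core_ext ?_
  have h1 : AmpEq m (amp (U (G Φ) : GhostSpace m)) (ghostAction g (flipAmp m (amp (Φ : GhostSpace m)))) :=
    AmpEq.trans (fun n w l s => hU (G Φ) n w l s) ((ampOp_ghostAction g hm).congr _ _ (hG Φ))
  have h2 : AmpEq m (amp (G (U Φ) : GhostSpace m)) (flipAmp m (ghostAction g (amp (Φ : GhostSpace m)))) :=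
    (hG (U Φ)).trans ((ampOp_flipAmp m).congr _ _ fun n w l s => hU Φ n w l s)
  rw [flipAmp_ghostAction] at h2
  exact h1.trans h2.symm

/-- The coefficient -1/2 is real, so even an antilinear U commutes with the number operator and
preserves its kernel. -/
theorem unphys_comm {M : Type*} [AddCommMonoid M] [Module ℂ M] {σ : ℂ →+* ℂ} (hσ : IsConjOrId σ)
    {Q G : M →ₗ[ℂ] M} {U : M →ₛₗ[σ] M} (h1 : ∀ v, U (Q v) = Q (U v)) (h2 : ∀ v, U (G v) = G (U v))
    {v : M} (h : (-1 / 2 : ℂ) • (Q (G (Q (G v))) + G (Q (G (Q v)))) = 0) :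
    (-1 / 2 : ℂ) • (Q (G (Q (G (U v)))) + G (Q (G (Q (U v))))) = 0 := by
  have h3 : σ (-1 / 2 : ℂ) = -1 / 2 := by
    rcases hσ with rfl | rfl
    · rfl
    · rw [map_div₀, map_neg, map_one, map_ofNat]
  have h4 := congrArg U h
  rw [map_smulₛₗ, h3, map_add, map_zero] at h4
  simpa only [h1, h2] using h4

theorem IsGhostAction.map_physical (hm : ∀ a, 0 < m a)
    {U : core m →ₛₗ[g.conjIfReversing] core m} (hU : IsGhostAction g U) {Φ : core m}
    (h : Φ ∈ physical m) : U Φ ∈ physical m :=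
  exists_supercharge (m := m) |>.elim fun _ hQ => exists_flip (m := m) |>.elim fun _ hG =>
    (unphysNumber_eq_zero_iff hm hQ hG (U Φ)).1 (unphys_comm g.isConjOrId
      (hU.comm_supercharge hm hQ) (hU.comm_flip hm hG)
      ((unphysNumber_eq_zero_iff hm hQ hG Φ).2 h))

end PoincareAction

/-! ### Sums over multi-indices -/

section MultiIndex

open Finset

variable {ι κ : Type} [Fintype ι] [Fintype κ] {n : ℕ}

/-- When the same matrices transform both tensors, the sum over the transformed indices factorises
over the slots. It serves both for the tetrads and for Lorentz matrices. -/
theorem sum_multiIndex_pairing [DecidableEq ι] [DecidableEq κ] (w : Fin n → κ → ℂ) (A : Fin n → κ → ι → ℝ)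
    (F G : (Fin n → ι) → ℂ) :
    ∑ j : Fin n → κ, (∏ i, w i (j i)) * (conj (∑ ν : Fin n → ι, (∏ i, (A i (j i) (ν i) : ℂ)) * F ν) *
      ∑ ν : Fin n → ι, (∏ i, (A i (j i) (ν i) : ℂ)) * G ν) =
    ∑ ν : Fin n → ι, ∑ ν' : Fin n → ι,
      (∏ i, ∑ j, w i j * A i j (ν i) * A i j (ν' i)) * (conj (F ν) * G ν') := by
  have h : ∀ ν ν' : Fin n → ι, ∏ i, ∑ j, w i j * A i j (ν i) * A i j (ν' i) =
      ∑ j : Fin n → κ, ∏ i, w i (j i) * A i (j i) (ν i) * A i (j i) (ν' i) := fun ν ν' => by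
    rw [Finset.prod_univ_sum, Fintype.piFinset_univ]
  simp only [h, sum_mul]
  rw [sum_congr rfl fun ν _ => sum_comm, sum_comm]
  refine sum_congr rfl fun j _ => ?_
  simp only [map_sum, map_mul, map_prod, Complex.conj_ofReal, sum_mul, mul_sum, prod_mul_distrib]
  rw [sum_comm]
  refine sum_congr rfl fun ν _ => sum_congr rfl fun ν' _ => ?_
  ring

theorem sum_multiIndex_cons {M : Type*} [AddCommMonoid M] (f : (Fin (n + 1) → ι) → M) :
    ∑ ν, f ν = ∑ a, ∑ ν : Fin n → ι, f (Fin.cons a ν) := by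
  rw [← Fintype.sum_prod_type']
  exact (Fintype.sum_equiv (Fin.consEquiv fun _ => ι) _ _ fun _ => rfl).symm

theorem prod_ite_eq_multiIndex {ι : Type} [DecidableEq ι] (d : Fin n → ι → ℂ) (ν ν' : Fin n → ι) :
    ∏ i, (if ν i = ν' i then d i (ν i) else 0) = if ν = ν' then ∏ i, d i (ν i) else 0 := by
  split_ifs with h
  · subst h; simp
  · obtain ⟨i, hi⟩ := Function.ne_iff.1 h
    exact prod_eq_zero (mem_univ i) (if_neg hi)

/-- A tensor product of rank one perturbations of diagonal matrices acts diagonally on tensors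
annihilated by the rank one parts. -/
theorem sum_prod_diagonal_add [DecidableEq ι] {n : ℕ} (d u k : Fin n → ι → ℂ) (μ : Fin n → ι)
    {f : (Fin n → ι) → ℂ} (hf : ∀ i ν, ∑ a, k i a * f (Function.update ν i a) = 0) :
    ∑ ν : Fin n → ι, (∏ i, ((if μ i = ν i then d i (μ i) else 0) + u i (μ i) * k i (ν i))) * f ν =
      (∏ i, d i (μ i)) * f μ := by
  induction n with
  | zero =>
    rw [Fintype.sum_unique, Subsingleton.elim default μ]
    simp
  | succ n ih =>
    have h1 : ∀ a, ∑ ν : Fin n → ι, (∏ i, ((if Fin.tail μ i = ν i then d i.succ (Fin.tail μ i) else 0)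
        + u i.succ (Fin.tail μ i) * k i.succ (ν i))) * f (Fin.cons a ν) =
        (∏ i : Fin n, d i.succ (Fin.tail μ i)) * f (Fin.cons a (Fin.tail μ)) := fun a => by
      refine ih (fun i => d i.succ) (fun i => u i.succ) (fun i => k i.succ) (Fin.tail μ) fun i ν => ?_
      have := hf i.succ (Fin.cons a ν)
      simpa only [← Fin.cons_update] using this
    have h2 := hf 0 μ
    rw [sum_multiIndex_cons]
    simp only [Fin.prod_univ_succ, Fin.cons_zero, Fin.cons_succ, mul_assoc, ← mul_sum]
    have h3 : ∀ a, (Function.update μ 0 a : Fin (n + 1) → ι) = Fin.cons a (Fin.tail μ) := fun a => by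
      conv_lhs => rw [← Fin.cons_self_tail μ, Fin.update_cons_zero]
    simp only [h3] at h2
    calc _ = ∑ a, ((if μ 0 = a then d 0 (μ 0) else 0) + u 0 (μ 0) * k 0 a) *
          ((∏ i : Fin n, d i.succ (μ i.succ)) * f (Fin.cons a (Fin.tail μ))) :=
          sum_congr rfl fun a _ => congrArg _ (h1 a)
      _ = ∑ a, (if μ 0 = a then d 0 (μ 0) * ((∏ i : Fin n, d i.succ (μ i.succ)) *
            f (Fin.cons a (Fin.tail μ))) else 0) + u 0 (μ 0) * (∏ i : Fin n, d i.succ (μ i.succ)) *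
            ∑ a, k 0 a * f (Fin.cons a (Fin.tail μ)) := by
          rw [mul_sum, ← sum_add_distrib]
          refine sum_congr rfl fun a _ => ?_
          split_ifs <;> ring
      _ = _ := by
          rw [h2, mul_zero, add_zero, sum_ite_eq, if_pos (mem_univ _), Fin.cons_self_tail]

end MultiIndex

/-! ### The invariant form of states of vector particles -/

section VecForm

variable (m : Fin r → ℝ) {n : ℕ}

/-- The measure on the variables of `n` vector particles. -/
abbrev vecPi (n : ℕ) : Measure (Fin n → Vec r) := Measure.pi fun _ => vecMeasure m

/-- The measure on the momenta of `n` particles. -/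
abbrev scalPi (n : ℕ) : Measure (Fin n → Scal r) := Measure.pi fun _ => scalMeasure m

/-- The form `∫ (-g)^{⊗n} conj(f) h`. -/
def vecForm (f h : (Fin n → Vec r) → ℂ) : ℂ :=
  ∫ K, (∏ i, (-(eta (K i).1) : ℂ)) * (conj (f K) * h K) ∂vecPi m n

/-- Joins indices and momenta. -/
def joinVec (μ : Fin n → Fin 4) (y : Fin n → Scal r) : Fin n → Vec r := fun i => (μ i, y i)

theorem bddMap_joinVec (μ : Fin n → Fin 4) : BddMap (joinVec μ) (scalPi m n) (vecPi m n) :=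
  BddMap.pi fun i => bddMap_mkVec m (μ i)

theorem measurePreserving_joinVec : MeasurePreserving
    (fun z : (Fin n → Fin 4) × (Fin n → Scal r) => joinVec z.1 z.2)
    (Measure.count.prod (scalPi m n)) (vecPi m n) := by
  have h := (measurePreserving_arrowProdEquivProdArrow (Fin 4) (Scal r) (Fin n)
    (fun _ => Measure.count) fun _ => scalMeasure m).symm
  have hc : (Measure.pi fun _ : Fin n => (Measure.count : Measure (Fin 4))) = Measure.count := by
    refine Measure.ext_of_singleton fun μ => ?_
    rw [Measure.pi_singleton, Measure.count_singleton]
    simp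
  rw [hc] at h
  exact h

theorem integral_vecPi {g : (Fin n → Vec r) → ℂ} (hg : Integrable g (vecPi m n)) :
    ∫ K, g K ∂vecPi m n = ∫ y, ∑ μ, g (joinVec μ y) ∂scalPi m n := by
  have h := measurePreserving_joinVec m (n := n)
  have h1 := h.integrable_comp_of_integrable hg
  rw [← integral_comp_measurePreserving h hg.aestronglyMeasurable]
  refine (integral_prod_symm _ h1).trans ?_
  exact integral_congr_ae (.of_forall fun y => integral_fintype .of_finite |>.trans (by simp))

variable {m}

theorem norm_prod_eta (K : Fin n → Vec r) : ‖∏ i, (-(eta (K i).1) : ℂ)‖ = 1 := by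
  rw [norm_prod]
  exact Finset.prod_eq_one fun i _ => by
    rw [norm_neg, Complex.norm_real, norm_eta]

theorem integrable_vecForm {f h : (Fin n → Vec r) → ℂ} (hf : MemLp f 2 (vecPi m n))
    (hh : MemLp h 2 (vecPi m n)) :
    Integrable (fun K => (∏ i, (-(eta (K i).1) : ℂ)) * (conj (f K) * h K)) (vecPi m n) := by
  have h1 : Integrable (fun K => conj (f K) * h K) (vecPi m n) :=
    MemLp.integrable_mul (p := 2) (q := 2) hf.star hh
  refine h1.bdd_mul (c := 1) ?_ (.of_forall fun K => (norm_prod_eta K).le)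
  refine (Finset.measurable_fun_prod _ fun i _ => ?_).aestronglyMeasurable
  exact (measurable_from_top (f := fun μ : Fin 4 => (-(eta μ) : ℂ))).comp (by fun_prop)

theorem vecForm_eq {f h : (Fin n → Vec r) → ℂ} (hf : MemLp f 2 (vecPi m n))
    (hh : MemLp h 2 (vecPi m n)) : vecForm m f h =
      ∫ y, ∑ μ : Fin n → Fin 4, (∏ i, (-(eta (μ i)) : ℂ)) *
        (conj (f (joinVec μ y)) * h (joinVec μ y)) ∂scalPi m n :=
  integral_vecPi m (integrable_vecForm hf hh)

theorem vecForm_congr {f f' h h' : (Fin n → Vec r) → ℂ} (e : f =ᵐ[vecPi m n] f')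
    (e' : h =ᵐ[vecPi m n] h') : vecForm m f h = vecForm m f' h' :=
  integral_congr_ae (by filter_upwards [e, e'] with K h1 h2; rw [h1, h2])

/-- The product state `φ₁ ⊗ ⋯ ⊗ φₙ`. -/
def prodFn (φ : Fin n → Vec r → ℂ) (K : Fin n → Vec r) : ℂ := ∏ i, φ i (K i)

theorem memLp_prodFn {φ : Fin n → Vec r → ℂ} (h : ∀ i, MemLp (φ i) 2 (vecMeasure m)) :
    MemLp (prodFn φ) 2 (vecPi m n) := by
  have hm : AEStronglyMeasurable (prodFn φ) (vecPi m n) := by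
    refine Finset.aestronglyMeasurable_fun_prod _ fun i _ => ?_
    exact (h i).1.comp_quasiMeasurePreserving
      (Measure.quasiMeasurePreserving_eval (μ := fun _ : Fin n => vecMeasure m) i)
  rw [memLp_two_iff_integrable_sq_norm hm]
  have := Integrable.fintype_prod (μ := fun _ : Fin n => vecMeasure m)
    (f := fun i z => ‖φ i z‖ ^ 2) fun i => (memLp_two_iff_integrable_sq_norm (h i).1).1 (h i)
  simpa only [prodFn, norm_prod, ← Finset.prod_pow] using this

theorem PreParticle.memLp (φ : PreParticle m) : MemLp φ.toLp 2 (vecMeasure m) := Lp.memLp _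

theorem vecForm_prodFn (φ ψ : Fin n → PreParticle m) :
    vecForm m (prodFn fun i => (φ i).toLp) (prodFn fun i => (ψ i).toLp) =
      ∏ i, oneForm (φ i) (ψ i) := by
  have h := integral_fintype_prod_eq_prod (μ := fun _ : Fin n => vecMeasure m)
    (fun i z => (-(eta z.1) : ℂ) * (conj ((φ i).toLp z) * (ψ i).toLp z))
  refine Eq.trans (integral_congr_ae (.of_forall fun K => ?_)) h
  simp only [prodFn, map_prod, ← Finset.prod_mul_distrib]

end VecForm

/-! ### Positivity on transverse states -/

section Positivity

variable {m : Fin r → ℝ} {n : ℕ}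

/-- The function is annihilated by contraction with the momentum in each variable. -/
def IsTransverse (m : Fin r → ℝ) (f : (Fin n → Vec r) → ℂ) : Prop :=
  ∀ᵐ y ∂scalPi m n, ∀ i μ, ∑ ν, ((y i).2 ν : ℂ) * f (joinVec (Function.update μ i ν) y) = 0

/-- Three vectors that span the covectors annihilating `p`. -/
def tetrad (μ : ℝ) (p : Mom) (j : Fin 3) : Fin 4 → ℝ :=
  Fin.cons (p j.succ / μ) fun i => (if i = j then 1 else 0) + p i.succ * p j.succ / (μ * (μ + p 0))

/-- The three covectors are, up to index position, the images of the spatial unit vectors under the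
boost taking (μ, 0) to p. Orthonormality of the boosted frame is this completeness relation. The
four cases separate time and space indices, and each uses |𝐩|² = (p⁰)² - μ². -/
theorem sum_tetrad {μ : ℝ} (hμ : 0 < μ) {p : Mom} (hp : p ∈ shell μ) (a b : Fin 4) :
    ∑ j, tetrad μ p j a * tetrad μ p j b = (if a = b then -eta a else 0) + p a * p b / μ ^ 2 := by
  obtain ⟨h1, h0⟩ := hp
  rw [mink_self] at h1
  have h2 : μ + p 0 ≠ 0 := by positivity
  have hne := hμ.ne'
  have e0 := eta_values.1
  have es : ∀ i : Fin 3, eta i.succ = -1 := fun i => if_neg (Fin.succ_ne_zero i)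
  have h3 : ∑ j : Fin 3, p j.succ * p j.succ = p 0 ^ 2 - μ ^ 2 := by
    rw [Fin.sum_univ_three]
    change p 1 * p 1 + p 2 * p 2 + p 3 * p 3 = _
    linear_combination -h1
  refine Fin.cases ?_ (fun i => ?_) a <;> refine Fin.cases ?_ (fun i' => ?_) b
  · simp only [tetrad, Fin.cons_zero, if_true, e0]
    calc _ = (∑ j : Fin 3, p j.succ * p j.succ) / μ ^ 2 := by
          rw [Finset.sum_div]
          exact Finset.sum_congr rfl fun j _ => by field_simp
      _ = _ := by rw [h3]; field_simp; ring
  · simp only [tetrad, Fin.cons_zero, Fin.cons_succ, (Fin.succ_ne_zero _).symm, if_false]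
    calc _ = ∑ j : Fin 3, (if i' = j then p j.succ / μ else 0) +
          (∑ j : Fin 3, p j.succ * p j.succ) * (p i'.succ / (μ ^ 2 * (μ + p 0))) := by
          rw [Finset.sum_mul, ← Finset.sum_add_distrib]
          refine Finset.sum_congr rfl fun j _ => ?_
          split_ifs <;> field_simp <;> ring
      _ = _ := by
          rw [h3, Finset.sum_ite_eq, if_pos (Finset.mem_univ _)]
          field_simp
          ring
  · simp only [tetrad, Fin.cons_zero, Fin.cons_succ, Fin.succ_ne_zero, if_false]
    calc _ = ∑ j : Fin 3, (if i = j then p j.succ / μ else 0) +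
          (∑ j : Fin 3, p j.succ * p j.succ) * (p i.succ / (μ ^ 2 * (μ + p 0))) := by
          rw [Finset.sum_mul, ← Finset.sum_add_distrib]
          refine Finset.sum_congr rfl fun j _ => ?_
          split_ifs <;> field_simp <;> ring
      _ = _ := by
          rw [h3, Finset.sum_ite_eq, if_pos (Finset.mem_univ _)]
          field_simp
          ring
  · simp only [tetrad, Fin.cons_succ, Fin.succ_inj, es, neg_neg]
    calc _ = ∑ j : Fin 3, (if i = j then (if i' = j then 1 else 0) +
            p i'.succ * p j.succ / (μ * (μ + p 0)) else 0) +
          ∑ j : Fin 3, (if i' = j then p i.succ * p j.succ / (μ * (μ + p 0)) else 0) +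
          (∑ j : Fin 3, p j.succ * p j.succ) *
            (p i.succ * p i'.succ / (μ ^ 2 * (μ + p 0) ^ 2)) := by
          rw [Finset.sum_mul, ← Finset.sum_add_distrib, ← Finset.sum_add_distrib]
          refine Finset.sum_congr rfl fun j _ => ?_
          split_ifs <;> field_simp <;> ring
      _ = _ := by
          rw [h3, Finset.sum_ite_eq, Finset.sum_ite_eq, if_pos (Finset.mem_univ _),
            if_pos (Finset.mem_univ _), add_assoc, add_assoc]
          simp only [eq_comm (a := i')]
          refine congrArg₂ (· + ·) rfl ?_
          field_simp
          ring

/-- The components of a tensor with respect to the tetrad. -/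
def tetradComp (m : Fin r → ℝ) (y : Fin n → Scal r) (F : (Fin n → Fin 4) → ℂ) (j : Fin n → Fin 3) : ℂ :=
  ∑ ν : Fin n → Fin 4, (∏ i, (tetrad (m (y i).1) (y i).2 (j i) (ν i) : ℂ)) * F ν

theorem sum_tetrad_cast (hm : ∀ a, 0 < m a) {y : Scal r} (hy : y.2 ∈ shell (m y.1)) (a b : Fin 4) :
    ∑ j, (tetrad (m y.1) y.2 j a : ℂ) * (tetrad (m y.1) y.2 j b : ℂ) =
      (if a = b then (-(eta a) : ℂ) else 0) + (y.2 a / (m y.1 : ℂ) ^ 2) * (y.2 b : ℂ) := by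
  have h := congrArg (fun x : ℝ => (x : ℂ)) (sum_tetrad (hm y.1) hy a b)
  simp only [Complex.ofReal_sum, Complex.ofReal_mul] at h
  rw [h]
  split_ifs <;> push_cast <;> ring

/-- In every slot Σ_j e_j e_j differs from -g by p p/m², and the latter annihilates transverse
tensors. -/
theorem sum_prod_tetrad (hm : ∀ a, 0 < m a) {y : Fin n → Scal r}
    (hy : ∀ i, (y i).2 ∈ shell (m (y i).1)) {G : (Fin n → Fin 4) → ℂ}
    (hG : ∀ i μ, ∑ ν, ((y i).2 ν : ℂ) * G (Function.update μ i ν) = 0) (μ : Fin n → Fin 4) :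
    ∑ ν : Fin n → Fin 4, (∏ i, ∑ j, (tetrad (m (y i).1) (y i).2 j (μ i) : ℂ) *
      (tetrad (m (y i).1) (y i).2 j (ν i) : ℂ)) * G ν = (∏ i, (-(eta (μ i)) : ℂ)) * G μ := by
  simp only [sum_tetrad_cast hm (hy _)]
  exact sum_prod_diagonal_add (fun _ a => (-(eta a) : ℂ)) (fun i a => (y i).2 a / (m (y i).1 : ℂ) ^ 2)
    (fun i a => (y i).2 a) μ hG

/-- Replacing -g by Σ_j e_j e_j in each slot turns the indefinite form into the standard Hermitian
product of the tetrad components. Transversality of one of the two arguments suffices. -/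
theorem sum_eta_transverse (hm : ∀ a, 0 < m a) {y : Fin n → Scal r}
    (hy : ∀ i, (y i).2 ∈ shell (m (y i).1)) (F : (Fin n → Fin 4) → ℂ) {G : (Fin n → Fin 4) → ℂ}
    (hG : ∀ i μ, ∑ ν, ((y i).2 ν : ℂ) * G (Function.update μ i ν) = 0) :
    ∑ μ : Fin n → Fin 4, (∏ i, (-(eta (μ i)) : ℂ)) * (conj (F μ) * G μ) =
      ∑ j, conj (tetradComp m y F j) * tetradComp m y G j := by
  have h := sum_multiIndex_pairing (fun _ _ => 1)
    (fun i j ν => tetrad (m (y i).1) (y i).2 j ν) F G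
  simp only [Finset.prod_const_one, one_mul] at h
  refine Eq.trans ?_ h.symm
  refine Finset.sum_congr rfl fun μ _ => ?_
  rw [mul_left_comm, ← sum_prod_tetrad hm hy hG, Finset.mul_sum]
  exact Finset.sum_congr rfl fun ν _ => by ring

/-- A transverse tensor is recovered, up to signs, by expanding in the tetrad, so its components
determine it. This upgrades positivity to definiteness. -/
theorem eq_zero_of_tetradComp (hm : ∀ a, 0 < m a) {y : Fin n → Scal r}
    (hy : ∀ i, (y i).2 ∈ shell (m (y i).1)) {G : (Fin n → Fin 4) → ℂ}
    (hG : ∀ i μ, ∑ ν, ((y i).2 ν : ℂ) * G (Function.update μ i ν) = 0)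
    (h : ∀ j, tetradComp m y G j = 0) (μ : Fin n → Fin 4) : G μ = 0 := by
  have h1 := sum_prod_tetrad hm hy hG μ
  simp only [Finset.prod_univ_sum, Fintype.piFinset_univ, Finset.sum_mul] at h1
  rw [Finset.sum_comm] at h1
  have h2 : ∀ j : Fin n → Fin 3, ∑ ν : Fin n → Fin 4,
      (∏ i, (tetrad (m (y i).1) (y i).2 (j i) (μ i) : ℂ) *
        (tetrad (m (y i).1) (y i).2 (j i) (ν i) : ℂ)) * G ν = 0 := fun j => by
    simp only [Finset.prod_mul_distrib, mul_assoc, ← Finset.mul_sum]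
    exact mul_eq_zero_of_right _ (h j)
  rw [Finset.sum_eq_zero fun j _ => h2 j] at h1
  refine (mul_eq_zero.1 h1.symm).resolve_left (Finset.prod_ne_zero_iff.2 fun i _ => ?_)
  unfold eta
  split_ifs <;> simp

theorem ae_shell_scalPi (m : Fin r → ℝ) (n : ℕ) :
    ∀ᵐ y ∂scalPi m n, ∀ i, (y i).2 ∈ shell (m (y i).1) :=
  ae_pi_fin (ae_mem_shell_scal m) n

/-- The density of the form on transverse states. -/
theorem IsTransverse.vecForm_eq (hm : ∀ a, 0 < m a) {f : (Fin n → Vec r) → ℂ}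
    (hf : MemLp f 2 (vecPi m n)) (ht : IsTransverse m f) :
    Integrable (fun y => ∑ j, ‖tetradComp m y (fun μ => f (joinVec μ y)) j‖ ^ 2) (scalPi m n) ∧
      vecForm m f f =
        ((∫ y, ∑ j, ‖tetradComp m y (fun μ => f (joinVec μ y)) j‖ ^ 2 ∂scalPi m n : ℝ) : ℂ) := by
  have h1 : (fun y => ∑ μ : Fin n → Fin 4, (∏ i, (-(eta (μ i)) : ℂ)) *
      (conj (f (joinVec μ y)) * f (joinVec μ y))) =ᵐ[scalPi m n]
      fun y => ((∑ j, ‖tetradComp m y (fun μ => f (joinVec μ y)) j‖ ^ 2 : ℝ) : ℂ) := by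
    filter_upwards [ht, ae_shell_scalPi m n] with y h2 h3
    rw [sum_eta_transverse hm h3 (fun μ => f (joinVec μ y)) (G := fun μ => f (joinVec μ y)) h2]
    push_cast
    exact Finset.sum_congr rfl fun j _ => Complex.conj_mul' _
  have h4 : Integrable (fun y => ∑ μ : Fin n → Fin 4, (∏ i, (-(eta (μ i)) : ℂ)) *
      (conj (f (joinVec μ y)) * f (joinVec μ y))) (scalPi m n) :=
    integrable_finsetSum _ fun μ _ => (MemLp.integrable_mul (p := 2) (q := 2)
      ((bddMap_joinVec m μ).memLp hf).star ((bddMap_joinVec m μ).memLp hf)).const_mul _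
  refine ⟨?_, ?_⟩
  · have := (h4.congr h1).re
    simpa only [RCLike.re_to_complex, Complex.ofReal_re] using this
  · rw [MassiveVector.vecForm_eq hf hf, integral_congr_ae h1]
    exact integral_ofReal

theorem IsTransverse.vecForm_self_nonneg (hm : ∀ a, 0 < m a) {f : (Fin n → Vec r) → ℂ}
    (hf : MemLp f 2 (vecPi m n)) (ht : IsTransverse m f) :
    ∃ x : ℝ, 0 ≤ x ∧ vecForm m f f = x :=
  ⟨_, integral_nonneg fun _ => Finset.sum_nonneg fun _ _ => sq_nonneg _, (ht.vecForm_eq hm hf).2⟩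

theorem IsTransverse.eq_zero (hm : ∀ a, 0 < m a) {f : (Fin n → Vec r) → ℂ}
    (hf : MemLp f 2 (vecPi m n)) (ht : IsTransverse m f) (h : vecForm m f f = 0) :
    f =ᵐ[vecPi m n] 0 := by
  obtain ⟨h1, h2⟩ := ht.vecForm_eq hm hf
  rw [h, eq_comm, Complex.ofReal_eq_zero, integral_eq_zero_iff_of_nonneg
    (fun _ => Finset.sum_nonneg fun _ _ => sq_nonneg _) h1] at h2
  have h3 : ∀ᵐ y ∂scalPi m n, ∀ μ, f (joinVec μ y) = 0 := by
    filter_upwards [h2, ht, ae_shell_scalPi m n] with y h4 h5 h6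
    refine eq_zero_of_tetradComp hm h6 (G := fun μ => f (joinVec μ y)) h5 fun j => ?_
    have := (Finset.sum_eq_zero_iff_of_nonneg fun _ _ => sq_nonneg _).1 h4 j (Finset.mem_univ _)
    simpa using this
  have h4 : BddMap (fun (K : Fin n → Vec r) i => (K i).2) (vecPi m n) (scalPi m n) :=
    BddMap.pi fun _ => bddMap_snd m
  filter_upwards [h4.ae h3] with K hK
  exact hK fun i => (K i).1

end Positivity

/-! ### The Poincaré action on states of vector particles -/

section VecAction

variable {m : Fin r → ℝ} {n : ℕ} (g : Poincare)

/-- The action on states of `n` vector particles. -/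
def vecAction (f : (Fin n → Vec r) → ℂ) (K : Fin n → Vec r) : ℂ :=
  (∏ i, g.phase (K i).2.2) * ∑ ν : Fin n → Fin 4, (∏ i, (g.cov (K i).1 (ν i) : ℂ)) *
    g.conjIfReversing (f (joinVec ν fun i => g.pull (K i).2))

theorem vecAction_prodFn (φ : Fin n → Vec r → ℂ) :
    vecAction g (prodFn φ) = prodFn fun i => oneAction g (φ i) := by
  funext K
  simp only [vecAction, prodFn, oneAction, Finset.prod_mul_distrib, Finset.prod_univ_sum,
    Fintype.piFinset_univ, map_prod, joinVec]

theorem memLp_bdd_mul {α : Type*} [MeasurableSpace α] {μ : Measure α} {c f : α → ℂ}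
    (hf : MemLp f 2 μ) (hc : Measurable c) {C : ℝ} (h : ∀ x, ‖c x‖ ≤ C) :
    MemLp (fun x => c x * f x) 2 μ :=
  hf.of_le_mul (c := C) (hc.aestronglyMeasurable.mul hf.1) (.of_forall fun x => by
    rw [norm_mul]
    exact mul_le_mul_of_nonneg_right (h x) (norm_nonneg _))

theorem memLp_vecAction (hm : ∀ a, 0 < m a) {f : (Fin n → Vec r) → ℂ} (hf : MemLp f 2 (vecPi m n)) :
    MemLp (vecAction g f) 2 (vecPi m n) := by
  have h0 : ∀ ν : Fin n → Fin 4, BddMap (fun K : Fin n → Vec r => joinVec ν fun i => g.pull (K i).2)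
      (vecPi m n) (vecPi m n) := fun ν => BddMap.pi fun i =>
    (bddMap_mkVec m (ν i)).comp ((g.measurePreserving_pull hm).bddMap.comp (bddMap_snd m))
  have h1 : MemLp (fun K : Fin n → Vec r => ∑ ν : Fin n → Fin 4,
      ((∏ i, g.phase (K i).2.2) * (∏ i, (g.cov (K i).1 (ν i) : ℂ))) *
        g.conjIfReversing (f (joinVec ν fun i => g.pull (K i).2))) 2 (vecPi m n) := by
    refine memLp_finsetSum _ fun ν _ => ?_
    refine memLp_bdd_mul (C := ∑ μ : Fin n → Fin 4, ‖∏ i, (g.cov (μ i) (ν i) : ℂ)‖)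
      (g.isConjOrId.memLp ((h0 ν).memLp hf)) ?_ fun K => ?_
    · have hcov : ∀ i, Measurable fun K : Fin n → Vec r => (g.cov (K i).1 (ν i) : ℂ) := fun i =>
        (measurable_from_top (f := fun μ => (g.cov μ (ν i) : ℂ))).comp (by fun_prop)
      refine (Measurable.mul (Finset.measurable_fun_prod _ fun i _ => g.measurable_phase.comp ?_)
        (Finset.measurable_fun_prod _ fun i _ => hcov i))
      fun_prop
    · rw [norm_mul, norm_prod]
      simp only [g.norm_phase, Finset.prod_const_one, one_mul]
      exact Finset.single_le_sum (f := fun μ : Fin n → Fin 4 => ‖∏ i, (g.cov (μ i) (ν i) : ℂ)‖)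
        (fun _ _ => norm_nonneg _) (Finset.mem_univ fun i => (K i).1)
  refine h1.ae_eq (.of_forall fun K => ?_)
  simp only [vecAction, Finset.mul_sum, mul_assoc]

theorem sum_eta_cov (F G : (Fin n → Fin 4) → ℂ) :
    ∑ μ : Fin n → Fin 4, (∏ i, (-(eta (μ i)) : ℂ)) *
      (conj (∑ ν : Fin n → Fin 4, (∏ i, (g.cov (μ i) (ν i) : ℂ)) * F ν) *
        ∑ ν : Fin n → Fin 4, (∏ i, (g.cov (μ i) (ν i) : ℂ)) * G ν) =
    ∑ μ : Fin n → Fin 4, (∏ i, (-(eta (μ i)) : ℂ)) * (conj (F μ) * G μ) := by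
  rw [sum_multiIndex_pairing (fun _ a => (-(eta a) : ℂ)) (fun _ μ ν => g.cov μ ν)]
  have h : ∀ a b, ∑ j, (-(eta j) : ℂ) * g.cov j a * g.cov j b = if a = b then (-(eta a) : ℂ) else 0 := by
    intro a b
    have := congrArg (fun x : ℝ => -(x : ℂ)) (g.sum_eta_cov_cov a b)
    simp only [Complex.ofReal_sum, Complex.ofReal_mul, ← Finset.sum_neg_distrib] at this
    simp only [neg_mul]
    rw [this]
    split_ifs <;> simp
  simp only [h, prod_ite_eq_multiIndex (fun _ a => (-(eta a) : ℂ)), ite_mul, zero_mul,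
    Finset.sum_ite_eq, Finset.mem_univ, if_true]

/-- The phases have modulus 1, the covariant matrices preserve the metric in every slot, and the
momentum map preserves the measure. What remains is the conjugation, which commutes with the
integral. -/
theorem vecForm_vecAction (hm : ∀ a, 0 < m a) {f h : (Fin n → Vec r) → ℂ}
    (hf : MemLp f 2 (vecPi m n)) (hh : MemLp h 2 (vecPi m n)) :
    vecForm m (vecAction g f) (vecAction g h) = g.conjIfReversing (vecForm m f h) := by
  have hp : MeasurePreserving (fun (y : Fin n → Scal r) i => g.pull (y i)) (scalPi m n) (scalPi m n) :=
    measurePreserving_pi _ _ fun _ => g.measurePreserving_pull hm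
  have hi : Integrable (fun y => ∑ μ : Fin n → Fin 4, (∏ i, (-(eta (μ i)) : ℂ)) *
      (conj (f (joinVec μ y)) * h (joinVec μ y))) (scalPi m n) :=
    integrable_finsetSum _ fun μ _ => (MemLp.integrable_mul (p := 2) (q := 2)
      ((bddMap_joinVec m μ).memLp hf).star ((bddMap_joinVec m μ).memLp hh)).const_mul _
  have hσ : ∀ u : (Fin n → Scal r) → ℂ, ∫ y, g.conjIfReversing (u y) ∂scalPi m n =
      g.conjIfReversing (∫ y, u y ∂scalPi m n) := fun u => by
    rcases g.isConjOrId with h1 | h1 <;> rw [h1]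
    · rfl
    · exact integral_conj
  have hc : ∀ z : ℂ, conj (g.conjIfReversing z) = g.conjIfReversing (conj z) := fun z => by
    rcases g.isConjOrId with h1 | h1 <;> rw [h1] <;> rfl
  rw [vecForm_eq (memLp_vecAction g hm hf) (memLp_vecAction g hm hh), vecForm_eq hf hh, ← hσ,
    ← integral_comp_measurePreserving hp (g.isConjOrId.continuous.comp_aestronglyMeasurable hi.1)]
  refine integral_congr_ae (.of_forall fun y => ?_)
  have h1 : conj (∏ i, g.phase (y i).2) * ∏ i, g.phase (y i).2 = 1 := by
    rw [Complex.conj_mul', norm_prod]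
    simp [g.norm_phase]
  have h2 := sum_eta_cov g (fun ν => g.conjIfReversing (f (joinVec ν fun i => g.pull (y i))))
    fun ν => g.conjIfReversing (h (joinVec ν fun i => g.pull (y i)))
  simp only [map_sum, map_mul, map_prod, map_neg, g.conj_ofReal, ← hc] at h2 ⊢
  rw [← h2]
  refine Finset.sum_congr rfl fun μ _ => ?_
  simp only [vecAction, joinVec, map_mul, map_sum, map_prod, Complex.conj_ofReal] at h1 ⊢
  linear_combination (∏ i, (-(eta (μ i)) : ℂ)) * ((∑ ν : Fin n → Fin 4, (∏ i, (g.cov (μ i) (ν i) : ℂ)) *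
    conj (g.conjIfReversing (f (joinVec ν fun i => g.pull (y i))))) *
    ∑ ν : Fin n → Fin 4, (∏ i, (g.cov (μ i) (ν i) : ℂ)) *
      g.conjIfReversing (h (joinVec ν fun i => g.pull (y i)))) * h1

end VecAction

/-! ## The invariant form on physical states -/

section PhysicalForm

variable {m : Fin r → ℝ} {n : ℕ}

/-- The configuration without ghosts. -/
def ofVec (K : Fin n → Vec r) : Config r n 0 0 0 := (K, Fin.elim0, Fin.elim0, Fin.elim0)

theorem ofVec_fst (x : Config r n 0 0 0) : ofVec x.1 = x :=
  Prod.ext rfl (Subsingleton.elim _ _)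

/-- The amplitude of `n` vector particles without ghosts. -/
def vecAmp (Ψ : Amp r) (n : ℕ) (K : Fin n → Vec r) : ℂ := Ψ n 0 0 0 (ofVec K)

instance (μ : Measure (Scal r)) : IsProbabilityMeasure (Measure.pi fun _ : Fin 0 => μ) := by
  rw [Measure.pi_of_empty _ Fin.elim0]
  infer_instance

theorem measurePreserving_vec (m : Fin r → ℝ) (n : ℕ) :
    MeasurePreserving (fun x : Config r n 0 0 0 => x.1) (configMeasure m n 0 0 0) (vecPi m n) := by
  unfold configMeasure
  exact measurePreserving_fst

theorem measurePreserving_ofVec (m : Fin r → ℝ) (n : ℕ) :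
    MeasurePreserving (ofVec (r := r)) (vecPi m n) (configMeasure m n 0 0 0) := by
  have hm : Measurable (ofVec (r := r) (n := n)) := measurable_id.prodMk measurable_const
  refine ⟨hm, ?_⟩
  rw [← (measurePreserving_vec m n).map_eq, Measure.map_map hm (measurePreserving_vec m n).measurable]
  exact (congrArg (fun f => Measure.map f (configMeasure m n 0 0 0)) (funext ofVec_fst)).trans
    Measure.map_id

theorem AmpEq.vecAmp {Ψ Ψ' : Amp r} (h : AmpEq m Ψ Ψ') (n : ℕ) :
    vecAmp Ψ n =ᵐ[vecPi m n] vecAmp Ψ' n :=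
  (measurePreserving_ofVec m n).quasiMeasurePreserving.ae (h n 0 0 0)

theorem memLp_vecAmp (Φ : core m) (n : ℕ) : MemLp (vecAmp (amp (Φ : GhostSpace m)) n) 2 (vecPi m n) :=
  (Lp.memLp _).comp_measurePreserving (measurePreserving_ofVec m n)

/-- Physical states are required to be transverse only in the first variable; symmetry moves any
variable there. A pointwise symmetric representative is used, so that this can be done inside an
almost everywhere statement. -/
theorem isTransverse_vecAmp {Φ : core m} (h : Φ ∈ physical m) (n : ℕ) :
    IsTransverse m (vecAmp (amp (Φ : GhostSpace m)) n) := by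
  obtain ⟨Ψ, hΨ, he⟩ := (coreAmp_amp Φ).sym
  have hv := he.vecAmp n
  have h1 : ∀ᵐ y ∂scalPi m n, ∀ μ, vecAmp (amp (Φ : GhostSpace m)) n (joinVec μ y) =
      vecAmp Ψ n (joinVec μ y) := ae_all_iff.2 fun μ => (bddMap_joinVec m μ).ae hv
  cases n with
  | zero => exact .of_forall fun y i => i.elim0
  | succ n =>
    have h2 : ∀ᵐ z ∂(scalMeasure m).prod (configMeasure m n 0 0 0),
        ∑ ν, (z.1.2 ν : ℂ) * Ψ (n + 1) 0 0 0 (insVec ν z.1 z.2) = 0 := by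
      have h3 : ∀ᵐ z ∂(scalMeasure m).prod (configMeasure m n 0 0 0), ∀ ν,
          amp (Φ : GhostSpace m) (n + 1) 0 0 0 (insVec ν z.1 z.2) =
            Ψ (n + 1) 0 0 0 (insVec ν z.1 z.2) := ae_all_iff.2 fun ν =>
        (quasiMeasurePreserving_insVec m n 0 0 0 ν).ae (he (n + 1) 0 0 0)
      filter_upwards [h.2 n, h3] with z h4 h5
      simpa only [h5] using h4
    have h3 : ∀ᵐ y ∂scalPi m (n + 1), ∀ (i : Fin (n + 1)) (μ : Fin (n + 1) → Fin 4),
        ∑ ν, ((y i).2 ν : ℂ) * Ψ (n + 1) 0 0 0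
          (insVec ν (y i) (ofVec (joinVec (i.removeNth μ) (i.removeNth y)))) = 0 := by
      refine ae_all_iff.2 fun i => ae_all_iff.2 fun μ => ?_
      exact (((BddMap.id (μ := scalMeasure m)).prodMap ((measurePreserving_ofVec m n).bddMap.comp
        (bddMap_joinVec m (i.removeNth μ)))).comp (BddMap.remove i)).ae h2
    filter_upwards [h1, h3] with y h4 h5 i μ
    rw [← h5 i μ]
    refine Finset.sum_congr rfl fun ν _ => ?_
    rw [h4]
    congr 1
    refine (hΨ.move_vec i _ _).trans ?_
    refine congrArg (Ψ (n + 1) 0 0 0) (Prod.ext ?_ (Subsingleton.elim _ _))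
    change (Fin.cons _ _ : Fin (n + 1) → Vec r) = Fin.cons _ _
    congr 1
    · simp [joinVec]
    · funext j
      simp [joinVec, Fin.removeNth, ofVec, Function.update_of_ne]

theorem kreinTerm_vec (Ψ Φ : Amp r) (hΨ : AEStronglyMeasurable (Ψ n 0 0 0) (configMeasure m n 0 0 0))
    (hΦ : AEStronglyMeasurable (Φ n 0 0 0) (configMeasure m n 0 0 0)) :
    kreinTerm m Ψ Φ (n, 0, 0, 0) = vecForm m (vecAmp Ψ n) (vecAmp Φ n) := by
  have h1 : AEStronglyMeasurable (fun x : Config r n 0 0 0 =>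
      (∏ i, (-(eta (x.1 i).1) : ℂ)) * (conj (Ψ n 0 0 0 x) * Φ n 0 0 0 x)) (configMeasure m n 0 0 0) := by
    refine AEStronglyMeasurable.mul (Measurable.aestronglyMeasurable ?_)
      ((Complex.continuous_conj.comp_aestronglyMeasurable hΨ).mul hΦ)
    exact Finset.measurable_fun_prod _ fun i _ =>
      (measurable_from_top (f := fun μ : Fin 4 => (-(eta μ) : ℂ))).comp (by fun_prop)
  refine Eq.trans ?_ (integral_comp_measurePreserving (measurePreserving_ofVec m n) h1).symm
  refine integral_congr_ae (.of_forall fun x => ?_)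
  have h2 : ((x.1, x.2.2.1, x.2.1, x.2.2.2) : Config r n 0 0 0) = x :=
    Prod.ext rfl (Subsingleton.elim _ _)
  simp only [kreinAmp, mul_zero, pow_zero, one_mul, h2]
  ring

/-- The Krein operator maps each ghost-free sector to itself, so one ghost-free argument suffices to
restrict the sum to these sectors. -/
theorem krein_of_ghostFree (Ψ Φ : GhostSpace m)
    (h : ∀ n w l s, (w, l, s) ≠ (0, 0, 0) → Ψ (n, w, l, s) = 0) :
    krein Ψ Φ = ∑' n, vecForm m (vecAmp (amp Ψ) n) (vecAmp (amp Φ) n) := by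
  rw [krein_eq, kreinForm]
  have hinj : Function.Injective fun n : ℕ => ((n, 0, 0, 0) : ℕ × ℕ × ℕ × ℕ) := fun a b h => by
    simpa using h
  rw [← hinj.tsum_eq]
  · exact tsum_congr fun n => kreinTerm_vec _ _ (Lp.aestronglyMeasurable _) (Lp.aestronglyMeasurable _)
  · rintro ⟨n, w, l, s⟩ h1
    by_contra h2
    refine h1 (integral_eq_zero_of_ae ?_)
    have h3 : (w, l, s) ≠ (0, 0, 0) := fun h4 => h2 ⟨n, by rw [h4]⟩
    have h4 : amp Ψ n w l s =ᵐ[configMeasure m n w l s] 0 := by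
      unfold amp
      rw [h n w l s h3]
      exact Lp.coeFn_zero ℂ 2 _
    filter_upwards [h4] with x hx
    simp [hx]

theorem krein_physical {Ψ : core m} (h : Ψ ∈ physical m) (Φ : core m) :
    krein (Ψ : GhostSpace m) (Φ : GhostSpace m) =
      ∑' n, vecForm m (vecAmp (amp (Ψ : GhostSpace m)) n) (vecAmp (amp (Φ : GhostSpace m)) n) :=
  krein_of_ghostFree _ _ h.1

theorem exists_vecForm_eq_zero (Ψ : core m) (Φ : GhostSpace m) : ∃ N, ∀ n, N < n →
    vecForm m (vecAmp (amp (Ψ : GhostSpace m)) n) (vecAmp (amp Φ) n) = 0 := by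
  obtain ⟨N, hN⟩ := (coreAmp_amp Ψ).fin
  refine ⟨N, fun n hn => integral_eq_zero_of_ae ?_⟩
  have h := (measurePreserving_ofVec m n).quasiMeasurePreserving.ae (hN n 0 0 0 hn)
  filter_upwards [h] with K hK
  have h1 : vecAmp (amp (Ψ : GhostSpace m)) n K = 0 := hK
  simp [h1]

theorem krein_self_nonneg (hm : ∀ a, 0 < m a) {Φ : core m} (h : Φ ∈ physical m) :
    0 ≤ (krein (Φ : GhostSpace m) (Φ : GhostSpace m)).re := by
  have h1 := fun n => (isTransverse_vecAmp h n).vecForm_self_nonneg hm (memLp_vecAmp Φ n)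
  choose x hx h2 using h1
  rw [krein_physical h]
  simp only [h2]
  rw [← Complex.ofReal_tsum, Complex.ofReal_re]
  exact tsum_nonneg hx

/-- The form is a finite sum of non-negative contributions, one for each particle number, so all of
them vanish and definiteness applies in every sector. -/
theorem eq_zero_of_krein_self (hm : ∀ a, 0 < m a) {Φ : core m} (h : Φ ∈ physical m)
    (h0 : krein (Φ : GhostSpace m) (Φ : GhostSpace m) = 0) : Φ = 0 := by
  have h1 := fun n => (isTransverse_vecAmp h n).vecForm_self_nonneg hm (memLp_vecAmp Φ n)
  choose x hx h2 using h1
  obtain ⟨N, hN⟩ := exists_vecForm_eq_zero Φ (Φ : GhostSpace m)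
  rw [krein_physical h] at h0
  simp only [h2] at h0 hN
  rw [← Complex.ofReal_tsum, Complex.ofReal_eq_zero] at h0
  have hs : Summable x := summable_of_ne_finset_zero (s := Finset.range (N + 1)) fun n hn => by
    simp only [Finset.mem_range, not_lt] at hn
    exact_mod_cast hN n hn
  have h3 : ∀ n, x n = 0 := fun n => congrFun ((hs.hasSum_iff.2 h0 |> (hasSum_zero_iff_of_nonneg hx).1)) n
  refine core_eq_zero ((ampEq_ghostFree h).trans fun n w l s => ?_)
  by_cases h4 : (w, l, s) = (0, 0, 0)
  · simp only [Prod.mk.injEq] at h4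
    obtain ⟨rfl, rfl, rfl⟩ := h4
    have h5 := (isTransverse_vecAmp h n).eq_zero hm (memLp_vecAmp Φ n) (by rw [h2, h3, Complex.ofReal_zero])
    filter_upwards [(measurePreserving_vec m n).quasiMeasurePreserving.ae h5] with x hx
    rw [vecAmp, ofVec_fst] at hx
    exact hx
  · rw [ghostFree_of_ne _ h4]
    rfl

variable {g : Poincare}

theorem vecAmp_ghostAction (Ψ : Amp r) (n : ℕ) :
    vecAmp (ghostAction g Ψ) n = vecAction g (vecAmp Ψ n) := by
  funext K
  change ghostAction g Ψ n 0 0 0 (ofVec K) = _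
  simp only [ghostAction, vecAction, zero_add, pow_zero, one_mul, Finset.univ_eq_empty,
    Finset.prod_empty, mul_one]
  refine congrArg _ (Finset.sum_congr rfl fun ν _ => ?_)
  exact congrArg (fun x => _ * g.conjIfReversing (Ψ n 0 0 0 x))
    (Prod.ext rfl (Subsingleton.elim _ _))

theorem krein_of_ghostAction (hm : ∀ a, 0 < m a) {Ψ Φ Ψ' Φ' : core m} (hΨ : Ψ ∈ physical m)
    (hΨ' : Ψ' ∈ physical m)
    (h : AmpEq m (amp (Ψ' : GhostSpace m)) (ghostAction g (amp (Ψ : GhostSpace m))))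
    (h' : AmpEq m (amp (Φ' : GhostSpace m)) (ghostAction g (amp (Φ : GhostSpace m)))) :
    krein (Ψ' : GhostSpace m) (Φ' : GhostSpace m) =
      g.conjIfReversing (krein (Ψ : GhostSpace m) (Φ : GhostSpace m)) := by
  obtain ⟨N, hN⟩ := exists_vecForm_eq_zero Ψ (Φ : GhostSpace m)
  have h1 : ∀ n, vecForm m (vecAmp (amp (Ψ' : GhostSpace m)) n) (vecAmp (amp (Φ' : GhostSpace m)) n) =
      g.conjIfReversing (vecForm m (vecAmp (amp (Ψ : GhostSpace m)) n)
        (vecAmp (amp (Φ : GhostSpace m)) n)) := fun n => by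
    rw [← vecForm_vecAction g hm (memLp_vecAmp Ψ n) (memLp_vecAmp Φ n), ← vecAmp_ghostAction,
      ← vecAmp_ghostAction]
    exact vecForm_congr (h.vecAmp n) (h'.vecAmp n)
  have h2 : ∀ n ∉ Finset.range (N + 1), vecForm m (vecAmp (amp (Ψ : GhostSpace m)) n)
      (vecAmp (amp (Φ : GhostSpace m)) n) = 0 := fun n hn => hN n (by simpa using hn)
  refine (krein_physical hΨ' Φ').trans (((tsum_congr h1).trans ?_).trans
    (congrArg g.conjIfReversing (krein_physical hΨ Φ).symm))
  rw [tsum_eq_sum h2, tsum_eq_sum fun n hn => by rw [h2 n hn, map_zero], map_sum]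

theorem IsGhostAction.krein_physical (hm : ∀ a, 0 < m a)
    {U : core m →ₛₗ[g.conjIfReversing] core m} (hU : IsGhostAction g U) {Ψ : core m}
    (hΨ : Ψ ∈ physical m) (Φ : core m) : krein (U Ψ : GhostSpace m) (U Φ : GhostSpace m) =
      g.conjIfReversing (krein (Ψ : GhostSpace m) (Φ : GhostSpace m)) :=
  krein_of_ghostAction hm hΨ (hU.map_physical hm hΨ) (fun n w l s => hU Ψ n w l s)
    fun n w l s => hU Φ n w l s

end PhysicalForm

/-! ## Hilbert space isometries determined by families of vectors -/

section Families

/-- Only the zero vector is orthogonal to the whole family. -/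
def IsTotal {I E : Type*} [NormedAddCommGroup E] [InnerProductSpace ℂ E] (x : I → E) : Prop :=
  ∀ v, (∀ i, ⟪x i, v⟫_ℂ = 0) → v = 0

variable {I E F : Type*} [NormedAddCommGroup E] [InnerProductSpace ℂ E]
  [NormedAddCommGroup F] [InnerProductSpace ℂ F] {σ : ℂ →+* ℂ}

/-- In a Hilbert space a trivial orthogonal complement means a dense span. -/
theorem IsTotal.denseRange [CompleteSpace E] {x : I → E} (hx : IsTotal x) :
    DenseRange (Finsupp.linearCombination ℂ x) := by
  have h : (Submodule.span ℂ (Set.range x)).topologicalClosure = ⊤ := by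
    rw [Submodule.topologicalClosure_eq_top_iff, Submodule.eq_bot_iff]
    exact fun v hv => hx v fun i => hv _ (Submodule.subset_span ⟨i, rfl⟩)
  rw [← Finsupp.range_linearCombination, ← Submodule.dense_iff_topologicalClosure_eq_top] at h
  exact h

/-- The semilinear combination `∑ σ(c_i) y_i`. -/
def semiCombination (σ : ℂ →+* ℂ) (y : I → F) : (I →₀ ℂ) →ₛₗ[σ] F where
  toFun c := Finsupp.linearCombination ℂ y (c.mapRange σ (map_zero σ))
  map_add' c d := by rw [Finsupp.mapRange_add (map_add σ), map_add]
  map_smul' a c := by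
    rw [← map_smul]
    congr 1
    ext i
    simp

theorem semiCombination_single (y : I → F) (i : I) (a : ℂ) :
    semiCombination σ y (Finsupp.single i a) = σ a • y i := by
  simp [semiCombination]

theorem inner_semiCombination (hσ : IsConjOrId σ) {x : I → E} {y : I → F}
    (h : ∀ i j, ⟪y i, y j⟫_ℂ = σ ⟪x i, x j⟫_ℂ) (c d : I →₀ ℂ) :
    ⟪semiCombination σ y c, semiCombination σ y d⟫_ℂ =
      σ ⟪Finsupp.linearCombination ℂ x c, Finsupp.linearCombination ℂ x d⟫_ℂ := by
  have hc : ∀ z, conj (σ z) = σ (conj z) := fun z => by rcases hσ with rfl | rfl <;> rfl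
  induction c using Finsupp.induction_linear with
  | zero => simp
  | add c c' h1 h2 => simp only [map_add, inner_add_left, h1, h2]
  | single i a =>
    induction d using Finsupp.induction_linear with
    | zero => simp
    | add c c' h1 h2 => simp only [map_add, inner_add_right, h1, h2]
    | single j b =>
      rw [semiCombination_single, semiCombination_single, Finsupp.linearCombination_single,
        Finsupp.linearCombination_single, inner_smul_left, inner_smul_right, inner_smul_left,
        inner_smul_right, h, hc, map_mul, map_mul]

/-- Equality of the Gram matrices makes Σ c_i x_i ↦ Σ σ(c_i) y_i norm preserving on finite
combinations. It is thus well defined on the dense span and extends by continuity. -/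
theorem exists_isometry_of_inner (hσ : IsConjOrId σ) [CompleteSpace E] [CompleteSpace F] {x : I → E} {y : I → F}
    (h : ∀ i j, ⟪y i, y j⟫_ℂ = σ ⟪x i, x j⟫_ℂ) (hx : IsTotal x) :
    ∃ U : E →SL[σ] F, (∀ v, ‖U v‖ = ‖v‖) ∧ ∀ i, U (x i) = y i := by
  have hn : ∀ c, ‖semiCombination σ y c‖ = ‖Finsupp.linearCombination ℂ x c‖ := fun c => by
    have h1 := congrArg norm (inner_semiCombination hσ h c c)
    rw [hσ.norm, inner_self_eq_norm_sq_to_K, inner_self_eq_norm_sq_to_K] at h1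
    simpa using h1
  have hd := hx.denseRange
  have he : ∀ c, (semiCombination σ y).extendOfNorm (Finsupp.linearCombination ℂ x)
      (Finsupp.linearCombination ℂ x c) = semiCombination σ y c :=
    LinearMap.extendOfNorm_eq hd ⟨1, fun c => by rw [hn, one_mul]⟩
  refine ⟨(semiCombination σ y).extendOfNorm (Finsupp.linearCombination ℂ x), fun v => ?_, fun i => ?_⟩
  · refine hd.induction_on (p := fun v => ‖(semiCombination σ y).extendOfNorm
      (Finsupp.linearCombination ℂ x) v‖ = ‖v‖) v ?_ fun c => ?_
    · exact isClosed_eq (ContinuousLinearMap.continuous _).norm continuous_norm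
    · rw [he, hn]
  · have := he (Finsupp.single i 1)
    rwa [Finsupp.linearCombination_single, one_smul, semiCombination_single, map_one, one_smul] at this

/-- As σ is an involution, the hypothesis is symmetric in the two families. The isometries in the
two directions are mutually inverse on the dense spans, hence everywhere. -/
theorem exists_isometryEquiv_of_inner (hσ : IsConjOrId σ) [RingHomInvPair σ σ] [CompleteSpace E] [CompleteSpace F]
    {x : I → E} {y : I → F} (h : ∀ i j, ⟪y i, y j⟫_ℂ = σ ⟪x i, x j⟫_ℂ) (hx : IsTotal x)
    (hy : IsTotal y) : ∃ U : E ≃ₛₗᵢ[σ] F, ∀ i, U (x i) = y i := by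
  have hs : ∀ z, σ (σ z) = z := fun z =>
    RingHomInvPair.comp_apply_eq (σ := σ) (σ' := σ) (x := z)
  obtain ⟨U, hU, hUx⟩ := exists_isometry_of_inner hσ h hx
  obtain ⟨V, -, hVy⟩ := exists_isometry_of_inner hσ (x := y) (y := x)
    (fun i j => by rw [h, hs]) hy
  have h1 : ∀ v, V (U v) = v := fun v => by
    refine hx.denseRange.induction_on (p := fun v => V (U v) = v) v
      (isClosed_eq (V.continuous.comp U.continuous) continuous_id) fun c => ?_
    induction c using Finsupp.induction_linear with
    | zero => simp
    | add c d h1 h2 => simp only [map_add, h1, h2]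
    | single i a => rw [Finsupp.linearCombination_single, map_smulₛₗ, map_smulₛₗ, hUx, hVy, hs]
  have h2 : ∀ v, U (V v) = v := fun v => by
    refine hy.denseRange.induction_on (p := fun v => U (V v) = v) v
      (isClosed_eq (U.continuous.comp V.continuous) continuous_id) fun c => ?_
    induction c using Finsupp.induction_linear with
    | zero => simp
    | add c d h1 h2 => simp only [map_add, h1, h2]
    | single i a => rw [Finsupp.linearCombination_single, map_smulₛₗ, map_smulₛₗ, hVy, hUx, hs]
  exact ⟨⟨{ U.toLinearMap with invFun := V, left_inv := h1, right_inv := h2 }, hU⟩, hUx⟩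

end Families

/-! ## Inner products and density in the Bosonic Fock space -/

section FockSpace

variable {K : Type} [NormedAddCommGroup K] [InnerProductSpace ℂ K]

theorem inner_elemTensor (n : ℕ) (v w : Fin n → K) :
    ⟪elemTensor n v, elemTensor n w⟫_ℂ = ∏ i, ⟪v i, w i⟫_ℂ := by
  induction n with
  | zero =>
    change ⟪(1 : ℂ), (1 : ℂ)⟫_ℂ = _
    simp
  | succ n ih =>
    rw [Fin.prod_univ_succ]
    exact (TensorProduct.inner_tmul (𝕜 := ℂ) _ _ _ _).trans (congrArg _ (ih _ _))

/-- The normalised permanent-like sum giving the inner products of symmetrised tensors. -/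
def symPairing (n : ℕ) (G : Fin n → Fin n → ℂ) : ℂ :=
  (n.factorial : ℂ)⁻¹ * ((n.factorial : ℂ)⁻¹ *
    ∑ π : Equiv.Perm (Fin n), ∑ ρ : Equiv.Perm (Fin n), ∏ i, G (π i) (ρ i))

theorem inner_symTensor (n : ℕ) (v w : Fin n → K) :
    ⟪symTensor n v, symTensor n w⟫_ℂ = symPairing n fun i j => ⟪v i, w j⟫_ℂ := by
  simp only [symTensor, inner_smul_left, inner_smul_right, sum_inner, inner_sum, inner_elemTensor,
    symPairing, map_inv₀, map_natCast]
  rw [← Finset.mul_sum, Finset.sum_comm]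

theorem inner_wedge (n : ℕ) (v w : Fin n → K) :
    ⟪wedge n v, wedge n w⟫_ℂ = symPairing n fun i j => ⟪v i, w j⟫_ℂ := by
  refine Eq.trans (b := ⟪wedgeFull n v, wedgeFull n w⟫_ℂ) rfl ?_
  rw [wedgeFull, lp.inner_single_left, wedgeFull, lp.single_apply_self,
    UniformSpace.Completion.inner_coe, inner_symTensor]

theorem inner_wedge_of_ne {n n' : ℕ} (h : n ≠ n') (v : Fin n → K) (w : Fin n' → K) :
    ⟪wedge n v, wedge n' w⟫_ℂ = 0 := by
  refine Eq.trans (b := ⟪wedgeFull n v, wedgeFull n' w⟫_ℂ) rfl ?_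
  rw [wedgeFull, lp.inner_single_left, wedgeFull, lp.single_apply_ne _ _ _ h, inner_zero_right]

theorem continuous_elemTensor (n : ℕ) : Continuous (elemTensor (K := K) n) := by
  induction n with
  | zero => exact continuous_const
  | succ n ih =>
    have h := (LinearMap.mkContinuous₂ (TensorProduct.mk ℂ K (TPow K n)) 1 fun x y => by
      rw [one_mul]; exact (TensorProduct.norm_tmul (𝕜 := ℂ) x y).le).continuous₂
    have h2 : Continuous fun v : Fin (n + 1) → K => (v 0, elemTensor n (Fin.tail v)) :=
      (continuous_apply 0).prodMk (ih.comp (continuous_pi fun i => continuous_apply _))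
    exact h.comp h2

theorem continuous_wedge (n : ℕ) : Continuous (wedge (K := K) n) := by
  refine Continuous.subtype_mk ?_ _
  refine ((lp.isometry_single n).continuous.comp (UniformSpace.Completion.continuous_coe _)).comp ?_
  refine Continuous.const_smul (continuous_finsetSum _ fun σ _ => ?_) _
  exact (continuous_elemTensor n).comp (continuous_pi fun i => continuous_apply _)

theorem isTotal_wedge : IsTotal fun z : Σ n, Fin n → K => wedge z.1 z.2 := by
  intro x hx
  have h : (x : FullFock K) ∈ (bosonSubspace K)ᗮ := by
    refine (Submodule.orthogonal_closure _).ge ?_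
    rw [Submodule.mem_orthogonal]
    intro u hu
    refine Submodule.span_induction (p := fun u _ => ⟪u, (x : FullFock K)⟫_ℂ = 0) ?_ ?_ ?_ ?_ hu
    · rintro _ ⟨n, v, rfl⟩
      exact hx ⟨n, v⟩
    · exact inner_zero_left _
    · intro a b _ _ h1 h2
      rw [inner_add_left, h1, h2, add_zero]
    · intro a b _ h1
      rw [inner_smul_left, h1, mul_zero]
  exact Subtype.ext (inner_self_eq_zero.1 (h _ x.2))

/-- Wedge products depend continuously on their factors jointly, so factors from a dense set
suffice. -/
theorem isTotal_wedge_of_dense {J : Type*} {d : J → K} (hd : DenseRange d) :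
    IsTotal fun z : Σ n, Fin n → J => wedge z.1 fun i => d (z.2 i) := by
  intro x hx
  refine isTotal_wedge x fun ⟨n, v⟩ => ?_
  have h1 : DenseRange fun (z : Fin n → J) i => d (z i) := DenseRange.piMap fun _ => hd
  refine h1.induction_on (p := fun v => ⟪wedge n v, x⟫_ℂ = 0) v ?_ fun z => hx ⟨n, z⟩
  exact isClosed_eq ((continuous_wedge n).inner continuous_const) continuous_const

variable {σ : ℂ →+* ℂ} [RingHomInvPair σ σ]

/-- The inner products of wedge products are polynomials with rational coefficients in those of
their factors, and thus transform by σ. The operator is then determined by its values on the total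
family of wedges. -/
theorem exists_isSecondQuantised (hσ : IsConjOrId σ) (u : K ≃ₛₗᵢ[σ] K) 
    (hu : ∀ v w, ⟪u v, u w⟫_ℂ = σ ⟪v, w⟫_ℂ) :
    ∃ V : BosonFock K ≃ₛₗᵢ[σ] BosonFock K, IsSecondQuantised u V := by
  have h : ∀ z z' : Σ n, Fin n → K, ⟪wedge z.1 fun i => u (z.2 i), wedge z'.1 fun i => u (z'.2 i)⟫_ℂ =
      σ ⟪wedge z.1 z.2, wedge z'.1 z'.2⟫_ℂ := by
    rintro ⟨n, v⟩ ⟨n', w⟩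
    by_cases h : n = n'
    · subst h
      simp only [inner_wedge, hu, symPairing, map_mul, map_sum, map_prod, map_inv₀, map_natCast]
    · simp only [inner_wedge_of_ne h, map_zero]
  obtain ⟨V, hV⟩ := exists_isometryEquiv_of_inner hσ h isTotal_wedge
    (isTotal_wedge_of_dense u.surjective.denseRange)
  exact ⟨V, fun n v => hV ⟨n, v⟩⟩

end FockSpace

/-! ## The one-particle space -/

section OneParticle

open scoped Matrix

variable {m : Fin r → ℝ}

theorem PreParticle.transverse (φ : PreParticle m) :
    ∀ᵐ y ∂scalMeasure m, ∑ ν, (y.2 ν : ℂ) * φ.toLp (ν, y) = 0 :=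
  (show MassiveVector.transverse m from φ).2

theorem exists_preParticle {f : Vec r → ℂ} (hf : MemLp f 2 (vecMeasure m))
    (ht : ∀ᵐ y ∂scalMeasure m, ∑ ν, (y.2 ν : ℂ) * f (ν, y) = 0) :
    ∃ φ : PreParticle m, φ.toLp =ᵐ[vecMeasure m] f := by
  have h1 : ∀ᵐ y ∂scalMeasure m, ∀ ν, hf.toLp f (ν, y) = f (ν, y) :=
    ae_all_iff.2 fun ν => (bddMap_mkVec m ν).ae hf.coeFn_toLp
  have h2 : hf.toLp f ∈ MassiveVector.transverse m := by
    change ∀ᵐ y ∂scalMeasure m, ∑ ν, (y.2 ν : ℂ) * hf.toLp f (ν, y) = 0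
    filter_upwards [h1, ht] with y h3 h4
    simpa only [h3] using h4
  exact ⟨(⟨hf.toLp f, h2⟩ : MassiveVector.transverse m), hf.coeFn_toLp⟩

theorem PreParticle.ext {φ ψ : PreParticle m} (h : φ.toLp =ᵐ[vecMeasure m] ψ.toLp) : φ = ψ := by
  have h1 : φ.toLp = ψ.toLp := Lp.ext h
  exact Subtype.ext (p := fun x => x ∈ MassiveVector.transverse m) h1

theorem inner_preParticle (φ ψ : PreParticle m) : ⟪φ, ψ⟫_ℂ = oneForm φ ψ := rfl

/-- The one-particle form is the case n = 1, so its invariance follows from that of the n-particle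
forms. -/
theorem oneForm_eq_vecForm (φ ψ : PreParticle m) : oneForm φ ψ =
    vecForm m (prodFn fun _ : Fin 1 => φ.toLp) (prodFn fun _ : Fin 1 => ψ.toLp) := by
  rw [vecForm_prodFn (n := 1) (fun _ => φ) fun _ => ψ, Fin.prod_univ_one]

theorem prodFn_congr {n : ℕ} {φ ψ : Fin n → Vec r → ℂ} (h : ∀ i, φ i =ᵐ[vecMeasure m] ψ i) :
    prodFn φ =ᵐ[vecPi m n] prodFn ψ := by
  have h1 : ∀ᵐ K ∂vecPi m n, ∀ i, φ i (K i) = ψ i (K i) := ae_all_iff.2 fun i =>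
    (Measure.quasiMeasurePreserving_eval (μ := fun _ : Fin n => vecMeasure m) i).ae (h i)
  filter_upwards [h1] with K hK
  exact Finset.prod_congr rfl fun i _ => hK i

variable (g : Poincare)

theorem exists_oneAction (hm : ∀ a, 0 < m a) (φ : PreParticle m) :
    ∃ ψ : PreParticle m, ψ.toLp =ᵐ[vecMeasure m] oneAction g φ.toLp := by
  refine exists_preParticle ?_ ?_
  · have h0 : ∀ ν, BddMap (fun z : Vec r => (ν, g.pull z.2)) (vecMeasure m) (vecMeasure m) := fun ν =>
      (bddMap_mkVec m ν).comp ((g.measurePreserving_pull hm).bddMap.comp (bddMap_snd m))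
    have h1 : MemLp (fun z : Vec r => ∑ ν, (g.phase z.2.2 * (g.cov z.1 ν : ℂ)) *
        g.conjIfReversing (φ.toLp (ν, g.pull z.2))) 2 (vecMeasure m) := by
      refine memLp_finsetSum _ fun ν _ => memLp_bdd_mul (C := ∑ μ, ‖(g.cov μ ν : ℂ)‖)
        (g.isConjOrId.memLp ((h0 ν).memLp φ.memLp)) ?_ fun z => ?_
      · exact (g.measurable_phase.comp (by fun_prop)).mul
          ((measurable_from_top (f := fun μ => (g.cov μ ν : ℂ))).comp measurable_fst)
      · rw [norm_mul, g.norm_phase, one_mul]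
        exact Finset.single_le_sum (f := fun μ => ‖(g.cov μ ν : ℂ)‖) (fun _ _ => norm_nonneg _)
          (Finset.mem_univ z.1)
    refine h1.ae_eq (.of_forall fun z => ?_)
    simp only [oneAction, Finset.mul_sum, mul_assoc]
  · filter_upwards [(g.measurePreserving_pull hm).quasiMeasurePreserving.ae φ.transverse] with y hy
    simp only [oneAction, Finset.mul_sum]
    rw [Finset.sum_comm]
    have h1 : ∀ ν, ∑ μ, (y.2 μ : ℂ) * (g.cov μ ν : ℂ) = (g.sgn : ℂ) * ((g.pull y).2 ν : ℂ) :=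
      fun ν => by exact_mod_cast g.sum_mul_cov y ν
    calc _ = ∑ ν, g.phase y.2 * ((∑ μ, (y.2 μ : ℂ) * (g.cov μ ν : ℂ)) *
          g.conjIfReversing (φ.toLp (ν, g.pull y))) := by
          refine Finset.sum_congr rfl fun ν _ => ?_
          rw [Finset.sum_mul, Finset.mul_sum]
          exact Finset.sum_congr rfl fun μ _ => by ring
      _ = g.phase y.2 * (g.sgn * g.conjIfReversing (∑ ν, ((g.pull y).2 ν : ℂ) *
          φ.toLp (ν, g.pull y))) := by
          simp only [h1, map_sum, map_mul, g.conj_ofReal, Finset.mul_sum]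
          exact Finset.sum_congr rfl fun ν _ => by ring
      _ = 0 := by rw [hy, map_zero, mul_zero, mul_zero]

theorem oneForm_of_oneAction (hm : ∀ a, 0 < m a) {φ ψ φ' ψ' : PreParticle m}
    (h : φ'.toLp =ᵐ[vecMeasure m] oneAction g φ.toLp)
    (h' : ψ'.toLp =ᵐ[vecMeasure m] oneAction g ψ.toLp) :
    oneForm φ' ψ' = g.conjIfReversing (oneForm φ ψ) := by
  rw [oneForm_eq_vecForm, oneForm_eq_vecForm φ ψ, ← vecForm_vecAction g hm
    (memLp_prodFn fun _ => φ.memLp) (memLp_prodFn fun _ => ψ.memLp), vecAction_prodFn,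
    vecAction_prodFn]
  exact vecForm_congr (prodFn_congr fun _ => h) (prodFn_congr fun _ => h')

theorem bounded_of_oneAction {φ ψ : PreParticle m} (hm : ∀ a, 0 < m a)
    (h : ψ.toLp =ᵐ[vecMeasure m] oneAction g φ.toLp) (hφ : φ.Bounded) : ψ.Bounded := by
  obtain ⟨R, hR⟩ := hφ
  obtain ⟨C, hC⟩ := g.exists_norm_le_pull (r := r)
  have h1 : ∀ᵐ z ∂vecMeasure m, ∀ ν, R < ‖(g.pull z.2).2‖ → φ.toLp (ν, g.pull z.2) = 0 :=
    ae_all_iff.2 fun ν => ((bddMap_mkVec m ν).comp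
      ((g.measurePreserving_pull hm).bddMap.comp (bddMap_snd m))).ae hR
  refine ⟨C * R, ?_⟩
  filter_upwards [h, h1] with z h2 h3 h4
  rw [h2, oneAction]
  refine mul_eq_zero_of_right _ (Finset.sum_eq_zero fun ν _ => ?_)
  rw [h3 ν (not_le.1 fun h5 => (hC R z.2 h5).not_gt h4), map_zero, mul_zero]

/-- The inverse Poincaré transformation. -/
def Poincare.inv : Poincare := ⟨-(lorentzInv g.L *ᵥ g.a), lorentzInv g.L, lorentz_lorentzInv g.isLorentz⟩

theorem Poincare.inv_zero : g.inv.L 0 0 = g.L 0 0 := by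
  change lorentzInv g.L 0 0 = _
  rw [lorentzInv_apply, eta_values.1, one_mul, mul_one]

theorem Poincare.sgn_inv : g.inv.sgn = g.sgn := by
  rw [sgn, sgn, inv_zero]

theorem Poincare.conjIfReversing_inv : g.inv.conjIfReversing = g.conjIfReversing := by
  rw [conjIfReversing, conjIfReversing, inv_zero]

theorem Poincare.inv_pull (y : Scal r) : g.inv.pull (g.pull y) = y := by
  refine Prod.ext rfl ?_
  rw [pull_eq, pull_eq]
  change g.inv.pullMatrix *ᵥ (g.pullMatrix *ᵥ y.2) = y.2
  rw [pullMatrix, pullMatrix, sgn_inv, inv, lorentzInv_lorentzInv, Matrix.mulVec_mulVec,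
    Matrix.smul_mul, Matrix.mul_smul, mul_lorentzInv g.isLorentz, smul_smul, sgn_mul_self, one_smul,
    Matrix.one_mulVec]

/-- For time-reversing elements both the momentum and the phase change sign, the first by the sign
in `pull`, the second by conjugation. The two effects compensate. -/
theorem Poincare.phase_inv (y : Scal r) :
    g.phase y.2 * g.conjIfReversing (g.inv.phase (g.pull y).2) = 1 := by
  have h1 : mink g.inv.a (g.pull y).2 = -(g.sgn * mink g.a y.2) := by
    have h2 := mink_mulVec (lorentz_lorentzInv g.isLorentz) g.a y.2
    rw [pull_eq, pullMatrix, inv, ← h2]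
    simp only [mink, Matrix.smul_mulVec, Pi.neg_apply, Pi.smul_apply, smul_eq_mul, Finset.mul_sum,
      ← Finset.sum_neg_distrib]
    exact Finset.sum_congr rfl fun μ _ => by ring
  have h3 : g.conjIfReversing (Complex.exp (Complex.I * (mink g.inv.a (g.pull y).2 : ℂ))) =
      Complex.exp (g.conjIfReversing (Complex.I * (mink g.inv.a (g.pull y).2 : ℂ))) := by
    rcases g.isConjOrId with h | h <;> rw [h]
    · rfl
    · exact (Complex.exp_conj _).symm
  rw [phase, phase, h3, ← Complex.exp_add, h1, map_mul, g.conj_ofReal, Complex.exp_eq_one_iff]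
  refine ⟨0, ?_⟩
  push_cast
  linear_combination (-(mink g.a y.2 : ℂ)) * g.sgn_mul_conj_I

theorem Poincare.sum_cov_inv (μ ρ : Fin 4) :
    ∑ ν, g.cov μ ν * g.inv.cov ν ρ = if μ = ρ then 1 else 0 := by
  have h := congrFun (congrFun (mul_lorentzInv g.isLorentz) μ) ρ
  rw [Matrix.mul_apply, Matrix.one_apply] at h
  calc _ = eta μ * eta ρ * ∑ ν, g.L μ ν * lorentzInv g.L ν ρ := by
        rw [Finset.mul_sum]
        refine Finset.sum_congr rfl fun ν _ => ?_
        rw [cov, cov, inv]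
        linear_combination (eta μ * eta ρ * g.L μ ν * lorentzInv g.L ν ρ) * eta_mul_eta ν
    _ = _ := by
        rw [h]
        split_ifs with h1
        · rw [h1, mul_one, eta_mul_eta]
        · rw [mul_zero]

theorem oneAction_inv (f : Vec r → ℂ) : oneAction g (oneAction g.inv f) = f := by
  have hσ : ∀ z, g.conjIfReversing (g.conjIfReversing z) = z := fun z =>
    RingHomInvPair.comp_apply_eq (σ := g.conjIfReversing) (σ' := g.conjIfReversing) (x := z)
  funext z
  have h1 : ∀ ρ, ∑ ν, (g.cov z.1 ν : ℂ) * (g.inv.cov ν ρ : ℂ) = if z.1 = ρ then 1 else 0 := fun ρ => by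
    have := congrArg (fun x : ℝ => (x : ℂ)) (g.sum_cov_inv z.1 ρ)
    simp only [Complex.ofReal_sum, Complex.ofReal_mul] at this
    rw [this]
    split_ifs <;> simp
  simp only [oneAction, g.conjIfReversing_inv, map_mul, map_sum, hσ, g.conj_ofReal, g.inv_pull]
  calc _ = (g.phase z.2.2 * g.conjIfReversing (g.inv.phase (g.pull z.2).2)) *
        ∑ ρ, (∑ ν, (g.cov z.1 ν : ℂ) * (g.inv.cov ν ρ : ℂ)) * f (ρ, z.2) := by
        simp only [Finset.mul_sum, Finset.sum_mul]
        rw [Finset.sum_comm]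
        exact Finset.sum_congr rfl fun ν _ => Finset.sum_congr rfl fun ρ _ => by ring
    _ = _ := by
        rw [g.phase_inv, one_mul]
        simp only [h1, ite_mul, one_mul, zero_mul, Finset.sum_ite_eq, Finset.mem_univ, if_true]

theorem oneAction_congr (hm : ∀ a, 0 < m a) {f h : Vec r → ℂ} (e : f =ᵐ[vecMeasure m] h) :
    oneAction g f =ᵐ[vecMeasure m] oneAction g h := by
  have h1 : ∀ᵐ z ∂vecMeasure m, ∀ ν, f (ν, g.pull z.2) = h (ν, g.pull z.2) :=
    ae_all_iff.2 fun ν => ((bddMap_mkVec m ν).comp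
      ((g.measurePreserving_pull hm).bddMap.comp (bddMap_snd m))).ae e
  filter_upwards [h1] with z hz
  simp only [oneAction, hz]

theorem isTotal_coe_of_dense {E : Type*} [SeminormedAddCommGroup E] [InnerProductSpace ℂ E]
    {J : Type*} {x : J → E} (hx : DenseRange fun i => (x i : UniformSpace.Completion E)) :
    IsTotal fun i => (x i : UniformSpace.Completion E) := by
  intro v hv
  refine inner_self_eq_zero.1 (hx.induction_on (p := fun w => ⟪w, v⟫_ℂ = 0) v ?_ hv)
  exact isClosed_eq (continuous_id.inner continuous_const) continuous_const

/-- The images of the dense family from H_m have the transformed Gram matrix, and they are dense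
because the inverse Poincaré element provides preimages. -/
theorem exists_isParticleAction (hm : ∀ a, 0 < m a) :
    ∃ u : Particle m ≃ₛₗᵢ[g.conjIfReversing] Particle m, IsParticleAction g u ∧
      ∀ v w, ⟪u v, u w⟫_ℂ = g.conjIfReversing ⟪v, w⟫_ℂ := by
  choose T hT using exists_oneAction (m := m) g hm
  have hsurj : Function.Surjective T := fun χ => by
    obtain ⟨φ, hφ⟩ := exists_oneAction g.inv hm χ
    refine ⟨φ, PreParticle.ext ((hT φ).trans ((oneAction_congr g hm hφ).trans ?_))⟩
    rw [oneAction_inv]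
  have hd : DenseRange fun φ : PreParticle m => (φ : Particle m) :=
    UniformSpace.Completion.denseRange_coe
  obtain ⟨u, hu⟩ := exists_isometryEquiv_of_inner g.isConjOrId
    (x := fun φ : PreParticle m => (φ : Particle m))
    (y := fun φ : PreParticle m => ((T φ : PreParticle m) : Particle m))
    (fun φ ψ => by
      rw [UniformSpace.Completion.inner_coe, UniformSpace.Completion.inner_coe]
      exact oneForm_of_oneAction g hm (hT φ) (hT ψ))
    (isTotal_coe_of_dense hd) (isTotal_coe_of_dense (hd.comp hsurj.denseRange
      (UniformSpace.Completion.continuous_coe _)))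
  refine ⟨u, fun φ => ⟨T φ, hT φ, hu φ⟩, fun v w => ?_⟩
  refine hd.induction_on₂ (p := fun v w => ⟪u v, u w⟫_ℂ = g.conjIfReversing ⟪v, w⟫_ℂ) ?_ ?_ v w
  · exact isClosed_eq ((u.continuous.comp continuous_fst).inner (u.continuous.comp continuous_snd))
      (g.isConjOrId.continuous.comp (continuous_fst.inner continuous_snd))
  · intro φ ψ
    rw [hu, hu, UniformSpace.Completion.inner_coe, UniformSpace.Completion.inner_coe]
    exact oneForm_of_oneAction g hm (hT φ) (hT ψ)

/-- Cutting off momenta keeps transversality, which is a condition at each momentum separately.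
Convergence of the cutoffs in the invariant norm is dominated convergence for the integrable density
of the form. -/
theorem denseRange_bounded (m : Fin r → ℝ) :
    DenseRange fun φ : {φ : PreParticle m // φ.Bounded} => (φ.1 : Particle m) := by
  refine UniformSpace.Completion.denseRange_coe.comp (f := fun φ : {φ : PreParticle m // φ.Bounded} => φ.1)
    ?_ (UniformSpace.Completion.continuous_coe _)
  intro φ
  have hB : ∀ k : ℕ, MeasurableSet {z : Vec r | ‖z.2.2‖ ≤ k} := fun k =>
    measurableSet_le (by fun_prop) measurable_const
  have h1 : ∀ k : ℕ, ∃ ψ : PreParticle m, ψ.toLp =ᵐ[vecMeasure m]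
      Set.indicator {z : Vec r | ‖z.2.2‖ ≤ k} φ.toLp := fun k => by
    refine exists_preParticle (φ.memLp.indicator (hB k)) ?_
    filter_upwards [φ.transverse] with y hy
    by_cases h : ‖y.2‖ ≤ k
    · simpa [Set.indicator, h] using hy
    · simp [Set.indicator, h]
  choose ψ hψ using h1
  have hb : ∀ k, (ψ k).Bounded := fun k => ⟨k, by
    filter_upwards [hψ k] with z h2 h3
    rw [h2, Set.indicator_of_notMem]
    exact not_le.2 h3⟩
  refine mem_closure_of_tendsto (f := ψ) (b := Filter.atTop) ?_ (.of_forall fun k => ⟨⟨ψ k, hb k⟩, rfl⟩)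
  have h2 : Filter.Tendsto (fun k => oneForm (ψ k - φ) (ψ k - φ)) Filter.atTop (nhds 0) := by
    have h3 : ∀ k : ℕ, oneForm (ψ k - φ) (ψ k - φ) = ∫ z, (if ‖z.2.2‖ ≤ k then 0 else
        (-(eta z.1) : ℂ) * (conj (φ.toLp z) * φ.toLp z)) ∂vecMeasure m := fun k => by
      refine integral_congr_ae ?_
      filter_upwards [Lp.coeFn_sub (ψ k).toLp φ.toLp, hψ k] with z h4 h5
      have h6 : (ψ k - φ).toLp z = (ψ k).toLp z - φ.toLp z := h4
      rw [h6, h5]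
      by_cases h : ‖z.2.2‖ ≤ k
      · rw [Set.indicator_of_mem (by exact h), if_pos h, sub_self, mul_zero, mul_zero]
      · rw [Set.indicator_of_notMem (by exact h), if_neg h, zero_sub, map_neg, neg_mul_neg]
    simp only [h3]
    refine (?_ : Filter.Tendsto _ _ (nhds (∫ _, (0 : ℂ) ∂vecMeasure m))).trans (by simp)
    refine tendsto_integral_of_dominated_convergence
      (fun z => ‖(-(eta z.1) : ℂ) * (conj (φ.toLp z) * φ.toLp z)‖) (fun k => ?_)
      (integrable_oneForm φ.toLp φ.toLp).norm (fun k => .of_forall fun z => ?_) (.of_forall fun z => ?_)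
    · exact ((integrable_oneForm φ.toLp φ.toLp).indicator (hB k).compl).1.congr
        (.of_forall fun z => by by_cases h : ‖z.2.2‖ ≤ k <;> simp [Set.indicator, h])
    · split_ifs
      · rw [norm_zero]; exact norm_nonneg _
      · exact le_rfl
    · refine tendsto_const_nhds.congr' ?_
      filter_upwards [Filter.eventually_ge_atTop ⌈‖z.2.2‖⌉₊] with k hk
      rw [if_pos (Nat.ceil_le.1 hk)]
  rw [tendsto_iff_norm_sub_tendsto_zero]
  have h3 : ∀ k, ‖ψ k - φ‖ = Real.sqrt (oneForm (ψ k - φ) (ψ k - φ)).re := fun k =>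
    norm_eq_sqrt_re_inner (𝕜 := ℂ) (ψ k - φ)
  simp only [h3]
  have h4 := (Real.continuous_sqrt.tendsto _).comp ((Complex.continuous_re.tendsto 0).comp h2)
  simpa [Function.comp_def] using h4

end OneParticle

/-! ## Wedge products as states -/

section Wedges

variable {m : Fin r → ℝ} {n : ℕ}

/-- The state has `n` vector particles, no ghosts, and amplitude `f`. -/
def IsVecState (n : ℕ) (f : (Fin n → Vec r) → ℂ) (Φ : GhostSpace m) : Prop :=
  (∀ i, i ≠ (n, 0, 0, 0) → Φ i = 0) ∧ amp Φ n 0 0 0 =ᵐ[configMeasure m n 0 0 0] fun x => f x.1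

/-- The amplitudes of a state of `n` vector particles. -/
def vecOnly (n : ℕ) (f : (Fin n → Vec r) → ℂ) : Amp r := fun n' w l s x =>
  if h : n' = n ∧ w = 0 ∧ l = 0 ∧ s = 0 then f (x.1 ∘ Fin.cast h.1.symm) else 0

theorem vecOnly_self (f : (Fin n → Vec r) → ℂ) : vecOnly n f n 0 0 0 = fun x => f x.1 :=
  funext fun _ => dif_pos ⟨rfl, rfl, rfl, rfl⟩

theorem vecOnly_of_ne (f : (Fin n → Vec r) → ℂ) {n' w l s : ℕ} (h : (n', w, l, s) ≠ (n, 0, 0, 0)) :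
    vecOnly n f n' w l s = 0 :=
  funext fun _ => dif_neg fun h' => h (by simp [h'])

theorem coreAmp_vecOnly {f : (Fin n → Vec r) → ℂ} (hf : MemLp f 2 (vecPi m n))
    (hs : ∀ (π : Equiv.Perm (Fin n)) (K : Fin n → Vec r), f (K ∘ π) = f K) {R : ℝ}
    (hb : ∀ᵐ K ∂vecPi m n, ¬ (∀ i, ‖(K i).2.2‖ ≤ R) → f K = 0) : CoreAmp m (vecOnly n f) where
  memLp n' w l s := by
    by_cases h : (n', w, l, s) = (n, 0, 0, 0)
    · simp only [Prod.mk.injEq] at h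
      obtain ⟨rfl, rfl, rfl, rfl⟩ := h
      rw [vecOnly_self]
      exact hf.comp_measurePreserving (measurePreserving_vec m n')
    · rw [vecOnly_of_ne _ h]
      exact MemLp.zero'
  sym := by
    refine ⟨vecOnly n f, fun n' w l s π ρ σ τ x => ?_, AmpEq.refl _⟩
    by_cases h : (n', w, l, s) = (n, 0, 0, 0)
    · simp only [Prod.mk.injEq] at h
      obtain ⟨rfl, rfl, rfl, rfl⟩ := h
      rw [vecOnly_self, Subsingleton.elim ρ 1, Subsingleton.elim σ 1]
      simp only [signC]
      exact (hs π x.1).trans (by simp)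
    · rw [vecOnly_of_ne _ h]
      simp
  fin := ⟨n, fun n' w l s h => by
    rw [vecOnly_of_ne _ fun h' => by simp only [Prod.mk.injEq] at h'; omega]⟩
  bdd := by
    refine ⟨R, fun n' w l s => ?_⟩
    by_cases h : (n', w, l, s) = (n, 0, 0, 0)
    · simp only [Prod.mk.injEq] at h
      obtain ⟨rfl, rfl, rfl, rfl⟩ := h
      rw [vecOnly_self]
      filter_upwards [(measurePreserving_vec m n').quasiMeasurePreserving.ae hb] with x h1 h2
      exact h1 fun h3 => h2 ⟨h3, fun i => i.elim0, fun i => i.elim0, fun i => i.elim0⟩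
    · rw [vecOnly_of_ne _ h]
      exact .of_forall fun _ _ => rfl

theorem exists_isVecState {f : (Fin n → Vec r) → ℂ} (hf : MemLp f 2 (vecPi m n))
    (hs : ∀ (π : Equiv.Perm (Fin n)) (K : Fin n → Vec r), f (K ∘ π) = f K) {R : ℝ}
    (hb : ∀ᵐ K ∂vecPi m n, ¬ (∀ i, ‖(K i).2.2‖ ≤ R) → f K = 0) :
    ∃ Φ : core m, IsVecState n f (Φ : GhostSpace m) := by
  obtain ⟨Φ, hΦ⟩ := (coreAmp_vecOnly hf hs hb).exists_core
  refine ⟨Φ, fun i hi => ?_, ?_⟩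
  · have h := hΦ i.1 i.2.1 i.2.2.1 i.2.2.2
    rw [vecOnly_of_ne f hi] at h
    exact Subtype.ext (Lp.ext (h.trans (Lp.coeFn_zero ℂ 2 _).symm))
  · have h := hΦ n 0 0 0
    rwa [vecOnly_self] at h

theorem IsVecState.vecAmp {f : (Fin n → Vec r) → ℂ} {Φ : GhostSpace m} (h : IsVecState n f Φ) :
    vecAmp (amp Φ) n =ᵐ[vecPi m n] f :=
  (measurePreserving_ofVec m n).quasiMeasurePreserving.ae h.2

theorem IsVecState.vecAmp_of_ne {f : (Fin n → Vec r) → ℂ} {Φ : GhostSpace m} (h : IsVecState n f Φ)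
    {k : ℕ} (hk : k ≠ n) : MassiveVector.vecAmp (amp Φ) k =ᵐ[vecPi m k] 0 := by
  have h1 : amp Φ k 0 0 0 =ᵐ[configMeasure m k 0 0 0] 0 := by
    unfold amp
    rw [h.1 (k, 0, 0, 0) (by simpa using hk)]
    exact Lp.coeFn_zero ℂ 2 _
  exact (measurePreserving_ofVec m k).quasiMeasurePreserving.ae h1

theorem IsVecState.ghostFree {f : (Fin n → Vec r) → ℂ} {Φ : GhostSpace m} (h : IsVecState n f Φ)
    (k w l s : ℕ) (h' : (w, l, s) ≠ (0, 0, 0)) : Φ (k, w, l, s) = 0 :=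
  h.1 _ fun h1 => h' (by simp only [Prod.mk.injEq] at h1 ⊢; exact h1.2)

theorem IsVecState.mem_physical {f : (Fin n → Vec r) → ℂ} {Φ : core m}
    (h : IsVecState n f (Φ : GhostSpace m)) (ht : IsTransverse m f) : Φ ∈ physical m := by
  refine ⟨h.ghostFree, fun k => ?_⟩
  have h0 := fun ν => (quasiMeasurePreserving_insVec m k 0 0 0 ν).ae
    ((measurePreserving_vec m (k + 1)).quasiMeasurePreserving.ae
      (p := fun K => MassiveVector.vecAmp (amp (Φ : GhostSpace m)) (k + 1) K =
        if h : k + 1 = n then f (K ∘ Fin.cast h.symm) else 0) (by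
    by_cases hk : k + 1 = n
    · subst hk
      filter_upwards [h.vecAmp] with K hK
      simpa using hK
    · filter_upwards [h.vecAmp_of_ne hk] with K hK
      simpa [hk] using hK))
  by_cases hk : k + 1 = n
  · subst hk
    have h2 : BddMap (fun z : Scal r × Config r k 0 0 0 =>
        (Fin.cons z.1 fun i => (z.2.1 i).2 : Fin (k + 1) → Scal r))
        ((scalMeasure m).prod (configMeasure m k 0 0 0)) (scalPi m (k + 1)) := by
      have h3 : BddMap (fun (K : Fin k → Vec r) i => (K i).2) (vecPi m k) (scalPi m k) :=
        BddMap.pi fun _ => bddMap_snd m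
      exact BddMap.cons.comp ((BddMap.id (μ := scalMeasure m)).prodMap
        (h3.comp (measurePreserving_vec m k).bddMap))
    filter_upwards [ae_all_iff.2 h0, h2.ae ht] with z h3 h4
    rw [← h4 0 (Fin.cons 0 fun i => (z.2.1 i).1)]
    refine Finset.sum_congr rfl fun ν _ => ?_
    have h5 := h3 ν
    rw [MassiveVector.vecAmp, ofVec_fst, dif_pos rfl] at h5
    rw [h5, Fin.cons_zero]
    congr 2
    funext i
    refine Fin.cases ?_ (fun i => ?_) i
    · simp [joinVec, insVec]
    · simp [joinVec, insVec]
  · filter_upwards [ae_all_iff.2 h0] with z h3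
    refine Finset.sum_eq_zero fun ν _ => ?_
    have h5 := h3 ν
    rw [MassiveVector.vecAmp, ofVec_fst, dif_neg hk] at h5
    rw [h5, mul_zero]

theorem IsVecState.krein_eq {f h : (Fin n → Vec r) → ℂ} {Φ Ψ : GhostSpace m}
    (hΦ : IsVecState n f Φ) (hΨ : IsVecState n h Ψ) : krein Φ Ψ = vecForm m f h := by
  rw [krein_of_ghostFree Φ Ψ hΦ.ghostFree, tsum_eq_single n fun k hk => ?_]
  · exact vecForm_congr hΦ.vecAmp hΨ.vecAmp
  · exact integral_eq_zero_of_ae (by filter_upwards [hΦ.vecAmp_of_ne hk] with K hK; simp [hK])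

theorem IsVecState.krein_of_ne {n' : ℕ} (hn : n ≠ n') {f : (Fin n → Vec r) → ℂ}
    {h : (Fin n' → Vec r) → ℂ} {Φ Ψ : GhostSpace m}
    (hΦ : IsVecState n f Φ) (hΨ : IsVecState n' h Ψ) : krein Φ Ψ = 0 := by
  rw [krein_of_ghostFree Φ Ψ hΦ.ghostFree]
  refine (tsum_congr fun k => ?_).trans tsum_zero
  by_cases hk : k = n
  · subst hk
    exact integral_eq_zero_of_ae (by filter_upwards [hΨ.vecAmp_of_ne hn] with K hK; simp [hK])
  · exact integral_eq_zero_of_ae (by filter_upwards [hΦ.vecAmp_of_ne hk] with K hK; simp [hK])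

/-- The amplitude of `φ₁ ∨ ⋯ ∨ φₙ`. -/
def symProd (φ : Fin n → Vec r → ℂ) (K : Fin n → Vec r) : ℂ :=
  (n.factorial : ℂ)⁻¹ * ∑ π : Equiv.Perm (Fin n), ∏ i, φ (π i) (K i)

theorem symProd_eq (φ : Fin n → Vec r → ℂ) : symProd φ =
    fun K => (n.factorial : ℂ)⁻¹ * ∑ π : Equiv.Perm (Fin n), prodFn (fun i => φ (π i)) K := rfl

theorem memLp_symProd {φ : Fin n → Vec r → ℂ} (h : ∀ i, MemLp (φ i) 2 (vecMeasure m)) :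
    MemLp (symProd φ) 2 (vecPi m n) :=
  (memLp_finsetSum _ fun π _ => memLp_prodFn fun i => h (π i)).const_mul _

theorem symProd_congr {φ ψ : Fin n → Vec r → ℂ} (h : ∀ i, φ i =ᵐ[vecMeasure m] ψ i) :
    symProd φ =ᵐ[vecPi m n] symProd ψ := by
  have h1 : ∀ᵐ K ∂vecPi m n, ∀ π : Equiv.Perm (Fin n),
      prodFn (fun i => φ (π i)) K = prodFn (fun i => ψ (π i)) K :=
    ae_all_iff.2 fun π => prodFn_congr fun i => h (π i)
  filter_upwards [h1] with K hK
  rw [symProd_eq, symProd_eq]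
  simp only [hK]

theorem symProd_comp (φ : Fin n → Vec r → ℂ) (π : Equiv.Perm (Fin n)) (K : Fin n → Vec r) :
    symProd φ (K ∘ π) = symProd φ K := by
  unfold symProd
  congr 1
  refine Fintype.sum_equiv (Equiv.mulRight π⁻¹) _ _ fun ρ => ?_
  refine Fintype.prod_equiv π _ _ fun i => ?_
  simp

/-- In every term of the symmetrisation the i-th variable occurs in a single factor, and that factor
is transverse. -/
theorem isTransverse_symProd (φ : Fin n → PreParticle m) :
    IsTransverse m (symProd fun i => (φ i).toLp) := by
  have h1 : ∀ᵐ y ∂scalPi m n, ∀ i j, ∑ ν, ((y i).2 ν : ℂ) * (φ j).toLp (ν, y i) = 0 :=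
    ae_pi_fin (ae_all_iff.2 fun j => (φ j).transverse) n
  filter_upwards [h1] with y hy i μ
  simp only [symProd, Finset.mul_sum]
  rw [Finset.sum_comm]
  refine Finset.sum_eq_zero fun π _ => ?_
  have h2 : ∀ ν, ∏ j, (φ (π j)).toLp (joinVec (Function.update μ i ν) y j) =
      (φ (π i)).toLp (ν, y i) * ∏ j ∈ Finset.univ.erase i, (φ (π j)).toLp (μ j, y j) := fun ν => by
    rw [← Finset.mul_prod_erase _ _ (Finset.mem_univ i)]
    congr 1
    · simp [joinVec]
    · refine Finset.prod_congr rfl fun j hj => ?_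
      rw [joinVec, Function.update_of_ne (Finset.ne_of_mem_erase hj)]
  simp only [h2]
  calc _ = ((n.factorial : ℂ)⁻¹ * ∏ j ∈ Finset.univ.erase i, (φ (π j)).toLp (μ j, y j)) *
        ∑ ν, ((y i).2 ν : ℂ) * (φ (π i)).toLp (ν, y i) := by
        rw [Finset.mul_sum]
        exact Finset.sum_congr rfl fun ν _ => by ring
    _ = 0 := by rw [hy, mul_zero]

theorem exists_isWedge {φ : Fin n → PreParticle m} (hφ : ∀ i, (φ i).Bounded) :
    ∃ Φ : core m, Φ ∈ physical m ∧ IsWedge n φ (Φ : GhostSpace m) := by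
  choose R hR using hφ
  have h1 : ∀ᵐ K ∂vecPi m n, ∀ i j, R j < ‖(K i).2.2‖ → (φ j).toLp (K i) = 0 :=
    ae_pi_fin (ae_all_iff.2 hR) n
  -- The sum of the absolute values is one radius that works for all factors, whatever the signs of
  -- the given ones.
  obtain ⟨Φ, hΦ⟩ := exists_isVecState (m := m) (f := symProd fun i => (φ i).toLp)
    (memLp_symProd fun i => (φ i).memLp) (fun π K => symProd_comp _ π K) (R := ∑ i, |R i|) (by
      filter_upwards [h1] with K h2 h3
      simp only [not_forall, not_le] at h3
      obtain ⟨i, hi⟩ := h3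
      refine mul_eq_zero_of_right _ (Finset.sum_eq_zero fun π _ => Finset.prod_eq_zero
        (Finset.mem_univ i) (h2 i (π i) (lt_of_le_of_lt ?_ hi)))
      exact (le_abs_self _).trans (Finset.single_le_sum (f := fun i => |R i|)
        (fun _ _ => abs_nonneg _) (Finset.mem_univ (π i))))
  exact ⟨Φ, hΦ.mem_physical (isTransverse_symProd φ), hΦ⟩

theorem vecForm_symProd (φ ψ : Fin n → PreParticle m) :
    vecForm m (symProd fun i => (φ i).toLp) (symProd fun i => (ψ i).toLp) =
      symPairing n fun i j => oneForm (φ i) (ψ j) := by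
  have h := fun π ρ : Equiv.Perm (Fin n) => vecForm_prodFn (fun i => φ (π i)) fun i => ψ (ρ i)
  have hi := fun π ρ : Equiv.Perm (Fin n) => integrable_vecForm
    (memLp_prodFn fun i => (φ (π i)).memLp) (memLp_prodFn fun i => (ψ (ρ i)).memLp)
  simp only [symPairing, ← h]
  have h1 : ∀ K, (∏ i, (-(eta (K i).1) : ℂ)) * (conj (symProd (fun i => (φ i).toLp) K) *
      symProd (fun i => (ψ i).toLp) K) = (n.factorial : ℂ)⁻¹ * ((n.factorial : ℂ)⁻¹ *
        ∑ π : Equiv.Perm (Fin n), ∑ ρ : Equiv.Perm (Fin n), (∏ i, (-(eta (K i).1) : ℂ)) *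
          (conj (prodFn (fun i => (φ (π i)).toLp) K) * prodFn (fun i => (ψ (ρ i)).toLp) K)) := fun K => by
    simp only [symProd_eq, map_mul, map_inv₀, map_natCast, map_sum, ← Finset.mul_sum, ← Finset.sum_mul]
    ring
  unfold vecForm
  simp only [h1]
  rw [integral_const_mul, integral_const_mul,
    integral_finsetSum _ fun π _ => integrable_finsetSum _ fun ρ _ => hi π ρ]
  congr 2
  exact Finset.sum_congr rfl fun π _ => integral_finsetSum _ fun ρ _ => hi π ρ

theorem IsWedge.isVecState {φ : Fin n → PreParticle m} {Φ : GhostSpace m} (h : IsWedge n φ Φ) :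
    IsVecState n (symProd fun i => (φ i).toLp) Φ := h

theorem IsWedge.krein_eq {φ ψ : Fin n → PreParticle m} {Φ Ψ : GhostSpace m}
    (hΦ : IsWedge n φ Φ) (hΨ : IsWedge n ψ Ψ) :
    krein Φ Ψ = symPairing n fun i j => oneForm (φ i) (ψ j) :=
  (hΦ.isVecState.krein_eq hΨ.isVecState).trans (vecForm_symProd φ ψ)

theorem physical_ext {Φ Ψ : core m} (hΦ : Φ ∈ physical m) (hΨ : Ψ ∈ physical m)
    (h : ∀ n, vecAmp (amp (Φ : GhostSpace m)) n =ᵐ[vecPi m n] vecAmp (amp (Ψ : GhostSpace m)) n) :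
    Φ = Ψ := by
  refine core_ext ((ampEq_ghostFree hΦ).trans (AmpEq.trans (fun n w l s => ?_)
    (ampEq_ghostFree hΨ).symm))
  by_cases h4 : (w, l, s) = (0, 0, 0)
  · simp only [Prod.mk.injEq] at h4
    obtain ⟨rfl, rfl, rfl⟩ := h4
    filter_upwards [(measurePreserving_vec m n).quasiMeasurePreserving.ae (h n)] with x hx
    rwa [vecAmp, vecAmp, ofVec_fst] at hx
  · rw [ghostFree_of_ne _ h4, ghostFree_of_ne _ h4]

variable {g : Poincare}

theorem vecAction_congr (hm : ∀ a, 0 < m a) {f h : (Fin n → Vec r) → ℂ} (e : f =ᵐ[vecPi m n] h) :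
    vecAction g f =ᵐ[vecPi m n] vecAction g h := by
  have h1 : ∀ᵐ K ∂vecPi m n, ∀ ν : Fin n → Fin 4, f (joinVec ν fun i => g.pull (K i).2) =
      h (joinVec ν fun i => g.pull (K i).2) := ae_all_iff.2 fun ν => (BddMap.pi fun i =>
    (bddMap_mkVec m (ν i)).comp ((g.measurePreserving_pull hm).bddMap.comp (bddMap_snd m))).ae e
  filter_upwards [h1] with K hK
  simp only [vecAction, hK]

theorem vecAction_symProd (φ : Fin n → Vec r → ℂ) :
    vecAction g (symProd φ) = symProd fun i => oneAction g (φ i) := by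
  have h := fun π : Equiv.Perm (Fin n) => vecAction_prodFn g fun i => φ (π i)
  rw [symProd_eq, symProd_eq]
  funext K
  simp only [← h, vecAction, map_mul, map_sum, map_inv₀, map_natCast, Finset.mul_sum]
  rw [Finset.sum_comm]
  exact Finset.sum_congr rfl fun π _ => Finset.sum_congr rfl fun ν _ => by ring

theorem isWedge_of_ghostAction (hm : ∀ a, 0 < m a) {φ φ' : Fin n → PreParticle m} {Φ Φ' Ψ : core m}
    (hΦ : IsWedge n φ (Φ : GhostSpace m)) (hΦ' : IsWedge n φ' (Φ' : GhostSpace m))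
    (h : ∀ i, (φ' i).toLp =ᵐ[vecMeasure m] oneAction g (φ i).toLp)
    (hΨ : AmpEq m (amp (Ψ : GhostSpace m)) (ghostAction g (amp (Φ : GhostSpace m))))
    (hΨp : Ψ ∈ physical m) (hΦp : Φ' ∈ physical m) : Ψ = Φ' := by
  refine physical_ext hΨp hΦp fun k => (hΨ.vecAmp k).trans ?_
  rw [vecAmp_ghostAction]
  by_cases hk : k = n
  · subst hk
    refine (vecAction_congr hm (hΦ.isVecState.vecAmp)).trans
      (Filter.EventuallyEq.trans ?_ (hΦ'.isVecState.vecAmp).symm)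
    have h1 := vecAction_symProd (g := g) fun i => (φ i).toLp
    exact (Filter.EventuallyEq.of_eq h1).trans (symProd_congr fun i => (h i).symm)
  · refine (vecAction_congr hm (hΦ.isVecState.vecAmp_of_ne hk)).trans
      (Filter.EventuallyEq.trans (.of_forall fun K => ?_) (hΦ'.isVecState.vecAmp_of_ne hk).symm)
    simp [vecAction]

end Wedges

/-! ## Density of products of indicator functions -/

section Boxes

variable {α : Type} [MeasurableSpace α] {μ : Measure α} {n : ℕ}

/-- Boxes form a π-system generating the product σ-algebra, and sets with vanishing integral are
closed under complements and disjoint unions. Restriction to B makes w integrable. -/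
theorem setIntegral_eq_zero_of_boxes {w : (Fin n → α) → ℂ} {B : Set (Fin n → α)}
    (hw : IntegrableOn w B (Measure.pi fun _ => μ))
    (h : ∀ A : Fin n → Set α, (∀ i, MeasurableSet (A i)) →
      ∫ x in Set.univ.pi A, w x ∂(Measure.pi fun _ => μ).restrict B = 0)
    {S : Set (Fin n → α)} (hS : MeasurableSet S) :
    ∫ x in S, w x ∂(Measure.pi fun _ => μ).restrict B = 0 := by
  have huniv : ∫ x, w x ∂(Measure.pi fun _ => μ).restrict B = 0 := by
    have := h (fun _ => Set.univ) fun _ => .univ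
    rwa [Set.pi_univ, Measure.restrict_univ] at this
  refine MeasurableSpace.induction_on_inter
    (C := fun S _ => ∫ x in S, w x ∂(Measure.pi fun _ => μ).restrict B = 0)
    generateFrom_pi.symm isPiSystem_pi ?_ ?_ ?_ ?_ S hS
  · simp
  · rintro _ ⟨A, hA, rfl⟩
    exact h A fun i => hA i trivial
  · intro S hS ih
    have := integral_add_compl hS hw
    rwa [ih, huniv, zero_add] at this
  · intro S hd hS ih
    rw [integral_iUnion hS hd hw.integrableOn]
    simp [ih]

/-- A function orthogonal to all boxes of finite measure has zero integral over every box inside a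
finite piece of the space, hence vanishes there. The finite pieces exhaust the space. -/
theorem isTotal_boxes [SigmaFinite μ] : IsTotal fun A : {A : Fin n → Set α // ∀ i, MeasurableSet (A i) ∧ μ (A i) ≠ ∞} =>
    (indicatorConstLp 2 (MeasurableSet.univ_pi fun i => (A.2 i).1) (by
      rw [Measure.pi_pi]
      exact ENNReal.prod_ne_top fun i _ => (A.2 i).2) (1 : ℂ) :
      Lp ℂ 2 (Measure.pi fun _ : Fin n => μ)) := by
  intro w hw
  have hB : ∀ k, w =ᵐ[(Measure.pi fun _ => μ).restrict (Set.univ.pi fun _ => spanningSets μ k)] 0 := by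
    intro k
    have hfin : (Measure.pi fun _ : Fin n => μ) (Set.univ.pi fun _ => spanningSets μ k) ≠ ∞ := by
      rw [Measure.pi_pi]
      exact ENNReal.prod_ne_top fun i _ => (measure_spanningSets_lt_top μ k).ne
    have hi : IntegrableOn w (Set.univ.pi fun _ => spanningSets μ k) (Measure.pi fun _ => μ) := by
      have : IsFiniteMeasure ((Measure.pi fun _ : Fin n => μ).restrict
        (Set.univ.pi fun _ => spanningSets μ k)) := ⟨by simpa using hfin.lt_top⟩
      exact ((Lp.memLp w).restrict _).integrable (by norm_num)
    refine Integrable.ae_eq_zero_of_forall_setIntegral_eq_zero hi fun S hS _ => ?_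
    refine setIntegral_eq_zero_of_boxes hi (fun A hA => ?_) hS
    rw [Measure.restrict_restrict (MeasurableSet.univ_pi hA), ← Set.pi_inter_distrib]
    have h1 := hw ⟨fun i => A i ∩ spanningSets μ k, fun i =>
      ⟨(hA i).inter (measurableSet_spanningSets μ k), 
      ((measure_mono Set.inter_subset_right).trans_lt (measure_spanningSets_lt_top μ k)).ne⟩⟩
    exact (L2.inner_indicatorConstLp_one (𝕜 := ℂ) _ _ w).symm.trans h1
  refine Lp.ext (Filter.EventuallyEq.trans ?_ (Lp.coeFn_zero ℂ 2 _).symm)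
  have hU : (⋃ k, Set.univ.pi fun _ : Fin n => spanningSets μ k) = Set.univ := by
    rw [Set.iUnion_univ_pi_of_monotone fun _ => monotone_spanningSets μ]
    simp only [iUnion_spanningSets, Set.pi_univ]
  have h2 := (ae_restrict_iUnion_iff (fun k => Set.univ.pi fun _ : Fin n => spanningSets μ k)
    fun x => w x = 0).2 hB
  rwa [hU, Measure.restrict_univ] at h2

theorem BddMap.integral_le {α β : Type} [MeasurableSpace α] [MeasurableSpace β] {μ : Measure α}
    {ν : Measure β} {f : α → β} (hf : BddMap f μ ν) : ∃ D : ℝ, 0 ≤ D ∧ ∀ g : β → ℝ, (∀ x, 0 ≤ g x) →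
      Integrable g ν → ∫ x, g (f x) ∂μ ≤ D * ∫ y, g y ∂ν := by
  obtain ⟨hm, C, hC, h⟩ := hf
  refine ⟨C.toReal, ENNReal.toReal_nonneg, fun g h0 hg => ?_⟩
  have h1 : Integrable g (C • ν) := hg.smul_measure hC
  rw [← integral_map hm.aemeasurable (h1.mono_measure h).1]
  refine (integral_mono_measure h (.of_forall h0) h1).trans_eq ?_
  rw [integral_smul_measure, smul_eq_mul]

end Boxes

/-! ## Density of the wedge products -/

section WedgeDensity

variable (m : Fin r → ℝ) (R : ℝ) {n : ℕ}

/-- The projection onto transverse functions. -/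
def projKernel (y : Scal r) (μ ν : Fin 4) : ℂ :=
  (if μ = ν then 1 else 0) + (-(eta μ) * y.2 μ / (m y.1 : ℂ) ^ 2) * (y.2 ν : ℂ)

/-- The projection onto transverse functions, restricted to bounded momenta. -/
def cutKernel (z : Vec r) (ν : Fin 4) : ℂ := if ‖z.2.2‖ ≤ R then projKernel m z.2 z.1 ν else 0

theorem measurable_cutKernel (ν : Fin 4) : Measurable fun z : Vec r => cutKernel m R z ν := by
  refine Measurable.ite (measurableSet_le (by fun_prop) measurable_const) ?_ measurable_const
  refine measurable_from_prod_countable_right fun μ => ?_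
  have h := measurable_mass (m := m)
  change Measurable fun y : Scal r =>
    (if μ = ν then 1 else 0) + (-(eta μ : ℂ) * (y.2 μ : ℂ) / (m y.1 : ℂ) ^ 2) * (y.2 ν : ℂ)
  exact ((((by fun_prop : Measurable fun y : Scal r => -(eta μ : ℂ) * (y.2 μ : ℂ))).div
    (h.pow_const 2)).mul (by fun_prop)).const_add _

theorem exists_norm_cutKernel_le :
    ∃ C : ℝ, 0 ≤ C ∧ ∀ z ν, ‖cutKernel m R z ν‖ ≤ C := by
  have hC : ∃ C : ℝ, 0 ≤ C ∧ ∀ a, ((m a) ^ 2)⁻¹ ≤ C :=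
    ⟨∑ a, ((m a) ^ 2)⁻¹, Finset.sum_nonneg fun _ _ => by positivity, fun a =>
      Finset.single_le_sum (f := fun a => ((m a) ^ 2)⁻¹) (fun _ _ => by positivity) (Finset.mem_univ a)⟩
  obtain ⟨C, hC0, hC⟩ := hC
  refine ⟨1 + |R| * C * |R|, by positivity, fun z ν => ?_⟩
  unfold cutKernel
  split_ifs with h
  · have h1 : ∀ μ, ‖((z.2.2 μ : ℝ) : ℂ)‖ ≤ |R| := fun μ => by
      rw [Complex.norm_real]
      exact ((norm_le_pi_norm _ μ).trans h).trans (le_abs_self R)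
    refine (norm_add_le _ _).trans (add_le_add ?_ ?_)
    · split_ifs <;> simp
    · rw [norm_mul, norm_div, norm_mul, norm_neg, Complex.norm_real (eta _), norm_eta, one_mul, norm_pow,
        Complex.norm_real (m _), Real.norm_eq_abs (m _), sq_abs, div_eq_mul_inv]
      exact mul_le_mul (mul_le_mul (h1 _) (hC _) (by positivity) (abs_nonneg _)) (h1 _)
        (norm_nonneg _) (by positivity)
  · rw [norm_zero]
    positivity

/-- The symmetrised projection onto transverse functions, restricted to bounded momenta. -/
def cutProj (f : (Fin n → Vec r) → ℂ) (K : Fin n → Vec r) : ℂ :=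
  ∑ t : Equiv.Perm (Fin n) × (Fin n → Fin 4), ((n.factorial : ℂ)⁻¹ * ∏ i, cutKernel m R (K i) (t.2 i)) *
    f (joinVec t.2 (fun i => (K i).2) ∘ t.1)

variable {m}

theorem bddMap_cutProj (t : Equiv.Perm (Fin n) × (Fin n → Fin 4)) :
    BddMap (fun K : Fin n → Vec r => joinVec t.2 (fun i => (K i).2) ∘ t.1) (vecPi m n) (vecPi m n) :=
  (measurePreserving_comp_perm (vecMeasure m) t.1).bddMap.comp
    (BddMap.pi fun i => (bddMap_mkVec m (t.2 i)).comp (bddMap_snd m))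

theorem cutProj_congr {f h : (Fin n → Vec r) → ℂ} (e : f =ᵐ[vecPi m n] h) :
    cutProj m R f =ᵐ[vecPi m n] cutProj m R h := by
  have h1 := ae_all_iff.2 fun t : Equiv.Perm (Fin n) × (Fin n → Fin 4) =>
    (bddMap_cutProj (m := m) t).ae e
  filter_upwards [h1] with K hK
  simp only [cutProj, hK]

theorem cutProj_add (f h : (Fin n → Vec r) → ℂ) :
    cutProj m R (f + h) = cutProj m R f + cutProj m R h := by
  funext K
  simp only [cutProj, Pi.add_apply, mul_add, Finset.sum_add_distrib]

theorem cutProj_smul (c : ℂ) (f : (Fin n → Vec r) → ℂ) :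
    cutProj m R (c • f) = c • cutProj m R f := by
  funext K
  simp only [cutProj, Pi.smul_apply, smul_eq_mul, Finset.mul_sum, mul_left_comm]

/-- A finite sum of terms, each a bounded coefficient times composition with a map of bounded
density. The constant collects the number of terms from Cauchy–Schwarz, the square of the bound on
the coefficients and the density bounds. The momentum cutoff is what makes the coefficients bounded.
-/
theorem exists_integral_cutProj_le (n : ℕ) : ∃ D : ℝ, 0 ≤ D ∧
    ∀ f : (Fin n → Vec r) → ℂ, MemLp f 2 (vecPi m n) → MemLp (cutProj m R f) 2 (vecPi m n) ∧
      ∫ K, ‖cutProj m R f K‖ ^ 2 ∂vecPi m n ≤ D * ∫ K, ‖f K‖ ^ 2 ∂vecPi m n := by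
  obtain ⟨C, hC0, hC⟩ := exists_norm_cutKernel_le m R
  let T := Equiv.Perm (Fin n) × (Fin n → Fin 4)
  choose D hD0 hD using fun t : T =>
    (bddMap_cutProj (m := m) t).integral_le
  have hc : ∀ (t : T) (K : Fin n → Vec r),
      ‖(n.factorial : ℂ)⁻¹ * ∏ i, cutKernel m R (K i) (t.2 i)‖ ≤ ‖(n.factorial : ℂ)⁻¹‖ * C ^ n :=
    fun t K => by
      rw [norm_mul, norm_prod]
      refine mul_le_mul_of_nonneg_left ((Finset.prod_le_prod (fun _ _ => norm_nonneg _)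
        fun i _ => hC (K i) (t.2 i)).trans_eq ?_) (norm_nonneg _)
      simp
  set E := ‖(n.factorial : ℂ)⁻¹‖ * C ^ n
  have hE : 0 ≤ E := by positivity
  refine ⟨Fintype.card T * (E ^ 2 * ∑ t, D t), mul_nonneg (by positivity) (mul_nonneg (by positivity)
    (Finset.sum_nonneg fun t _ => hD0 t)), fun f hf => ?_⟩
  have hft : ∀ t : T, MemLp (fun K => f (joinVec t.2 (fun i => (K i).2) ∘ t.1)) 2 (vecPi m n) :=
    fun t => (bddMap_cutProj t).memLp hf
  have hmem : MemLp (cutProj m R f) 2 (vecPi m n) := by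
    refine memLp_finsetSum _ fun t _ => memLp_bdd_mul (hft t) ?_ (hc t)
    exact (Finset.measurable_fun_prod _ fun i _ =>
      (measurable_cutKernel m R (t.2 i)).comp (measurable_pi_apply i)).const_mul _
  have hsq := fun {h : (Fin n → Vec r) → ℂ} (hh : MemLp h 2 (vecPi m n)) =>
    (memLp_two_iff_integrable_sq_norm hh.1).1 hh
  refine ⟨hmem, ?_⟩
  have h1 : ∀ K, ‖cutProj m R f K‖ ^ 2 ≤ Fintype.card T *
      ∑ t : T, E ^ 2 * ‖f (joinVec t.2 (fun i => (K i).2) ∘ t.1)‖ ^ 2 := fun K => by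
    refine (pow_le_pow_left₀ (norm_nonneg _) (norm_sum_le _ _) 2).trans ?_
    refine sq_sum_le_card_mul_sum_sq.trans (mul_le_mul_of_nonneg_left ?_ (by positivity))
    refine Finset.sum_le_sum fun t _ => ?_
    rw [norm_mul, mul_pow]
    exact mul_le_mul_of_nonneg_right (pow_le_pow_left₀ (norm_nonneg _) (hc t K) 2) (by positivity)
  have hint : ∀ t : T, Integrable (fun K : Fin n → Vec r =>
      E ^ 2 * ‖f (joinVec t.2 (fun i => (K i).2) ∘ t.1)‖ ^ 2) (vecPi m n) :=
    fun t => (hsq (hft t)).const_mul _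
  calc _ ≤ ∫ K, Fintype.card T * ∑ t : T, E ^ 2 * ‖f (joinVec t.2 (fun i => (K i).2) ∘ t.1)‖ ^ 2
        ∂vecPi m n := integral_mono (hsq hmem)
          ((integrable_finsetSum _ fun t _ => hint t).const_mul _) h1
    _ = Fintype.card T * ∑ t : T, E ^ 2 *
        ∫ K, ‖f (joinVec t.2 (fun i => (K i).2) ∘ t.1)‖ ^ 2 ∂vecPi m n := by
        rw [integral_const_mul, integral_finsetSum _ fun t _ => hint t]
        simp only [integral_const_mul]
    _ ≤ Fintype.card T * ∑ t : T, E ^ 2 * (D t * ∫ K, ‖f K‖ ^ 2 ∂vecPi m n) := by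
        refine mul_le_mul_of_nonneg_left (Finset.sum_le_sum fun t _ => mul_le_mul_of_nonneg_left ?_
          (by positivity)) (by positivity)
        exact hD t (fun K => ‖f K‖ ^ 2) (fun _ => by positivity) (hsq hf)
    _ = _ := by
        rw [← Finset.mul_sum, ← Finset.sum_mul]
        ring

/-- The transverse projection of the indicator of a set, restricted to bounded momenta. -/
theorem exists_preParticle_indicator (hm : ∀ a, 0 < m a) {A : Set (Vec r)} (hA : MeasurableSet A)
    (hfin : vecMeasure m A ≠ ∞) : ∃ φ : PreParticle m, φ.Bounded ∧ φ.toLp =ᵐ[vecMeasure m]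
      fun z => ∑ ν, cutKernel m R z ν * A.indicator 1 (ν, z.2) := by
  obtain ⟨C, -, hC⟩ := exists_norm_cutKernel_le m R
  have h1 : MemLp (A.indicator (1 : Vec r → ℂ)) 2 (vecMeasure m) :=
    memLp_indicator_const 2 hA 1 (.inr hfin)
  obtain ⟨φ, hφ⟩ := exists_preParticle (m := m)
    (f := fun z => ∑ ν, cutKernel m R z ν * A.indicator 1 (ν, z.2))
    (memLp_finsetSum _ fun ν _ => memLp_bdd_mul
      (((bddMap_mkVec m ν).comp (bddMap_snd m)).memLp h1) (measurable_cutKernel m R ν)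
      fun z => hC z ν) (by
    filter_upwards [ae_mem_shell_scal m] with y hy
    simp only [Finset.mul_sum]
    rw [Finset.sum_comm]
    refine Finset.sum_eq_zero fun ν _ => ?_
    have h2 : ∑ μ, (y.2 μ : ℂ) * cutKernel m R (μ, y) ν = 0 := by
      unfold cutKernel
      by_cases h : ‖y.2‖ ≤ R
      · simp only [if_pos h]
        have h3 : ∑ μ, (eta μ : ℂ) * y.2 μ * y.2 μ = (m y.1 : ℂ) ^ 2 := by
          have := congrArg (fun x : ℝ => (x : ℂ)) hy.1
          simpa [mink] using this
        have hne : (m y.1 : ℂ) ≠ 0 := by exact_mod_cast (hm y.1).ne'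
        simp only [projKernel, mul_add, Finset.sum_add_distrib, mul_ite, mul_one, mul_zero,
          Finset.sum_ite_eq', Finset.mem_univ, if_true]
        calc _ = (y.2 ν : ℂ) - (∑ μ, (eta μ : ℂ) * y.2 μ * y.2 μ) * ((y.2 ν : ℂ) / (m y.1 : ℂ) ^ 2) := by
              rw [Finset.sum_mul, sub_eq_add_neg, ← Finset.sum_neg_distrib]
              exact congrArg _ (Finset.sum_congr rfl fun μ _ => by ring)
          _ = 0 := by
              rw [h3]
              field_simp
              ring
      · simp only [if_neg h, mul_zero, Finset.sum_const_zero]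
    calc _ = (∑ μ, (y.2 μ : ℂ) * cutKernel m R (μ, y) ν) * A.indicator 1 (ν, y) := by
          rw [Finset.sum_mul]
          exact Finset.sum_congr rfl fun μ _ => by ring
      _ = 0 := by rw [h2, zero_mul])
  refine ⟨φ, ⟨R, ?_⟩, hφ⟩
  filter_upwards [hφ] with z h2 h3
  rw [h2]
  exact Finset.sum_eq_zero fun ν _ => by rw [cutKernel, if_neg (not_le.2 h3), zero_mul]

/-- The projection acts on each factor separately and the permutations symmetrise, so product
functions become wedge amplitudes. -/
theorem cutProj_prodFn (h : Fin n → Vec r → ℂ) :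
    cutProj m R (prodFn h) = symProd fun i z => ∑ ν, cutKernel m R z ν * h i (ν, z.2) := by
  funext K
  simp only [cutProj, symProd, Fintype.sum_prod_type, prodFn, Function.comp_apply]
  -- Permuting the variables is the same as permuting the factors by the inverse permutation.
  rw [Finset.mul_sum, ← Equiv.sum_comp (Equiv.inv (Equiv.Perm (Fin n)))]
  refine Finset.sum_congr rfl fun π _ => ?_
  simp only [Finset.prod_univ_sum, Fintype.piFinset_univ, Finset.mul_sum]
  refine Finset.sum_congr rfl fun ν _ => ?_
  rw [mul_assoc, Finset.prod_mul_distrib]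
  congr 2
  refine Fintype.prod_equiv π⁻¹ _ _ fun i => ?_
  simp [joinVec]

/-- Inside the cutoff the projection is the identity plus a part annihilated by transversality, and
the permutations average to the identity on a symmetric function. Outside the cutoff both sides
vanish. -/
theorem cutProj_eq_self {f : (Fin n → Vec r) → ℂ} (ht : IsTransverse m f)
    (hs : ∀ (π : Equiv.Perm (Fin n)) (K : Fin n → Vec r), f (K ∘ π) = f K)
    (hb : ∀ᵐ K ∂vecPi m n, ¬ (∀ i, ‖(K i).2.2‖ ≤ R) → f K = 0) :
    cutProj m R f =ᵐ[vecPi m n] f := by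
  have h2 : BddMap (fun (K : Fin n → Vec r) i => (K i).2) (vecPi m n) (scalPi m n) :=
    BddMap.pi fun _ => bddMap_snd m
  filter_upwards [hb, h2.ae ht] with K h3 h4
  by_cases h : ∀ i, ‖(K i).2.2‖ ≤ R
  · have h5 : ∀ i ν, cutKernel m R (K i) ν = projKernel m (K i).2 (K i).1 ν := fun i ν => if_pos (h i)
    have h6 := sum_prod_diagonal_add (fun _ _ => 1)
      (fun i a => -(eta a) * (K i).2.2 a / (m (K i).2.1 : ℂ) ^ 2) (fun i a => (K i).2.2 a)
      (fun i => (K i).1) (f := fun μ => f (joinVec μ fun i => (K i).2)) h4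
    simp only [cutProj, hs, h5, Fintype.sum_prod_type, mul_assoc, ← Finset.mul_sum, projKernel]
    refine (congrArg ((n.factorial : ℂ)⁻¹ * ·) (Finset.sum_congr rfl fun π _ => h6)).trans ?_
    rw [Finset.prod_const_one, one_mul, Finset.sum_const, Finset.card_univ, Fintype.card_perm,
      Fintype.card_fin, nsmul_eq_mul, ← mul_assoc,
      inv_mul_cancel₀ (by exact_mod_cast n.factorial_ne_zero), one_mul]
    rfl
  · rw [h3 h]
    obtain ⟨i, hi⟩ := not_forall.1 h
    refine Finset.sum_eq_zero fun t _ => ?_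
    rw [Finset.prod_eq_zero (Finset.mem_univ i) (if_neg hi), mul_zero, zero_mul]

end WedgeDensity

/-! ### Bounded functionals vanishing on wedge products are zero -/

section WedgeTotal

variable {m : Fin r → ℝ} {n : ℕ}

theorem IsVecState.congr {f h : (Fin n → Vec r) → ℂ} {Φ : GhostSpace m} (hΦ : IsVecState n f Φ)
    (e : f =ᵐ[vecPi m n] h) : IsVecState n h Φ :=
  ⟨hΦ.1, hΦ.2.trans ((measurePreserving_vec m n).quasiMeasurePreserving.ae e)⟩

theorem IsVecState.add {f h : (Fin n → Vec r) → ℂ} {Φ Ψ : GhostSpace m} (hΦ : IsVecState n f Φ)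
    (hΨ : IsVecState n h Ψ) : IsVecState n (f + h) (Φ + Ψ) := by
  refine ⟨fun i hi => ?_, ?_⟩
  · change Φ i + Ψ i = 0
    rw [hΦ.1 i hi, hΨ.1 i hi, add_zero]
  · filter_upwards [amp_add Φ Ψ n 0 0 0, hΦ.2, hΨ.2] with x h1 h2 h3
    rw [h1, Pi.add_apply, h2, h3, Pi.add_apply]

theorem IsVecState.smul {f : (Fin n → Vec r) → ℂ} {Φ : GhostSpace m} (hΦ : IsVecState n f Φ)
    (c : ℂ) : IsVecState n (c • f) (c • Φ) := by
  refine ⟨fun i hi => ?_, ?_⟩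
  · change c • Φ i = 0
    rw [hΦ.1 i hi, smul_zero]
  · filter_upwards [amp_smul c Φ n 0 0 0, hΦ.2] with x h1 h2
    rw [h1, Pi.smul_apply, h2, Pi.smul_apply]

theorem isVecState_zero : IsVecState n 0 (0 : GhostSpace m) :=
  ⟨fun _ _ => rfl, amp_zero m n 0 0 0⟩

theorem norm_vecForm_self_le {f : (Fin n → Vec r) → ℂ} :
    ‖vecForm m f f‖ ≤ ∫ K, ‖f K‖ ^ 2 ∂vecPi m n := by
  refine (norm_integral_le_integral_norm _).trans_eq (integral_congr_ae (.of_forall fun K => ?_))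
  simp only [norm_mul, norm_prod_eta, one_mul, RCLike.norm_conj, sq]

theorem integral_norm_sq_eq {α : Type} [MeasurableSpace α] {μ : Measure α} (F : Lp ℂ 2 μ) :
    ∫ x, ‖F x‖ ^ 2 ∂μ = ‖F‖ ^ 2 := by
  have h := L2.inner_def (𝕜 := ℂ) F F
  simp only [inner_self_eq_norm_sq_to_K, ← RCLike.ofReal_pow] at h
  rw [integral_ofReal] at h
  exact (RCLike.ofReal_injective h).symm

theorem LinearMap.map_smul_of_eq_zero {M : Type*} [AddCommGroup M] [Module ℂ M] {L : M →ₗ[ℂ] ℂ}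
    {x : M} (h : L x = 0) (c : ℂ) : L (c • x) = 0 := by
  rw [map_smul, h, smul_zero]

theorem LinearMap.map_add_of_eq_zero {M : Type*} [AddCommGroup M] [Module ℂ M] {L : M →ₗ[ℂ] ℂ}
    {y : M} (x : M) (h : L y = 0) : L (x + y) = L x := by
  rw [map_add, h, add_zero]

/-- `f` is the amplitude of a physical state on which `L` vanishes. -/
def IsVecNull (L : physical m →ₗ[ℂ] ℂ) (f : (Fin n → Vec r) → ℂ) : Prop :=
  ∃ Ψ : physical m, IsVecState n f ((Ψ : core m) : GhostSpace m) ∧ L Ψ = 0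

variable {L : physical m →ₗ[ℂ] ℂ}

theorem isVecNull_zero : IsVecNull L (0 : (Fin n → Vec r) → ℂ) := ⟨0, isVecState_zero, map_zero L⟩

theorem IsVecNull.add {f h : (Fin n → Vec r) → ℂ} (hf : IsVecNull L f) (hh : IsVecNull L h) :
    IsVecNull L (f + h) :=
  hf.elim fun Φ hΦ => hh.elim fun Ψ hΨ =>
    ⟨Φ + Ψ, hΦ.1.add hΨ.1, (LinearMap.map_add_of_eq_zero Φ hΨ.2).trans hΦ.2⟩

theorem IsVecNull.smul {f : (Fin n → Vec r) → ℂ} (hf : IsVecNull L f) (c : ℂ) :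
    IsVecNull L (c • f) :=
  hf.elim fun Φ hΦ => ⟨c • Φ, hΦ.1.smul c, LinearMap.map_smul_of_eq_zero hΦ.2 c⟩

theorem IsVecNull.congr {f h : (Fin n → Vec r) → ℂ} (hf : IsVecNull L f) (e : f =ᵐ[vecPi m n] h) :
    IsVecNull L h :=
  hf.elim fun Φ hΦ => ⟨Φ, hΦ.1.congr e, hΦ.2⟩

theorem isVecNull_symProd (hw : ∀ (φ : Fin n → PreParticle m) (Φ : physical m),
      (∀ i, (φ i).Bounded) → IsWedge n φ ((Φ : core m) : GhostSpace m) → L Φ = 0)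
    {φ : Fin n → PreParticle m} (hb : ∀ i, (φ i).Bounded) :
    IsVecNull L (symProd fun i => (φ i).toLp) :=
  (exists_isWedge hb).elim fun Φ hΦ => ⟨⟨Φ, hΦ.1⟩, hΦ.2.isVecState, hw φ ⟨Φ, hΦ.1⟩ hb hΦ.2⟩

/-- Combinations of box indicators give states on which a functional vanishing on the wedge
products vanishes. -/
theorem exists_isVecNull_cutProj (hm : ∀ a, 0 < m a) (R : ℝ)
    (hw : ∀ (φ : Fin n → PreParticle m) (Φ : physical m), (∀ i, (φ i).Bounded) →
      IsWedge n φ ((Φ : core m) : GhostSpace m) → L Φ = 0) :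
    ∃ d : Set (Lp ℂ 2 (vecPi m n)), Dense d ∧ ∀ G ∈ d, IsVecNull L (cutProj m R G) := by
  refine ⟨_, (isTotal_boxes (μ := vecMeasure m) (n := n)).denseRange, ?_⟩
  rintro _ ⟨c, rfl⟩
  induction c using Finsupp.induction_linear with
  | zero =>
    rw [map_zero]
    have h1 : cutProj m R (0 : (Fin n → Vec r) → ℂ) = 0 := by
      funext K
      simp [cutProj]
    have h2 := isVecNull_zero (n := n) (L := L)
    rw [← h1] at h2
    exact h2.congr (cutProj_congr R (Lp.coeFn_zero ℂ 2 _).symm)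
  | add c c' h h' =>
    have h1 := h.add h'
    rw [← cutProj_add] at h1
    rw [map_add]
    exact h1.congr (cutProj_congr R (Lp.coeFn_add _ _).symm)
  | single A c =>
    choose φ hb hφ using fun i => exists_preParticle_indicator R hm (A.2 i).1 (A.2 i).2
    have h1 := (isVecNull_symProd hw hb).congr (symProd_congr hφ)
    rw [← cutProj_prodFn R fun i => (A.1 i).indicator 1] at h1
    have h2 : prodFn (fun i => (A.1 i).indicator (1 : Vec r → ℂ)) =
        (Set.univ.pi A.1).indicator fun _ => (1 : ℂ) := by
      funext K
      by_cases h : ∀ i, K i ∈ A.1 i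
      · rw [Set.indicator_of_mem (by simpa using h)]
        exact Finset.prod_eq_one fun i _ => Set.indicator_of_mem (h i) _
      · rw [Set.indicator_of_notMem (by simpa using h)]
        obtain ⟨i, hi⟩ := not_forall.1 h
        exact Finset.prod_eq_zero (Finset.mem_univ i) (Set.indicator_of_notMem hi _)
    rw [h2] at h1
    rw [Finsupp.linearCombination_single]
    refine IsVecNull.congr ?_ (cutProj_congr R (Lp.coeFn_smul _ _).symm)
    rw [cutProj_smul]
    exact (h1.congr (cutProj_congr R indicatorConstLp_coeFn.symm)).smul c

set_option maxHeartbeats 1000000 in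
theorem norm_sq_le_of_isVecNull {C : ℝ}
    (hL : ∀ Φ : physical m, ‖L Φ‖ ^ 2 ≤
      C * ‖krein ((Φ : core m) : GhostSpace m) ((Φ : core m) : GhostSpace m)‖)
    {f h : (Fin n → Vec r) → ℂ} {Φ : physical m} (hΦ : IsVecState n f ((Φ : core m) : GhostSpace m))
    (hh : IsVecNull L h) : ‖L Φ‖ ^ 2 ≤ |C| * ∫ K, ‖(f + (-1 : ℂ) • h) K‖ ^ 2 ∂vecPi m n := by
  refine hh.elim fun Ψ hΨ => ?_
  have h4 : L (Φ + (-1 : ℂ) • Ψ) = L Φ :=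
    LinearMap.map_add_of_eq_zero Φ (LinearMap.map_smul_of_eq_zero hΨ.2 (-1))
  have h5 : IsVecState n (f + (-1 : ℂ) • h)
      (((Φ + (-1 : ℂ) • Ψ : physical m) : core m) : GhostSpace m) := hΦ.add (hΨ.1.smul (-1))
  have h6 : ‖L Φ‖ ^ 2 ≤ C * ‖vecForm m (f + (-1 : ℂ) • h) (f + (-1 : ℂ) • h)‖ :=
    (congrArg (fun z : ℂ => ‖z‖ ^ 2) h4).symm.trans_le ((hL (Φ + (-1 : ℂ) • Ψ)).trans_eq
      (congrArg (fun z : ℂ => C * ‖z‖) (h5.krein_eq h5)))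
  exact h6.trans ((mul_le_mul_of_nonneg_right (le_abs_self C) (norm_nonneg _)).trans
    (mul_le_mul_of_nonneg_left norm_vecForm_self_le (abs_nonneg C)))

-- The amplitude f is its own image under the cut projection, whereas images of combinations G of
-- boxes are amplitudes on which L vanishes. Hence |LΦ|² is at most a constant times ‖f - G‖², and
-- density lets G tend to f.
set_option maxHeartbeats 1000000 in
theorem eq_zero_of_isVecState (hm : ∀ a, 0 < m a) {C : ℝ}
    (hL : ∀ Φ : physical m, ‖L Φ‖ ^ 2 ≤
      C * ‖krein ((Φ : core m) : GhostSpace m) ((Φ : core m) : GhostSpace m)‖)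
    (hw : ∀ (φ : Fin n → PreParticle m) (Φ : physical m), (∀ i, (φ i).Bounded) →
      IsWedge n φ ((Φ : core m) : GhostSpace m) → L Φ = 0) {f : (Fin n → Vec r) → ℂ}
    (hf : MemLp f 2 (vecPi m n)) (ht : IsTransverse m f)
    (hs : ∀ (π : Equiv.Perm (Fin n)) (K : Fin n → Vec r), f (K ∘ π) = f K) {R : ℝ}
    (hb : ∀ᵐ K ∂vecPi m n, ¬ (∀ i, ‖(K i).2.2‖ ≤ R) → f K = 0) {Φ : physical m}
    (hΦ : IsVecState n f ((Φ : core m) : GhostSpace m)) : L Φ = 0 := by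
  refine (exists_integral_cutProj_le (m := m) R n).elim fun D hD' => ?_
  have hD := hD'.2
  refine (exists_isVecNull_cutProj hm R hw).elim fun d hd => ?_
  have hF := hf.coeFn_toLp
  generalize hf.toLp f = F at hF
  have h1 : ∀ G ∈ d, ‖L Φ‖ ^ 2 ≤ |C| * (D * ‖F - G‖ ^ 2) := fun G hG => by
    refine (norm_sq_le_of_isVecNull hL hΦ (hd.2 G hG)).trans
      (mul_le_mul_of_nonneg_left ?_ (abs_nonneg C))
    have h6 : (F - G : Lp ℂ 2 (vecPi m n)) =ᵐ[vecPi m n] f + (-1 : ℂ) • (G : (Fin n → Vec r) → ℂ) := by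
      filter_upwards [Lp.coeFn_sub F G, hF] with K h7 h8
      rw [h7, Pi.sub_apply, h8, Pi.add_apply, Pi.smul_apply, neg_one_smul, sub_eq_add_neg]
    have h7 := cutProj_congr R h6
    rw [cutProj_add, cutProj_smul] at h7
    rw [← integral_norm_sq_eq]
    refine (integral_congr_ae ?_).trans_le (hD _ (Lp.memLp (F - G))).2
    filter_upwards [h7, cutProj_eq_self R ht hs hb] with K h8 h9
    rw [h8, Pi.add_apply, Pi.add_apply, h9]
  have h2 : ∀ G : Lp ℂ 2 (vecPi m n), ‖L Φ‖ ^ 2 ≤ |C| * (D * ‖F - G‖ ^ 2) := fun G =>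
    hd.1.induction h1 (isClosed_le continuous_const (by fun_prop)) G
  have h3 := h2 F
  rw [sub_self, norm_zero] at h3
  exact norm_eq_zero.1 (pow_eq_zero_iff two_ne_zero |>.1 (le_antisymm (h3.trans_eq (by ring)) (sq_nonneg _)))

theorem IsSymAmp.vecAmp_comp {Ψ : Amp r} (h : IsSymAmp Ψ) (n : ℕ) (π : Equiv.Perm (Fin n))
    (K : Fin n → Vec r) : vecAmp Ψ n (K ∘ π) = vecAmp Ψ n K := by
  have h1 := h n 0 0 0 π 1 1 1 (ofVec K)
  rw [map_one, one_mul, one_mul] at h1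
  exact (congrArg (Ψ n 0 0 0) (Prod.ext rfl (Subsingleton.elim _ _))).trans h1

theorem IsTransverse.congr {f h : (Fin n → Vec r) → ℂ} (hf : IsTransverse m f)
    (e : f =ᵐ[vecPi m n] h) : IsTransverse m h := by
  have h1 : ∀ᵐ y ∂scalPi m n, ∀ μ, f (joinVec μ y) = h (joinVec μ y) :=
    ae_all_iff.2 fun μ => (bddMap_joinVec m μ).ae e
  filter_upwards [hf, h1] with y h2 h3
  simpa only [h3] using h2

theorem vecAmp_add_neg {Φ Θ : GhostSpace m} (h : vecAmp (amp Φ) n =ᵐ[vecPi m n] vecAmp (amp Θ) n) :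
    vecAmp (amp (Φ + (-1 : ℂ) • Θ)) n =ᵐ[vecPi m n] 0 := by
  have h7 := (measurePreserving_ofVec m n).quasiMeasurePreserving.ae (amp_add Φ ((-1 : ℂ) • Θ) n 0 0 0)
  have h8 := (measurePreserving_ofVec m n).quasiMeasurePreserving.ae (amp_smul (-1 : ℂ) Θ n 0 0 0)
  filter_upwards [h, h7, h8] with K h9 h10 h11
  refine h10.trans ?_
  rw [Pi.add_apply, h11, Pi.smul_apply]
  change amp Φ n 0 0 0 (ofVec K) = amp Θ n 0 0 0 (ofVec K) at h9
  rw [h9, neg_one_smul, add_neg_cancel]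
  rfl

/-- A bounded functional on the physical space is determined by its values on wedge products. -/
theorem eq_zero_of_isWedge (hm : ∀ a, 0 < m a) {C : ℝ}
    (hL : ∀ Φ : physical m, ‖L Φ‖ ^ 2 ≤
      C * ‖krein ((Φ : core m) : GhostSpace m) ((Φ : core m) : GhostSpace m)‖)
    (hw : ∀ (n : ℕ) (φ : Fin n → PreParticle m) (Φ : physical m), (∀ i, (φ i).Bounded) →
      IsWedge n φ ((Φ : core m) : GhostSpace m) → L Φ = 0) (Φ : physical m) : L Φ = 0 := by
  -- Induction on a bound for the particle number: the component of highest degree is itself a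
  -- physical state annihilated by L, and subtracting it lowers the bound.
  have key : ∀ (N : ℕ) (Φ : physical m),
      (∀ n, N ≤ n → vecAmp (amp ((Φ : core m) : GhostSpace m)) n =ᵐ[vecPi m n] 0) → L Φ = 0 := by
    intro N
    induction N with
    | zero =>
      intro Φ h
      have h1 : (Φ : core m) = ((0 : physical m) : core m) :=
        physical_ext Φ.2 (0 : physical m).2 fun n => (h n n.zero_le).trans
          (Filter.EventuallyEq.symm
            ((measurePreserving_ofVec m n).quasiMeasurePreserving.ae (amp_zero m n 0 0 0)))
      exact (congrArg L (Subtype.ext h1)).trans (map_zero L)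
    | succ N ih =>
      intro Φ h
      refine (coreAmp_amp (Φ : core m)).exists_isSymAmp.elim fun Ψ hΨ => ?_
      have h1 := hΨ.1
      have h2 := hΨ.2.1
      have h3 := hΨ.2.2
      refine h2.bdd.elim fun R hR => ?_
      have hv := h1.vecAmp N
      have hf : MemLp (vecAmp Ψ N) 2 (vecPi m N) :=
        (h2.memLp N 0 0 0).comp_measurePreserving (measurePreserving_ofVec m N)
      have hs := h3.vecAmp_comp N
      have hb : ∀ᵐ K ∂vecPi m N, ¬ (∀ i, ‖(K i).2.2‖ ≤ R) → vecAmp Ψ N K = 0 := by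
        filter_upwards [(measurePreserving_ofVec m N).quasiMeasurePreserving.ae (hR N 0 0 0)]
          with K h4 h5
        exact h4 fun h6 => h5 h6.1
      have ht : IsTransverse m (vecAmp Ψ N) := (isTransverse_vecAmp Φ.2 N).congr hv
      refine (exists_isVecState hf hs hb).elim fun Θ hΘ => ?_
      let Θ' : physical m := ⟨Θ, hΘ.mem_physical ht⟩
      have h4 : L Θ' = 0 := eq_zero_of_isVecState hm hL (hw N) hf ht hs hb hΘ
      have h5 : L (Φ + (-1 : ℂ) • Θ') = 0 := by
        refine ih _ fun n hn => ?_
        have h6 : vecAmp (amp ((Φ : core m) : GhostSpace m)) n =ᵐ[vecPi m n]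
            vecAmp (amp (Θ : GhostSpace m)) n := by
          rcases hn.eq_or_lt with rfl | hn
          · exact hv.trans hΘ.vecAmp.symm
          · exact (h n hn).trans (hΘ.vecAmp_of_ne hn.ne').symm
        exact vecAmp_add_neg h6
      have h6 : L (Φ + (-1 : ℂ) • Θ') = L Φ :=
        LinearMap.map_add_of_eq_zero Φ (LinearMap.map_smul_of_eq_zero h4 (-1))
      exact h6.symm.trans h5
  refine (coreAmp_amp (Φ : core m)).fin.elim fun N hN => ?_
  exact key (N + 1) Φ fun n hn =>
    (measurePreserving_ofVec m n).quasiMeasurePreserving.ae (hN n 0 0 0 (by omega))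

end WedgeTotal

/-! ## Cohomology with a positive definite form -/

section FormCohomology

variable {M : Type} [AddCommGroup M] [Module ℂ M] {Q : M →ₗ[ℂ] M}

theorem mk_eq_mk_of_eq_add {Φ Ψ : LinearMap.ker Q} {Θ : M} (h : (Φ : M) = Ψ + Q Θ) :
    (Submodule.Quotient.mk Φ : LinearMap.ker Q ⧸ (LinearMap.range Q).submoduleOf (LinearMap.ker Q)) =
      Submodule.Quotient.mk Ψ := by
  have h1 : ((Φ - Ψ : LinearMap.ker Q) : M) ∈ LinearMap.range Q :=
    ⟨Θ, by rw [Submodule.coe_sub, h, add_sub_cancel_left]⟩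
  exact (Submodule.Quotient.eq _).2 h1

theorem apply_eq_zero_of_comm {σ : ℂ →+* ℂ} {U : M →ₛₗ[σ] M} (h : ∀ Φ, U (Q Φ) = Q (U Φ)) {Φ : M}
    (hΦ : Q Φ = 0) : Q (U Φ) = 0 := by
  rw [← h, hΦ, map_zero]

theorem map_eq_add_of_comm {σ : ℂ →+* ℂ} {U : M →ₛₗ[σ] M} (h : ∀ Φ, U (Q Φ) = Q (U Φ)) {Φ Ψ Θ : M}
    (hΦ : Φ = Ψ + Q Θ) : U Φ = U Ψ + Q (U Θ) := by
  rw [← h, hΦ, map_add]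

/-- If every cocycle is cohomologous to an element of `P`, on which the form is positive definite,
then `P` is isomorphic to the cohomology, and the form induces an inner product there. -/
theorem exists_core_cohomology {P : Submodule ℂ M} {κ : M → M → ℂ} (hP : ∀ Φ ∈ P, Q Φ = 0)
    (hdec : ∀ Φ, Q Φ = 0 → ∃ Ψ ∈ P, ∃ Θ, Φ = Ψ + Q Θ)
    (hadd : ∀ Φ Ψ Ψ', κ Φ (Ψ + Ψ') = κ Φ Ψ + κ Φ Ψ') (hsmul : ∀ (c : ℂ) Φ Ψ, κ Φ (c • Ψ) = c * κ Φ Ψ)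
    (hconj : ∀ Φ Ψ, conj (κ Φ Ψ) = κ Ψ Φ) (hrange : ∀ Φ Ψ, Q Φ = 0 → κ Φ (Q Ψ) = 0)
    (hpos : ∀ Φ ∈ P, 0 ≤ (κ Φ Φ).re) (hdef : ∀ Φ ∈ P, κ Φ Φ = 0 → Φ = 0) :
    ∃ c : InnerProductSpace.Core ℂ (LinearMap.ker Q ⧸ (LinearMap.range Q).submoduleOf (LinearMap.ker Q)),
      (∀ Φ Ψ : LinearMap.ker Q, c.inner (Submodule.Quotient.mk Φ) (Submodule.Quotient.mk Ψ) = κ Φ Ψ) ∧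
      ∃ e : P ≃ₗ[ℂ] (LinearMap.ker Q ⧸ (LinearMap.range Q).submoduleOf (LinearMap.ker Q)),
        ∀ Φ : P, ∃ h : (Φ : M) ∈ LinearMap.ker Q, e Φ = Submodule.Quotient.mk ⟨Φ, h⟩ := by
  have hle : P ≤ LinearMap.ker Q := hP
  let f := (Submodule.mkQ ((LinearMap.range Q).submoduleOf (LinearMap.ker Q))).comp (Submodule.inclusion hle)
  have hinj : Function.Injective f := by
    -- An element of P that is a coboundary is orthogonal to all cocycles, in particular to itself,
    -- so definiteness makes it zero.
    refine (injective_iff_map_eq_zero f).2 fun Φ hΦ => ?_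
    have h1 : Submodule.inclusion hle Φ ∈ (LinearMap.range Q).submoduleOf (LinearMap.ker Q) :=
      (Submodule.Quotient.mk_eq_zero _).1 hΦ
    obtain ⟨Θ, hΘ⟩ : (Φ : M) ∈ LinearMap.range Q := h1
    refine Subtype.ext (hdef Φ Φ.2 ?_)
    have h2 := hrange Φ Θ (hP Φ Φ.2)
    rwa [hΘ] at h2
  have hsurj : Function.Surjective f := fun z => by
    obtain ⟨Φ, rfl⟩ := Submodule.Quotient.mk_surjective _ z
    obtain ⟨Ψ, h1, Θ, h2⟩ := hdec Φ Φ.2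
    exact ⟨⟨Ψ, h1⟩, (mk_eq_mk_of_eq_add (Ψ := ⟨Ψ, hP Ψ h1⟩) h2).symm⟩
  let e := LinearEquiv.ofBijective f ⟨hinj, hsurj⟩
  have hes : ∀ Φ : LinearMap.ker Q, ∃ Θ, (Φ : M) = (e.symm (Submodule.Quotient.mk Φ) : P) + Q Θ := fun Φ => by
    obtain ⟨Ψ, h1, Θ, h2⟩ := hdec Φ Φ.2
    refine ⟨Θ, ?_⟩
    have h3 : e ⟨Ψ, h1⟩ = Submodule.Quotient.mk Φ :=
      (mk_eq_mk_of_eq_add (Ψ := ⟨Ψ, hP Ψ h1⟩) h2).symm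
    rw [← h3, e.symm_apply_apply]
    exact h2
  have hadd' : ∀ Φ Φ' Ψ, κ (Φ + Φ') Ψ = κ Φ Ψ + κ Φ' Ψ := fun Φ Φ' Ψ => by
    rw [← hconj, hadd, map_add, hconj, hconj]
  -- The inner product is transported from P, where the axioms are known. That it agrees with the
  -- form on arbitrary cocycles is checked afterwards, since coboundaries do not contribute.
  refine ⟨{ inner := fun a b => κ (e.symm a : P) (e.symm b : P)
            conj_inner_symm := fun a b => hconj _ _
            re_inner_nonneg := fun a => hpos _ (e.symm a).2
            add_left := fun a b c => by
              rw [map_add, Submodule.coe_add, hadd']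
            smul_left := fun a b c => by
              rw [map_smul, Submodule.coe_smul, ← hconj, hsmul, map_mul, hconj]
            definite := fun a ha =>
              e.symm.map_eq_zero_iff.1 (Subtype.ext (hdef _ (e.symm a).2 ha)) }, fun Φ Ψ => ?_, e,
    fun Φ => ⟨hP Φ Φ.2, rfl⟩⟩
  obtain ⟨Θ, h1⟩ := hes Φ
  obtain ⟨Θ', h2⟩ := hes Ψ
  have h3 : ∀ Ψ, Q Ψ = 0 → κ (Q Θ) Ψ = 0 := fun Ψ hΨ => by
    rw [← hconj, hrange _ _ hΨ, map_zero]
  change κ (e.symm (Submodule.Quotient.mk Φ) : P) (e.symm (Submodule.Quotient.mk Ψ) : P) = κ Φ Ψ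
  conv_rhs => rw [h2, hadd, hrange _ _ Φ.2, add_zero, h1, hadd', h3 _ (hP _ (e.symm _).2), add_zero]

end FormCohomology

/-! ### Totality in the completion, tested by bounded functionals -/

section CompletionTotal

variable {I V P : Type} [AddCommGroup V] [Module ℂ V] [AddCommGroup P] [Module ℂ P]

theorem inner_toCompletion (c : InnerProductSpace.Core ℂ V) (v w : V) :
    ⟪toCompletion c v, toCompletion c w⟫_ℂ = c.inner v w :=
  UniformSpace.Completion.inner_coe (E := WithForm c) v w

/-- The inner product with a vector orthogonal to the family is a functional L on P, bounded by
Cauchy–Schwarz with constant ‖v‖², that vanishes on the family. If such functionals are zero, the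
vector is orthogonal to the dense image of V. -/
theorem isTotal_toCompletion (c : InnerProductSpace.Core ℂ V) (e : P ≃ₗ[ℂ] V) {x : I → P}
    (h : ∀ (L : P →ₗ[ℂ] ℂ) (C : ℝ), (∀ Φ, ‖L Φ‖ ^ 2 ≤ C * ‖c.inner (e Φ) (e Φ)‖) →
      (∀ i, L (x i) = 0) → ∀ Φ, L Φ = 0) : IsTotal fun i => toCompletion c (e (x i)) := by
  intro v hv
  let ι : V →ₗ[ℂ] HilbertCompletion c :=
    (UniformSpace.Completion.toComplL (𝕜 := ℂ) (E := WithForm c)).toLinearMap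
  have hι : ∀ w, ι w = toCompletion c w := fun _ => rfl
  have h1 := h ((innerₛₗ ℂ v).comp (ι.comp e.toLinearMap)) (‖v‖ ^ 2) (fun Φ => by
    have h2 := norm_inner_le_norm (𝕜 := ℂ) v (toCompletion c (e Φ))
    rw [← inner_toCompletion, inner_self_eq_norm_sq_to_K, norm_pow, RCLike.norm_ofReal, abs_norm, ← mul_pow]
    exact pow_le_pow_left₀ (norm_nonneg _) h2 2) fun i => by
      refine inner_eq_zero_symm.1 (hv i)
  refine isTotal_coe_of_dense (E := WithForm c) (J := WithForm c) (x := fun w => w)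
    UniformSpace.Completion.denseRange_coe v fun w => ?_
  have h2 := h1 (e.symm (show V from w))
  refine inner_eq_zero_symm.1 ?_
  have h3 : ⟪v, toCompletion c (e (e.symm (show V from w)))⟫_ℂ = 0 := h2
  rwa [e.apply_symm_apply] at h3

end CompletionTotal

/-! ### Linear and antilinear isometries and inner products -/

section SemilinearIsometry

variable {I E F : Type*} [NormedAddCommGroup E] [InnerProductSpace ℂ E]
  [NormedAddCommGroup F] [InnerProductSpace ℂ F] {σ : ℂ →+* ℂ} [RingHomInvPair σ σ]

theorem IsConjOrId.inner_map_map (hσ : IsConjOrId σ) (U : E ≃ₛₗᵢ[σ] F) (v w : E) :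
    ⟪U v, U w⟫_ℂ = σ ⟪v, w⟫_ℂ := by
  have hr : ∀ x : ℝ, σ (x : ℂ) = x := by
    rcases hσ with rfl | rfl <;> simp
  have h1 : ‖U v + U w‖ = ‖v + w‖ := by rw [← map_add, U.norm_map]
  have h2 : ‖U v - U w‖ = ‖v - w‖ := by rw [← map_sub, U.norm_map]
  have h3 : ‖U v - σ Complex.I • U w‖ = ‖v - Complex.I • w‖ := by
    rw [← map_smulₛₗ, ← map_sub, U.norm_map]
  have h4 : ‖U v + σ Complex.I • U w‖ = ‖v + Complex.I • w‖ := by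
    rw [← map_smulₛₗ, ← map_add, U.norm_map]
  rw [inner_eq_sum_norm_sq_div_four, inner_eq_sum_norm_sq_div_four, h1, h2]
  simp only [RCLike.I_to_complex, Complex.coe_algebraMap, map_div₀, map_add, map_sub, map_mul, map_pow,
    hr, map_ofNat]
  -- Polarisation expresses the inner product by norms. In the antilinear case the two terms
  -- involving i are interchanged, which amounts to complex conjugation.
  rcases hσ with h | h
  · have hI : σ Complex.I = Complex.I := by rw [h]; rfl
    rw [hI] at h3 h4 ⊢
    rw [h3, h4]
  · have hI : σ Complex.I = -Complex.I := by rw [h]; exact Complex.conj_I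
    rw [hI, neg_smul, sub_neg_eq_add] at h3
    rw [hI, neg_smul, ← sub_eq_add_neg] at h4
    rw [h3, h4, hI]
    ring

theorem IsTotal.eq_of_inner (hσ : IsConjOrId σ) {y : I → E} (hy : IsTotal y) (U : E ≃ₛₗᵢ[σ] F) {a : E}
    {b : F} (h : ∀ i, ⟪U (y i), b⟫_ℂ = σ ⟪y i, a⟫_ℂ) : U a = b := by
  have hs : ∀ z, σ (σ z) = z := fun z =>
    RingHomInvPair.comp_apply_eq (σ := σ) (σ' := σ) (x := z)
  have h1 : a - U.symm b = 0 := hy _ fun i => by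
    have h2 : σ ⟪y i, U.symm b⟫_ℂ = σ ⟪y i, a⟫_ℂ := by
      rw [← hσ.inner_map_map U, U.apply_symm_apply, h]
    have h3 := congrArg σ h2
    rw [hs, hs] at h3
    rw [inner_sub_right, h3, sub_self]
  rw [sub_eq_zero.1 h1, U.apply_symm_apply]

end SemilinearIsometry

/-! ### Isomorphisms of the completion and intertwining relations -/

section CompletionEquiv

variable {I V P F : Type} [AddCommGroup V] [Module ℂ V] [AddCommGroup P] [Module ℂ P]
  [NormedAddCommGroup F] [InnerProductSpace ℂ F]

theorem exists_completionEquiv [CompleteSpace F] {c : InnerProductSpace.Core ℂ V} {e : P ≃ₗ[ℂ] V} {κ : P → P → ℂ}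
    (he : ∀ Φ Ψ, c.inner (e Φ) (e Ψ) = κ Φ Ψ) {x : I → P} {y : I → F}
    (hx : ∀ (L : P →ₗ[ℂ] ℂ) (C : ℝ), (∀ Φ, ‖L Φ‖ ^ 2 ≤ C * ‖κ Φ Φ‖) → (∀ i, L (x i) = 0) →
      ∀ Φ, L Φ = 0)
    (hy : IsTotal y) (h : ∀ i j, ⟪y i, y j⟫_ℂ = κ (x i) (x j)) :
    ∃ W : HilbertCompletion c ≃ₗᵢ[ℂ] F, ∀ i, W (toCompletion c (e (x i))) = y i :=
  exists_isometryEquiv_of_inner (.inl rfl)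
    (fun i j => by rw [h, inner_toCompletion, he, RingHom.id_apply])
    (isTotal_toCompletion c e fun L C hC => hx L C (by simpa only [he] using hC)) hy

/-- An equality in F can be tested against a total family, where it reduces to the transformation
law of the given form. -/
theorem completionEquiv_comm {σ : ℂ →+* ℂ} [RingHomInvPair σ σ] (hσ : IsConjOrId σ)
    {c : InnerProductSpace.Core ℂ V} {e : P ≃ₗ[ℂ] V} {κ : P → P → ℂ}
    (he : ∀ Φ Ψ, c.inner (e Φ) (e Ψ) = κ Φ Ψ) (W : HilbertCompletion c ≃ₗᵢ[ℂ] F) {y : I → F}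
    (hy : IsTotal y) (Γ : F ≃ₛₗᵢ[σ] F) {Φ Φ' : P}
    (h : ∀ i, ∃ Ψ Ψ', W (toCompletion c (e Ψ)) = y i ∧ W (toCompletion c (e Ψ')) = Γ (y i) ∧
      κ Ψ' Φ' = σ (κ Ψ Φ)) :
    Γ (W (toCompletion c (e Φ))) = W (toCompletion c (e Φ')) :=
  hy.eq_of_inner hσ Γ fun i => by
    obtain ⟨Ψ, Ψ', h1, h2, h3⟩ := h i
    rw [← h2, ← h1, W.inner_map_map, W.inner_map_map, inner_toCompletion, inner_toCompletion, he, he, h3]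

end CompletionEquiv

/-! ### Cohomology as Fock space, with its Poincaré action -/

section FockEquiv

variable {m : Fin r → ℝ} {V : Type} [AddCommGroup V] [Module ℂ V]

theorem IsVecState.core_eq {n : ℕ} {f : (Fin n → Vec r) → ℂ} {Φ Ψ : core m}
    (h : IsVecState n f (Φ : GhostSpace m)) (h' : IsVecState n f (Ψ : GhostSpace m))
    (hΦ : Φ ∈ physical m) (hΨ : Ψ ∈ physical m) : Φ = Ψ := by
  refine physical_ext hΦ hΨ fun k => ?_
  by_cases hk : k = n
  · subst hk
    exact h.vecAmp.trans h'.vecAmp.symm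
  · exact (h.vecAmp_of_ne hk).trans (h'.vecAmp_of_ne hk).symm

theorem inner_wedge_eq_krein {n n' : ℕ} {φ : Fin n → PreParticle m} {ψ : Fin n' → PreParticle m}
    {Φ Ψ : GhostSpace m} (hΦ : IsWedge n φ Φ) (hΨ : IsWedge n' ψ Ψ) :
    ⟪wedge n fun i => (φ i : Particle m), wedge n' fun i => (ψ i : Particle m)⟫_ℂ = krein Φ Ψ := by
  by_cases h : n = n'
  · subst h
    rw [inner_wedge, hΦ.krein_eq hΨ]
    simp only [UniformSpace.Completion.inner_coe, inner_preParticle]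
  · rw [inner_wedge_of_ne h, IsVecState.krein_of_ne h hΦ.isVecState hΨ.isVecState]

theorem exists_wedgeFamily (m : Fin r → ℝ) :
    ∃ x : (Σ n, Fin n → {φ : PreParticle m // φ.Bounded}) → physical m, ∀ z,
      IsWedge z.1 (fun i => (z.2 i).1) ((x z : core m) : GhostSpace m) :=
  ⟨_, fun z => Exists.choose_spec (p := fun Φ : physical m =>
    IsWedge z.1 (fun i => (z.2 i).1) ((Φ : core m) : GhostSpace m))
    ((exists_isWedge fun i => (z.2 i).2).elim fun Φ hΦ => ⟨⟨Φ, hΦ.1⟩, hΦ.2⟩)⟩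

/-- A physical state with prescribed wedge amplitude is unique, so vanishing on one chosen state for
each tuple covers all wedge states. -/
theorem eq_zero_of_wedgeFamily (hm : ∀ a, 0 < m a)
    {x : (Σ n, Fin n → {φ : PreParticle m // φ.Bounded}) → physical m}
    (hx : ∀ z, IsWedge z.1 (fun i => (z.2 i).1) ((x z : core m) : GhostSpace m))
    (L : physical m →ₗ[ℂ] ℂ) (C : ℝ) (hC : ∀ Φ : physical m, ‖L Φ‖ ^ 2 ≤
      C * ‖krein ((Φ : core m) : GhostSpace m) ((Φ : core m) : GhostSpace m)‖)
    (hL : ∀ z, L (x z) = 0) (Φ : physical m) : L Φ = 0 := by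
  refine eq_zero_of_isWedge hm hC (fun n φ Φ hb hΦ => ?_) Φ
  have h1 : (Φ : core m) = x ⟨n, fun i => ⟨φ i, hb i⟩⟩ :=
    IsVecState.core_eq hΦ.isVecState (hx ⟨n, fun i => ⟨φ i, hb i⟩⟩).isVecState Φ.2 (x _).2
  exact (congrArg L (Subtype.ext h1)).trans (hL _)

theorem exists_fockEquiv (hm : ∀ a, 0 < m a) (c : InnerProductSpace.Core ℂ V) (e : physical m ≃ₗ[ℂ] V)
    (he : ∀ Φ Ψ : physical m, c.inner (e Φ) (e Ψ) =
      krein ((Φ : core m) : GhostSpace m) ((Ψ : core m) : GhostSpace m)) :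
    ∃ W : HilbertCompletion c ≃ₗᵢ[ℂ] BosonFock (Particle m),
      ∀ (n : ℕ) (φ : Fin n → PreParticle m), (∀ i, (φ i).Bounded) → ∃ Φ : physical m,
        IsWedge n φ ((Φ : core m) : GhostSpace m) ∧
        W (toCompletion c (e Φ)) = wedge n fun i => (φ i : Particle m) :=
  (exists_wedgeFamily m).elim fun x hx => (exists_completionEquiv he (eq_zero_of_wedgeFamily hm hx)
    (isTotal_wedge_of_dense (denseRange_bounded m))
    fun z z' => inner_wedge_eq_krein (hx z) (hx z')).elim fun W hW =>
      ⟨W, fun n φ hb => ⟨x ⟨n, fun i => ⟨φ i, hb i⟩⟩, hx ⟨n, fun i => ⟨φ i, hb i⟩⟩,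
        hW ⟨n, fun i => ⟨φ i, hb i⟩⟩⟩⟩

theorem krein_eq_of_isWedge (hm : ∀ a, 0 < m a) {g : Poincare}
    {U : core m →ₛₗ[g.conjIfReversing] core m} (hU : IsGhostAction g U) {n : ℕ}
    {φ ψ : Fin n → PreParticle m} (h : ∀ i, (ψ i).toLp =ᵐ[vecMeasure m] oneAction g (φ i).toLp)
    {Φ Φ' Ψ Ψ' : physical m} (hΦ : U Φ = Φ') (hΨ : IsWedge n φ ((Ψ : core m) : GhostSpace m))
    (hΨ' : IsWedge n ψ ((Ψ' : core m) : GhostSpace m)) :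
    krein ((Ψ' : core m) : GhostSpace m) ((Φ' : core m) : GhostSpace m) =
      g.conjIfReversing (krein ((Ψ : core m) : GhostSpace m) ((Φ : core m) : GhostSpace m)) := by
  have h1 : U Ψ = Ψ' := isWedge_of_ghostAction hm hΨ hΨ' h (fun n w l s => hU Ψ n w l s)
    (hU.map_physical hm Ψ.2) Ψ'.2
  exact (congrArg₂ (fun a b : core m => krein (a : GhostSpace m) (b : GhostSpace m)) h1.symm
    hΦ.symm).trans (hU.krein_physical hm Ψ.2 (Φ : core m))

/-- The equivalence with the Fock space intertwines the Poincaré actions. -/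
theorem exists_secondQuantised_comm (hm : ∀ a, 0 < m a) (c : InnerProductSpace.Core ℂ V)
    (e : physical m ≃ₗ[ℂ] V) (he : ∀ Φ Ψ : physical m, c.inner (e Φ) (e Ψ) =
      krein ((Φ : core m) : GhostSpace m) ((Ψ : core m) : GhostSpace m))
    (W : HilbertCompletion c ≃ₗᵢ[ℂ] BosonFock (Particle m))
    (hW : ∀ (n : ℕ) (φ : Fin n → PreParticle m), (∀ i, (φ i).Bounded) → ∃ Φ : physical m,
        IsWedge n φ ((Φ : core m) : GhostSpace m) ∧
        W (toCompletion c (e Φ)) = wedge n fun i => (φ i : Particle m))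
    {g : Poincare} {U : core m →ₛₗ[g.conjIfReversing] core m} (hU : IsGhostAction g U) :
    ∃ (u : Particle m ≃ₛₗᵢ[g.conjIfReversing] Particle m)
      (Γ : BosonFock (Particle m) ≃ₛₗᵢ[g.conjIfReversing] BosonFock (Particle m)),
      IsParticleAction g u ∧ IsSecondQuantised u Γ ∧ ∀ Φ Φ' : physical m, U Φ = Φ' →
        Γ (W (toCompletion c (e Φ))) = W (toCompletion c (e Φ')) := by
  refine (exists_isParticleAction g hm).elim fun u hu => ?_
  refine (exists_isSecondQuantised g.isConjOrId u hu.2).elim fun Γ hΓ => ?_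
  refine ⟨u, Γ, hu.1, hΓ, fun Φ Φ' hΦ => ?_⟩
  refine completionEquiv_comm g.isConjOrId he W (isTotal_wedge_of_dense (denseRange_bounded m)) Γ
    fun z => ?_
  refine (hW z.1 (fun i => (z.2 i).1) fun i => (z.2 i).2).elim fun Ψ hΨ => ?_
  refine (Classical.skolem.1 fun i => hu.1 (z.2 i).1).elim fun ψ hψ => ?_
  refine (hW z.1 ψ fun i => bounded_of_oneAction g hm (hψ i).1 (z.2 i).2).elim fun Ψ' hΨ' => ?_
  refine ⟨Ψ, Ψ', hΨ.2, hΨ'.2.trans ?_, krein_eq_of_isWedge hm hU (fun i => (hψ i).1) hΦ hΨ.1 hΨ'.1⟩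
  exact (congrArg (wedge z.1) (funext fun i => (hψ i).2.symm)).trans (hΓ _ _).symm

end FockEquiv

theorem exists_core_supercharge {m : Fin r → ℝ} (hm : ∀ a, 0 < m a) {Q : core m →ₗ[ℂ] core m}
    (hQ : IsSupercharge m Q) :
    ∃ c : InnerProductSpace.Core ℂ (Cohomology Q),
      (∀ Φ Ψ : LinearMap.ker Q, c.inner (cls Q Φ) (cls Q Ψ) =
        krein ((Φ : core m) : GhostSpace m) ((Ψ : core m) : GhostSpace m)) ∧
      ∃ e : physical m ≃ₗ[ℂ] Cohomology Q, ∀ Φ : physical m,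
        ∃ h : (Φ : core m) ∈ LinearMap.ker Q, e Φ = cls Q ⟨Φ, h⟩ :=
  exists_core_cohomology (Q := Q) (P := physical m)
    (κ := fun Φ Ψ => krein (Φ : GhostSpace m) (Ψ : GhostSpace m))
    (fun _ h => hQ.physical_le_ker h) (fun _ h => exists_physical_add hm hQ h) krein_add_right
    krein_smul_right krein_conj (fun _ Ψ h => krein_range Q hQ h Ψ)
    (fun _ h => krein_self_nonneg hm h) fun _ h h0 => eq_zero_of_krein_self hm h h0


theorem cohomology_inner_eq {m : Fin r → ℝ} {Q : core m →ₗ[ℂ] core m}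
    {c : InnerProductSpace.Core ℂ (Cohomology Q)} {e : physical m ≃ₗ[ℂ] Cohomology Q}
    (hc : ∀ Φ Ψ : LinearMap.ker Q, c.inner (cls Q Φ) (cls Q Ψ) =
      krein ((Φ : core m) : GhostSpace m) ((Ψ : core m) : GhostSpace m))
    (he : ∀ Φ : physical m, ∃ h : (Φ : core m) ∈ LinearMap.ker Q, e Φ = cls Q ⟨Φ, h⟩)
    (Φ Ψ : physical m) : c.inner (e Φ) (e Ψ) =
      krein ((Φ : core m) : GhostSpace m) ((Ψ : core m) : GhostSpace m) :=
  (he Φ).elim fun h1 h2 => (he Ψ).elim fun h3 h4 =>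
    (congrArg₂ c.inner h2 h4).trans (hc ⟨Φ, h1⟩ ⟨Ψ, h3⟩)

/-- Every class has a physical representative, also after the action of a Poincaré element. -/
theorem exists_physical_cls {m : Fin r → ℝ} (hm : ∀ a, 0 < m a) {Q : core m →ₗ[ℂ] core m}
    (hQ : IsSupercharge m Q) {e : physical m ≃ₗ[ℂ] Cohomology Q}
    (he : ∀ Φ : physical m, ∃ h : (Φ : core m) ∈ LinearMap.ker Q, e Φ = cls Q ⟨Φ, h⟩)
    {g : Poincare} {U : core m →ₛₗ[g.conjIfReversing] core m} (hU : IsGhostAction g U)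
    (Φ : LinearMap.ker Q) : ∃ (h : U (Φ : core m) ∈ LinearMap.ker Q) (Ψ Ψ' : physical m),
      U Ψ = Ψ' ∧ e Ψ = cls Q Φ ∧ e Ψ' = cls Q ⟨U (Φ : core m), h⟩ := by
  have hcomm := hU.comm_supercharge hm hQ
  refine ⟨apply_eq_zero_of_comm hcomm Φ.2, ?_⟩
  refine (exists_physical_add hm hQ Φ.2).elim fun Ψ hΨ => hΨ.2.elim fun Θ hΘ => ?_
  have hp := hU.map_physical hm hΨ.1
  refine ⟨⟨Ψ, hΨ.1⟩, ⟨U Ψ, hp⟩, rfl, (he ⟨Ψ, hΨ.1⟩).elim fun h1 h2 => h2.trans ?_,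
    (he ⟨U Ψ, hp⟩).elim fun h1 h2 => h2.trans ?_⟩
  · exact (mk_eq_mk_of_eq_add (Φ := Φ) (Ψ := ⟨Ψ, h1⟩) hΘ).symm
  · exact (mk_eq_mk_of_eq_add (Φ := ⟨U (Φ : core m), apply_eq_zero_of_comm hcomm Φ.2⟩)
      (Ψ := ⟨U Ψ, h1⟩) (map_eq_add_of_comm hcomm hΘ)).symm

theorem exists_poincare_action {m : Fin r → ℝ} (hm : ∀ a, 0 < m a) {Q : core m →ₗ[ℂ] core m}
    (hQ : IsSupercharge m Q) {V : Type} [AddCommGroup V] [Module ℂ V] {c : InnerProductSpace.Core ℂ V}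
    {e : physical m ≃ₗ[ℂ] V} {cl : LinearMap.ker Q → V}
    (hi : ∀ Φ Ψ : physical m, c.inner (e Φ) (e Ψ) =
      krein ((Φ : core m) : GhostSpace m) ((Ψ : core m) : GhostSpace m))
    (he : ∀ (g : Poincare) (U : core m →ₛₗ[g.conjIfReversing] core m), IsGhostAction g U →
      ∀ Φ : LinearMap.ker Q, ∃ (h : U (Φ : core m) ∈ LinearMap.ker Q) (Ψ Ψ' : physical m),
        U Ψ = Ψ' ∧ e Ψ = cl Φ ∧ e Ψ' = cl ⟨U (Φ : core m), h⟩)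
    {W : HilbertCompletion c ≃ₗᵢ[ℂ] BosonFock (Particle m)}
    (hW : ∀ (n : ℕ) (φ : Fin n → PreParticle m), (∀ i, (φ i).Bounded) → ∃ Φ : physical m,
        IsWedge n φ ((Φ : core m) : GhostSpace m) ∧
        W (toCompletion c (e Φ)) = wedge n fun i => (φ i : Particle m)) (g : Poincare) :
    ∃ (U : core m →ₛₗ[g.conjIfReversing] core m)
      (u : Particle m ≃ₛₗᵢ[g.conjIfReversing] Particle m)
      (Γ : BosonFock (Particle m) ≃ₛₗᵢ[g.conjIfReversing] BosonFock (Particle m)),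
      IsGhostAction g U ∧ IsParticleAction g u ∧ IsSecondQuantised u Γ ∧
      (∀ Φ, U (Q Φ) = Q (U Φ)) ∧ (∀ Φ ∈ physical m, U Φ ∈ physical m) ∧
      ∀ Φ : LinearMap.ker Q, ∃ h : U (Φ : core m) ∈ LinearMap.ker Q,
        Γ (W (toCompletion c (cl Φ))) = W (toCompletion c (cl ⟨U (Φ : core m), h⟩)) := by
  refine (exists_ghostAction g hm).elim fun U hU => ?_
  refine (exists_secondQuantised_comm hm c e hi W hW hU).elim fun u hu => ?_
  refine hu.elim fun Γ hΓ => ⟨U, u, Γ, hU, hΓ.1, hΓ.2.1, hU.comm_supercharge hm hQ,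
    fun Φ hΦ => hU.map_physical hm hΦ, fun Φ => ?_⟩
  refine (he g U hU Φ).elim fun h hp => ⟨h, ?_⟩
  exact hp.elim fun Ψ hΨ => hΨ.elim fun Ψ' hΨ' =>
    (congrArg (fun v => Γ (W (toCompletion c v))) hΨ'.2.1).symm.trans
      ((hΓ.2.2 Ψ Ψ' hΨ'.1).trans (congrArg (fun v => W (toCompletion c v)) hΨ'.2.2))

end MassiveVector

end

theorem mainTheorem3 (r : ℕ) (m : Fin r → ℝ) (hm : ∀ a, 0 < m a) :
    ∃ Q : MassiveVector.core m →ₗ[ℂ] MassiveVector.core m,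
      MassiveVector.IsSupercharge m Q ∧ (∀ Φ, Q (Q Φ) = 0) ∧
      ∃ c : InnerProductSpace.Core ℂ (MassiveVector.Cohomology Q),
        (∀ Φ Ψ : LinearMap.ker Q, c.inner (MassiveVector.cls Q Φ) (MassiveVector.cls Q Ψ) =
          MassiveVector.krein ((Φ : MassiveVector.core m) : MassiveVector.GhostSpace m)
            ((Ψ : MassiveVector.core m) : MassiveVector.GhostSpace m)) ∧
        ∃ e : MassiveVector.physical m ≃ₗ[ℂ] MassiveVector.Cohomology Q,
          (∀ Φ : MassiveVector.physical m, ∃ h : (Φ : MassiveVector.core m) ∈ LinearMap.ker Q,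
            e Φ = MassiveVector.cls Q ⟨Φ, h⟩) ∧
          ∃ W : MassiveVector.HilbertCompletion c ≃ₗᵢ[ℂ]
              MassiveVector.BosonFock (MassiveVector.Particle m),
            (∀ (n : ℕ) (φ : Fin n → MassiveVector.PreParticle m), (∀ i, (φ i).Bounded) →
              ∃ Φ : MassiveVector.physical m,
                MassiveVector.IsWedge n φ
                  ((Φ : MassiveVector.core m) : MassiveVector.GhostSpace m) ∧
                W (MassiveVector.toCompletion c (e Φ)) =
                  MassiveVector.wedge n fun i => (φ i : MassiveVector.Particle m)) ∧
            ∀ g : MassiveVector.Poincare,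
              ∃ (U : MassiveVector.core m →ₛₗ[g.conjIfReversing] MassiveVector.core m)
                (u : MassiveVector.Particle m ≃ₛₗᵢ[g.conjIfReversing] MassiveVector.Particle m)
                (V : MassiveVector.BosonFock (MassiveVector.Particle m)
                  ≃ₛₗᵢ[g.conjIfReversing] MassiveVector.BosonFock (MassiveVector.Particle m)),
                MassiveVector.IsGhostAction g U ∧
                MassiveVector.IsParticleAction g u ∧
                MassiveVector.IsSecondQuantised u V ∧
                (∀ Φ, U (Q Φ) = Q (U Φ)) ∧
                (∀ Φ ∈ MassiveVector.physical m, U Φ ∈ MassiveVector.physical m) ∧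
                ∀ Φ : LinearMap.ker Q,
                  ∃ h : U (Φ : MassiveVector.core m) ∈ LinearMap.ker Q,
                    V (W (MassiveVector.toCompletion c (MassiveVector.cls Q Φ))) =
                      W (MassiveVector.toCompletion c
                        (MassiveVector.cls Q ⟨U (Φ : MassiveVector.core m), h⟩)) := by
  refine (MassiveVector.exists_supercharge m).elim fun Q hQ => ⟨Q, hQ, hQ.sq_eq_zero, ?_⟩
  refine (MassiveVector.exists_core_supercharge hm hQ).elim fun c hc => ⟨c, hc.1, ?_⟩
  refine hc.2.elim fun e he => ⟨e, he, ?_⟩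
  have hi := MassiveVector.cohomology_inner_eq hc.1 he
  refine (MassiveVector.exists_fockEquiv hm c e hi).elim fun W hW => ⟨W, hW, ?_⟩
  exact MassiveVector.exists_poincare_action hm hQ hi
    (fun _ _ hU => MassiveVector.exists_physical_cls hm hQ he hU) hW
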